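/- Let $\mathbf{k}$ be a field of characteristic $0$. **2-disks.** A 2-disk $U=(n_1,\dots,n_r)$, $r\ge 1$, $n_i\ge 1$, is the pruned 2-level tree $[n_1+\dots+n_r-1]\to[r-1]\to[0]$. Its leaves form the set $\mathcal F(U)$ of minimal balls, ordered lexicographically, and $\pi_U(\nu)\in\{1,\dots,r\}$ is the column of $\nu$. A map $P\colon U\to V$ is a surjection $\mathcal F(U)\to\mathcal F(V)$ which induces a monotone map of columns and is monotone on each column. The fibre $P^{-1}(\mu)$, $\mu\in\mathcal F(V)$, is the 2-disk formed by the balls $\nu$ with $P(\nu)=\mu$. **$\mathbf{seq}$.** For 1-ordinals $I_\nu=[\ell_\nu]$ ($\nu\in\mathcal F(U)$) and $J=[m]$, an element of $\mathbf{seq}(U)(\{I_\nu\};J)$ is a total order on $\bigsqcup_\nu I_\nu$ together with a monotone map $W$ from the resulting ordinal to $J$, such that (1) the order restricts to the given one on each $I_\nu$; (2) if $\pi_U(\nu_1)=\pi_U(\nu_2)$ and $\nu_1<\nu_2$, then $I_{\nu_1}<I_{\nu_2}$; (3) if $\pi_U(\nu_1)<\pi_U(\nu_2)$, then $I_{\nu_1}<I_{\nu_2}$,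 or $I_{\nu_1}>I_{\nu_2}$, or $[0,a]<I_{\nu_1}<[a+1,\ell_{\nu_2}]$ for some $0\le a<\ell_{\nu_2}$, where $[0,a],[a+1,\ell_{\nu_2}]\subset I_{\nu_2}$. It is contravariant in the $I_\nu$ (pull back the order and compose $W$) and covariant in $J$. For $P\colon U\to V$, the composition of $\alpha_\mu=(I_{\mu,\mathrm{tot}},W_\mu)\in\mathbf{seq}(P^{-1}(\mu))(\{I_\nu\};J_\mu)$, $\mu\in\mathcal F(V)$, with $\beta=(J_{\mathrm{tot}},W)\in\mathbf{seq}(V)(\{J_\mu\};K)$ pulls the order $J_{\mathrm{tot}}$ back along the $W_\mu$ and composes the maps to the output ordinals. **dg 2-operads.** A dg 2-operad $\mathcal O$ over $\mathbf k$ consists of a complex $\mathcal O(U)$ for every 2-disk $U$, maps of complexes $\bigotimes_{\mu\in\mathcal F(V)}\mathcal O(P^{-1}(\mu))\otimes\mathcal O(V)\to\mathcal O(U)$ for every $P\colon U\to V$, which are associative (with Koszul signs), and a two-sided unit, a cocycle of degree $0$ in $\mathcal O((1))$. A morphism preserves all this; it is a quasi-isomorphism if all its components are quasi-isomorphisms of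 complexes. **$|\mathbf{seq}|$.** The non-normalised condensation is $$|\mathbf{seq}|(U)^n=\prod_{m\ge 0}\ \bigoplus_{m-\sum_\nu\ell_\nu=n}\mathbf k\big[\mathbf{seq}(U)(\{[\ell_\nu]\};[m])\big].$$ On elements of degree $n$ the differential is $d-(-1)^n\delta$, where $d$ is the sum over $\nu$ of the alternating sums of faces in the variable $\nu$, with the Koszul signs for the order of the balls, and $\delta$ is the alternating sum of cofaces in the output variable. The composition is induced by that of $\mathbf{seq}$, with Koszul signs ($[\ell]$ having degree $-\ell$ as an input ordinal); the unit is $(\mathrm{id}_{[m]})_{m\ge 0}$. **$\mathbf{Breq}$ and the whiskering map.** $\mathbf{Breq}(U)$ is the complex with $$\mathbf{Breq}(U)^n=\bigoplus_{-\sum_\nu\ell_\nu=n}\mathbf k\big[\mathbf{seq}(U)(\{[\ell_\nu]\};[0])\big]$$ and differential $d$. For $\alpha\in\mathbf{seq}(U)(\{I_\nu\};[0])$ put $w(\alpha)=\prod_{q\ge0}w_{[q]}(\alpha)$, $w_{[q]}(\alpha)=\sum_s\varepsilon_s\, w_{[q],s}(\alpha)$, the sum being over all families $s$ of monotone surjections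 $p_\nu\colon I'_\nu\to I_\nu$ with $\sum_{\nu}(|I'_\nu|-|I_\nu|)=q$. Here $w_{[q],s}(\alpha)\in\mathbf{seq}(U)(\{I'_\nu\};[q])$ is the pulled back total order with the map to $[q]$ which starts at $0$, grows by $1$ along each elementary interval contained in a fibre of some $p_\nu$ (an inserted interval), and is constant along all other elementary intervals. The sign $\varepsilon_s$ is the sign of the permutation of the elementary intervals of the ordinals $I'_\nu$ from the lexicographic order (first by $\nu$, then by the position in $I'_\nu$) to the order in which the non-inserted intervals come first, in the lexicographic order, followed by the inserted ones in the pulled back total order. The composition in $\mathbf{Breq}$ of $\alpha_\mu\in\mathbf{Breq}(P^{-1}(\mu))$ and $\beta\in\mathbf{Breq}(V)$ is the composition in $|\mathbf{seq}|$ of the $w(\alpha_\mu)$ with $\beta$ (placed in the component $[0]$), whose component at $[0]$ is taken; the unit is $\mathrm{id}_{[0]}$. **$\mathrm{Nor}(\mathbf{Breq})$.** $\mathrm{Nor}(\mathbf{Breq})(U)$ is the quotient of $\mathbf{Breq}(U)$ by the span of the total orders in which two consecutive elements belong to the same $I_\nu$, with the induced differential, composition and unit. **Proposition.** $|\mathbf{seq}|$,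 $\mathbf{Breq}$ and $\mathrm{Nor}(\mathbf{Breq})$ are dg 2-operads (in particular, the structure of $\mathbf{Breq}$ descends to $\mathrm{Nor}(\mathbf{Breq})$). For every 2-disk $U$ the whiskering map $w\colon\mathbf{Breq}(U)\to|\mathbf{seq}|(U)$ is a map of complexes and a quasi-isomorphism. Hence $w\colon\mathbf{Breq}\to|\mathbf{seq}|$ is a morphism of dg 2-operads which is a quasi-isomorphism. The quotient map $\mathbf{Breq}\to\mathrm{Nor}(\mathbf{Breq})$ is a morphism of dg 2-operads and a quasi-isomorphism as well, so that $$|\mathbf{seq}|\xleftarrow{\ w\ }\mathbf{Breq}\longrightarrow\mathrm{Nor}(\mathbf{Breq})$$ is a zig-zag of quasi-isomorphisms of dg 2-operads. -/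

import Mathlib

open CategoryTheory

universe u

/-! ## 2-disks -/

/-- A 2-disk `U = (n₁, …, n_k)`, `k ≥ 1`, `nᵢ ≥ 1`, presented by its pruned 2-level tree
`[n₁ + ⋯ + n_k - 1] → [k - 1] → [0]`.  The leaves are the minimal balls of `U`, the vertices of
level one are the intervals of `U`, and `col` is the map `π_U`. -/
structure TwoDisk where
  numBalls : ℕ
  numIntervals : ℕ
  col : Fin numBalls → Fin numIntervals
  col_mono : Monotone col
  col_surj : Function.Surjective col
  pos : 0 < numBalls

namespace TwoDisk

/-- The set `𝓕(U)` of minimal balls, with its lexicographic order. -/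
abbrev Ball (U : TwoDisk) : Type := Fin U.numBalls

/-- The 2-disk `(1)` with a single minimal ball. -/
def point : TwoDisk where
  numBalls := 1
  numIntervals := 1
  col := id
  col_mono := monotone_id
  col_surj := Function.surjective_id
  pos := Nat.one_pos

/-- A surjective map of pruned 2-trees, given by its map on leaves: it induces a monotone map of
intervals and is monotone on the set of balls lying over each interval. -/
structure Hom (U V : TwoDisk) where
  toFun : U.Ball → V.Ball
  col_le : ∀ a b, U.col a ≤ U.col b → V.col (toFun a) ≤ V.col (toFun b)
  ball_le : ∀ a b, U.col a = U.col b → a ≤ b → toFun a ≤ toFun b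
  surj : Function.Surjective toFun

instance {U V : TwoDisk} : CoeFun (Hom U V) (fun _ => U.Ball → V.Ball) := ⟨Hom.toFun⟩

/-- `Fibration P T` says that, for every ball `μ` of `V`, the 2-disk `T μ` is the (prunisation of
the) fibre `P⁻¹(μ)`: its balls are the balls `ν` of `U` with `P ν = μ`, with the structure
induced from `U`. The isomorphisms `e μ` are unique. -/
structure Fibration {U V : TwoDisk} (P : Hom U V) (T : V.Ball → TwoDisk) where
  e : ∀ μ, (T μ).Ball ≃ {ν : U.Ball // P ν = μ}
  le_iff : ∀ μ a b, a ≤ b ↔ (e μ a : U.Ball) ≤ (e μ b : U.Ball)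
  col_le_iff : ∀ μ a b, (T μ).col a ≤ (T μ).col b ↔ U.col (e μ a) ≤ U.col (e μ b)

/-- A ball `ν` of `U`, as a ball of the fibre over `P ν`. -/
def Fibration.loc {U V : TwoDisk} {P : Hom U V} {T : V.Ball → TwoDisk} (F : Fibration P T)
    (ν : U.Ball) : (T (P ν)).Ball := (F.e (P ν)).symm ⟨ν, rfl⟩

end TwoDisk

open TwoDisk

/-! ## Tamarkin's 2-operad `seq` in sets -/

/-- The disjoint union `⊔_ν I_ν`, where `I_ν = [ℓ ν] = {0 < ⋯ < ℓ ν}`. -/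
abbrev Points {ι : Type} (ℓ : ι → ℕ) : Type := Σ ν : ι, Fin (ℓ ν + 1)

/-- For an order relation `lt` on `X` and sequences `f`, `g` of points: either `f < g`, or `g < f`,
or there is `0 ≤ a < n` with `g[0..a] < f < g[a+1..n]`. -/
def Braced {X : Type} (lt : X → X → Prop) {m n : ℕ} (f : Fin (m + 1) → X) (g : Fin (n + 1) → X) :
    Prop :=
  (∀ i j, lt (f i) (g j)) ∨ (∀ i j, lt (g j) (f i)) ∨
    ∃ a : ℕ, a < n ∧ ∀ (i : Fin (m + 1)) (j : Fin (n + 1)), ((j : ℕ) ≤ a → lt (g j) (f i)) ∧ (a < (j : ℕ) → lt (f i) (g j))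

theorem braced_iff {X : Type} (lt : X → X → Prop) {m n : ℕ} (f : Fin (m + 1) → X)
    (g : Fin (n + 1) → X) :
    Braced lt f g ↔
      ∃ c : ℕ, ∀ (i : Fin (m + 1)) (j : Fin (n + 1)), ((j : ℕ) < c → lt (g j) (f i)) ∧ (c ≤ (j : ℕ) → lt (f i) (g j)) := by
  constructor
  · rintro (h | h | ⟨a, -, h⟩)
    · exact ⟨0, fun i j => ⟨fun hj => absurd hj (by omega), fun _ => h i j⟩⟩
    · exact ⟨n + 1, fun i j => ⟨fun _ => h i j, fun hj => absurd hj (by omega)⟩⟩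
    · exact ⟨a + 1, fun i j => ⟨fun hj => (h i j).1 (by omega), fun hj => (h i j).2 (by omega)⟩⟩
  · rintro ⟨c, h⟩
    rcases Nat.eq_zero_or_pos c with rfl | hc
    · exact Or.inl fun i j => (h i j).2 (Nat.zero_le _)
    · by_cases hn : n < c
      · exact Or.inr (Or.inl fun i j => (h i j).1 (by omega))
      · exact Or.inr (Or.inr ⟨c - 1, by omega, fun i j =>
          ⟨fun hj => (h i j).1 (by omega), fun hj => (h i j).2 (by omega)⟩⟩)

theorem exists_cut {n n' : ℕ} (φ : Fin (n + 1) → Fin (n' + 1)) (hφ : Monotone φ) (c : ℕ) :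
    ∃ c' : ℕ, ∀ j : Fin (n + 1), (j : ℕ) < c' ↔ (φ j : ℕ) < c := by
  classical
  have hex : ∃ c' : ℕ, ∀ j : Fin (n + 1), c' ≤ (j : ℕ) → c ≤ (φ j : ℕ) :=
    ⟨n + 1, fun j hj => absurd hj (by omega)⟩
  refine ⟨Nat.find hex, fun j => ⟨fun hj => ?_, fun hj => ?_⟩⟩
  · by_contra hc
    have := Nat.find_min' hex (m := (j : ℕ))
      (fun j' hj' => (not_lt.mp hc).trans (Fin.le_def.mp (hφ (Fin.le_def.mpr hj'))))
    omega
  · by_contra hc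
    exact absurd (Nat.find_spec hex j (not_lt.mp hc)) (by omega)

/-- The set `seq(U)({[ℓ ν]}; [m])`: a total order `lt` on `⊔_ν [ℓ ν]` subject to (1)-(3), together
with a monotone map `W` of the resulting 1-ordinal to `[m]`. -/
@[ext]
structure TSeq (U : TwoDisk) (ℓ : U.Ball → ℕ) (m : ℕ) where
  lt : Points ℓ → Points ℓ → Prop
  irrefl : ∀ a, ¬ lt a a
  trans : ∀ a b c, lt a b → lt b c → lt a c
  total : ∀ a b, a ≠ b → lt a b ∨ lt b a
  W : Points ℓ → Fin (m + 1)
  W_mono : ∀ a b, lt a b → W a ≤ W b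
  order : ∀ ν (i j : Fin (ℓ ν + 1)), i < j → lt ⟨ν, i⟩ ⟨ν, j⟩
  column : ∀ ν₁ ν₂, U.col ν₁ = U.col ν₂ → ν₁ < ν₂ → ∀ i j, lt ⟨ν₁, i⟩ ⟨ν₂, j⟩
  brace : ∀ ν₁ ν₂, U.col ν₁ < U.col ν₂ →
    Braced lt (fun i : Fin (ℓ ν₁ + 1) => ⟨ν₁, i⟩) (fun j : Fin (ℓ ν₂ + 1) => ⟨ν₂, j⟩)

namespace TSeq

variable {U : TwoDisk}

/-- Covariance in the output ordinal. -/
def push {ℓ : U.Ball → ℕ} {m m' : ℕ} (θ : Fin (m + 1) →o Fin (m' + 1)) (α : TSeq U ℓ m) :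
    TSeq U ℓ m' :=
  { α with
    W := fun a => θ (α.W a)
    W_mono := fun a b h => θ.monotone (α.W_mono a b h) }

/-- The map `⊔ I'_ν → ⊔ I_ν` induced by maps `I'_ν → I_ν`. -/
def mapPoints {ℓ ℓ' : U.Ball → ℕ} (φ : ∀ ν, Fin (ℓ' ν + 1) → Fin (ℓ ν + 1)) (a : Points ℓ') :
    Points ℓ := ⟨a.1, φ a.1 a.2⟩

/-- Contravariance in the input ordinals: the total order pulls back along monotone maps
`φ_ν : I'_ν → I_ν` (two points with the same image belong to the same `I'_ν` and keep their order
there), and `W` is composed with the induced map. -/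
def pull {ℓ ℓ' : U.Ball → ℕ} {m : ℕ} (φ : ∀ ν, Fin (ℓ' ν + 1) → Fin (ℓ ν + 1))
    (hφ : ∀ ν, Monotone (φ ν)) (α : TSeq U ℓ m) : TSeq U ℓ' m where
  lt a b := α.lt (mapPoints φ a) (mapPoints φ b) ∨
    (mapPoints φ a = mapPoints φ b ∧ (a.2 : ℕ) < (b.2 : ℕ))
  irrefl a h := by
    rcases h with h | h
    · exact α.irrefl _ h
    · exact lt_irrefl _ h.2
  trans a b c := by
    rintro (h | h) (h' | h')
    · exact Or.inl (α.trans _ _ _ h h')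
    · exact Or.inl (h'.1 ▸ h)
    · exact Or.inl (h.1 ▸ h')
    · exact Or.inr ⟨h.1.trans h'.1, h.2.trans h'.2⟩
  total a b hab := by
    by_cases h : mapPoints φ a = mapPoints φ b
    · obtain ⟨ν, i⟩ := a
      obtain ⟨ν', j⟩ := b
      obtain rfl : ν = ν' := congrArg Sigma.fst h
      have hij : (i : ℕ) ≠ (j : ℕ) := fun hij => hab (by rw [Fin.ext hij])
      rcases lt_or_gt_of_ne hij with h1 | h1
      · exact Or.inl (Or.inr ⟨h, h1⟩)
      · exact Or.inr (Or.inr ⟨h.symm, h1⟩)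
    · rcases α.total _ _ h with h1 | h1
      · exact Or.inl (Or.inl h1)
      · exact Or.inr (Or.inl h1)
  W a := α.W (mapPoints φ a)
  W_mono a b := by
    rintro (h | h)
    · exact α.W_mono _ _ h
    · exact le_of_eq (congrArg α.W h.1)
  order ν i j hij := by
    rcases (hφ ν hij.le).lt_or_eq with h | h
    · exact Or.inl (α.order ν _ _ h)
    · exact Or.inr ⟨by simp [mapPoints, h], hij⟩
  column ν₁ ν₂ hc hν i j := Or.inl (α.column ν₁ ν₂ hc hν _ _)
  brace ν₁ ν₂ hc := by
    obtain ⟨c, h⟩ := (braced_iff _ _ _).1 (α.brace ν₁ ν₂ hc)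
    obtain ⟨c', h'⟩ := exists_cut (φ ν₂) (hφ ν₂) c
    refine (braced_iff _ _ _).2 ⟨c', fun i j => ⟨fun hj => ?_, fun hj => ?_⟩⟩
    · exact Or.inl ((h _ _).1 ((h' j).1 hj))
    · exact Or.inl ((h _ _).2 (not_lt.1 (mt (h' j).2 (not_lt.2 hj))))

section Comp

variable {V : TwoDisk} {P : Hom U V} {T : V.Ball → TwoDisk} (F : Fibration P T)

/-- The identification `⊔_{ν ∈ 𝓕(U)} I_ν = ⊔_μ ⊔_{ν ∈ 𝓕(P⁻¹(μ))} I_ν`. -/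
def locate (ℓ : ∀ μ, (T μ).Ball → ℕ) (a : Points (fun ν => ℓ (P ν) (F.loc ν))) :
    Σ μ, Points (ℓ μ) := ⟨P a.1, ⟨F.loc a.1, a.2⟩⟩

theorem locate_of_mem (ℓ : ∀ μ, (T μ).Ball → ℕ) (ν : U.Ball) {μ : V.Ball} (h : P ν = μ) :
    ∃ b : (T μ).Ball, (F.e μ b : U.Ball) = ν ∧ ∀ i : Fin (ℓ (P ν) (F.loc ν) + 1),
      ∃ i' : Fin (ℓ μ b + 1), (i' : ℕ) = i ∧
        locate F ℓ ⟨ν, i⟩ = (⟨μ, ⟨b, i'⟩⟩ : Σ μ, Points (ℓ μ)) := by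
  subst h
  exact ⟨F.loc ν, by simp [Fibration.loc], fun i => ⟨i, rfl, rfl⟩⟩

theorem locate_injective (ℓ : ∀ μ, (T μ).Ball → ℕ) : Function.Injective (locate F ℓ) := by
  rintro ⟨ν, i⟩ ⟨ν', j⟩ h
  obtain ⟨b, hb, hi⟩ := locate_of_mem F ℓ ν (rfl : P ν = P ν)
  have h1 : P ν' = P ν := (congrArg Sigma.fst h).symm
  obtain ⟨b', hb', hj⟩ := locate_of_mem F ℓ ν' h1
  obtain ⟨i', hi', hi''⟩ := hi i
  obtain ⟨j', hj', hj''⟩ := hj j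
  rw [hi'', hj''] at h
  have h2 := eq_of_heq (Sigma.mk.inj h).2
  have h3 : b = b' := congrArg Sigma.fst h2
  subst h3
  have h4 : i' = j' := eq_of_heq (Sigma.mk.inj h2).2
  subst h4
  have h5 : ν = ν' := hb.symm.trans hb'
  subst h5
  have h6 : i = j := Fin.ext (hi'.symm.trans hj')
  rw [h6]

/-- The map `⊔_μ I_{μ,tot} → J_tot` given by the maps `W_μ`. -/
def toOuter {ℓ : ∀ μ, (T μ).Ball → ℕ} {J : V.Ball → ℕ} (α : ∀ μ, TSeq (T μ) (ℓ μ) (J μ))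
    (a : Σ μ, Points (ℓ μ)) : Points J := ⟨a.1, (α a.1).W a.2⟩

/-- The 2-operadic composition of `seq`: the total order `J_tot` is pulled back along the maps
`W_μ` (two points with the same image in `J_tot` belong to the same `I_{μ,tot}` and keep their
order there), and the maps to the output ordinal are composed. -/
def comp {ℓ : ∀ μ, (T μ).Ball → ℕ} {J : V.Ball → ℕ} {K : ℕ}
    (α : ∀ μ, TSeq (T μ) (ℓ μ) (J μ)) (β : TSeq V J K) :
    TSeq U (fun ν => ℓ (P ν) (F.loc ν)) K where
  lt a b := β.lt (toOuter α (locate F ℓ a)) (toOuter α (locate F ℓ b)) ∨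
    ∃ μ, ∃ x y : Points (ℓ μ), locate F ℓ a = ⟨μ, x⟩ ∧ locate F ℓ b = ⟨μ, y⟩ ∧
      (α μ).W x = (α μ).W y ∧ (α μ).lt x y
  irrefl a h := by
    rcases h with h | ⟨μ, x, y, hx, hy, -, h⟩
    · exact β.irrefl _ h
    · rw [hx] at hy
      have := eq_of_heq (Sigma.mk.inj hy).2
      subst this
      exact (α μ).irrefl _ h
  trans a b c := by
    rintro (h | ⟨μ, x, y, hx, hy, hW, h⟩) (h' | ⟨μ', x', y', hx', hy', hW', h'⟩)
    · exact Or.inl (β.trans _ _ _ h h')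
    · left
      rw [hy']
      rw [hx'] at h
      simpa [toOuter, hW'] using h
    · left
      rw [hx]
      rw [hy] at h'
      simpa [toOuter, hW] using h'
    · right
      rw [hy] at hx'
      obtain rfl : μ = μ' := congrArg Sigma.fst hx'
      have := eq_of_heq (Sigma.mk.inj hx').2
      subst this
      exact ⟨μ, x, y', hx, hy', hW.trans hW', (α μ).trans _ _ _ h h'⟩
  total a b hab := by
    by_cases h : toOuter α (locate F ℓ a) = toOuter α (locate F ℓ b)
    · have hab' : locate F ℓ a ≠ locate F ℓ b := fun h => hab (locate_injective F ℓ h)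
      generalize ha : locate F ℓ a = A at h hab'
      generalize hb : locate F ℓ b = B at h hab'
      obtain ⟨μ, x⟩ := A
      obtain ⟨μ', y⟩ := B
      obtain rfl : μ = μ' := congrArg Sigma.fst h
      have hW : (α μ).W x = (α μ).W y := eq_of_heq (Sigma.mk.inj h).2
      have hxy : x ≠ y := fun hxy => hab' (by rw [hxy])
      rcases (α μ).total x y hxy with h1 | h1
      · exact Or.inl (Or.inr ⟨μ, x, y, rfl, rfl, hW, h1⟩)
      · exact Or.inr (Or.inr ⟨μ, y, x, rfl, rfl, hW.symm, h1⟩)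
    · rcases β.total _ _ h with h1 | h1
      · exact Or.inl (Or.inl h1)
      · exact Or.inr (Or.inl h1)
  W a := β.W (toOuter α (locate F ℓ a))
  W_mono a b := by
    rintro (h | ⟨μ, x, y, hx, hy, hW, -⟩)
    · exact β.W_mono _ _ h
    · rw [hx, hy]
      exact le_of_eq (congrArg β.W (by simp [toOuter, hW]))
  order ν i j hij := by
    have hlt : (α (P ν)).lt ⟨F.loc ν, i⟩ ⟨F.loc ν, j⟩ := (α (P ν)).order _ _ _ hij
    rcases ((α (P ν)).W_mono _ _ hlt).lt_or_eq with h | h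
    · exact Or.inl (β.order _ _ _ h)
    · exact Or.inr ⟨P ν, _, _, rfl, rfl, h, hlt⟩
  column ν₁ ν₂ hc hν i j := by
    rcases (P.ball_le ν₁ ν₂ hc hν.le).lt_or_eq with h | h
    · exact Or.inl (β.column _ _
        (le_antisymm (P.col_le _ _ hc.le) (P.col_le _ _ hc.ge)) h _ _)
    · obtain ⟨b₁, hb₁, hi⟩ := locate_of_mem F ℓ ν₁ h
      obtain ⟨b₂, hb₂, hj⟩ := locate_of_mem F ℓ ν₂ (rfl : P ν₂ = P ν₂)
      obtain ⟨i', -, hi'⟩ := hi i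
      obtain ⟨j', -, hj'⟩ := hj j
      have hcol : (T (P ν₂)).col b₁ = (T (P ν₂)).col b₂ :=
        le_antisymm ((F.col_le_iff _ _ _).2 (by rw [hb₁, hb₂]; exact hc.le))
          ((F.col_le_iff _ _ _).2 (by rw [hb₁, hb₂]; exact hc.ge))
      have hlt : b₁ < b₂ := lt_of_not_ge fun hle =>
        absurd ((F.le_iff _ _ _).1 hle) (by rw [hb₁, hb₂]; exact not_le.2 hν)
      have hα := (α (P ν₂)).column b₁ b₂ hcol hlt i' j'
      rw [hi', hj']
      rcases ((α _).W_mono _ _ hα).lt_or_eq with h' | h'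
      · exact Or.inl (β.order _ _ _ h')
      · exact Or.inr ⟨_, _, _, rfl, rfl, h', hα⟩
  brace ν₁ ν₂ hc := by
    have key : ∀ {a b : Σ μ, Points (ℓ μ)} {μ : V.Ball} {x y : Points (ℓ μ)}, a = ⟨μ, x⟩ →
        b = ⟨μ, y⟩ → (α μ).lt x y → β.lt (toOuter α a) (toOuter α b) ∨
          ∃ μ, ∃ x y : Points (ℓ μ), a = ⟨μ, x⟩ ∧ b = ⟨μ, y⟩ ∧
            (α μ).W x = (α μ).W y ∧ (α μ).lt x y := by
      rintro a b μ x y rfl rfl h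
      rcases ((α _).W_mono _ _ h).lt_or_eq with h' | h'
      · exact Or.inl (β.order _ _ _ h')
      · exact Or.inr ⟨_, _, _, rfl, rfl, h', h⟩
    by_cases hP : P ν₁ = P ν₂
    · obtain ⟨b₁, hb₁, hi⟩ := locate_of_mem F ℓ ν₁ hP
      obtain ⟨b₂, hb₂, hj⟩ := locate_of_mem F ℓ ν₂ (rfl : P ν₂ = P ν₂)
      have hcol : (T (P ν₂)).col b₁ < (T (P ν₂)).col b₂ := lt_of_not_ge fun hle =>
        absurd ((F.col_le_iff _ _ _).1 hle) (by rw [hb₁, hb₂]; exact not_le.2 hc)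
      obtain ⟨c, h⟩ := (braced_iff _ _ _).1 ((α (P ν₂)).brace b₁ b₂ hcol)
      refine (braced_iff _ _ _).2 ⟨c, fun i j => ?_⟩
      obtain ⟨i', -, hi'⟩ := hi i
      obtain ⟨j', hj0, hj'⟩ := hj j
      exact ⟨fun hlt => key hj' hi' ((h i' j').1 (by omega)),
        fun hle => key hi' hj' ((h i' j').2 (by omega))⟩
    · rcases (P.col_le _ _ hc.le).lt_or_eq with h | h
      · obtain ⟨c, h⟩ := (braced_iff _ _ _).1 (β.brace _ _ h)
        obtain ⟨c', h'⟩ := exists_cut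
          (fun j : Fin (ℓ (P ν₂) (F.loc ν₂) + 1) => (α (P ν₂)).W ⟨F.loc ν₂, j⟩)
          (fun j j' hjj => by
            rcases hjj.lt_or_eq with h1 | rfl
            · exact (α _).W_mono _ _ ((α _).order _ _ _ h1)
            · exact le_rfl) c
        refine (braced_iff _ _ _).2 ⟨c', fun i j => ⟨fun hj => ?_, fun hj => ?_⟩⟩
        · exact Or.inl ((h _ _).1 ((h' j).1 hj))
        · exact Or.inl ((h _ _).2 (not_lt.1 (mt (h' j).2 (not_lt.2 hj))))
      · rcases lt_or_gt_of_ne hP with h1 | h1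
        · exact Or.inl fun i j => Or.inl (β.column _ _ h h1 _ _)
        · exact Or.inr (Or.inl fun i j => Or.inl (β.column _ _ h.symm h1 _ _))

end Comp

end TSeq

/-! ## Polysimplicial chains -/

/-- The disjoint union over `{I_ν}` of the sets `seq(U)({I_ν}; [m])`. -/
abbrev Cell (U : TwoDisk) (m : ℕ) : Type := Σ ℓ : U.Ball → ℕ, TSeq U ℓ m

namespace Cell

variable {U : TwoDisk} {m : ℕ}

/-- The total simplicial dimension `∑_ν ℓ_ν`. -/
def dim (x : Cell U m) : ℕ := ∑ ν, x.1 ν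

/-- The coface `δ^i : [ℓ ν - 1] → [ℓ ν]` in the variable `ν` and the identity in the other ones.
(For `ℓ ν ≥ 1` the clamping has no effect.) -/
def faceMap (ℓ : U.Ball → ℕ) (ν : U.Ball) (i : ℕ) (ν' : U.Ball)
    (j : Fin (Function.update ℓ ν (ℓ ν - 1) ν' + 1)) : Fin (ℓ ν' + 1) :=
  Fin.clamp (if ν' = ν ∧ i ≤ (j : ℕ) then (j : ℕ) + 1 else j) (ℓ ν')

theorem faceMap_mono (ℓ : U.Ball → ℕ) (ν : U.Ball) (i : ℕ) (ν' : U.Ball) :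
    Monotone (faceMap ℓ ν i ν') := by
  intro j j' h
  have h' : (j : ℕ) ≤ j' := h
  simp only [faceMap, Fin.clamp, Fin.mk_le_mk]
  refine min_le_min_right _ ?_
  split_ifs <;> grind

/-- The `i`-th face of a cell in the variable `ν`, used for `ℓ ν ≥ 1`. -/
def face (x : Cell U m) (ν : U.Ball) (i : ℕ) : Cell U m :=
  ⟨Function.update x.1 ν (x.1 ν - 1),
    x.2.pull (faceMap x.1 ν i) (faceMap_mono x.1 ν i)⟩

/-- The `j`-th coface of a cell in the output variable. -/
def coface (j : Fin (m + 2)) (x : Cell U m) : Cell U (m + 1) :=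
  ⟨x.1, x.2.push (Fin.succAboveOrderEmb j).toOrderHom⟩

/-- The 2-operadic composition, for arbitrary input ordinals. -/
def comp {V : TwoDisk} {P : Hom U V} {T : V.Ball → TwoDisk} (F : Fibration P T)
    (β : Cell V m) (α : ∀ μ, Cell (T μ) (β.1 μ)) : Cell U m :=
  ⟨fun ν => (α (P ν)).1 (F.loc ν), TSeq.comp F (fun μ => (α μ).2) β.2⟩

end Cell

noncomputable section

/-- The vector space spanned by all `seq(U)({I_ν}; [m])`, for `m` fixed. -/
abbrev Chains (k : Type u) [Field k] (U : TwoDisk) (m : ℕ) : Type u := Cell U m →₀ k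

/-- The simplicial differential: the sum over all `ν` of the alternating sums of the faces in the
variable `ν`, with the Koszul sign for the order of the balls. -/
def chainD (k : Type u) [Field k] (U : TwoDisk) (m : ℕ) : Chains k U m →ₗ[k] Chains k U m :=
  Finsupp.linearCombination k fun x : Cell U m =>
    ∑ ν : U.Ball, ∑ i : Fin (x.1 ν + 1),
      if x.1 ν = 0 then 0
      else Finsupp.single (x.face ν i) ((-1 : k) ^ ((∑ ν' ∈ Finset.Iio ν, x.1 ν') + i))

/-- The alternating sum of the cofaces, times the sign `(-1)^n` on cells of total degree `n`
(`n = m - dim x`). -/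
def cochainD (k : Type u) [Field k] (U : TwoDisk) (m : ℕ) :
    Chains k U m →ₗ[k] Chains k U (m + 1) :=
  Finsupp.linearCombination k fun x : Cell U m =>
    ∑ j : Fin (m + 2), Finsupp.single (x.coface j) ((-1 : k) ^ (m + x.dim + (j : ℕ)))

/-! ## dg 2-operads -/

/-- The data of a dg 2-operad over `k`.  The component at `U` is the complex whose term in degree
`n` is `deg U n`; these terms are realised as subspaces of a common vector space `obj U`.
For `P : U → V` with fibres `P⁻¹(μ) = T μ`, `comp` is the composition
`⊗_μ O(P⁻¹(μ)) ⊗ O(V) → O(U)`, the factors being ordered by the order of the balls `μ`. -/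
structure Dg2OperadData (k : Type u) [Field k] where
  obj : TwoDisk → Type u
  [addCommGroup : ∀ U, AddCommGroup (obj U)]
  [module : ∀ U, Module k (obj U)]
  deg : ∀ U, ℤ → Submodule k (obj U)
  d : ∀ U, obj U →ₗ[k] obj U
  comp : ∀ {U V : TwoDisk} {P : Hom U V} {T : V.Ball → TwoDisk}, Fibration P T →
    (∀ μ, obj (T μ)) → obj V → obj U
  one : obj point

attribute [instance] Dg2OperadData.addCommGroup Dg2OperadData.module

/-- The axioms of a dg 2-operad. -/
structure IsDg2Operad {k : Type u} [Field k] (O : Dg2OperadData k) : Prop where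
  d_mem : ∀ U n, ∀ x ∈ O.deg U n, O.d U x ∈ O.deg U (n + 1)
  d_d : ∀ U n, ∀ x ∈ O.deg U n, O.d U (O.d U x) = 0
  /-- The composition is linear in each variable. -/
  comp_add_left : ∀ {U V : TwoDisk} {P : Hom U V} {T : V.Ball → TwoDisk} (F : Fibration P T)
    (x : ∀ μ, O.obj (T μ)) (y : O.obj V) (μ : V.Ball) (a b : O.obj (T μ)),
    O.comp F (Function.update x μ (a + b)) y =
      O.comp F (Function.update x μ a) y + O.comp F (Function.update x μ b) y
  comp_smul_left : ∀ {U V : TwoDisk} {P : Hom U V} {T : V.Ball → TwoDisk} (F : Fibration P T)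
    (x : ∀ μ, O.obj (T μ)) (y : O.obj V) (μ : V.Ball) (c : k) (a : O.obj (T μ)),
    O.comp F (Function.update x μ (c • a)) y = c • O.comp F (Function.update x μ a) y
  comp_add_right : ∀ {U V : TwoDisk} {P : Hom U V} {T : V.Ball → TwoDisk} (F : Fibration P T)
    (x : ∀ μ, O.obj (T μ)) (a b : O.obj V), O.comp F x (a + b) = O.comp F x a + O.comp F x b
  comp_smul_right : ∀ {U V : TwoDisk} {P : Hom U V} {T : V.Ball → TwoDisk} (F : Fibration P T)
    (x : ∀ μ, O.obj (T μ)) (c : k) (a : O.obj V), O.comp F x (c • a) = c • O.comp F x a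
  /-- The composition has degree 0. -/
  comp_mem : ∀ {U V : TwoDisk} {P : Hom U V} {T : V.Ball → TwoDisk} (F : Fibration P T)
    (x : ∀ μ, O.obj (T μ)) (y : O.obj V) (p : V.Ball → ℤ) (q : ℤ),
    (∀ μ, x μ ∈ O.deg (T μ) (p μ)) → y ∈ O.deg V q → O.comp F x y ∈ O.deg U ((∑ μ, p μ) + q)
  /-- The composition is a map of complexes. -/
  d_comp : ∀ {U V : TwoDisk} {P : Hom U V} {T : V.Ball → TwoDisk} (F : Fibration P T)
    (x : ∀ μ, O.obj (T μ)) (y : O.obj V) (p : V.Ball → ℤ) (q : ℤ),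
    (∀ μ, x μ ∈ O.deg (T μ) (p μ)) → y ∈ O.deg V q →
    O.d U (O.comp F x y) =
      (∑ μ, (∑ μ' ∈ Finset.Iio μ, p μ').negOnePow •
        O.comp F (Function.update x μ (O.d (T μ) (x μ))) y) +
      (∑ μ, p μ).negOnePow • O.comp F x (O.d V y)
  /-- Associativity for `U --P--> V --Q--> W` with composite `S`, up to the Koszul sign.  Here
  `A v`, `B w`, `C w` are the fibres of `P`, `Q`, `S`, and `R w : C w → B w` is the restriction of
  `P`, whose fibres are those of `P`. -/
  assoc : ∀ {U V W : TwoDisk} {P : Hom U V} {Q : Hom V W} {S : Hom U W}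
    {A : V.Ball → TwoDisk} {B C : W.Ball → TwoDisk}
    (F : Fibration P A) (G : Fibration Q B) (H : Fibration S C)
    (R : ∀ w, Hom (C w) (B w)) (K : ∀ w, Fibration (R w) (fun b => A (G.e w b))),
    (∀ ν, S ν = Q (P ν)) →
    (∀ w c, (G.e w (R w c) : V.Ball) = P (H.e w c)) →
    ∀ (x : ∀ v, O.obj (A v)) (y : ∀ w, O.obj (B w)) (z : O.obj W)
      (p : V.Ball → ℤ) (q : W.Ball → ℤ) (r : ℤ),
    (∀ v, x v ∈ O.deg (A v) (p v)) → (∀ w, y w ∈ O.deg (B w) (q w)) → z ∈ O.deg W r →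
    O.comp H (fun w => O.comp (K w) (fun b => x (G.e w b)) (y w)) z =
      ((∑ v, ∑ v' ∈ Finset.Ioi v, if Q v' < Q v then p v * p v' else 0) +
        (∑ w, ∑ v, if w < Q v then q w * p v else 0)).negOnePow •
      O.comp F x (O.comp G y z)
  one_mem : O.one ∈ O.deg point 0
  d_one : O.d point O.one = 0
  /-- The unit axiom for the map `U → point`, whose only fibre is `U`. -/
  comp_one : ∀ {U : TwoDisk} {P : Hom U point} (F : Fibration P (fun _ => U)) (n : ℤ),
    ∀ x ∈ O.deg U n, O.comp F (fun _ => x) O.one = x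
  /-- The unit axiom for the identity map of `U`, whose fibres are points. -/
  one_comp : ∀ {U : TwoDisk} {P : Hom U U} (F : Fibration P (fun _ => point)),
    (∀ ν, P ν = ν) → ∀ n, ∀ x ∈ O.deg U n, O.comp F (fun _ => O.one) x = x

/-- A family of linear maps is a morphism of dg 2-operads. -/
structure IsDg2OperadHom {k : Type u} [Field k] (O O' : Dg2OperadData k)
    (f : ∀ U, O.obj U →ₗ[k] O'.obj U) : Prop where
  map_deg : ∀ U n, ∀ x ∈ O.deg U n, f U x ∈ O'.deg U n
  map_d : ∀ U n, ∀ x ∈ O.deg U n, f U (O.d U x) = O'.d U (f U x)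
  map_comp : ∀ {U V : TwoDisk} {P : Hom U V} {T : V.Ball → TwoDisk} (F : Fibration P T)
    (x : ∀ μ, O.obj (T μ)) (y : O.obj V) (p : V.Ball → ℤ) (q : ℤ),
    (∀ μ, x μ ∈ O.deg (T μ) (p μ)) → y ∈ O.deg V q →
    f U (O.comp F x y) = O'.comp F (fun μ => f (T μ) (x μ)) (f V y)
  map_one : f point O.one = O'.one

/-- The component of a dg 2-operad at `U`, as a cochain complex of vector spaces. -/
def IsDg2Operad.complex {k : Type u} [Field k] {O : Dg2OperadData k} (h : IsDg2Operad O)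
    (U : TwoDisk) : CochainComplex (ModuleCat.{u} k) ℤ :=
  CochainComplex.of (fun n => ModuleCat.of k (O.deg U n))
    (fun n => ModuleCat.ofHom ((O.d U).restrict (h.d_mem U n)))
    (fun n => by
      ext x
      exact h.d_d U n x x.2)

/-- The component of a morphism of dg 2-operads at `U`, as a map of complexes. -/
def IsDg2OperadHom.complexMap {k : Type u} [Field k] {O O' : Dg2OperadData k}
    {f : ∀ U, O.obj U →ₗ[k] O'.obj U} (hf : IsDg2OperadHom O O' f) (h : IsDg2Operad O)
    (h' : IsDg2Operad O') (U : TwoDisk) : h.complex U ⟶ h'.complex U :=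
  CochainComplex.ofHom (X := h.complex U) (Y := h'.complex U)
    (fun n => ModuleCat.ofHom ((f U).restrict (hf.map_deg U n)))
    (fun n => by
      simp only [IsDg2Operad.complex, CochainComplex.of_d]
      ext x
      exact (hf.map_d U n x x.2).symm)

/-- A morphism of dg 2-operads all of whose components are quasi-isomorphisms. -/
def IsDg2OperadHom.IsQuasiIso {k : Type u} [Field k] {O O' : Dg2OperadData k}
    {f : ∀ U, O.obj U →ₗ[k] O'.obj U} (hf : IsDg2OperadHom O O' f) (h : IsDg2Operad O)
    (h' : IsDg2Operad O') : Prop :=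
  ∀ U, QuasiIso (hf.complexMap h h' U)

/-! ## The condensation `|seq|` -/

/-- The exponent of the Koszul sign of the composition of `β` with the `α μ`: moving the `α μ'`
(of degree `J_μ' - dim (α μ')`) past the input ordinals `J_μ`, `μ < μ'`, of `β`, and then shuffling
the input ordinals from the order by `μ` to the order of the balls of `U`. -/
def compSign {U V : TwoDisk} {P : Hom U V} {T : V.Ball → TwoDisk} (F : Fibration P T) {m : ℕ}
    (β : Cell V m) (α : ∀ μ, Cell (T μ) (β.1 μ)) : ℕ :=
  (∑ μ, ∑ μ' ∈ Finset.Ioi μ, β.1 μ * (β.1 μ' + (α μ').dim)) +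
    ∑ ν, ∑ ν' ∈ Finset.Ioi ν,
      if P ν' < P ν then (Cell.comp F β α).1 ν * (Cell.comp F β α).1 ν' else 0

open Classical in
/-- The composition in `|seq|`: the component at the output ordinal `[K]` is obtained by
composing the terms `β` of `y K` with the components of the `x μ` at the input ordinals of `β`. -/
def condensedComp (k : Type u) [Field k] {U V : TwoDisk} {P : Hom U V} {T : V.Ball → TwoDisk}
    (F : Fibration P T) (x : ∀ μ, ∀ m, Chains k (T μ) m) (y : ∀ m, Chains k V m) :
    ∀ m, Chains k U m := fun K =>
  (y K).sum fun β c =>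
    ∑ α ∈ Fintype.piFinset (fun μ => (x μ (β.1 μ)).support),
      Finsupp.single (Cell.comp F β α)
        ((-1 : k) ^ compSign F β α * (∏ μ, x μ (β.1 μ) (α μ)) * c)

/-- The cell of `seq(point)([m]; [m])` with `W = id`. -/
def idCell (m : ℕ) : Cell point m :=
  ⟨fun _ => m,
    { lt := fun a b => a.2 < b.2
      irrefl := fun a => lt_irrefl _
      trans := fun a b c => lt_trans
      total := fun a b hab => lt_or_gt_of_ne fun h => hab (by
        obtain ⟨ν, i⟩ := a
        obtain ⟨ν', j⟩ := b
        obtain rfl : ν = ν' := Subsingleton.elim (α := Fin 1) ν ν'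
        exact congrArg _ h)
      W := fun a => a.2
      W_mono := fun a b h => h.le
      order := fun ν i j h => h
      column := fun ν₁ ν₂ _ h => absurd h (by
        rw [Subsingleton.elim (α := Fin 1) ν₁ ν₂]; exact lt_irrefl _)
      brace := fun ν₁ ν₂ h => absurd h (by
        rw [Subsingleton.elim (α := Fin 1) ν₁ ν₂]; exact lt_irrefl _) }⟩

/-- The dg condensation `|seq|`: the non-normalised totalisation by the output ordinal (a product)
of the non-normalised realisation by the input ordinals (a direct sum), so that
`|seq|(U)^n = ∏_m ⊕_{m - ∑ ℓ_ν = n} k[seq(U)({[ℓ_ν]}; [m])]`. -/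
def condensedSeq (k : Type u) [Field k] : Dg2OperadData k where
  obj U := ∀ m, Chains k U m
  deg U n :=
    { carrier := {f | ∀ m, ∀ x ∈ (f m).support, (m : ℤ) - x.dim = n}
      add_mem' := by
        classical
        intro f g hf hg m x hx
        rcases Finset.mem_union.1 (Finsupp.support_add hx) with h | h
        · exact hf m x h
        · exact hg m x h
      zero_mem' := by
        intro m x hx
        simp at hx
      smul_mem' := by
        intro c f hf m x hx
        exact hf m x (Finsupp.support_smul hx) }
  d U := LinearMap.pi fun m =>
    match m with
    | 0 => (chainD k U 0).comp (LinearMap.proj 0)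
    | m + 1 => (chainD k U (m + 1)).comp (LinearMap.proj (m + 1)) -
        (cochainD k U m).comp (LinearMap.proj m)
  comp F := condensedComp k F
  one := fun m => Finsupp.single (idCell m) 1

/-! ## The whiskering map -/

namespace Cell

variable {U : TwoDisk}

/-- For `p_ν : I'_ν → I_ν`, a point of `I'_ν` is new if it is not the first element of its fibre;
equivalently, if the elementary interval of `I'_ν` ending at this point is an inserted one. -/
def IsNew {ℓ ℓ' : U.Ball → ℕ} (p : ∀ ν, Fin (ℓ' ν + 1) → Fin (ℓ ν + 1)) (z : Points ℓ') : Prop :=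
  ∃ j < z.2, p z.1 j = p z.1 z.2

open Classical in
/-- The element `w_{J,s}(α)` for `J = [q]` and `s = {p_ν : I'_ν → I_ν}`: the pulled back total
order, with the map `W'` that sends the first point to `0` and increases by one precisely along
the inserted elementary intervals.  (If there are `q` inserted intervals, as in all uses below,
then the clamping has no effect.) -/
def whisker (x : Cell U 0) (q : ℕ) (ℓ' : U.Ball → ℕ) (p : ∀ ν, Fin (ℓ' ν + 1) → Fin (x.1 ν + 1))
    (hp : ∀ ν, Monotone (p ν)) : Cell U q :=
  ⟨ℓ', { x.2.pull p hp with
    W := fun z => Fin.clamp (Finset.univ.filter fun y : Points ℓ' =>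
      IsNew p y ∧ (y = z ∨ (x.2.pull p hp).lt y z)).card q
    W_mono := fun a b h => by
      simp only [Fin.clamp, Fin.mk_le_mk]
      refine min_le_min_right _ (Finset.card_le_card ?_)
      intro y
      simp only [Finset.mem_filter, Finset.mem_univ, true_and]
      rintro ⟨hy, rfl | hlt⟩
      · exact ⟨hy, Or.inr h⟩
      · exact ⟨hy, Or.inr ((x.2.pull p hp).trans _ _ _ hlt h)⟩ }⟩

open Classical in
/-- The exponent of the sign of `w_{J,s}(α)`.  It is the sign of the permutation of the elementary
intervals of the `I'_ν` (each named by its right end) from the lexicographic order (by `ν`, and by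
the order of `I'_ν` for the same `ν`) to the order in which the old intervals come first, in the
lexicographic order, and then the inserted ones, in the pulled back total order. -/
def whiskerSign (x : Cell U 0) (ℓ' : U.Ball → ℕ) (p : ∀ ν, Fin (ℓ' ν + 1) → Fin (x.1 ν + 1))
    (hp : ∀ ν, Monotone (p ν)) : ℕ :=
  (Finset.univ.filter fun z : Points ℓ' × Points ℓ' =>
    IsNew p z.1 ∧ 0 < (z.2.2 : ℕ) ∧
    (z.1.1 < z.2.1 ∨ (z.1.1 = z.2.1 ∧ (z.1.2 : ℕ) < (z.2.2 : ℕ))) ∧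
    (¬ IsNew p z.2 ∨ (x.2.pull p hp).lt z.2 z.1)).card

end Cell

open Classical in
/-- The whiskering map `w(α) = ∏_q w_{[q]}(α)`, where `w_{[q]}(α)` is the signed sum over all
families of surjections `p_ν : I'_ν → I_ν` of 1-ordinals that insert `q` elementary intervals. -/
def whiskering (k : Type u) [Field k] (U : TwoDisk) :
    Chains k U 0 →ₗ[k] (∀ m, Chains k U m) :=
  LinearMap.pi fun q => Finsupp.linearCombination k fun x : Cell U 0 =>
    ∑ ℓ' ∈ (Finset.univ : Finset U.Ball).piAntidiag (x.dim + q),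
      ∑ p : (∀ ν, Fin (ℓ' ν + 1) → Fin (x.1 ν + 1)),
        if h : (∀ ν, Monotone (p ν)) ∧ ∀ ν, Function.Surjective (p ν) then
          Finsupp.single (x.whisker q ℓ' p h.1) ((-1 : k) ^ x.whiskerSign ℓ' p h.1)
        else 0

/-! ## `Breq` and its normalisation -/

/-- The dg 2-operad `Breq`: `Breq(U)` is the non-normalised realisation of
`seq(U)({I_ν}; [0])`, and the composition of the `x μ` and `y` is the composition of the `w (x μ)`
and `y`, where `y` is placed in the component `J = [0]` of `|seq|(V)`. -/
def breq (k : Type u) [Field k] : Dg2OperadData k where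
  obj U := Chains k U 0
  deg U n := Finsupp.supported k k {x : Cell U 0 | -(x.dim : ℤ) = n}
  d U := chainD k U 0
  comp {_ _ _ T} F x y :=
    condensedComp k F (fun μ => whiskering k (T μ) (x μ)) (Pi.single 0 y) 0
  one := Finsupp.single (idCell 0) 1

/-- A total order is degenerate if it has two consecutive elements of the same colour. -/
def Cell.IsDegenerate {U : TwoDisk} (x : Cell U 0) : Prop :=
  ∃ (ν : U.Ball) (i j : Fin (x.1 ν + 1)), i < j ∧
    ∀ z, ¬ (x.2.lt ⟨ν, i⟩ z ∧ x.2.lt z ⟨ν, j⟩)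

/-- The subspace `Breq(U)₀` spanned by the degenerate total orders. -/
def degenerate (k : Type u) [Field k] (U : TwoDisk) : Submodule k (Chains k U 0) :=
  Finsupp.supported k k {x : Cell U 0 | x.IsDegenerate}

open Classical in
/-- The representative of a class modulo degenerate orders that has no degenerate terms. -/
def normalForm (k : Type u) [Field k] (U : TwoDisk) :
    (Chains k U 0 ⧸ degenerate k U) →ₗ[k] Chains k U 0 :=
  (degenerate k U).liftQ
    ((Finsupp.supported k k {x : Cell U 0 | ¬ x.IsDegenerate}).subtype ∘ₗ
      Finsupp.restrictDom k k {x : Cell U 0 | ¬ x.IsDegenerate})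
    (fun f hf => by
      have h : ∀ x ∈ f.support, x.IsDegenerate := fun x hx => hf hx
      simp only [LinearMap.mem_ker, LinearMap.comp_apply, Submodule.subtype_apply,
        Finsupp.restrictDom_apply]
      exact (Finsupp.filter_eq_zero_iff _ _).2 fun x hx => by
        by_contra h0
        exact hx (h x (Finsupp.mem_support_iff.2 h0)))

/-- The dg 2-operad `Nor(Breq)`: the quotient of `Breq` by the degenerate orders, with the
differential and the composition computed on representatives. -/
def norBreq (k : Type u) [Field k] : Dg2OperadData k where
  obj U := Chains k U 0 ⧸ degenerate k U
  deg U n := ((breq k).deg U n).map (degenerate k U).mkQ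
  d U := (degenerate k U).mkQ ∘ₗ chainD k U 0 ∘ₗ normalForm k U
  comp {U V _ T} F x y :=
    (degenerate k U).mkQ
      ((breq k).comp F (fun μ => normalForm k (T μ) (x μ)) (normalForm k V y))
  one := (degenerate k point).mkQ (breq k).one

/-- The quotient map `Breq(U) → Nor(Breq)(U)`. -/
def normalization (k : Type u) [Field k] (U : TwoDisk) :
    (breq k).obj U →ₗ[k] (norBreq k).obj U :=
  (degenerate k U).mkQ

end

/-!
Cells of `seq` are handled in coordinates: the points of a family of ordinals `[ℓ ν]` are the pairs
`(ν, i)` with `i ≤ ℓ ν`, and a cell is determined by its dimensions, by the order `Cell.rel` of its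
points and by their labels `Cell.lab` in the output ordinal (`Cell.ext'`). Faces `Cell.fc`, which
omit a point, and degeneracies `Cell.dg`, which double one, are substitutions of coordinates.

The mechanism behind all the homotopies is the formula `Cell.chainD_of_doubling` for the boundary
of a cell in which one point `z` has been doubled. The faces at the two copies of `z` appear with
opposite signs and the other faces are the doublings of the faces, so that a signed sum over `z` of
doublings has a boundary that telescopes along the total order (`Cell.chainD_hop_single`). It is
used three times.

* If a cut of the output ordinal is inserted between the two copies of a point labelled `u`, and
  `z` runs through all points labelled `u`, the result is an operator `eop k u` whose commutator
  with the simplicial differential is the difference of the cofaces `u` and `u + 1` (`chainD_eop`).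
  Whiskering is generated by this operator: removing from a family of surjections the inserted
  interval of a given rank gives `w_[q+1] = ± eop k u w_[q]` for *every* `u ≤ q`
  (`whiskering_succ`; the sign is computed in `whiskerSign_ins`). With `u = q` this recursion
  determines `w` by its component at `[0]` and yields `dtot_whiskering`. Since `eop` is also
  compatible with the composition (`comp_eop`), the composite of whiskered families is whiskered,
  which is `comp_whiskering`.
* If a cut that is present is moved through the points of one label, one gets the homotopy `hop`.
  Together with the last codegeneracy of the output ordinal it contracts the part of `|seq|(U)` of
  positive output, by successive approximation in the output ordinal (`exists_dtot_eq`). As `w` is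
  a section of the projection to the component at `[0]`, it is a quasi-isomorphism.
* Doubling the first repetition of a degenerate order contracts the degenerate orders modulo those
  with an earlier repetition (`sub_homotopy_mem_repBelow`), so that they span an acyclic subcomplex
  (`exists_chainD_eq_of_mem_degenerate`) and the normalisation is a quasi-isomorphism.

The axioms for `|seq|` are reduced to basis elements by the principles `LocLin.eq_zero` and
`LocMulti.eq_zero`, which cope with the products over the output ordinals. On basis elements they
say that composites are characterised in coordinates (`Cell.IsComp`), that a coface of an inner
cell is traded for a face of the outer one (`Cell.IsComp.fc_outer`), and that the Koszul signs
agree; the signs are quadratic forms over the field with two elements (`sgn`, `sgn_assoc`). The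
axioms for `Breq` follow because `w` is injective and multiplicative, and those for the quotient
because composition with a degenerate order is degenerate (`compB_mem_degenerate_left`,
`compB_mem_degenerate_right`). For an outer degenerate order this uses the recursion of whiskering
once more: two consecutive labels `t`, `t + 1` of an inner cell arise by an insertion at `t`, and
the two points so created remain consecutive in the composite.
-/

/-! ### Points and cells in coordinates -/

/-- The points `(ν, i)`, `0 ≤ i ≤ ℓ ν`, of a family of ordinals `[ℓ ν]`. -/
def pts {n : ℕ} (ℓ : Fin n → ℕ) : Finset (Fin n × ℕ) :=
  Finset.univ.biUnion fun ν => (Finset.range (ℓ ν + 1)).image (Prod.mk ν)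

@[simp] theorem mem_pts {n : ℕ} {ℓ : Fin n → ℕ} {a : Fin n × ℕ} : a ∈ pts ℓ ↔ a.2 ≤ ℓ a.1 := by
  obtain ⟨ν, i⟩ := a
  simp [pts]

theorem sum_pts {M : Type*} [AddCommMonoid M] {n : ℕ} (ℓ : Fin n → ℕ) (f : Fin n × ℕ → M) :
    ∑ a ∈ pts ℓ, f a = ∑ ν, ∑ i : Fin (ℓ ν + 1), f (ν, i) := by
  rw [pts, Finset.sum_biUnion]
  · refine Finset.sum_congr rfl fun ν _ => ?_
    rw [Finset.sum_image (by intro a _ b _ h; simpa using h), Finset.sum_range]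
  · intro ν _ ν' _ h
    simp only [Function.onFun, Finset.disjoint_left, Finset.mem_image, not_exists, not_and]
    rintro a ⟨i, _, rfl⟩ j _ h'
    exact h (by simpa using (congrArg Prod.fst h').symm)

namespace Cell

variable {U V : TwoDisk} {m : ℕ}

/-- The total order of a cell, as a relation between points in coordinates. -/
def rel (x : Cell U m) (a b : U.Ball × ℕ) : Prop :=
  ∃ (ha : a.2 < x.1 a.1 + 1) (hb : b.2 < x.1 b.1 + 1),
    x.2.lt ⟨a.1, ⟨a.2, ha⟩⟩ ⟨b.1, ⟨b.2, hb⟩⟩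

/-- The label in the output ordinal of a point in coordinates. -/
def lab (x : Cell U m) (a : U.Ball × ℕ) : ℕ :=
  if ha : a.2 < x.1 a.1 + 1 then (x.2.W ⟨a.1, ⟨a.2, ha⟩⟩ : ℕ) else 0

theorem rel.left {x : Cell U m} {a b : U.Ball × ℕ} (h : x.rel a b) : a ∈ pts x.1 := by
  obtain ⟨h, _⟩ := h
  simpa [Nat.lt_succ_iff] using h

theorem rel.right {x : Cell U m} {a b : U.Ball × ℕ} (h : x.rel a b) : b ∈ pts x.1 := by
  obtain ⟨_, h, _⟩ := h
  simpa [Nat.lt_succ_iff] using h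

theorem rel_irrefl (x : Cell U m) (a : U.Ball × ℕ) : ¬ x.rel a a :=
  fun ⟨_, _, h⟩ => x.2.irrefl _ h

theorem rel_trans {x : Cell U m} {a b c : U.Ball × ℕ} (h : x.rel a b) (h' : x.rel b c) :
    x.rel a c := by
  obtain ⟨h1, h2, h⟩ := h
  obtain ⟨h3, h4, h'⟩ := h'
  exact ⟨h1, h4, x.2.trans _ _ _ h h'⟩

theorem rel_asymm {x : Cell U m} {a b : U.Ball × ℕ} (h : x.rel a b) : ¬ x.rel b a :=
  fun h' => x.rel_irrefl _ (rel_trans h h')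

theorem rel_total (x : Cell U m) {a b : U.Ball × ℕ} (ha : a ∈ pts x.1) (hb : b ∈ pts x.1)
    (hab : a ≠ b) : x.rel a b ∨ x.rel b a := by
  obtain ⟨ν, i⟩ := a
  obtain ⟨ν', j⟩ := b
  simp only [mem_pts] at ha hb
  rcases x.2.total ⟨ν, ⟨i, Nat.lt_succ_iff.2 ha⟩⟩ ⟨ν', ⟨j, Nat.lt_succ_iff.2 hb⟩⟩ (by
    intro h
    apply hab
    obtain rfl : ν = ν' := congrArg Sigma.fst h
    have := eq_of_heq (Sigma.mk.inj h).2
    simp only [Fin.mk.injEq] at this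
    rw [this]) with h | h
  · exact Or.inl ⟨_, _, h⟩
  · exact Or.inr ⟨_, _, h⟩

theorem rel_index (x : Cell U m) {ν : U.Ball} {i j : ℕ} (hij : i < j) (hj : j ≤ x.1 ν) :
    x.rel (ν, i) (ν, j) :=
  ⟨by dsimp; omega, by dsimp; omega, x.2.order ν _ _ hij⟩

theorem rel_same (x : Cell U m) {ν : U.Ball} {i j : ℕ} :
    x.rel (ν, i) (ν, j) ↔ i < j ∧ j ≤ x.1 ν := by
  refine ⟨fun h => ⟨?_, by simpa using h.right⟩, fun h => x.rel_index h.1 h.2⟩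
  by_contra hij
  rcases (not_lt.1 hij).lt_or_eq with h' | rfl
  · exact rel_asymm h (x.rel_index h' (by simpa using h.left))
  · exact x.rel_irrefl _ h

theorem lab_eq (x : Cell U m) {a : U.Ball × ℕ} (ha : a ∈ pts x.1) :
    x.lab a = (x.2.W ⟨a.1, ⟨a.2, Nat.lt_succ_iff.2 (mem_pts.1 ha)⟩⟩ : ℕ) :=
  dif_pos (Nat.lt_succ_iff.2 (mem_pts.1 ha))

theorem lab_mono {x : Cell U m} {a b : U.Ball × ℕ} (h : x.rel a b) : x.lab a ≤ x.lab b := by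
  obtain ⟨ha, hb, h⟩ := h
  simp only [lab, ha, hb, dif_pos]
  exact x.2.W_mono _ _ h

theorem lab_le (x : Cell U m) (a : U.Ball × ℕ) : x.lab a ≤ m := by
  unfold lab
  split_ifs
  · exact Nat.lt_succ_iff.1 (Fin.is_lt _)
  · exact Nat.zero_le _

/-- A cell is determined by its order and its labels; as the orders are total, it suffices that
one order implies the other. -/
theorem ext' {x y : Cell U m} (h : x.1 = y.1)
    (hr : ∀ a b, a ∈ pts x.1 → b ∈ pts x.1 → x.rel a b → y.rel a b)
    (hl : ∀ a ∈ pts x.1, x.lab a = y.lab a) : x = y := by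
  obtain ⟨ℓ, x⟩ := x
  obtain ⟨ℓ', y⟩ := y
  obtain rfl : ℓ = ℓ' := h
  congr 1
  have key : ∀ a b : Points ℓ, x.lt a b → y.lt a b := by
    intro a b hab
    obtain ⟨_, _, h⟩ := hr (a.1, a.2) (b.1, b.2) (by simp [Nat.lt_succ_iff.1 a.2.2])
      (by simp [Nat.lt_succ_iff.1 b.2.2]) ⟨a.2.2, b.2.2, hab⟩
    exact h
  apply TSeq.ext
  · funext a b
    refine propext ⟨key a b, fun hab => ?_⟩
    by_contra hn
    rcases eq_or_ne a b with rfl | hne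
    · exact y.irrefl _ hab
    · rcases x.total a b hne with h1 | h1
      · exact hn h1
      · exact y.irrefl _ (y.trans _ _ _ hab (key _ _ h1))
  · funext a
    have := hl (a.1, a.2) (by simp [Nat.lt_succ_iff.1 a.2.2])
    simp only [lab, a.2.2, dif_pos] at this
    exact Fin.ext this

/-! ### Pulling back and relabelling -/

/-- The pull-back of a cell along maps `[ℓ' ν] → [ℓ ν]` given on natural numbers (values that are
too large are clamped). -/
def pl (x : Cell U m) (ℓ' : U.Ball → ℕ) (φ : U.Ball → ℕ → ℕ) (hφ : ∀ ν, Monotone (φ ν)) :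
    Cell U m :=
  ⟨ℓ', x.2.pull (fun ν j => Fin.clamp (φ ν j) (x.1 ν)) (fun ν i j hij => by
    simp only [Fin.clamp, Fin.mk_le_mk]
    exact min_le_min_right _ (hφ ν hij))⟩

/-- The map on points induced by maps on each ordinal. -/
def onPt (φ : U.Ball → ℕ → ℕ) (a : U.Ball × ℕ) : U.Ball × ℕ := (a.1, φ a.1 a.2)

@[simp] theorem onPt_fst (φ : U.Ball → ℕ → ℕ) (a : U.Ball × ℕ) : (onPt φ a).1 = a.1 := rfl

@[simp] theorem pl_fst (x : Cell U m) (ℓ' : U.Ball → ℕ) (φ : U.Ball → ℕ → ℕ)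
    (hφ : ∀ ν, Monotone (φ ν)) : (x.pl ℓ' φ hφ).1 = ℓ' := rfl

theorem clamp_of_le {n k : ℕ} (h : n ≤ k) : Fin.clamp n k = ⟨n, Nat.lt_succ_iff.2 h⟩ := by
  simp [Fin.clamp, h]

theorem rel_pl {x : Cell U m} {ℓ' : U.Ball → ℕ} {φ : U.Ball → ℕ → ℕ}
    {hφ : ∀ ν, Monotone (φ ν)} {a b : U.Ball × ℕ} (ha : a ∈ pts ℓ') (hb : b ∈ pts ℓ')
    (ha' : onPt φ a ∈ pts x.1) (hb' : onPt φ b ∈ pts x.1) :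
    (x.pl ℓ' φ hφ).rel a b ↔
      x.rel (onPt φ a) (onPt φ b) ∨ (onPt φ a = onPt φ b ∧ a.2 < b.2) := by
  obtain ⟨ν, i⟩ := a
  obtain ⟨ν', j⟩ := b
  simp only [mem_pts, onPt] at ha hb ha' hb'
  simp only [rel, pl, TSeq.pull, TSeq.mapPoints, onPt, Nat.lt_succ_iff, ha, hb, ha', hb',
    exists_true_left, clamp_of_le]
  refine or_congr Iff.rfl (and_congr_left fun _ => ?_)
  constructor
  · intro h
    obtain rfl : ν = ν' := congrArg Sigma.fst h
    have := eq_of_heq (Sigma.mk.inj h).2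
    simp only [Fin.mk.injEq] at this
    rw [this]
  · intro h
    obtain rfl : ν = ν' := congrArg Prod.fst h
    have h2 := congrArg Prod.snd h
    dsimp only at h2
    simp only [h2]

theorem lab_pl {x : Cell U m} {ℓ' : U.Ball → ℕ} {φ : U.Ball → ℕ → ℕ}
    {hφ : ∀ ν, Monotone (φ ν)} {a : U.Ball × ℕ} (ha : a ∈ pts ℓ') (ha' : onPt φ a ∈ pts x.1) :
    (x.pl ℓ' φ hφ).lab a = x.lab (onPt φ a) := by
  rw [lab_eq _ (show a ∈ pts (x.pl ℓ' φ hφ).1 from ha), lab_eq _ ha']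
  simp only [mem_pts, onPt] at ha ha'
  simp only [pl, TSeq.pull, TSeq.mapPoints, onPt, clamp_of_le ha']

theorem pl_pl {x : Cell U m} {ℓ' ℓ'' : U.Ball → ℕ} {φ ψ : U.Ball → ℕ → ℕ}
    {hφ : ∀ ν, Monotone (φ ν)} {hψ : ∀ ν, Monotone (ψ ν)}
    (h : ∀ a ∈ pts ℓ'', onPt ψ a ∈ pts ℓ') (h' : ∀ a ∈ pts ℓ', onPt φ a ∈ pts x.1) :
    (x.pl ℓ' φ hφ).pl ℓ'' ψ hψ =
      x.pl ℓ'' (fun ν => φ ν ∘ ψ ν) (fun ν => (hφ ν).comp (hψ ν)) := by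
  have e : ∀ a, onPt (fun ν => φ ν ∘ ψ ν) a = onPt φ (onPt ψ a) := fun a => rfl
  have h2 : ∀ a ∈ pts ℓ'', onPt (fun ν => φ ν ∘ ψ ν) a ∈ pts x.1 := fun a ha => by
    rw [e]; exact h' _ (h a ha)
  have h3 : ∀ a ∈ pts ℓ'', onPt ψ a ∈ pts (x.pl ℓ' φ hφ).1 := h
  refine ext' rfl (fun a b ha hb hr => ?_) fun a ha => ?_
  · change a ∈ pts ℓ'' at ha
    change b ∈ pts ℓ'' at hb
    rw [rel_pl ha hb (h3 a ha) (h3 b hb), rel_pl (h a ha) (h b hb) (h' _ (h a ha))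
      (h' _ (h b hb))] at hr
    rw [rel_pl ha hb (h2 a ha) (h2 b hb), e, e]
    rcases hr with (hr | ⟨h1, h2⟩) | ⟨h1, h2⟩
    · exact Or.inl hr
    · refine Or.inr ⟨h1, ?_⟩
      by_contra hn
      have h3 : (onPt φ (onPt ψ a)).1 = (onPt φ (onPt ψ b)).1 := congrArg Prod.fst h1
      simp only [onPt_fst] at h3
      have h4 : ψ b.1 b.2 ≤ ψ b.1 a.2 := hψ _ (not_lt.1 hn)
      simp only [onPt, h3] at h2
      omega
    · exact Or.inr ⟨congrArg (onPt φ) h1, h2⟩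
  · change a ∈ pts ℓ'' at ha
    rw [lab_pl ha (h3 a ha), lab_pl (h a ha) (h' _ (h a ha)), lab_pl ha (h2 a ha), e]

theorem pl_congr {x : Cell U m} {ℓ' ℓ'' : U.Ball → ℕ} {φ ψ : U.Ball → ℕ → ℕ}
    {hφ : ∀ ν, Monotone (φ ν)} {hψ : ∀ ν, Monotone (ψ ν)} (hℓ : ℓ' = ℓ'')
    (h : ∀ a ∈ pts ℓ', φ a.1 a.2 = ψ a.1 a.2) (h' : ∀ a ∈ pts ℓ', onPt φ a ∈ pts x.1) :
    x.pl ℓ' φ hφ = x.pl ℓ'' ψ hψ := by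
  subst hℓ
  have e : ∀ a ∈ pts ℓ', onPt ψ a = onPt φ a := fun a ha => by simp [onPt, h a ha]
  refine ext' rfl (fun a b ha hb hr => ?_) fun a ha => ?_
  · change a ∈ pts ℓ' at ha
    change b ∈ pts ℓ' at hb
    rw [rel_pl ha hb (h' a ha) (h' b hb)] at hr
    rwa [rel_pl ha hb (by rw [e a ha]; exact h' a ha) (by rw [e b hb]; exact h' b hb),
      e a ha, e b hb]
  · change a ∈ pts ℓ' at ha
    rw [lab_pl ha (h' a ha), lab_pl ha (by rw [e a ha]; exact h' a ha), e a ha]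

theorem pl_self {x : Cell U m} {ℓ' : U.Ball → ℕ} {φ : U.Ball → ℕ → ℕ}
    {hφ : ∀ ν, Monotone (φ ν)} (hℓ : ℓ' = x.1) (h : ∀ a ∈ pts ℓ', φ a.1 a.2 = a.2) :
    x.pl ℓ' φ hφ = x := by
  subst hℓ
  have e : ∀ a ∈ pts x.1, onPt φ a = a := fun a ha => by simp [onPt, h a ha]
  refine ext' rfl (fun a b ha hb hr => ?_) fun a ha => ?_
  · change a ∈ pts x.1 at ha
    change b ∈ pts x.1 at hb
    rw [rel_pl ha hb (by rwa [e a ha]) (by rwa [e b hb]), e a ha, e b hb] at hr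
    rcases hr with hr | ⟨rfl, h2⟩
    · exact hr
    · exact absurd h2 (lt_irrefl _)
  · change a ∈ pts x.1 at ha
    rw [lab_pl ha (by rwa [e a ha]), e a ha]

/-- The cell with the same order and with new labels, which are clamped. -/
def relabel (x : Cell U m) (m' : ℕ) (g : U.Ball × ℕ → ℕ) (hg : ∀ a b, x.rel a b → g a ≤ g b) :
    Cell U m' :=
  ⟨x.1, { x.2 with
    W := fun a => Fin.clamp (g (a.1, a.2)) m'
    W_mono := fun a b h => by
      simp only [Fin.clamp, Fin.mk_le_mk]
      exact min_le_min_right _ (hg _ _ ⟨a.2.2, b.2.2, h⟩) }⟩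

theorem lab_relabel {x : Cell U m} {m' : ℕ} {g : U.Ball × ℕ → ℕ}
    {hg : ∀ a b, x.rel a b → g a ≤ g b} {a : U.Ball × ℕ} (ha : a ∈ pts x.1) (h : g a ≤ m') :
    (x.relabel m' g hg).lab a = g a := by
  rw [lab_eq _ (show a ∈ pts (x.relabel m' g hg).1 from ha)]
  simpa [relabel, Fin.clamp] using h

/-! ### Faces, degeneracies and cofaces -/

/-- The coface map of points that skips `w`, on coordinates. -/
def fφ (w : U.Ball × ℕ) (ν : U.Ball) (j : ℕ) : ℕ := if ν = w.1 ∧ w.2 ≤ j then j + 1 else j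

/-- The codegeneracy map of points that repeats the value `z`, on coordinates. -/
def sφ (z : U.Ball × ℕ) (ν : U.Ball) (j : ℕ) : ℕ := if ν = z.1 ∧ z.2 < j then j - 1 else j

theorem fφ_mono (w : U.Ball × ℕ) (ν : U.Ball) : Monotone (fφ w ν) := by
  intro i j hij
  unfold fφ
  grind

theorem sφ_mono (w : U.Ball × ℕ) (ν : U.Ball) : Monotone (sφ w ν) := by
  intro i j hij
  unfold sφ
  grind

/-- The coface map of points that skips `w`. -/
def fmap (w a : U.Ball × ℕ) : U.Ball × ℕ := (a.1, fφ w a.1 a.2)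

/-- The codegeneracy map of points that takes the value `z` twice, at `z` and at `nx z`. -/
def smap (z a : U.Ball × ℕ) : U.Ball × ℕ := (a.1, sφ z a.1 a.2)

/-- The point after `z` of the same ball. -/
def nx (z : U.Ball × ℕ) : U.Ball × ℕ := (z.1, z.2 + 1)

/-- The dimensions after a face in the ball of `w`. -/
def lo (ℓ : U.Ball → ℕ) (w : U.Ball × ℕ) : U.Ball → ℕ := Function.update ℓ w.1 (ℓ w.1 - 1)

/-- The dimensions after a degeneracy in the ball of `z`. -/
def hi (ℓ : U.Ball → ℕ) (z : U.Ball × ℕ) : U.Ball → ℕ := Function.update ℓ z.1 (ℓ z.1 + 1)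

theorem lo_apply (ℓ : U.Ball → ℕ) (w : U.Ball × ℕ) (ν : U.Ball) :
    lo ℓ w ν = if ν = w.1 then ℓ ν - 1 else ℓ ν := by
  unfold lo
  by_cases h : ν = w.1
  · subst h; simp
  · simp [h]

theorem hi_apply (ℓ : U.Ball → ℕ) (w : U.Ball × ℕ) (ν : U.Ball) :
    hi ℓ w ν = if ν = w.1 then ℓ ν + 1 else ℓ ν := by
  unfold hi
  by_cases h : ν = w.1
  · subst h; simp
  · simp [h]

/-- The face of a cell at a point. -/
def fc (x : Cell U m) (w : U.Ball × ℕ) : Cell U m := x.face w.1 w.2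

theorem fc_eq_pl (x : Cell U m) (w : U.Ball × ℕ) : x.fc w = x.pl (lo x.1 w) (fφ w) (fφ_mono w) :=
  rfl

/-- The degeneracy of a cell at a point: the point `z` is replaced by `z < nx z`. -/
def dg (x : Cell U m) (z : U.Ball × ℕ) : Cell U m := x.pl (hi x.1 z) (sφ z) (sφ_mono z)

@[simp] theorem fc_fst (x : Cell U m) (w : U.Ball × ℕ) : (x.fc w).1 = lo x.1 w := rfl
@[simp] theorem dg_fst (x : Cell U m) (w : U.Ball × ℕ) : (x.dg w).1 = hi x.1 w := rfl

theorem onPt_fφ (w a : U.Ball × ℕ) : onPt (fφ w) a = fmap w a := rfl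
theorem onPt_sφ (w a : U.Ball × ℕ) : onPt (sφ w) a = smap w a := rfl

theorem fmap_mem {ℓ : U.Ball → ℕ} {w a : U.Ball × ℕ} (hw : 1 ≤ ℓ w.1) (ha : a ∈ pts (lo ℓ w)) :
    fmap w a ∈ pts ℓ := by
  simp only [mem_pts, lo_apply, fmap, fφ] at *
  split_ifs at * with h1 h2 <;> grind

theorem smap_mem {ℓ : U.Ball → ℕ} {z a : U.Ball × ℕ} (hz : z ∈ pts ℓ) (ha : a ∈ pts (hi ℓ z)) :
    smap z a ∈ pts ℓ := by
  simp only [mem_pts, hi_apply, smap, sφ] at *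
  split_ifs at * with h1 h2 <;> grind

theorem fmap_injective (w : U.Ball × ℕ) : Function.Injective (fmap w) := by
  rintro ⟨ν, i⟩ ⟨ν', j⟩ h
  simp only [fmap, fφ, Prod.mk.injEq] at h ⊢
  grind

theorem rel_fc {x : Cell U m} {w a b : U.Ball × ℕ} (hw : 1 ≤ x.1 w.1) (ha : a ∈ pts (lo x.1 w))
    (hb : b ∈ pts (lo x.1 w)) : (x.fc w).rel a b ↔ x.rel (fmap w a) (fmap w b) := by
  rw [fc_eq_pl, rel_pl ha hb (fmap_mem hw ha) (fmap_mem hw hb), onPt_fφ, onPt_fφ]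
  refine ⟨?_, Or.inl⟩
  rintro (h | ⟨h, h'⟩)
  · exact h
  · rw [fmap_injective w h] at h'
    exact absurd h' (lt_irrefl _)

theorem lab_fc {x : Cell U m} {w a : U.Ball × ℕ} (hw : 1 ≤ x.1 w.1) (ha : a ∈ pts (lo x.1 w)) :
    (x.fc w).lab a = x.lab (fmap w a) := by
  rw [fc_eq_pl, lab_pl ha (fmap_mem hw ha), onPt_fφ]

theorem rel_dg {x : Cell U m} {z a b : U.Ball × ℕ} (hz : z ∈ pts x.1) (ha : a ∈ pts (hi x.1 z))
    (hb : b ∈ pts (hi x.1 z)) :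
    (x.dg z).rel a b ↔ x.rel (smap z a) (smap z b) ∨ (a = z ∧ b = nx z) := by
  rw [dg, rel_pl ha hb (smap_mem hz ha) (smap_mem hz hb), onPt_sφ, onPt_sφ]
  refine or_congr Iff.rfl ?_
  obtain ⟨ν, i⟩ := a
  obtain ⟨ν', j⟩ := b
  obtain ⟨ν'', l⟩ := z
  simp only [smap, sφ, Prod.mk.injEq, nx]
  grind

theorem lab_dg {x : Cell U m} {z a : U.Ball × ℕ} (hz : z ∈ pts x.1) (ha : a ∈ pts (hi x.1 z)) :
    (x.dg z).lab a = x.lab (smap z a) := by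
  rw [dg, lab_pl ha (smap_mem hz ha), onPt_sφ]

theorem mem_hi_self {ℓ : U.Ball → ℕ} {z : U.Ball × ℕ} (hz : z ∈ pts ℓ) : z ∈ pts (hi ℓ z) := by
  simp only [mem_pts, hi_apply] at *
  simp; omega

theorem nx_mem_hi {ℓ : U.Ball → ℕ} {z : U.Ball × ℕ} (hz : z ∈ pts ℓ) : nx z ∈ pts (hi ℓ z) := by
  simp only [mem_pts, hi_apply, nx] at *
  simp; omega

/-- Faces at two different points commute. -/
theorem fc_fc {x : Cell U m} {w w' : U.Ball × ℕ} (hw : w ∈ pts x.1) (hw' : w' ∈ pts x.1)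
    (hne : w ≠ w') (h : 1 ≤ x.1 w.1) (h' : 1 ≤ lo x.1 w w'.1) :
    (x.fc w).fc (smap w w') = (x.fc w').fc (smap w' w) := by
  have h1 : 1 ≤ x.1 w'.1 := by
    rw [lo_apply] at h'; split_ifs at h' <;> omega
  have h2 : 1 ≤ lo x.1 w' w.1 := by
    rw [lo_apply] at *; split_ifs at * <;> grind
  have key : ∀ v v' : U.Ball × ℕ, 1 ≤ x.1 v.1 → 1 ≤ lo x.1 v v'.1 →
      (x.fc v).fc (smap v v') = x.pl (lo (lo x.1 v) (smap v v'))
        (fun ν => fφ v ν ∘ fφ (smap v v') ν)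
        (fun ν => (fφ_mono _ ν).comp (fφ_mono _ ν)) := by
    intro v v' hv hv'
    rw [fc_eq_pl, fc_eq_pl, pl_pl]
    · rfl
    · intro a ha
      exact fmap_mem hv' ha
    · intro a ha
      exact fmap_mem hv ha
  rw [key _ _ h h', key _ _ h1 h2]
  refine pl_congr ?_ ?_ ?_
  · funext ν
    simp only [lo_apply, smap]
    split_ifs <;> omega
  · intro a ha
    obtain ⟨ν, i⟩ := w
    obtain ⟨ν', j⟩ := w'
    have : ¬ (ν = ν' ∧ i = j) := by simpa using hne
    simp only [Function.comp, fφ, smap, sφ]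
    clear key
    grind
  · intro a ha
    have := fmap_mem h (fmap_mem (w := smap w w') (ℓ := lo x.1 w) h' ha)
    exact this

/-- The faces of a degeneracy at the repeated point. -/
theorem fc_dg_self {x : Cell U m} {z w : U.Ball × ℕ} (hz : z ∈ pts x.1) (hw : w = z ∨ w = nx z) :
    (x.dg z).fc w = x := by
  have hw1 : w.1 = z.1 := by rcases hw with rfl | rfl <;> rfl
  rw [fc_eq_pl, dg, pl_pl]
  · refine pl_self ?_ ?_
    · funext ν
      simp only [lo_apply, hi_apply, pl_fst, hw1]
      split_ifs <;> omega
    · intro a ha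
      rcases hw with rfl | rfl <;> simp only [Function.comp, fφ, sφ, nx] <;> grind
  · intro a ha
    exact fmap_mem (by simp [hi_apply, hw1]) ha
  · intro a ha
    exact smap_mem hz ha

/-- The other faces of a degeneracy are degeneracies of faces. -/
theorem fc_dg {x : Cell U m} {z w : U.Ball × ℕ} (hz : z ∈ pts x.1) (hw : w ∈ pts x.1)
    (hne : w ≠ z) (h : 1 ≤ x.1 w.1) :
    (x.dg z).fc (fmap (nx z) w) = (x.fc w).dg (smap w z) := by
  have hz' : smap w z ∈ pts (lo x.1 w) := by
    obtain ⟨ν, i⟩ := w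
    obtain ⟨ν', j⟩ := z
    have : ¬ (ν = ν' ∧ i = j) := by simpa using hne
    simp only [smap, sφ, mem_pts, lo_apply] at *
    grind
  rw [fc_eq_pl, dg, pl_pl, fc_eq_pl, dg, pl_pl]
  · refine pl_congr ?_ ?_ ?_
    · funext ν
      simp only [lo_apply, hi_apply, pl_fst, smap, fmap]
      grind
    · intro a ha
      obtain ⟨ν, i⟩ := w
      obtain ⟨ν', j⟩ := z
      have : ¬ (ν = ν' ∧ i = j) := by simpa using hne
      simp only [Function.comp, fφ, sφ, nx, fmap, smap]
      grind
    · intro a ha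
      exact smap_mem hz (fmap_mem (w := fmap (nx z) w)
        (by simp only [hi_apply, fmap]; split_ifs <;> omega) ha)
  · intro a ha
    exact smap_mem (ℓ := lo x.1 w) hz' ha
  · intro a ha
    exact fmap_mem h ha
  · intro a ha
    exact fmap_mem (by simp only [hi_apply, fmap]; split_ifs <;> omega) ha
  · intro a ha
    exact smap_mem hz ha

theorem val_succAboveOrderEmb (j : Fin (m + 2)) (i : Fin (m + 1)) :
    ((Fin.succAboveOrderEmb j i : Fin (m + 2)) : ℕ) = if (i : ℕ) < j then (i : ℕ) else i + 1 := by
  simp only [Fin.succAboveOrderEmb_apply, Fin.succAbove, Fin.lt_def, Fin.val_castSucc]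
  split_ifs <;> simp

@[simp] theorem coface_fst (x : Cell U m) (j : Fin (m + 2)) : (x.coface j).1 = x.1 := rfl

@[simp] theorem rel_coface {x : Cell U m} {j : Fin (m + 2)} {a b : U.Ball × ℕ} :
    (x.coface j).rel a b ↔ x.rel a b := Iff.rfl

theorem lab_coface {x : Cell U m} {j : Fin (m + 2)} {a : U.Ball × ℕ} (ha : a ∈ pts x.1) :
    (x.coface j).lab a = if x.lab a < j then x.lab a else x.lab a + 1 := by
  rw [lab_eq _ (show a ∈ pts (x.coface j).1 from ha), lab_eq _ ha]
  exact val_succAboveOrderEmb j _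

theorem coface_coface {x : Cell U m} {i : Fin (m + 2)} {j : Fin (m + 3)} (h : (i : ℕ) < j) :
    (x.coface i).coface j =
      (x.coface (⟨j - 1, by omega⟩ : Fin (m + 2))).coface ⟨i, by omega⟩ := by
  refine ext' rfl (fun a b ha hb hr => hr) fun a ha => ?_
  simp only [coface_fst] at ha
  rw [lab_coface (by exact ha), lab_coface ha, lab_coface (by exact ha), lab_coface ha]
  simp only
  split_ifs <;> omega

end Cell

/-! ### Signs and sums over points -/

theorem neg_one_pow_of_mod_eq {R : Type*} [Ring R] {a b : ℕ} (h : a % 2 = b % 2) :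
    (-1 : R) ^ a = (-1) ^ b := by
  rw [neg_one_pow_eq_pow_mod_two, h, ← neg_one_pow_eq_pow_mod_two]

theorem neg_one_pow_of_mod_ne {R : Type*} [Ring R] {a b : ℕ} (h : a % 2 ≠ b % 2) :
    (-1 : R) ^ a = -(-1) ^ b := by
  rw [neg_one_pow_of_mod_eq (show a % 2 = (b + 1) % 2 by omega), pow_succ]
  simp

namespace Cell

variable {U V : TwoDisk} {m : ℕ}

/-- The exponent of the Koszul sign of a point: the dimensions of the balls before its ball, plus
its position in its own ordinal. -/
def ex (ℓ : U.Ball → ℕ) (w : U.Ball × ℕ) : ℕ := (∑ ν' ∈ Finset.Iio w.1, ℓ ν') + w.2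

theorem sum_Iio_hi (ℓ : U.Ball → ℕ) (z : U.Ball × ℕ) (ν : U.Ball) :
    ∑ ν' ∈ Finset.Iio ν, hi ℓ z ν' = ∑ ν' ∈ Finset.Iio ν, ℓ ν' + if z.1 < ν then 1 else 0 := by
  have : ∀ ν', hi ℓ z ν' = ℓ ν' + if ν' = z.1 then 1 else 0 := fun ν' => by
    rw [hi_apply]; split_ifs <;> rfl
  simp only [this, Finset.sum_add_distrib, Finset.sum_ite_eq', Finset.mem_Iio]

theorem sum_Iio_lo (ℓ : U.Ball → ℕ) (w : U.Ball × ℕ) (ν : U.Ball) (h : 1 ≤ ℓ w.1) :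
    (∑ ν' ∈ Finset.Iio ν, lo ℓ w ν' + if w.1 < ν then 1 else 0) = ∑ ν' ∈ Finset.Iio ν, ℓ ν' := by
  have : ∀ ν', ℓ ν' = lo ℓ w ν' + if ν' = w.1 then 1 else 0 := fun ν' => by
    rw [lo_apply]
    split_ifs with h1
    · subst h1; omega
    · rfl
  rw [Finset.sum_congr rfl fun ν' _ => this ν']
  simp only [Finset.sum_add_distrib, Finset.sum_ite_eq', Finset.mem_Iio]

theorem sum_lo (ℓ : U.Ball → ℕ) (w : U.Ball × ℕ) (h : 1 ≤ ℓ w.1) :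
    ∑ ν', lo ℓ w ν' + 1 = ∑ ν', ℓ ν' := by
  have : ∀ ν', ℓ ν' = lo ℓ w ν' + if ν' = w.1 then 1 else 0 := fun ν' => by
    rw [lo_apply]
    split_ifs with h1
    · subst h1; omega
    · rfl
  rw [Finset.sum_congr rfl fun ν' _ => this ν']
  simp [Finset.sum_add_distrib]

theorem sum_hi (ℓ : U.Ball → ℕ) (z : U.Ball × ℕ) : ∑ ν', hi ℓ z ν' = ∑ ν', ℓ ν' + 1 := by
  have : ∀ ν', hi ℓ z ν' = ℓ ν' + if ν' = z.1 then 1 else 0 := fun ν' => by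
    rw [hi_apply]; split_ifs <;> rfl
  simp [this, Finset.sum_add_distrib]

theorem smap_fmap (w a : U.Ball × ℕ) : smap w (fmap w a) = a := by
  obtain ⟨ν, i⟩ := w
  obtain ⟨ν', j⟩ := a
  simp only [smap, fmap, sφ, fφ, Prod.mk.injEq, true_and]
  grind

theorem fmap_smap {w a : U.Ball × ℕ} (h : a ≠ w) : fmap w (smap w a) = a := by
  obtain ⟨ν, i⟩ := w
  obtain ⟨ν', j⟩ := a
  have : ¬ (ν' = ν ∧ j = i) := by simpa using h
  simp only [smap, fmap, sφ, fφ, Prod.mk.injEq, true_and]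
  grind

theorem fmap_ne (w a : U.Ball × ℕ) : fmap w a ≠ w := by
  obtain ⟨ν, i⟩ := w
  obtain ⟨ν', j⟩ := a
  simp only [fmap, fφ, ne_eq, Prod.mk.injEq]
  grind

theorem smap_mem_lo {ℓ : U.Ball → ℕ} {w a : U.Ball × ℕ} (hw : w ∈ pts ℓ) (ha : a ∈ pts ℓ)
    (h : a ≠ w) : smap w a ∈ pts (lo ℓ w) := by
  obtain ⟨ν, i⟩ := w
  obtain ⟨ν', j⟩ := a
  have : ¬ (ν' = ν ∧ j = i) := by simpa using h
  simp only [mem_pts, smap, sφ, lo_apply] at *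
  grind

theorem fmap_nx_self (z : U.Ball × ℕ) : fmap (nx z) z = z := by
  simp [fmap, fφ, nx]

theorem smap_self (z : U.Ball × ℕ) : smap z z = z := by
  simp [smap, sφ]

theorem smap_nx (z : U.Ball × ℕ) : smap z (nx z) = z := by
  simp [smap, sφ, nx]

theorem smap_fmap_nx (z a : U.Ball × ℕ) : smap z (fmap (nx z) a) = a := by
  obtain ⟨ν, i⟩ := z
  obtain ⟨ν', j⟩ := a
  simp only [smap, fmap, sφ, fφ, nx, Prod.mk.injEq, true_and]
  grind

theorem fmap_nx_mem {ℓ : U.Ball → ℕ} {z a : U.Ball × ℕ} (ha : a ∈ pts ℓ) :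
    fmap (nx z) a ∈ pts (hi ℓ z) := by
  simp only [mem_pts, hi_apply, fmap, fφ, nx] at *
  grind

theorem lo_hi (ℓ : U.Ball → ℕ) {z w : U.Ball × ℕ} (h : w.1 = z.1) : lo (hi ℓ z) w = ℓ := by
  funext ν
  simp only [lo_apply, hi_apply, h]
  split_ifs <;> omega

theorem hi_lo (ℓ : U.Ball → ℕ) {z w : U.Ball × ℕ} (h : w.1 = z.1) (hz : 1 ≤ ℓ z.1) :
    hi (lo ℓ z) w = ℓ := by
  funext ν
  simp only [lo_apply, hi_apply, h]
  split_ifs with h1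
  · subst h1; omega
  · rfl

theorem sum_pts_lo {M : Type*} [AddCommMonoid M] {ℓ : U.Ball → ℕ} {w : U.Ball × ℕ}
    (hw : w ∈ pts ℓ) (h : 1 ≤ ℓ w.1) (f : U.Ball × ℕ → M) :
    ∑ a ∈ pts (lo ℓ w), f a = ∑ a ∈ (pts ℓ).erase w, f (smap w a) := by
  symm
  refine Finset.sum_bij' (fun a _ => smap w a) (fun a _ => fmap w a) ?_ ?_ ?_ ?_ ?_
  · intro a ha
    exact smap_mem_lo hw (Finset.mem_of_mem_erase ha) (Finset.ne_of_mem_erase ha)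
  · intro a ha
    exact Finset.mem_erase.2 ⟨fmap_ne w a, fmap_mem h ha⟩
  · intro a ha
    exact fmap_smap (Finset.ne_of_mem_erase ha)
  · intro a _
    exact smap_fmap w a
  · intros; rfl

/-- The points after a doubling of `z` are `z`, `nx z` and the images of the other points under the
map that skips `nx z`. -/
theorem sum_pts_hi {M : Type*} [AddCommMonoid M] {ℓ : U.Ball → ℕ} {z : U.Ball × ℕ}
    (hz : z ∈ pts ℓ) (f : U.Ball × ℕ → M) :
    ∑ a ∈ pts (hi ℓ z), f a =
      f z + f (nx z) + ∑ a ∈ (pts ℓ).erase z, f (fmap (nx z) a) := by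
  rw [← Finset.add_sum_erase _ _ (nx_mem_hi hz), add_comm (f z), add_assoc]
  congr 1
  have h1 : ∑ a ∈ (pts (hi ℓ z)).erase (nx z), f a = ∑ a ∈ pts ℓ, f (fmap (nx z) a) := by
    symm
    refine Finset.sum_bij' (fun a _ => fmap (nx z) a) (fun a _ => smap z a) ?_ ?_ ?_ ?_ ?_
    · intro a ha
      exact Finset.mem_erase.2 ⟨fmap_ne _ a, fmap_nx_mem ha⟩
    · intro a ha
      exact smap_mem hz (Finset.mem_of_mem_erase ha)
    · intro a _
      exact smap_fmap_nx z a
    · intro a ha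
      have h2 := Finset.ne_of_mem_erase ha
      obtain ⟨ν, i⟩ := z
      obtain ⟨ν', j⟩ := a
      have : ¬ (ν' = ν ∧ j = i + 1) := by simpa [nx] using h2
      simp only [smap, fmap, sφ, fφ, nx, Prod.mk.injEq, true_and]
      grind
    · intros; rfl
  rw [h1, ← Finset.add_sum_erase _ _ hz, fmap_nx_self]

/-- The sign rule for two faces. -/
theorem ex_lo_lo {ℓ : U.Ball → ℕ} {w w' : U.Ball × ℕ} (hne : w ≠ w') (h : 1 ≤ ℓ w.1)
    (h' : 1 ≤ ℓ w'.1) :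
    (ex ℓ w + ex (lo ℓ w) (smap w w')) % 2 ≠ (ex ℓ w' + ex (lo ℓ w') (smap w' w)) % 2 := by
  have h1 := sum_Iio_lo ℓ w w'.1 h
  have h2 := sum_Iio_lo ℓ w' w.1 h'
  obtain ⟨ν, i⟩ := w
  obtain ⟨ν', j⟩ := w'
  have : ¬ (ν = ν' ∧ i = j) := by simpa using hne
  simp only [ex, smap, sφ] at *
  rcases lt_trichotomy ν ν' with h3 | rfl | h3
  · simp only [h3, h3.ne, h3.ne', h3.not_gt, if_true, if_false, false_and] at *; omega
  · simp only [lt_irrefl, if_false, true_and] at *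
    split_ifs <;> omega
  · simp only [h3, h3.ne, h3.ne', h3.not_gt, if_true, if_false, false_and] at *; omega

/-- The sign rule for a degeneracy and a face. -/
theorem ex_hi_lo {ℓ : U.Ball → ℕ} {z w : U.Ball × ℕ} (hne : w ≠ z) (h : 1 ≤ ℓ w.1) :
    (ex ℓ z + ex (hi ℓ z) (fmap (nx z) w)) % 2 ≠ (ex ℓ w + ex (lo ℓ w) (smap w z)) % 2 := by
  have h1 := sum_Iio_lo ℓ w z.1 h
  have h2 := sum_Iio_hi ℓ z w.1
  obtain ⟨ν, i⟩ := w
  obtain ⟨ν', j⟩ := z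
  have : ¬ (ν = ν' ∧ i = j) := by simpa using hne
  simp only [ex, smap, sφ, fmap, fφ, nx] at *
  rcases lt_trichotomy ν ν' with h3 | rfl | h3
  · simp only [h3, h3.ne, h3.ne', h3.not_gt, if_true, if_false, false_and] at *; omega
  · simp only [lt_irrefl, if_false, true_and] at *
    split_ifs <;> omega
  · simp only [h3, h3.ne, h3.ne', h3.not_gt, if_true, if_false, false_and] at *; omega

/-! ### The simplicial differential on basis elements -/

section Chain

variable (k : Type u) [Field k]

theorem chainD_single (x : Cell U m) :
    chainD k U m (Finsupp.single x 1) = ∑ w ∈ pts x.1,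
      if x.1 w.1 = 0 then 0 else (-1 : k) ^ ex x.1 w • Finsupp.single (x.fc w) 1 := by
  rw [sum_pts]
  simp only [chainD, Finsupp.linearCombination_single, ex, fc, one_smul, Finsupp.smul_single,
    smul_eq_mul, mul_one]

theorem chainD_single' (x : Cell U m) :
    chainD k U m (Finsupp.single x 1) = ∑ w ∈ pts x.1,
      if 1 ≤ x.1 w.1 then (-1 : k) ^ ex x.1 w • Finsupp.single (x.fc w) 1 else 0 := by
  rw [chainD_single]
  refine Finset.sum_congr rfl fun w _ => ?_
  split_ifs <;> first | rfl | omega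

/-- The faces at two points commute, and exchanging the two points changes the sign. -/
theorem chainD_comp_self : chainD k U m ∘ₗ chainD k U m = 0 := by
  ext x : 2
  simp only [LinearMap.comp_apply, Finsupp.lsingle_apply, LinearMap.zero_apply]
  rw [chainD_single', map_sum]
  have key : ∀ w ∈ pts x.1, chainD k U m (if 1 ≤ x.1 w.1 then
      (-1 : k) ^ ex x.1 w • Finsupp.single (x.fc w) 1 else 0) =
      ∑ w' ∈ pts x.1, if w ≠ w' ∧ 1 ≤ x.1 w.1 ∧ 1 ≤ lo x.1 w w'.1 then
        (-1 : k) ^ (ex x.1 w + ex (lo x.1 w) (smap w w')) •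
          Finsupp.single ((x.fc w).fc (smap w w')) (1 : k) else 0 := by
    intro w hw
    by_cases h : 1 ≤ x.1 w.1
    · rw [if_pos h, map_smul, chainD_single', fc_fst, sum_pts_lo hw h,
        ← Finset.add_sum_erase _ _ hw]
      simp only [ne_eq, not_true_eq_false, false_and, if_false, zero_add, Finset.smul_sum]
      refine Finset.sum_congr rfl fun w' hw' => ?_
      have h2 := (Finset.ne_of_mem_erase hw').symm
      simp only [h2, h, not_false_eq_true, true_and, smul_ite, smul_zero, smul_smul, ← pow_add]
      rfl
    · simp [h]
  rw [Finset.sum_congr rfl key, ← Finset.sum_product']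
  refine Finset.sum_involution (fun p _ => (p.2, p.1)) ?_ ?_ ?_ ?_
  · rintro ⟨w, w'⟩ hp
    simp only [Finset.mem_product] at hp
    by_cases h : w ≠ w' ∧ 1 ≤ x.1 w.1 ∧ 1 ≤ lo x.1 w w'.1
    · have h' : w' ≠ w ∧ 1 ≤ x.1 w'.1 ∧ 1 ≤ lo x.1 w' w.1 := by
        obtain ⟨h1, h2, h3⟩ := h
        refine ⟨h1.symm, ?_⟩
        simp only [lo_apply] at *
        split_ifs at * <;> grind
      simp only [if_pos h, if_pos h']
      rw [fc_fc hp.1 hp.2 h.1 h.2.1 h.2.2, neg_one_pow_of_mod_ne (ex_lo_lo h.1 h.2.1 h'.2.1)]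
      simp
    · have h' : ¬ (w' ≠ w ∧ 1 ≤ x.1 w'.1 ∧ 1 ≤ lo x.1 w' w.1) := by
        rintro ⟨h1, h2, h3⟩
        refine h ⟨h1.symm, ?_⟩
        simp only [lo_apply] at *
        split_ifs at * <;> grind
      simp only [if_neg h, if_neg h', add_zero]
  · rintro ⟨w, w'⟩ _ h he
    simp only [Prod.mk.injEq] at he
    simp only at h
    rw [if_neg (by simp [he.1])] at h
    exact h rfl
  · rintro ⟨w, w'⟩ hp
    simp only [Finset.mem_product] at hp ⊢
    exact hp.symm
  · rintro ⟨w, w'⟩ _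
    rfl

/-- The boundary of a cell obtained by doubling a point `z`: the faces at `z` and `nx z`, and the
doublings `G w` of the other faces. -/
theorem chainD_of_doubling {m' : ℕ} (x : Cell U m) (y : Cell U m') {z : U.Ball × ℕ}
    (hz : z ∈ pts x.1) (hy : y.1 = hi x.1 z) (G : U.Ball × ℕ → Cell U m')
    (hG : ∀ w ∈ pts x.1, w ≠ z → 1 ≤ x.1 w.1 → y.fc (fmap (nx z) w) = G w) :
    (-1 : k) ^ ex x.1 z • chainD k U m' (Finsupp.single y 1) =
      Finsupp.single (y.fc z) 1 - Finsupp.single (y.fc (nx z)) 1 -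
      ∑ w ∈ (pts x.1).erase z, if 1 ≤ x.1 w.1 then
        ((-1 : k) ^ ex x.1 w * (-1 : k) ^ ex (lo x.1 w) (smap w z)) • Finsupp.single (G w) 1
        else 0 := by
  have hz1 : 1 ≤ hi x.1 z z.1 := by simp [hi_apply]
  rw [chainD_single', hy, sum_pts_hi hz, if_pos hz1, if_pos (show 1 ≤ hi x.1 z (nx z).1 from hz1),
    smul_add, smul_add, smul_smul, smul_smul, ← pow_add, ← pow_add]
  have e1 : ex (hi x.1 z) z = ex x.1 z := by
    simp only [ex, sum_Iio_hi]
    simp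
  have e2 : ex (hi x.1 z) (nx z) = ex x.1 z + 1 := by
    simp only [ex, sum_Iio_hi, nx]
    simp; ring
  rw [e1, e2, neg_one_pow_of_mod_eq (b := 0) (by omega),
    neg_one_pow_of_mod_eq (a := ex x.1 z + (ex x.1 z + 1)) (b := 1) (by omega), sub_eq_add_neg,
    sub_eq_add_neg, ← Finset.sum_neg_distrib, Finset.smul_sum]
  congr 1
  · simp
  · refine Finset.sum_congr rfl fun w hw => ?_
    have hne := Finset.ne_of_mem_erase hw
    have hw' := Finset.mem_of_mem_erase hw
    by_cases h : 1 ≤ x.1 w.1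
    · rw [if_pos h, if_pos (by simp only [hi_apply, fmap]; split_ifs <;> omega), smul_smul,
        ← pow_add, neg_one_pow_of_mod_ne (ex_hi_lo hne h), hG w hw' hne h, pow_add, neg_smul]
    · rw [if_neg h, if_neg, smul_zero, neg_zero]
      simp only [hi_apply, fmap]
      obtain ⟨ν, i⟩ := w
      obtain ⟨ν', j⟩ := z
      have : ¬ (ν = ν' ∧ i = j) := by simpa using hne
      simp only [mem_pts] at *
      grind

end Chain

/-- The rank function of a finite total order. -/
theorem card_filter_lt_of_rel {α : Type*} (r : α → α → Prop) [DecidableRel r]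
    (hirr : ∀ a, ¬ r a a) (htr : ∀ a b c, r a b → r b c → r a c) {X : Finset α} {a b : α}
    (ha : a ∈ X) (h : r a b) : (X.filter (r · a)).card < (X.filter (r · b)).card := by
  refine Finset.card_lt_card ((Finset.ssubset_iff_of_subset ?_).2 ⟨a, ?_, ?_⟩)
  · intro c hc
    simp only [Finset.mem_filter] at hc ⊢
    exact ⟨hc.1, htr _ _ _ hc.2 h⟩
  · simp [ha, h]
  · simp [hirr]

/-- A telescoping sum along a finite total order. -/
theorem sum_telescope {α M : Type*} [AddCommGroup M] [DecidableEq α] (r : α → α → Prop)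
    [DecidableRel r] (hirr : ∀ a, ¬ r a a) (htr : ∀ a b c, r a b → r b c → r a c) (G : Finset α → M)
    (X : Finset α) (htot : ∀ a ∈ X, ∀ b ∈ X, a ≠ b → r a b ∨ r b a) :
    ∑ z ∈ X, (G (X.filter (r · z)) - G (X.filter fun a => a = z ∨ r a z)) = G ∅ - G X := by
  induction hn : X.card generalizing X with
  | zero =>
    obtain rfl := Finset.card_eq_zero.1 hn
    simp
  | succ n ih =>
    have hne : X.Nonempty := by
      rw [← Finset.card_pos]; omega
    -- the largest element of `X`
    obtain ⟨z, hz, hmax⟩ : ∃ z ∈ X, ∀ a ∈ X, ¬ r z a := by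
      obtain ⟨z, hz⟩ := X.exists_maximalFor (fun a => (X.filter (r · a)).card) hne
      refine ⟨z, hz.1, fun a ha h => ?_⟩
      have h1 := card_filter_lt_of_rel r hirr htr hz.1 h
      have h2 := hz.2 ha h1.le
      simp only at h2
      omega
    have hlt : ∀ a ∈ X.erase z, r a z := fun a ha =>
      (htot a (Finset.mem_of_mem_erase ha) z hz (Finset.ne_of_mem_erase ha)).resolve_right
        (hmax a (Finset.mem_of_mem_erase ha))
    rw [← Finset.add_sum_erase _ _ hz]
    have e1 : X.filter (r · z) = X.erase z := by
      ext a
      simp only [Finset.mem_filter, Finset.mem_erase]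
      exact ⟨fun h => ⟨fun h' => hirr z (h' ▸ h.2), h.1⟩,
        fun h => ⟨h.2, hlt a (Finset.mem_erase.2 h)⟩⟩
    have e2 : (X.filter fun a => a = z ∨ r a z) = X := by
      refine Finset.filter_true_of_mem fun a ha => ?_
      by_cases h : a = z
      · exact Or.inl h
      · exact Or.inr (hlt a (Finset.mem_erase.2 ⟨h, ha⟩))
    have e3 : ∑ w ∈ X.erase z, (G (X.filter (r · w)) - G (X.filter fun a => a = w ∨ r a w)) =
        ∑ w ∈ X.erase z, (G ((X.erase z).filter (r · w)) -
          G ((X.erase z).filter fun a => a = w ∨ r a w)) := by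
      refine Finset.sum_congr rfl fun w hw => ?_
      have hw' := Finset.mem_of_mem_erase hw
      rw [Finset.filter_erase, Finset.filter_erase, Finset.erase_eq_of_notMem,
        Finset.erase_eq_of_notMem]
      · simp only [Finset.mem_filter, not_and, not_or]
        exact fun _ => ⟨(Finset.ne_of_mem_erase hw).symm, hmax w hw'⟩
      · simp only [Finset.mem_filter, not_and]
        exact fun _ => hmax w hw'
    rw [e3, ih, e1, e2]
    · abel
    · intro a ha b hb
      exact htot a (Finset.mem_of_mem_erase ha) b (Finset.mem_of_mem_erase hb)
    · rw [Finset.card_erase_of_mem hz, hn]; rfl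

/-! ### Moving a cut -/

section Cut

open Classical in
/-- The cell with the same order in which the label `c` of the points of a lower set `S` of the
points labelled `c` is replaced by `c - 1`: the cut between the labels `c - 1` and `c` is moved to
the end of `S`. -/
noncomputable def lowS (x : Cell U m) (c : ℕ) (S : U.Ball × ℕ → Prop) : Cell U m :=
  x.relabel m (fun a => if x.lab a = c ∧ S a ∧ ∀ b, x.rel b a → x.lab b = c → S b then c - 1
    else x.lab a) (fun a b h => by
      have h1 := lab_mono h
      split_ifs with h2 h3 h3
      · exact le_rfl
      · omega
      · have h4 : x.lab a ≠ c := fun h4 => h2 ⟨h4, h3.2.2 _ h h4, fun b' hb' hc' =>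
          h3.2.2 _ (rel_trans hb' h) hc'⟩
        omega
      · exact h1)

open Classical in
theorem lab_lowS {x : Cell U m} {c : ℕ} {S : U.Ball × ℕ → Prop}
    (hS : ∀ a b, x.rel a b → x.lab a = c → x.lab b = c → S b → S a) {a : U.Ball × ℕ}
    (ha : a ∈ pts x.1) :
    (x.lowS c S).lab a = if x.lab a = c ∧ S a then c - 1 else x.lab a := by
  have h := x.lab_le a
  rw [lowS, lab_relabel ha]
  · by_cases h1 : x.lab a = c ∧ S a
    · rw [if_pos h1, if_pos ⟨h1.1, h1.2, fun b hb hc => hS b a hb hc h1.1 h1.2⟩]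
    · rw [if_neg h1, if_neg fun h2 => h1 ⟨h2.1, h2.2.1⟩]
  · split_ifs with h1 <;> omega

/-- The point `z` is replaced by `z < nx z`, and all points up to `z` with the label of `z` get the
preceding label. -/
noncomputable def hcut (x : Cell U m) (z : U.Ball × ℕ) : Cell U m :=
  (x.dg z).lowS (x.lab z) (fun a => a = z ∨ x.rel (smap z a) z)

@[simp] theorem hcut_fst (x : Cell U m) (z : U.Ball × ℕ) : (x.hcut z).1 = hi x.1 z := rfl

open Classical in
theorem lab_hcut {x : Cell U m} {z a : U.Ball × ℕ} (hz : z ∈ pts x.1) (ha : a ∈ pts (hi x.1 z)) :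
    (x.hcut z).lab a = if x.lab (smap z a) = x.lab z ∧ (a = z ∨ x.rel (smap z a) z) then
      x.lab z - 1 else x.lab (smap z a) := by
  rw [hcut, lab_lowS, lab_dg hz ha]
  · congr
  · intro a b hab _ _ hb
    have ha' := hab.left
    have hb' := hab.right
    rw [rel_dg hz ha' hb'] at hab
    rcases hab with h | ⟨rfl, h⟩
    · rcases hb with rfl | hb
      · rw [smap_self] at h
        exact Or.inr h
      · exact Or.inr (rel_trans h hb)
    · exact Or.inl rfl
  · exact ha

/-- The face at the first copy leaves the cut immediately before `z`. -/
theorem fc_hcut_self (x : Cell U m) {z : U.Ball × ℕ} (hz : z ∈ pts x.1) :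
    (x.hcut z).fc z = x.lowS (x.lab z) (x.rel · z) := by
  have h1 : 1 ≤ hi x.1 z z.1 := by simp [hi_apply]
  have hlo : lo (hi x.1 z) z = x.1 := lo_hi _ rfl
  refine ext' hlo (fun a b ha hb hr => ?_) fun a ha => ?_
  · have hr' : ((x.dg z).fc z).rel a b := hr
    rwa [fc_dg_self hz (Or.inl rfl)] at hr'
  · change a ∈ pts (lo (hi x.1 z) z) at ha
    have ha' : a ∈ pts x.1 := by rwa [hlo] at ha
    rw [lab_fc (x := x.hcut z) h1 ha, lab_hcut hz (fmap_mem h1 ha), smap_fmap,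
      lab_lowS (fun a b h _ _ h' => rel_trans h h') ha']
    classical exact if_congr (and_congr_right fun _ => or_iff_right (fmap_ne z a)) rfl rfl

/-- The face at the second copy leaves the cut immediately after `z`. -/
theorem fc_hcut_nx (x : Cell U m) {z : U.Ball × ℕ} (hz : z ∈ pts x.1) :
    (x.hcut z).fc (nx z) = x.lowS (x.lab z) (fun a => a = z ∨ x.rel a z) := by
  have h1 : 1 ≤ hi x.1 z (nx z).1 := by simp [hi_apply, nx]
  have hlo : lo (hi x.1 z) (nx z) = x.1 := lo_hi _ rfl
  refine ext' hlo (fun a b ha hb hr => ?_) fun a ha => ?_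
  · have hr' : ((x.dg z).fc (nx z)).rel a b := hr
    rwa [fc_dg_self hz (Or.inr rfl)] at hr'
  · change a ∈ pts (lo (hi x.1 z) (nx z)) at ha
    have ha' : a ∈ pts x.1 := by rwa [hlo] at ha
    have e : fmap (nx z) a = z ↔ a = z :=
      ⟨fun h => fmap_injective (nx z) (h.trans (fmap_nx_self z).symm),
        fun h => h ▸ fmap_nx_self _⟩
    rw [lab_fc (x := x.hcut z) h1 ha, lab_hcut hz (fmap_mem h1 ha), smap_fmap_nx,
      lab_lowS _ ha']
    · have e' : (x.lab a = x.lab z ∧ (fmap (nx z) a = z ∨ x.rel a z)) =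
          (x.lab a = x.lab z ∧ (a = z ∨ x.rel a z)) :=
        propext (and_congr_right fun _ => or_congr_left e)
      congr 1
    · rintro a b h - - (rfl | h')
      · exact Or.inr h
      · exact Or.inr (rel_trans h h')

theorem smap_fmap_fmap {z w a : U.Ball × ℕ} (hne : w ≠ z) :
    smap z (fmap (fmap (nx z) w) a) = fmap w (smap (smap w z) a) := by
  obtain ⟨ν, i⟩ := w
  obtain ⟨ν', j⟩ := z
  obtain ⟨ν'', l⟩ := a
  have : ¬ (ν = ν' ∧ i = j) := by simpa using hne
  simp only [fφ, sφ, nx, fmap, smap]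
  grind

theorem fmap_fmap_eq_iff {z w a : U.Ball × ℕ} (hne : w ≠ z) :
    fmap (fmap (nx z) w) a = z ↔ a = smap w z := by
  obtain ⟨ν, i⟩ := w
  obtain ⟨ν', j⟩ := z
  obtain ⟨ν'', l⟩ := a
  have : ¬ (ν = ν' ∧ i = j) := by simpa using hne
  simp only [fφ, sφ, nx, fmap, smap]
  grind

theorem lo_hi_comm {ℓ : U.Ball → ℕ} {z w : U.Ball × ℕ} (h : 1 ≤ ℓ w.1) :
    lo (hi ℓ z) (fmap (nx z) w) = hi (lo ℓ w) (smap w z) := by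
  funext ν
  simp only [lo_apply, hi_apply, smap, fmap]
  grind

theorem fc_hcut {x : Cell U m} {z w : U.Ball × ℕ} (hz : z ∈ pts x.1) (hw : w ∈ pts x.1)
    (hne : w ≠ z) (h : 1 ≤ x.1 w.1) :
    (x.hcut z).fc (fmap (nx z) w) = (x.fc w).hcut (smap w z) := by
  have hz' : smap w z ∈ pts (x.fc w).1 := smap_mem_lo hw hz hne.symm
  have hlo : lo (hi x.1 z) (fmap (nx z) w) = hi (lo x.1 w) (smap w z) := lo_hi_comm h
  have h1 : 1 ≤ (x.hcut z).1 (fmap (nx z) w).1 := by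
    simp only [hcut_fst, hi_apply, fmap]; split_ifs <;> omega
  refine ext' hlo (fun a b ha hb hr => ?_) fun a ha => ?_
  · have hr' : ((x.dg z).fc (fmap (nx z) w)).rel a b := hr
    rwa [fc_dg hz hw hne h] at hr'
  · change a ∈ pts (lo (hi x.1 z) (fmap (nx z) w)) at ha
    have ha' : a ∈ pts (hi (x.fc w).1 (smap w z)) := by rwa [hlo] at ha
    have hb := smap_mem hz' ha'
    rw [lab_fc (x := x.hcut z) h1 ha, lab_hcut hz (fmap_mem h1 ha), lab_hcut hz' ha',
      lab_fc h hb, lab_fc h hz', rel_fc h hb hz', smap_fmap_fmap hne, fmap_smap hne.symm]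
    classical exact if_congr (and_congr_right fun _ => or_congr_left (fmap_fmap_eq_iff hne)) rfl rfl

variable (k : Type u) [Field k]

open Classical in
/-- The homotopy that moves the cut before the label `c` through all points labelled `c`. -/
noncomputable def hop (c : ℕ) : Chains k U m →ₗ[k] Chains k U m :=
  Finsupp.linearCombination k fun x : Cell U m =>
    ∑ z ∈ pts x.1, if x.lab z = c then
      (-1 : k) ^ ex x.1 z • Finsupp.single (x.hcut z) (1 : k) else 0

open Classical in
theorem hop_single (c : ℕ) (x : Cell U m) : hop k c (Finsupp.single x 1) =
    ∑ z ∈ pts x.1, if x.lab z = c then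
      (-1 : k) ^ ex x.1 z • Finsupp.single (x.hcut z) (1 : k) else 0 := by
  simp [hop]

/-- Moving the cut is a homotopy from the identity to the map that removes the label `c`: the faces
at the two copies of a point telescope along the order of the points labelled `c`. -/
theorem chainD_hop_single (c : ℕ) (x : Cell U m) :
    chainD k U m (hop k c (Finsupp.single x 1)) + hop k c (chainD k U m (Finsupp.single x 1)) =
      Finsupp.single x 1 - Finsupp.single (x.lowS c fun _ => True) 1 := by
  classical
  set X := (pts x.1).filter (fun z => x.lab z = c) with hX
  set G : Finset (U.Ball × ℕ) → Chains k U m := fun S =>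
    Finsupp.single (x.lowS c (· ∈ S)) 1 with hG
  -- the cut moved past `S` depends only on the points of `S` labelled `c`
  have hdep : ∀ S S' : U.Ball × ℕ → Prop, (∀ a b, x.rel a b → x.lab a = c → x.lab b = c → S b → S a) →
      (∀ a b, x.rel a b → x.lab a = c → x.lab b = c → S' b → S' a) →
      (∀ a ∈ pts x.1, x.lab a = c → (S a ↔ S' a)) → x.lowS c S = x.lowS c S' := by
    intro S S' h1 h2 h
    refine ext' rfl (fun a b _ _ hr => hr) fun a ha => ?_
    change a ∈ pts x.1 at ha
    rw [lab_lowS h1 ha, lab_lowS h2 ha]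
    by_cases hc : x.lab a = c
    · simp only [h a ha hc]
    · simp [hc]
  have htel := sum_telescope x.rel x.rel_irrefl (fun a b c => rel_trans) G X
    (fun a ha b hb => x.rel_total (Finset.mem_filter.1 ha).1 (Finset.mem_filter.1 hb).1)
  have e1 : G ∅ = Finsupp.single x 1 := by
    simp only [hG]
    congr 1
    refine ext' rfl (fun a b _ _ hr => hr) fun a ha => ?_
    change a ∈ pts x.1 at ha
    rw [lab_lowS (by simp) ha]
    simp
  have e2 : G X = Finsupp.single (x.lowS c fun _ => True) 1 := by
    simp only [hG]
    congr 1
    refine hdep _ _ (fun a b h h1 _ _ => ?_) (fun _ _ _ _ _ _ => trivial) fun a ha hc => ?_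
    · exact Finset.mem_filter.2 ⟨h.left, h1⟩
    · simp [hX, hc, mem_pts.1 ha]
  rw [e1, e2] at htel
  rw [← htel, hop_single, chainD_single', map_sum, map_sum, hX, Finset.sum_filter]
  -- the boundary of one summand: an increment of `G`, and terms indexed by pairs of points
  have k1 : ∀ z ∈ pts x.1, chainD k U m (if x.lab z = c then
      (-1 : k) ^ ex x.1 z • Finsupp.single (x.hcut z) (1 : k) else 0) =
      (if x.lab z = c then G (X.filter (x.rel · z)) - G (X.filter fun a => a = z ∨ x.rel a z)
        else 0) - ∑ w ∈ pts x.1, if w ≠ z ∧ x.lab z = c ∧ 1 ≤ x.1 w.1 then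
          ((-1 : k) ^ ex x.1 w * (-1 : k) ^ ex (lo x.1 w) (smap w z)) •
            Finsupp.single ((x.fc w).hcut (smap w z)) (1 : k) else 0 := by
    intro z hz
    by_cases hc : x.lab z = c
    · rw [if_pos hc, if_pos hc, map_smul, chainD_of_doubling k x (x.hcut z) hz rfl
        (fun w => (x.fc w).hcut (smap w z)) (fun w hw hne h => fc_hcut hz hw hne h),
        fc_hcut_self x hz, fc_hcut_nx x hz, ← Finset.add_sum_erase _ _ hz]
      congr 1
      · simp only [hG]
        rw [hc]
        congr 2
        · refine hdep _ _ (fun a b h _ _ h' => rel_trans h h') (fun a b h h1 _ h' => ?_)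
            fun a ha h1 => ?_
          · simp only [Finset.mem_filter, hX] at h' ⊢
            exact ⟨⟨h.left, h1⟩, rel_trans h h'.2⟩
          · simp [hX, h1, mem_pts.1 ha]
        · refine hdep _ _ (fun a b h _ _ h' => ?_) (fun a b h h1 _ h' => ?_)
            fun a ha h1 => ?_
          · rcases h' with rfl | h'
            · exact Or.inr h
            · exact Or.inr (rel_trans h h')
          · simp only [Finset.mem_filter, hX] at h' ⊢
            refine ⟨⟨h.left, h1⟩, ?_⟩
            rcases h'.2 with rfl | h'
            · exact Or.inr h
            · exact Or.inr (rel_trans h h')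
          · simp [hX, h1, mem_pts.1 ha]
      · rw [if_neg (by simp), zero_add]
        refine Finset.sum_congr rfl fun w hw => ?_
        simp [hc, Finset.ne_of_mem_erase hw]
    · simp [hc]
  -- the homotopy applied to one face gives the same terms, indexed by pairs of points
  have k2 : ∀ w ∈ pts x.1, hop k c (if 1 ≤ x.1 w.1 then
      (-1 : k) ^ ex x.1 w • Finsupp.single (x.fc w) (1 : k) else 0) =
      ∑ z ∈ pts x.1, if w ≠ z ∧ x.lab z = c ∧ 1 ≤ x.1 w.1 then
          ((-1 : k) ^ ex x.1 w * (-1 : k) ^ ex (lo x.1 w) (smap w z)) •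
            Finsupp.single ((x.fc w).hcut (smap w z)) (1 : k) else 0 := by
    intro w hw
    by_cases h : 1 ≤ x.1 w.1
    · rw [if_pos h, map_smul, hop_single, fc_fst, sum_pts_lo hw h, ← Finset.add_sum_erase _ _ hw,
        if_neg (by simp), zero_add, Finset.smul_sum]
      refine Finset.sum_congr rfl fun z hz => ?_
      have hz' := smap_mem_lo hw (Finset.mem_of_mem_erase hz) (Finset.ne_of_mem_erase hz)
      rw [lab_fc h hz', fmap_smap (Finset.ne_of_mem_erase hz)]
      simp [h, (Finset.ne_of_mem_erase hz).symm]
    · simp [h]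
  rw [Finset.sum_congr rfl k1, Finset.sum_congr rfl k2, Finset.sum_sub_distrib, Finset.sum_comm,
    sub_add_cancel]

end Cut

end Cell

/-! ### Cofaces, codegeneracies and cuts as operators -/

namespace Cell

variable {U V : TwoDisk} {m : ℕ}

theorem lab_relabel_min {x : Cell U m} {m' : ℕ} {g : U.Ball × ℕ → ℕ}
    {hg : ∀ a b, x.rel a b → g a ≤ g b} {a : U.Ball × ℕ} (ha : a ∈ pts x.1) :
    (x.relabel m' g hg).lab a = min (g a) m' := by
  rw [lab_eq _ (show a ∈ pts (x.relabel m' g hg).1 from ha)]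
  simp [relabel, Fin.clamp]

theorem dim_fc {x : Cell U m} {w : U.Ball × ℕ} (h : 1 ≤ x.1 w.1) : (x.fc w).dim + 1 = x.dim :=
  sum_lo x.1 w h

theorem dim_of_fst_eq_hi {m' : ℕ} {x : Cell U m} {y : Cell U m'} {z : U.Ball × ℕ}
    (h : y.1 = hi x.1 z) : y.dim = x.dim + 1 := by
  rw [dim, h]
  exact sum_hi x.1 z

@[simp] theorem dim_coface (x : Cell U m) (j : Fin (m + 2)) : (x.coface j).dim = x.dim := rfl

/-- The last codegeneracy in the output variable: the last two labels are identified. -/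
def cod (x : Cell U (m + 1)) : Cell U m := x.relabel m x.lab (fun _ _ h => lab_mono h)

@[simp] theorem dim_cod (x : Cell U (m + 1)) : x.cod.dim = x.dim := rfl

theorem lab_cod {x : Cell U (m + 1)} {a : U.Ball × ℕ} (ha : a ∈ pts x.1) :
    x.cod.lab a = min (x.lab a) m := lab_relabel_min ha

theorem fc_cod {x : Cell U (m + 1)} {w : U.Ball × ℕ} (h : 1 ≤ x.1 w.1) :
    x.cod.fc w = (x.fc w).cod := by
  refine ext' rfl (fun a b _ _ hr => hr) fun a ha => ?_
  change a ∈ pts (lo x.1 w) at ha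
  rw [lab_cod (x := x.fc w) ha, lab_fc (x := x.cod) h ha, lab_cod (fmap_mem h ha), lab_fc h ha]

theorem cod_coface {x : Cell U (m + 1)} {j : ℕ} (hj : j ≤ m) :
    (x.coface ⟨j, by omega⟩).cod = x.cod.coface ⟨j, by omega⟩ := by
  refine ext' rfl (fun a b _ _ hr => hr) fun a ha => ?_
  change a ∈ pts x.1 at ha
  have h := x.lab_le a
  rw [lab_coface (x := x.cod) ha, lab_cod (x := x.coface _) ha, lab_coface ha, lab_cod ha]
  simp only
  split_ifs <;> omega

theorem cod_coface_last {x : Cell U m} {j : ℕ} (hj : j = m ∨ j = m + 1) :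
    (x.coface ⟨j, by omega⟩).cod = x := by
  refine ext' rfl (fun a b _ _ hr => hr) fun a ha => ?_
  change a ∈ pts x.1 at ha
  have h := x.lab_le a
  rw [lab_cod (x := x.coface _) ha, lab_coface ha]
  simp only
  split_ifs <;> omega

theorem coface_cod (x : Cell U (m + 1)) :
    x.cod.coface ⟨m + 1, by omega⟩ = x.lowS (m + 1) (fun _ => True) := by
  refine ext' rfl (fun a b _ _ hr => hr) fun a ha => ?_
  change a ∈ pts x.1 at ha
  have h := x.lab_le a
  rw [lab_coface (x := x.cod) ha, lab_lowS (by simp) ha, lab_cod ha]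
  simp only [and_true]
  split_ifs <;> omega

/-- The point `z` is replaced by `z < nx z`, and a new cut of the output ordinal is inserted
between them. -/
noncomputable def ecut (x : Cell U m) (z : U.Ball × ℕ) : Cell U (m + 1) :=
  (x.coface ⟨x.lab z, by have := x.lab_le z; omega⟩).hcut z

@[simp] theorem ecut_fst (x : Cell U m) (z : U.Ball × ℕ) : (x.ecut z).1 = hi x.1 z := rfl

theorem rel_ecut {x : Cell U m} {z a b : U.Ball × ℕ} :
    (x.ecut z).rel a b ↔ (x.dg z).rel a b := Iff.rfl

open Classical in
/-- The points after the inserted cut, beginning with the second copy of `z`, are relabelled. -/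
theorem lab_ecut {x : Cell U m} {z a : U.Ball × ℕ} (hz : z ∈ pts x.1) (ha : a ∈ pts (hi x.1 z)) :
    (x.ecut z).lab a =
      x.lab (smap z a) + if a = nx z ∨ x.rel z (smap z a) then 1 else 0 := by
  have hb := smap_mem hz ha
  rw [ecut, lab_hcut (x := x.coface _) hz ha, lab_coface hb, lab_coface hz]
  simp only [rel_coface, lt_irrefl, if_false]
  by_cases h : smap z a = z
  · rw [h]
    have h3 : a = z ∨ a = nx z := by
      obtain ⟨ν, i⟩ := a
      obtain ⟨ν', j⟩ := z
      simp only [smap, sφ, nx, Prod.mk.injEq] at h ⊢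
      grind
    have h4 : z ≠ nx z := by
      intro h5
      have := congrArg Prod.snd h5
      simp [nx] at this
    rcases h3 with rfl | rfl
    · simp [x.rel_irrefl, h4]
    · simp [x.rel_irrefl, h4.symm]
  · have h1 : a ≠ z := fun h' => h (h' ▸ smap_self z)
    have h2 : a ≠ nx z := fun h' => h (h' ▸ smap_nx z)
    rcases x.rel_total hb hz h with h3 | h3
    · have h4 := lab_mono h3
      simp only [h1, h2, h3, rel_asymm h3, false_or, or_true, and_true, if_false]
      split_ifs <;> omega
    · have h4 := lab_mono h3
      simp only [h1, h2, h3, rel_asymm h3, false_or, or_true, and_false, if_true, if_false]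
      split_ifs <;> omega

theorem dim_ecut (x : Cell U m) (z : U.Ball × ℕ) : (x.ecut z).dim = x.dim + 1 :=
  dim_of_fst_eq_hi rfl

/-- Cofaces below the last label commute with insertions at the last label. -/
theorem ecut_coface {x : Cell U m} {z : U.Ball × ℕ} (hz : z ∈ pts x.1) (hl : x.lab z = m) {j : ℕ}
    (hj : j ≤ m) :
    (x.coface ⟨j, by omega⟩).ecut z = (x.ecut z).coface ⟨j, by omega⟩ := by
  classical
  refine ext' rfl (fun a b _ _ hr => hr) fun a ha => ?_
  change a ∈ pts (hi x.1 z) at ha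
  have hb := smap_mem hz ha
  rw [lab_ecut (x := x.coface _) hz ha, lab_coface (x := x.ecut z) ha, lab_ecut hz ha,
    lab_coface hb]
  simp only [rel_coface]
  by_cases h : a = nx z ∨ x.rel z (smap z a)
  · have h1 : m ≤ x.lab (smap z a) := by
      rcases h with rfl | h
      · rw [smap_nx, hl]
      · have := lab_mono h
        omega
    simp only [if_pos h]
    split_ifs <;> omega
  · simp only [if_neg h]
    split_ifs <;> omega

end Cell

section Operators

open Cell

variable (k : Type u) [Field k] {U : TwoDisk} {m : ℕ}

/-- The `j`-th coface operator. -/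
noncomputable def cof (j : Fin (m + 2)) : Chains k U m →ₗ[k] Chains k U (m + 1) :=
  Finsupp.lmapDomain k k (coface j)

@[simp] theorem cof_single (j : Fin (m + 2)) (x : Cell U m) (c : k) :
    cof k j (Finsupp.single x c) = Finsupp.single (x.coface j) c := by
  simp [cof]

theorem cochainD_single (x : Cell U m) :
    cochainD k U m (Finsupp.single x 1) =
      ∑ j : Fin (m + 2), (-1 : k) ^ (m + x.dim + (j : ℕ)) • cof k j (Finsupp.single x 1) := by
  simp [cochainD]

theorem chainD_cof (j : Fin (m + 2)) :
    chainD k U (m + 1) ∘ₗ cof k j = cof k j ∘ₗ chainD k U m := by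
  ext x : 2
  simp only [LinearMap.comp_apply, Finsupp.lsingle_apply, cof_single, chainD_single', map_sum]
  refine Finset.sum_congr rfl fun w _ => ?_
  change (if 1 ≤ x.1 w.1 then _ else _) = _
  split_ifs
  · rw [map_smul, cof_single]
    rfl
  · rw [map_zero]

theorem chainD_cochainD :
    chainD k U (m + 1) ∘ₗ cochainD k U m = -(cochainD k U m ∘ₗ chainD k U m) := by
  ext x : 2
  simp only [LinearMap.comp_apply, Finsupp.lsingle_apply, LinearMap.neg_apply]
  rw [cochainD_single, map_sum]
  simp only [map_smul]
  have h : ∀ j : Fin (m + 2), chainD k U (m + 1) (cof k j (Finsupp.single x 1)) =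
      cof k j (chainD k U m (Finsupp.single x 1)) := fun j =>
    LinearMap.congr_fun (chainD_cof k j) _
  simp only [h, chainD_single', map_sum, Finset.smul_sum]
  rw [Finset.sum_comm, ← Finset.sum_neg_distrib]
  refine Finset.sum_congr rfl fun w _ => ?_
  split_ifs with h1
  · simp only [map_smul]
    rw [cochainD_single, Finset.smul_sum, ← Finset.sum_neg_distrib]
    refine Finset.sum_congr rfl fun j _ => ?_
    have h2 := dim_fc h1
    rw [neg_one_pow_of_mod_ne (b := m + (x.fc w).dim + (j : ℕ)) (by omega), smul_smul, smul_smul,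
      ← neg_smul, neg_mul, mul_comm]
  · simp

/-- The cosimplicial identities pair the terms with opposite signs. -/
theorem cochainD_cochainD : cochainD k U (m + 1) ∘ₗ cochainD k U m = 0 := by
  ext x : 2
  simp only [LinearMap.comp_apply, Finsupp.lsingle_apply, LinearMap.zero_apply]
  rw [cochainD_single, map_sum]
  simp only [map_smul, cof_single, cochainD_single, dim_coface, Finset.smul_sum, smul_smul,
    ← pow_add]
  rw [← Finset.sum_product']
  refine Finset.sum_involution (fun p _ => if h : (p.1 : ℕ) < p.2 then
    ((⟨p.2 - 1, by omega⟩ : Fin (m + 2)), (⟨p.1, by omega⟩ : Fin (m + 1 + 2))) else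
    ((⟨p.2, by omega⟩ : Fin (m + 2)), (⟨p.1 + 1, by omega⟩ : Fin (m + 1 + 2)))) ?_ ?_ ?_ ?_
  · rintro ⟨i, j⟩ _
    dsimp only
    split_ifs with h
    · rw [coface_coface h, neg_one_pow_of_mod_ne
        (a := m + x.dim + (i : ℕ) + (m + 1 + x.dim + (j : ℕ)))
        (b := m + x.dim + ((j : ℕ) - 1) + (m + 1 + x.dim + (i : ℕ))) (by omega)]
      simp
    · rw [coface_coface (x := x) (i := ⟨(j : ℕ), by omega⟩) (j := ⟨(i : ℕ) + 1, by omega⟩)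
        (by simp only; omega), neg_one_pow_of_mod_ne
        (a := m + x.dim + (i : ℕ) + (m + 1 + x.dim + (j : ℕ)))
        (b := m + x.dim + (j : ℕ) + (m + 1 + x.dim + ((i : ℕ) + 1))) (by omega)]
      simp
  · rintro ⟨i, j⟩ _ _ he
    dsimp only at he
    split_ifs at he with h <;> simp only [Prod.mk.injEq, Fin.ext_iff] at he <;> omega
  · intro p _
    simp
  · rintro ⟨i, j⟩ _
    dsimp only
    by_cases h : (i : ℕ) < j
    · simp only [h, dif_pos]
      rw [dif_neg (by omega)]
      refine Prod.ext (Fin.ext ?_) (Fin.ext ?_) <;> dsimp only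
      omega
    · simp only [h, dif_neg, not_false_eq_true]
      rw [dif_pos (by omega)]
      refine Prod.ext (Fin.ext ?_) (Fin.ext ?_) <;> dsimp only
      omega

open Classical in
/-- The signed sum of all ways to double a point labelled `u` and to insert a cut between the two
copies. -/
noncomputable def eop (u : ℕ) : Chains k U m →ₗ[k] Chains k U (m + 1) :=
  Finsupp.linearCombination k fun x : Cell U m =>
    ∑ z ∈ pts x.1, if x.lab z = u then
      (-1 : k) ^ ex x.1 z • Finsupp.single (x.ecut z) (1 : k) else 0

open Classical in
theorem eop_single (u : ℕ) (x : Cell U m) : eop k u (Finsupp.single x 1) =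
    ∑ z ∈ pts x.1, if x.lab z = u then
      (-1 : k) ^ ex x.1 z • Finsupp.single (x.ecut z) (1 : k) else 0 := by
  simp [eop]

theorem eop_eq {u : ℕ} (hu : u ≤ m) :
    (eop k u : Chains k U m →ₗ[k] _) = hop k (u + 1) ∘ₗ cof k ⟨u, by omega⟩ := by
  ext x : 2
  simp only [LinearMap.comp_apply, Finsupp.lsingle_apply, cof_single, eop_single, hop_single]
  refine Finset.sum_congr rfl fun z hz => ?_
  rw [lab_coface (x := x) hz]
  by_cases h : x.lab z = u
  · subst h
    simp only [lt_irrefl, if_true, if_false]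
    rfl
  · rw [if_neg h, if_neg]
    simp only
    split_ifs <;> omega

/-- Moving the inserted cut through all points labelled `u` is a homotopy between two
consecutive cofaces. -/
theorem chainD_eop {u : ℕ} (hu : u ≤ m) :
    chainD k U (m + 1) ∘ₗ eop k u + eop k u ∘ₗ chainD k U m =
      cof k ⟨u, by omega⟩ - cof k ⟨u + 1, by omega⟩ := by
  ext x : 2
  rw [eop_eq k hu]
  simp only [LinearMap.add_apply, LinearMap.sub_apply, LinearMap.comp_apply,
    Finsupp.lsingle_apply]
  have h := chainD_hop_single k (u + 1) (x.coface ⟨u, by omega⟩)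
  rw [← cof_single, show chainD k U (m + 1) (cof k ⟨u, by omega⟩ (Finsupp.single x 1)) =
    cof k ⟨u, by omega⟩ (chainD k U m (Finsupp.single x 1)) from
    LinearMap.congr_fun (chainD_cof k _) _] at h
  rw [h, cof_single, cof_single]
  congr 2
  refine ext' rfl (fun a b _ _ hr => hr) fun a ha => ?_
  change a ∈ pts x.1 at ha
  rw [lab_lowS (x := x.coface _) (by simp) ha, lab_coface ha, lab_coface ha]
  simp only [and_true]
  split_ifs <;> omega

theorem eop_cof {j : ℕ} (hj : j ≤ m) (c : Chains k U m) :
    eop k (m + 1) (cof k ⟨j, by omega⟩ c) = cof k ⟨j, by omega⟩ (eop k m c) := by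
  have : (eop k (m + 1) : Chains k U (m + 1) →ₗ[k] _) ∘ₗ cof k ⟨j, by omega⟩ =
      cof k ⟨j, by omega⟩ ∘ₗ eop k m := by
    ext x : 2
    simp only [LinearMap.comp_apply, Finsupp.lsingle_apply, cof_single, eop_single, map_sum]
    refine Finset.sum_congr rfl fun z hz => ?_
    change z ∈ pts x.1 at hz
    rw [lab_coface hz]
    have h := x.lab_le z
    by_cases hl : x.lab z = m
    · rw [if_pos hl, if_pos (by simp only; split_ifs <;> omega), map_smul, cof_single,
        ecut_coface hz hl hj]
      rfl
    · rw [if_neg hl, if_neg (by simp only; split_ifs <;> omega), map_zero]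
  exact LinearMap.congr_fun this c

/-- After the last coface no point has the last but one label. -/
theorem eop_cof_last (c : Chains k U m) :
    eop k (m + 1) (cof k ⟨m + 1, by omega⟩ c) = 0 := by
  have : (eop k (m + 1) : Chains k U (m + 1) →ₗ[k] _) ∘ₗ cof k ⟨m + 1, by omega⟩ = 0 := by
    ext x : 2
    simp only [LinearMap.comp_apply, Finsupp.lsingle_apply, cof_single, eop_single,
      LinearMap.zero_apply]
    refine Finset.sum_eq_zero fun z hz => ?_
    change z ∈ pts x.1 at hz
    rw [lab_coface hz]
    have h := x.lab_le z
    rw [if_neg (by simp only; split_ifs <;> omega)]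
  exact LinearMap.congr_fun this c

/-- The last codegeneracy operator, with the sign `(-1)^dim`. -/
noncomputable def sop : Chains k U (m + 1) →ₗ[k] Chains k U m :=
  Finsupp.linearCombination k fun x : Cell U (m + 1) =>
    (-1 : k) ^ x.dim • Finsupp.single x.cod (1 : k)

theorem sop_single (x : Cell U (m + 1)) : sop k (Finsupp.single x 1) =
    (-1 : k) ^ x.dim • Finsupp.single x.cod (1 : k) := by
  simp [sop]

theorem chainD_sop (c : Chains k U (m + 1)) :
    chainD k U m (sop k c) = - sop k (chainD k U (m + 1) c) := by
  have : chainD k U m ∘ₗ sop k = -(sop k ∘ₗ chainD k U (m + 1)) := by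
    ext x : 2
    simp only [LinearMap.comp_apply, Finsupp.lsingle_apply, LinearMap.neg_apply]
    rw [sop_single, map_smul, chainD_single', chainD_single', map_sum, Finset.smul_sum,
      ← Finset.sum_neg_distrib]
    refine Finset.sum_congr rfl fun w _ => ?_
    change (-1 : k) ^ x.dim • (if 1 ≤ x.1 w.1 then _ else _) = _
    split_ifs with h
    · have h2 := dim_fc h
      rw [map_smul, sop_single, smul_smul, smul_smul, neg_one_pow_of_mod_ne
        (b := (x.fc w).dim) (by omega), fc_cod h, ← neg_smul, neg_mul, mul_comm]
      rfl
    · simp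
  exact LinearMap.congr_fun this c

/-- The codegeneracy operator is a homotopy, with respect to the cosimplicial differential, from
zero to the projector that identifies the last two labels. -/
theorem sop_cochainD (c : Chains k U (m + 1)) :
    sop k (cochainD k U (m + 1) c) + cochainD k U m (sop k c) =
      - Finsupp.lmapDomain k k (fun x : Cell U (m + 1) => x.lowS (m + 1) fun _ => True) c := by
  have : sop k ∘ₗ cochainD k U (m + 1) + cochainD k U m ∘ₗ sop k =
      - Finsupp.lmapDomain k k (fun x : Cell U (m + 1) => x.lowS (m + 1) fun _ => True) := by
    ext x : 2
    simp only [LinearMap.comp_apply, Finsupp.lsingle_apply, LinearMap.neg_apply,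
      LinearMap.add_apply, Finsupp.lmapDomain_apply, Finsupp.mapDomain_single]
    rw [sop_single, map_smul, cochainD_single, cochainD_single, map_sum, dim_cod, Finset.smul_sum]
    simp only [map_smul, cof_single, sop_single, dim_coface, smul_smul, ← pow_add]
    rw [Fin.sum_univ_castSucc (n := m + 2), Fin.sum_univ_castSucc (n := m + 1),
      Fin.sum_univ_castSucc (n := m + 1)]
    have e1 : ∑ i : Fin (m + 1), (-1 : k) ^ (m + 1 + x.dim + ((i.castSucc.castSucc : Fin (m + 3)) : ℕ) +
          x.dim) • Finsupp.single (x.coface i.castSucc.castSucc).cod (1 : k) =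
        -∑ i : Fin (m + 1), (-1 : k) ^ (x.dim + (m + x.dim + ((i.castSucc : Fin (m + 2)) : ℕ))) •
          Finsupp.single (x.cod.coface i.castSucc) (1 : k) := by
      rw [← Finset.sum_neg_distrib]
      refine Finset.sum_congr rfl fun i _ => ?_
      rw [neg_one_pow_of_mod_ne (b := x.dim + (m + x.dim + ((i.castSucc : Fin (m + 2)) : ℕ)))
        (by simp only [Fin.val_castSucc]; omega), neg_smul,
        show (x.coface i.castSucc.castSucc).cod = x.cod.coface i.castSucc from
          cod_coface (j := i) (by omega)]
    have e2 : (x.coface (Fin.last (m + 1)).castSucc).cod = x :=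
      cod_coface_last (j := m + 1) (Or.inl rfl)
    have e3 : (x.coface (Fin.last (m + 1 + 1))).cod = x :=
      cod_coface_last (j := m + 2) (Or.inr rfl)
    have e4 : x.cod.coface (Fin.last (m + 1)) = x.lowS (m + 1) fun _ => True := coface_cod x
    rw [e1, e2, e3, e4]
    simp only [Fin.val_castSucc, Fin.val_last]
    rw [neg_one_pow_of_mod_ne (a := m + 1 + x.dim + (m + 1) + x.dim) (b := 1) (by omega),
      neg_one_pow_of_mod_eq (a := m + 1 + x.dim + (m + 1 + 1) + x.dim) (b := 1) (by omega),
      neg_one_pow_of_mod_eq (a := x.dim + (m + x.dim + (m + 1))) (b := 1) (by omega)]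
    simp only [pow_one, neg_smul, one_smul, neg_neg]
    abel
  exact LinearMap.congr_fun this c

theorem sop_cochainD_zero (c : Chains k U 0) : sop k (cochainD k U 0 c) = 0 := by
  have : sop k ∘ₗ cochainD k U 0 = 0 := by
    ext x : 2
    simp only [LinearMap.comp_apply, Finsupp.lsingle_apply, LinearMap.zero_apply]
    rw [cochainD_single, map_sum]
    simp only [map_smul, cof_single, sop_single, dim_coface, smul_smul, ← pow_add]
    rw [Fin.sum_univ_two]
    rw [show (x.coface 0).cod = x from cod_coface_last (j := 0) (Or.inl rfl),
      show (x.coface 1).cod = x from cod_coface_last (j := 1) (Or.inr rfl)]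
    rw [neg_one_pow_of_mod_ne (b := 0 + x.dim + ((1 : Fin 2) : ℕ) + x.dim) (by simp; omega)]
    simp
  exact LinearMap.congr_fun this c

theorem chainD_hop (c : Chains k U (m + 1)) (e : ℕ) :
    chainD k U (m + 1) (hop k e c) + hop k e (chainD k U (m + 1) c) =
      c - Finsupp.lmapDomain k k (fun x : Cell U (m + 1) => x.lowS e fun _ => True) c := by
  have : chainD k U (m + 1) ∘ₗ hop k e + hop k e ∘ₗ chainD k U (m + 1) =
      LinearMap.id -
        Finsupp.lmapDomain k k (fun x : Cell U (m + 1) => x.lowS e fun _ => True) := by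
    ext x : 2
    simp only [LinearMap.comp_apply, Finsupp.lsingle_apply, LinearMap.sub_apply,
      LinearMap.add_apply, Finsupp.lmapDomain_apply, Finsupp.mapDomain_single, LinearMap.id_apply]
    exact chainD_hop_single k e x
  exact LinearMap.congr_fun this c

end Operators

/-! ### The total complex and the contraction of its part of positive output -/

section Total

open Cell

variable (k : Type u) [Field k] (U : TwoDisk)

/-- The families of chains underlying `|seq|(U)`. -/
abbrev Fam : Type u := ∀ m, Chains k U m

/-- The total differential of `|seq|(U)`. -/
noncomputable def dtot : Fam k U →ₗ[k] Fam k U := (condensedSeq k).d U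

/-- The elements of degree `n` of `|seq|(U)`. -/
noncomputable def degS (n : ℤ) : Submodule k (Fam k U) := (condensedSeq k).deg U n

variable {k U}

@[simp] theorem dtot_zero (f : Fam k U) : dtot k U f 0 = chainD k U 0 (f 0) := rfl

@[simp] theorem dtot_succ (f : Fam k U) (m : ℕ) :
    dtot k U f (m + 1) = chainD k U (m + 1) (f (m + 1)) - cochainD k U m (f m) := rfl

theorem mem_degS {n : ℤ} {f : Fam k U} : f ∈ degS k U n ↔
    ∀ m, f m ∈ Finsupp.supported k k {x : Cell U m | (m : ℤ) - x.dim = n} := by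
  refine forall_congr' fun m => ?_
  rw [Finsupp.mem_supported]
  rfl

/-- A linear map between free modules respects supports if it does so on basis elements. -/
theorem map_mem_supported {X Y : Type*} {R : Type*} [CommRing R] (L : (X →₀ R) →ₗ[R] (Y →₀ R))
    {s : Set X} {t : Set Y} (h : ∀ x ∈ s, L (Finsupp.single x 1) ∈ Finsupp.supported R R t)
    {c : X →₀ R} (hc : c ∈ Finsupp.supported R R s) : L c ∈ Finsupp.supported R R t := by
  rw [Finsupp.supported_eq_span_single] at hc
  have : Submodule.span R ((fun i => Finsupp.single i (1 : R)) '' s) ≤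
      (Finsupp.supported R R t).comap L := by
    rw [Submodule.span_le]
    rintro _ ⟨x, hx, rfl⟩
    exact h x hx
  exact this hc

theorem chainD_mem {m : ℕ} {s t : Set (Cell U m)}
    (h : ∀ x ∈ s, ∀ w ∈ pts x.1, 1 ≤ x.1 w.1 → x.fc w ∈ t) {c : Chains k U m}
    (hc : c ∈ Finsupp.supported k k s) : chainD k U m c ∈ Finsupp.supported k k t := by
  refine map_mem_supported _ (fun x hx => ?_) hc
  rw [chainD_single']
  refine Submodule.sum_mem _ fun w hw => ?_
  split_ifs with h1
  · exact Submodule.smul_mem _ _ (Finsupp.single_mem_supported _ _ (h x hx w hw h1))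
  · exact Submodule.zero_mem _

theorem cochainD_mem {m : ℕ} {s : Set (Cell U m)} {t : Set (Cell U (m + 1))}
    (h : ∀ x ∈ s, ∀ j, x.coface j ∈ t) {c : Chains k U m}
    (hc : c ∈ Finsupp.supported k k s) : cochainD k U m c ∈ Finsupp.supported k k t := by
  refine map_mem_supported _ (fun x hx => ?_) hc
  rw [cochainD_single]
  refine Submodule.sum_mem _ fun j _ => ?_
  rw [cof_single]
  exact Submodule.smul_mem _ _ (Finsupp.single_mem_supported _ _ (h x hx j))

theorem hop_mem {m c : ℕ} {s t : Set (Cell U m)}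
    (h : ∀ x ∈ s, ∀ z ∈ pts x.1, x.lab z = c → x.hcut z ∈ t) {a : Chains k U m}
    (ha : a ∈ Finsupp.supported k k s) : hop k c a ∈ Finsupp.supported k k t := by
  classical
  refine map_mem_supported _ (fun x hx => ?_) ha
  rw [hop_single]
  refine Submodule.sum_mem _ fun w hw => ?_
  split_ifs with h1
  · exact Submodule.smul_mem _ _ (Finsupp.single_mem_supported _ _ (h x hx w hw h1))
  · exact Submodule.zero_mem _

theorem eop_mem {m c : ℕ} {s : Set (Cell U m)} {t : Set (Cell U (m + 1))}
    (h : ∀ x ∈ s, ∀ z ∈ pts x.1, x.lab z = c → x.ecut z ∈ t) {a : Chains k U m}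
    (ha : a ∈ Finsupp.supported k k s) : eop k c a ∈ Finsupp.supported k k t := by
  classical
  refine map_mem_supported _ (fun x hx => ?_) ha
  rw [eop_single]
  refine Submodule.sum_mem _ fun w hw => ?_
  split_ifs with h1
  · exact Submodule.smul_mem _ _ (Finsupp.single_mem_supported _ _ (h x hx w hw h1))
  · exact Submodule.zero_mem _

theorem sop_mem {m : ℕ} {s : Set (Cell U (m + 1))} {t : Set (Cell U m)}
    (h : ∀ x ∈ s, x.cod ∈ t) {a : Chains k U (m + 1)}
    (ha : a ∈ Finsupp.supported k k s) : sop k a ∈ Finsupp.supported k k t := by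
  refine map_mem_supported _ (fun x hx => ?_) ha
  rw [sop_single]
  exact Submodule.smul_mem _ _ (Finsupp.single_mem_supported _ _ (h x hx))

theorem chainD_mem_dim {m : ℕ} {n : ℤ} {c : Chains k U m}
    (hc : c ∈ Finsupp.supported k k {x : Cell U m | (m : ℤ) - x.dim = n}) :
    chainD k U m c ∈ Finsupp.supported k k {x : Cell U m | (m : ℤ) - x.dim = n + 1} := by
  refine chainD_mem (fun x hx w _ h => ?_) hc
  have := dim_fc h
  simp only [Set.mem_ofPred_eq] at hx ⊢
  omega

theorem dtot_mem {n : ℤ} {f : Fam k U} (hf : f ∈ degS k U n) : dtot k U f ∈ degS k U (n + 1) := by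
  rw [mem_degS] at *
  rintro (_ | m)
  · exact chainD_mem_dim (hf 0)
  · rw [dtot_succ]
    refine Submodule.sub_mem _ (chainD_mem_dim (hf (m + 1))) (cochainD_mem (fun x hx j => ?_) (hf m))
    simp only [Set.mem_ofPred_eq, dim_coface] at hx ⊢
    push_cast
    omega

theorem chainD_chainD {m : ℕ} (c : Chains k U m) : chainD k U m (chainD k U m c) = 0 :=
  LinearMap.congr_fun (chainD_comp_self k) c

theorem dtot_dtot (f : Fam k U) : dtot k U (dtot k U f) = 0 := by
  have h2 : ∀ m (c : Chains k U m), chainD k U (m + 1) (cochainD k U m c) =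
    -cochainD k U m (chainD k U m c) := fun m c => LinearMap.congr_fun (chainD_cochainD k) c
  have h3 : ∀ m (c : Chains k U m), cochainD k U (m + 1) (cochainD k U m c) = 0 :=
    fun m c => LinearMap.congr_fun (cochainD_cochainD k) c
  funext m
  rcases m with _ | _ | m
  · simp [chainD_chainD]
  · simp [chainD_chainD, h2]
  · simp [chainD_chainD, h2, h3]

/-- The homotopy of `|seq|(U)` onto its component at the output ordinal `[0]`, up to terms of
higher output. -/
noncomputable def htot (f : Fam k U) : Fam k U
  | 0 => sop k (f 1)
  | m + 1 => hop k (m + 1) (f (m + 1)) + sop k (f (m + 2))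

theorem htot_mem {n : ℤ} {f : Fam k U} (hf : f ∈ degS k U n) : htot f ∈ degS k U (n - 1) := by
  have hs : ∀ m, sop k (f (m + 1)) ∈
      Finsupp.supported k k {x : Cell U m | (m : ℤ) - x.dim = n - 1} := by
    intro m
    refine sop_mem (fun x hx => ?_) (mem_degS.1 hf (m + 1))
    simp only [Set.mem_ofPred_eq, dim_cod] at hx ⊢
    push_cast at hx
    omega
  rw [mem_degS]
  rintro (_ | m)
  · exact hs 0
  · refine Submodule.add_mem _ (hop_mem (fun x hx z _ _ => ?_) (mem_degS.1 hf (m + 1))) (hs (m + 1))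
    have := dim_of_fst_eq_hi (hcut_fst x z)
    simp only [Set.mem_ofPred_eq] at hx ⊢
    omega

theorem dtot_htot_zero {f : Fam k U} (hf : dtot k U f = 0) : dtot k U (htot f) 0 = 0 := by
  have h1 := congrFun hf 1
  simp only [dtot_succ, Pi.zero_apply, sub_eq_zero] at h1
  change chainD k U 0 (sop k (f 1)) = 0
  rw [chainD_sop, h1, sop_cochainD_zero, neg_zero]

/-- On cocycles the homotopy reproduces the lowest possibly nonzero component. -/
theorem dtot_htot_succ {f : Fam k U} (hf : dtot k U f = 0) {m : ℕ} (h0 : f m = 0) :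
    dtot k U (htot f) (m + 1) = f (m + 1) := by
  have h1 := congrFun hf (m + 1)
  have h2 := congrFun hf (m + 2)
  simp only [dtot_succ, Pi.zero_apply, sub_eq_zero] at h1 h2
  rw [h0, map_zero] at h1
  have h3 := chainD_hop k (f (m + 1)) (m + 1)
  rw [h1, map_zero, add_zero] at h3
  have h4 : htot f m = sop k (f (m + 1)) := by
    rcases m with _ | m
    · rfl
    · change hop k (m + 1) (f (m + 1)) + _ = _
      rw [h0, map_zero, zero_add]
  have h5 := sop_cochainD k (f (m + 1))
  rw [dtot_succ, h4]
  change chainD k U (m + 1) (hop k (m + 1) (f (m + 1)) + sop k (f (m + 2))) - _ = _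
  rw [map_add, h3, chainD_sop, h2]
  rw [eq_sub_of_add_eq' h5]
  abel

/-- The families of positive output form an acyclic complex. -/
theorem exists_dtot_eq {n : ℤ} {f : Fam k U} (hf : f ∈ degS k U n) (hd : dtot k U f = 0)
    (h0 : f 0 = 0) : ∃ g ∈ degS k U (n - 1), dtot k U g = f := by
  -- the defect of the homotopy increases the output
  let R : ℕ → Fam k U := fun i => (fun f => f - dtot k U (htot f))^[i] f
  have R0 : R 0 = f := rfl
  have Rs : ∀ i, R (i + 1) = R i - dtot k U (htot (R i)) := fun i =>
    Function.iterate_succ_apply' _ _ _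
  have hR : ∀ i, R i ∈ degS k U n ∧ dtot k U (R i) = 0 ∧ ∀ m ≤ i, R i m = 0 := by
    intro i
    induction i with
    | zero => exact ⟨hf, hd, fun m hm => by rw [Nat.le_zero.1 hm]; exact h0⟩
    | succ i ih =>
      obtain ⟨h1, h2, h3⟩ := ih
      refine ⟨?_, ?_, ?_⟩
      · rw [Rs]
        have := dtot_mem (htot_mem h1)
        rw [sub_add_cancel] at this
        exact Submodule.sub_mem _ h1 this
      · rw [Rs, map_sub, h2, dtot_dtot, sub_zero]
      · rintro (_ | m) hm
        · rw [Rs, Pi.sub_apply, dtot_htot_zero h2, h3 0 (Nat.zero_le _), sub_zero]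
        · rw [Rs, Pi.sub_apply, dtot_htot_succ h2 (h3 m (by omega)), sub_self]
  -- so that the sum of the homotopies is finite in each output
  have hH : ∀ i m, m < i → htot (R i) m = 0 := by
    rintro i (_ | m) hm
    · change sop k (R i 1) = 0
      rw [(hR i).2.2 1 (by omega), map_zero]
    · change hop k (m + 1) (R i (m + 1)) + sop k (R i (m + 2)) = 0
      rw [(hR i).2.2 (m + 1) (by omega), (hR i).2.2 (m + 2) (by omega), map_zero, map_zero,
        add_zero]
  let g : Fam k U := fun m => ∑ i ∈ Finset.range (m + 1), htot (R i) m
  have hg : ∀ N m, m ≤ N → g m = (∑ i ∈ Finset.range (N + 1), htot (R i)) m := by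
    intro N m hm
    rw [Finset.sum_apply]
    refine Finset.sum_subset (Finset.range_mono (by omega)) fun i _ hi => hH i m ?_
    simp only [Finset.mem_range] at hi
    omega
  have hs : ∀ N, dtot k U (∑ i ∈ Finset.range N, htot (R i)) = f - R N := by
    intro N
    induction N with
    | zero => simp [R0]
    | succ N ih => rw [Finset.sum_range_succ, map_add, ih, Rs]; abel
  refine ⟨g, ?_, ?_⟩
  · rw [mem_degS]
    intro m
    exact Submodule.sum_mem _ fun i _ => mem_degS.1 (htot_mem (hR i).1) m
  · funext m
    have h1 : dtot k U g m = dtot k U (∑ i ∈ Finset.range (m + 1), htot (R i)) m := by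
      rcases m with _ | m
      · rw [dtot_zero, dtot_zero, hg 0 0 le_rfl]
      · rw [dtot_succ, dtot_succ, hg (m + 1) (m + 1) le_rfl, hg (m + 1) m (by omega)]
    rw [h1, hs, Pi.sub_apply, (hR (m + 1)).2.2 m (by omega), sub_zero]

end Total

/-! ### Insertions of intervals -/

namespace Cell

variable {U : TwoDisk}

/-- A family of maps `[ℓ' ν] → [ℓ ν]` to the input ordinals of a cell. -/
abbrev Ins (x : Cell U 0) : Type :=
  Σ ℓ' : U.Ball → ℕ, ∀ ν, Fin (ℓ' ν + 1) → Fin (x.1 ν + 1)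

theorem fmap_nx_smap {z a : U.Ball × ℕ} (h : a ≠ nx z) : fmap (nx z) (smap z a) = a := by
  obtain ⟨ν, i⟩ := a
  obtain ⟨ν', j⟩ := z
  have h' : ¬ (ν = ν' ∧ i = j + 1) := by simpa [nx] using h
  simp only [fmap, smap, fφ, sφ, nx, Prod.mk.injEq, true_and]
  grind

namespace Ins

variable {x : Cell U 0}

/-- The family consists of monotone surjections. -/
def Valid (s : Ins x) : Prop :=
  (∀ ν, Monotone (s.2 ν)) ∧ ∀ ν, Function.Surjective (s.2 ν)

/-- The values of the family in coordinates. -/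
def pv (s : Ins x) (a : U.Ball × ℕ) : ℕ := s.2 a.1 (Fin.clamp a.2 (s.1 a.1))

theorem pv_le (s : Ins x) (a : U.Ball × ℕ) : s.pv a ≤ x.1 a.1 := Nat.lt_succ_iff.1 (Fin.is_lt _)

theorem pv_fin (s : Ins x) (ν : U.Ball) (j : Fin (s.1 ν + 1)) : s.pv (ν, j) = s.2 ν j := by
  simp only [pv, clamp_of_le (Nat.lt_succ_iff.1 j.2)]

theorem ext_pv {s t : Ins x} (h : s.1 = t.1) (h' : ∀ a ∈ pts s.1, s.pv a = t.pv a) : s = t := by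
  obtain ⟨ℓ, p⟩ := s
  obtain ⟨ℓ', p'⟩ := t
  obtain rfl : ℓ = ℓ' := h
  congr 1
  funext ν j
  have := h' (ν, j) (by simp [Nat.lt_succ_iff.1 j.2])
  exact Fin.ext ((pv_fin (x := x) ⟨ℓ, p⟩ ν j).symm.trans (this.trans (pv_fin (x := x) ⟨ℓ, p'⟩ ν j)))

theorem pv_mono {s : Ins x} (hs : s.Valid) (ν : U.Ball) : Monotone fun j => s.pv (ν, j) := by
  intro i j hij
  refine hs.1 ν ?_
  simp only [Fin.clamp, Fin.mk_le_mk]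
  exact min_le_min_right _ hij

/-- The point of the cell under a point of the family. -/
def pt (s : Ins x) (a : U.Ball × ℕ) : U.Ball × ℕ := (a.1, s.pv a)

theorem pt_mem (s : Ins x) (a : U.Ball × ℕ) : s.pt a ∈ pts x.1 := by
  simpa [pt] using s.pv_le a

/-- The new points, in coordinates: those with the same value as their predecessor. -/
def nw (s : Ins x) : Finset (U.Ball × ℕ) :=
  (pts s.1).filter fun a => 0 < a.2 ∧ s.pv (a.1, a.2 - 1) = s.pv a

theorem mem_nw {s : Ins x} {a : U.Ball × ℕ} :
    a ∈ s.nw ↔ a ∈ pts s.1 ∧ 0 < a.2 ∧ s.pv (a.1, a.2 - 1) = s.pv a := Finset.mem_filter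

theorem isNew_iff {s : Ins x} (hs : s.Valid) (z : Points s.1) :
    IsNew s.2 z ↔ (z.1, (z.2 : ℕ)) ∈ s.nw := by
  obtain ⟨ν, i⟩ := z
  have hi : (i : ℕ) ≤ s.1 ν := Nat.lt_succ_iff.1 i.2
  simp only [IsNew, mem_nw, mem_pts, hi, true_and]
  constructor
  · rintro ⟨j, hj, he⟩
    have hj' : (j : ℕ) < i := hj
    refine ⟨by omega, ?_⟩
    have h1 := pv_mono hs ν (show (j : ℕ) ≤ (i : ℕ) - 1 by omega)
    have h2 := pv_mono hs ν (show (i : ℕ) - 1 ≤ (i : ℕ) by omega)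
    have h3 : s.pv (ν, j) = s.pv (ν, i) := by rw [pv_fin, pv_fin, he]
    simp only at h1 h2
    omega
  · rintro ⟨h0, he⟩
    refine ⟨⟨(i : ℕ) - 1, by omega⟩, by rw [Fin.lt_def]; simp only; omega, Fin.ext ?_⟩
    rw [← pv_fin, ← pv_fin]
    exact he

theorem pv_zero {s : Ins x} (hs : s.Valid) (ν : U.Ball) : s.pv (ν, 0) = 0 := by
  obtain ⟨j, hj⟩ := hs.2 ν 0
  have h1 := pv_mono hs ν (Nat.zero_le (j : ℕ))
  simp only [pv_fin, hj] at h1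
  simpa using h1

theorem pv_last {s : Ins x} (hs : s.Valid) (ν : U.Ball) : s.pv (ν, s.1 ν) = x.1 ν := by
  obtain ⟨j, hj⟩ := hs.2 ν (Fin.last _)
  have h1 := pv_mono hs ν (Nat.lt_succ_iff.1 j.2)
  have h2 := s.pv_le (ν, s.1 ν)
  simp only [pv_fin, hj, Fin.val_last] at h1 h2
  omega

theorem pv_succ_le {s : Ins x} (hs : s.Valid) (ν : U.Ball) (j : ℕ) :
    s.pv (ν, j + 1) ≤ s.pv (ν, j) + 1 := by
  by_contra hc
  have h3 := s.pv_le (ν, j + 1)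
  obtain ⟨i, hi⟩ := hs.2 ν ⟨s.pv (ν, j) + 1, by simp only at h3; omega⟩
  have hi' : s.pv (ν, i) = s.pv (ν, j) + 1 := by rw [pv_fin, hi]
  rcases Nat.lt_or_ge i (j + 1) with h | h
  · have h1 := pv_mono hs ν (show (i : ℕ) ≤ j by omega)
    simp only at h1
    omega
  · have h1 := pv_mono hs ν h
    simp only at h1
    omega

/-- The value at a point is its position minus the number of new points up to it. -/
theorem pv_add_card {s : Ins x} (hs : s.Valid) (ν : U.Ball) {j : ℕ} (hj : j ≤ s.1 ν) :
    s.pv (ν, j) + ((Finset.range (j + 1)).filter fun i => (ν, i) ∈ s.nw).card = j := by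
  induction j with
  | zero =>
    rw [pv_zero hs, zero_add, Finset.card_eq_zero, Finset.filter_eq_empty_iff]
    intro i hi h
    have h1 := (mem_nw.1 h).2.1
    simp only [Finset.mem_range] at hi
    simp only at h1
    omega
  | succ j ih =>
    have ih := ih (by omega)
    have h1 := pv_succ_le hs ν j
    have h2 := pv_mono hs ν (Nat.le_succ j)
    simp only [Nat.succ_eq_add_one] at h2
    rw [Finset.range_add_one, Finset.filter_insert]
    by_cases h : s.pv (ν, j) = s.pv (ν, j + 1)
    · rw [if_pos (mem_nw.2 ⟨by simpa using hj, by simp, by simpa using h⟩),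
        Finset.card_insert_of_notMem (by simp)]
      omega
    · rw [if_neg fun h' => h (by simpa using (mem_nw.1 h').2.2)]
      omega

theorem card_nw {s : Ins x} (hs : s.Valid) : s.nw.card + x.dim = ∑ ν, s.1 ν := by
  have h1 : s.nw.card = ∑ ν, ((Finset.range (s.1 ν + 1)).filter fun i => (ν, i) ∈ s.nw).card := by
    rw [Finset.card_eq_sum_card_fiberwise (f := Prod.fst) (t := Finset.univ) (by simp)]
    refine Finset.sum_congr rfl fun ν _ => ?_
    symm
    refine Finset.card_bij (fun i _ => (ν, i)) ?_ ?_ ?_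
    · intro i hi
      simpa using (Finset.mem_filter.1 hi).2
    · intro i _ j _ h
      simpa using h
    · rintro ⟨ν', i⟩ h
      simp only [Finset.mem_filter] at h
      obtain ⟨h, rfl⟩ := h
      have h2 := mem_pts.1 (mem_nw.1 h).1
      exact ⟨i, by simpa [Nat.lt_succ_iff, h] using h2, rfl⟩
  rw [h1, dim, ← Finset.sum_add_distrib]
  refine Finset.sum_congr rfl fun ν _ => ?_
  have h2 := pv_add_card hs ν le_rfl
  rw [pv_last hs] at h2
  omega

/-- The insertion of one more interval, after the point `z`. -/
def ins (s : Ins x) (z : U.Ball × ℕ) : Ins x :=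
  ⟨hi s.1 z, fun ν j => s.2 ν (Fin.clamp (sφ z ν j) (s.1 ν))⟩

/-- The omission of a point `w`. -/
def del (s : Ins x) (w : U.Ball × ℕ) : Ins x :=
  ⟨lo s.1 w, fun ν j => s.2 ν (Fin.clamp (fφ w ν j) (s.1 ν))⟩

@[simp] theorem ins_fst (s : Ins x) (z : U.Ball × ℕ) : (s.ins z).1 = hi s.1 z := rfl
@[simp] theorem del_fst (s : Ins x) (z : U.Ball × ℕ) : (s.del z).1 = lo s.1 z := rfl

theorem pv_ins {s : Ins x} {z a : U.Ball × ℕ} (ha : a ∈ pts (hi s.1 z)) :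
    (s.ins z).pv a = s.pv (smap z a) := by
  have h : (Fin.clamp a.2 ((s.ins z).1 a.1) : ℕ) = a.2 := by
    simpa [Fin.clamp] using ha
  change ((s.2 a.1 (Fin.clamp (sφ z a.1 (Fin.clamp a.2 ((s.ins z).1 a.1) : ℕ)) (s.1 a.1)) : ℕ)) = _
  rw [h]
  rfl

theorem pv_del {s : Ins x} {z a : U.Ball × ℕ} (ha : a ∈ pts (lo s.1 z)) :
    (s.del z).pv a = s.pv (fmap z a) := by
  have h : (Fin.clamp a.2 ((s.del z).1 a.1) : ℕ) = a.2 := by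
    simpa [Fin.clamp] using ha
  change ((s.2 a.1 (Fin.clamp (fφ z a.1 (Fin.clamp a.2 ((s.del z).1 a.1) : ℕ)) (s.1 a.1)) : ℕ)) = _
  rw [h]
  rfl

theorem valid_ins {s : Ins x} (hs : s.Valid) (z : U.Ball × ℕ) :
    (s.ins z).Valid := by
  refine ⟨fun ν i j hij => ?_, fun ν i => ?_⟩
  · refine hs.1 ν ?_
    simp only [Fin.clamp, Fin.mk_le_mk]
    exact min_le_min_right _ (sφ_mono z ν hij)
  · obtain ⟨j, hj⟩ := hs.2 ν i
    have hj' : ((ν, (j : ℕ)) : U.Ball × ℕ) ∈ pts s.1 := by simp [Nat.lt_succ_iff.1 j.2]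
    have h1 := fmap_nx_mem (z := z) hj'
    refine ⟨⟨(fmap (nx z) (ν, (j : ℕ))).2, Nat.lt_succ_iff.2 (mem_pts.1 h1)⟩, Fin.ext ?_⟩
    rw [← pv_fin]
    change (s.ins z).pv (fmap (nx z) (ν, (j : ℕ))) = _
    rw [pv_ins h1, smap_fmap_nx, pv_fin, hj]

theorem one_le_of_mem_nw {s : Ins x} {w : U.Ball × ℕ} (hw : w ∈ s.nw) : 1 ≤ s.1 w.1 := by
  have h := mem_nw.1 hw
  have h1 := mem_pts.1 h.1
  omega

theorem valid_del {s : Ins x} (hs : s.Valid) {w : U.Ball × ℕ} (hw : w ∈ s.nw) :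
    (s.del w).Valid := by
  have hw' := mem_nw.1 hw
  refine ⟨fun ν i j hij => ?_, fun ν i => ?_⟩
  · refine hs.1 ν ?_
    simp only [Fin.clamp, Fin.mk_le_mk]
    exact min_le_min_right _ (fφ_mono w ν hij)
  · -- a preimage other than `w`
    obtain ⟨b, hb, hne, hbi⟩ : ∃ b : ℕ, (ν, b) ∈ pts s.1 ∧ (ν, b) ≠ w ∧ s.pv (ν, b) = i := by
      obtain ⟨j, hj⟩ := hs.2 ν i
      by_cases h : ((ν, (j : ℕ)) : U.Ball × ℕ) = w
      · refine ⟨(j : ℕ) - 1, by have := j.2; simp only [mem_pts]; omega, ?_, ?_⟩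
        · subst h
          have := hw'.2.1
          simp only at this
          simp only [ne_eq, Prod.mk.injEq, true_and]
          omega
        · subst h
          rw [hw'.2.2, pv_fin, hj]
      · exact ⟨j, by simp [Nat.lt_succ_iff.1 j.2], h, by rw [pv_fin, hj]⟩
    have h1 := smap_mem_lo hw'.1 hb hne
    refine ⟨⟨(smap w (ν, b)).2, Nat.lt_succ_iff.2 (mem_pts.1 h1)⟩, Fin.ext ?_⟩
    rw [← pv_fin]
    change (s.del w).pv (smap w (ν, b)) = _
    rw [pv_del h1, fmap_smap hne, hbi]

theorem del_ins {s : Ins x} {z : U.Ball × ℕ} : (s.ins z).del (nx z) = s := by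
  have hlo : lo (s.ins z).1 (nx z) = s.1 := lo_hi s.1 rfl
  have h1 : 1 ≤ (s.ins z).1 (nx z).1 := by simp [hi_apply, nx]
  refine ext_pv (s := (s.ins z).del (nx z)) hlo fun a ha => ?_
  have ha' : a ∈ pts (lo (s.ins z).1 (nx z)) := ha
  have e1 := pv_del (s := s.ins z) ha'
  have e2 := pv_ins (s := s) (z := z) (fmap_mem h1 ha')
  rw [e1, e2, smap_fmap_nx]

theorem ins_del {s : Ins x} {w : U.Ball × ℕ} (hw : w ∈ s.nw) :
    (s.del w).ins (w.1, w.2 - 1) = s := by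
  have hhi : hi (s.del w).1 (w.1, w.2 - 1) = s.1 := hi_lo s.1 rfl (one_le_of_mem_nw hw)
  have hw' := mem_nw.1 hw
  have hz : (w.1, w.2 - 1) ∈ pts (s.del w).1 := by
    have := mem_pts.1 hw'.1
    simp only [mem_pts, del_fst, lo_apply, if_true]
    omega
  refine ext_pv (s := (s.del w).ins (w.1, w.2 - 1)) hhi fun a ha => ?_
  have ha' : a ∈ pts (hi (s.del w).1 (w.1, w.2 - 1)) := ha
  have e1 := pv_ins (s := s.del w) ha'
  have e2 := pv_del (s := s) (z := w) (smap_mem hz ha')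
  rw [e1, e2]
  by_cases h : a = w
  · subst h
    rw [← hw'.2.2]
    congr 1
    obtain ⟨ν, i⟩ := a
    have h0 : 0 < i := hw'.2.1
    simp only [fmap, smap, fφ, sφ, Prod.mk.injEq, true_and]
    grind
  · congr 1
    obtain ⟨ν, i⟩ := a
    obtain ⟨ν', j⟩ := w
    have h0 : 0 < j := hw'.2.1
    have : ¬ (ν = ν' ∧ i = j) := by simpa using h
    simp only [fmap, smap, fφ, sφ, Prod.mk.injEq, true_and]
    grind

theorem nx_mem_nw {s : Ins x} {z : U.Ball × ℕ} (hz : z ∈ pts s.1) : nx z ∈ (s.ins z).nw := by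
  refine mem_nw.2 ⟨nx_mem_hi hz, Nat.succ_pos _, ?_⟩
  have h : ((nx z).1, (nx z).2 - 1) = z := by simp [nx]
  rw [h, pv_ins (mem_hi_self hz), pv_ins (nx_mem_hi hz), smap_self, smap_nx]

/-- The new points after an insertion: the second copy, and the previous new points. -/
theorem nw_ins {s : Ins x} {z : U.Ball × ℕ} (hz : z ∈ pts s.1) :
    (s.ins z).nw = insert (nx z) (s.nw.image (fmap (nx z))) := by
  ext a
  simp only [Finset.mem_insert, Finset.mem_image]
  by_cases h : a = nx z
  · simp only [h, true_or, iff_true]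
    exact nx_mem_nw hz
  · have key : a ∈ (s.ins z).nw ↔ smap z a ∈ s.nw := by
      by_cases ha : a ∈ pts (hi s.1 z)
      · have ha' : (a.1, a.2 - 1) ∈ pts (hi s.1 z) := by
          simp only [mem_pts] at ha ⊢; omega
        simp only [mem_nw, ins_fst, ha, smap_mem hz ha, true_and, pv_ins ha, pv_ins ha']
        obtain ⟨ν, i⟩ := a
        obtain ⟨ν', j⟩ := z
        have h' : ¬ (ν = ν' ∧ i = j + 1) := by simpa [nx] using h
        have e : 0 < i → smap (ν', j) (ν, i - 1) =
            ((smap (ν', j) (ν, i)).1, (smap (ν', j) (ν, i)).2 - 1) := by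
          simp only [smap, sφ, Prod.mk.injEq, true_and]
          grind
        have e' : 0 < i ↔ 0 < (smap (ν', j) (ν, i)).2 := by
          simp only [smap, sφ]
          grind
        rw [← e']
        refine and_congr_right fun h0 => ?_
        simp only [e h0]
      · refine iff_of_false (fun h1 => ha (mem_nw.1 h1).1) fun h1 => ha ?_
        have h2 := fmap_nx_mem (z := z) (mem_nw.1 h1).1
        rwa [fmap_nx_smap h] at h2
    rw [key]
    simp only [h, false_or]
    constructor
    · intro h1
      exact ⟨_, h1, fmap_nx_smap h⟩
    · rintro ⟨b, hb, rfl⟩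
      rwa [smap_fmap_nx]

end Ins

end Cell

/-! ### Whiskering is generated by single insertions -/

namespace Cell.Ins

variable {U : TwoDisk} {x : Cell U 0}

/-- The cell obtained by whiskering along a valid family. -/
noncomputable def wk {s : Ins x} (hs : s.Valid) (q : ℕ) : Cell U q := x.whisker q s.1 s.2 hs.1

@[simp] theorem wk_fst {s : Ins x} (hs : s.Valid) (q : ℕ) : (wk hs q).1 = s.1 := rfl

theorem rel_wk_iff {s : Ins x} (hs : s.Valid) {q q' : ℕ} {a b : U.Ball × ℕ} :
    (wk hs q).rel a b ↔ (wk hs q').rel a b := Iff.rfl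

theorem rel_wk {s : Ins x} (hs : s.Valid) {q : ℕ} {a b : U.Ball × ℕ} (ha : a ∈ pts s.1)
    (hb : b ∈ pts s.1) : (wk hs q).rel a b ↔
      x.rel (s.pt a) (s.pt b) ∨ (s.pt a = s.pt b ∧ a.2 < b.2) := by
  have key : (wk hs 0).rel a b ↔ (x.pl s.1 (fun ν j => s.pv (ν, j)) (pv_mono hs)).rel a b := by
    have e : (fun ν (j : Fin (s.1 ν + 1)) => Fin.clamp (s.pv (ν, j)) (x.1 ν)) = s.2 := by
      funext ν j
      have h := s.pv_le (ν, j)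
      rw [clamp_of_le h]
      exact Fin.ext (pv_fin s ν j)
    simp only [rel, wk, whisker, pl, e]
  rw [rel_wk_iff hs (q' := 0), key, rel_pl ha hb (s.pt_mem a) (s.pt_mem b)]
  rfl

/-- A point of a disjoint union of ordinals, in coordinates. -/
def coord {ℓ : U.Ball → ℕ} (z : Points ℓ) : U.Ball × ℕ := (z.1, z.2)

theorem coord_injective {ℓ : U.Ball → ℕ} : Function.Injective (coord : Points ℓ → _) := by
  rintro ⟨ν, i⟩ ⟨ν', j⟩ h
  obtain rfl : ν = ν' := congrArg Prod.fst h
  have h2 : (i : ℕ) = j := congrArg Prod.snd h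
  rw [Fin.ext h2]

theorem coord_mem {ℓ : U.Ball → ℕ} (z : Points ℓ) : coord z ∈ pts ℓ := by
  simp [coord, Nat.lt_succ_iff.1 z.2.2]

theorem exists_coord {ℓ : U.Ball → ℕ} {a : U.Ball × ℕ} (ha : a ∈ pts ℓ) :
    ∃ z : Points ℓ, coord z = a :=
  ⟨⟨a.1, ⟨a.2, Nat.lt_succ_iff.2 (mem_pts.1 ha)⟩⟩, rfl⟩

theorem rel_wk_coord {s : Ins x} (hs : s.Valid) {q : ℕ} {y z : Points s.1} :
    (wk hs q).rel (coord y) (coord z) ↔ (x.2.pull s.2 hs.1).lt y z :=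
  ⟨fun ⟨_, _, h⟩ => h, fun h => ⟨y.2.2, z.2.2, h⟩⟩

open Classical in
/-- The label of a point of a whiskering is the number of new points up to it. -/
theorem lab_wk {s : Ins x} (hs : s.Valid) {q : ℕ} {a : U.Ball × ℕ} (ha : a ∈ pts s.1) :
    (wk hs q).lab a = min (s.nw.filter fun b => b = a ∨ (wk hs 0).rel b a).card q := by
  obtain ⟨z, rfl⟩ := exists_coord ha
  rw [lab_eq _ (show _ ∈ pts (wk hs q).1 from ha)]
  have e : ∀ N : ℕ, (Finset.univ.filter fun y : Points s.1 =>
      IsNew s.2 y ∧ (y = z ∨ (x.2.pull s.2 hs.1).lt y z)).card = N →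
      ((wk hs q).2.W z : ℕ) = min N q := by
    rintro N rfl
    rfl
  refine e _ ?_
  refine Finset.card_bij (fun y _ => coord y) ?_ ?_ ?_
  · intro y hy
    simp only [Finset.mem_filter, Finset.mem_univ, true_and] at hy ⊢
    refine ⟨(isNew_iff hs y).1 hy.1, ?_⟩
    rcases hy.2 with rfl | h
    · exact Or.inl rfl
    · exact Or.inr ((rel_wk_coord hs).2 h)
  · intro y _ y' _ h
    exact coord_injective h
  · intro b hb
    simp only [Finset.mem_filter] at hb
    obtain ⟨y, rfl⟩ := exists_coord (mem_nw.1 hb.1).1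
    refine ⟨y, ?_, rfl⟩
    simp only [Finset.mem_filter, Finset.mem_univ, true_and]
    refine ⟨(isNew_iff hs y).2 hb.1, ?_⟩
    rcases hb.2 with h | h
    · exact Or.inl (coord_injective h)
    · exact Or.inr ((rel_wk_coord hs).1 h)

/-- The lexicographic order on points. -/
def lex (a b : U.Ball × ℕ) : Prop := a.1 < b.1 ∨ (a.1 = b.1 ∧ a.2 < b.2)

/-- The points other than the first ones of the balls. -/
def pos (ℓ : U.Ball → ℕ) : Finset (U.Ball × ℕ) := (pts ℓ).filter fun a => 0 < a.2

open Classical in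
/-- The sign of a whiskering, in coordinates: the inversions between new points `a` and points `b`
behind them in the lexicographic order. -/
theorem whiskerSign_eq {s : Ins x} (hs : s.Valid) :
    x.whiskerSign s.1 s.2 hs.1 = ∑ a ∈ s.nw, ∑ b ∈ pos s.1,
      if lex a b ∧ (b ∉ s.nw ∨ (wk hs 0).rel b a) then 1 else 0 := by
  rw [← Finset.sum_product', ← Finset.card_filter, whiskerSign]
  refine Finset.card_bij (fun y _ => (coord y.1, coord y.2)) ?_ ?_ ?_
  · rintro ⟨y, z⟩ h
    simp only [Finset.mem_filter, Finset.mem_univ, true_and] at h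
    simp only [Finset.mem_filter, Finset.mem_product, pos]
    refine ⟨⟨(isNew_iff hs y).1 h.1, coord_mem z, h.2.1⟩, h.2.2.1, ?_⟩
    exact h.2.2.2.imp (fun h h' => h ((isNew_iff hs z).2 h')) fun h => (rel_wk_coord hs).2 h
  · rintro ⟨y, z⟩ _ ⟨y', z'⟩ _ h
    simp only [Prod.mk.injEq] at h
    rw [coord_injective h.1, coord_injective h.2]
  · rintro ⟨a, b⟩ h
    simp only [Finset.mem_filter, Finset.mem_product, pos] at h
    obtain ⟨⟨h1, h2, h3⟩, h4, h5⟩ := h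
    obtain ⟨y, rfl⟩ := exists_coord (mem_nw.1 h1).1
    obtain ⟨z, rfl⟩ := exists_coord h2
    refine ⟨(y, z), ?_, rfl⟩
    simp only [Finset.mem_filter, Finset.mem_univ, true_and]
    exact ⟨(isNew_iff hs y).2 h1, h3, h4,
      h5.imp (fun h h' => h ((isNew_iff hs z).1 h')) fun h => (rel_wk_coord hs).1 h⟩

theorem rel_wk_ins {s : Ins x} (hs : s.Valid) {z : U.Ball × ℕ} (hz : z ∈ pts s.1) {q q' : ℕ}
    {a b : U.Ball × ℕ} (ha : a ∈ pts (hi s.1 z)) (hb : b ∈ pts (hi s.1 z)) :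
    (wk (valid_ins hs z) q).rel a b ↔
      (wk hs q').rel (smap z a) (smap z b) ∨ (a = z ∧ b = nx z) := by
  have e : ∀ c ∈ pts (hi s.1 z), (s.ins z).pt c = s.pt (smap z c) := fun c hc => by
    simp only [pt, pv_ins hc]
    rfl
  rw [rel_wk (valid_ins hs z) (s := s.ins z) ha hb, rel_wk hs (smap_mem hz ha) (smap_mem hz hb),
    e a ha, e b hb, or_assoc]
  refine or_congr Iff.rfl ?_
  have h1 : (s.pt (smap z a) = s.pt (smap z b) → a.1 = b.1) := fun h =>
    show (s.pt (smap z a)).1 = (s.pt (smap z b)).1 from congrArg Prod.fst h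
  obtain ⟨ν, i⟩ := a
  obtain ⟨ν', j⟩ := b
  obtain ⟨ν'', l⟩ := z
  constructor
  · rintro ⟨h2, h3⟩
    obtain rfl : ν = ν' := h1 h2
    by_cases h4 : (smap (ν'', l) (ν, i)).2 < (smap (ν'', l) (ν, j)).2
    · exact Or.inl ⟨h2, h4⟩
    · refine Or.inr ?_
      simp only [smap, sφ, nx, Prod.mk.injEq] at h3 h4 ⊢
      grind
  · rintro (⟨h2, h3⟩ | ⟨h2, h3⟩)
    · refine ⟨h2, ?_⟩
      obtain rfl : ν = ν' := h1 h2
      simp only [smap, sφ] at h3 ⊢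
      grind
    · rw [h2, h3, smap_self, smap_nx]
      simp [nx]

/-- The number of new points up to a given point, as a function of the family. -/
theorem card_nw_ins {s : Ins x} (hs : s.Valid) {z : U.Ball × ℕ} (hz : z ∈ pts s.1)
    [DecidableRel (wk hs 0).rel] [DecidableRel (wk (valid_ins hs z) 0).rel]
    {a : U.Ball × ℕ} (ha : a ∈ pts (hi s.1 z)) :
    ((s.ins z).nw.filter fun b => b = a ∨ (wk (valid_ins hs z) 0).rel b a).card =
      (s.nw.filter fun b => b = smap z a ∨ (wk hs 0).rel b (smap z a)).card +
        if a = nx z ∨ (wk hs 0).rel z (smap z a) then 1 else 0 := by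
  have hn : nx z ∉ s.nw.image (fmap (nx z)) := by
    simp only [Finset.mem_image, not_exists, not_and]
    exact fun b _ => fmap_ne _ _
  have hzn : z ≠ nx z := fun h => by simpa [nx] using congrArg Prod.snd h
  rw [nw_ins hz, Finset.filter_insert]
  have e1 : (nx z = a ∨ (wk (valid_ins hs z) 0).rel (nx z) a) ↔
      (a = nx z ∨ (wk hs 0).rel z (smap z a)) := by
    rw [rel_wk_ins hs hz (nx_mem_hi hz) ha (q' := 0), smap_nx]
    simp [hzn.symm, eq_comm]
  have e2 : ((s.nw.image (fmap (nx z))).filter fun b =>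
      b = a ∨ (wk (valid_ins hs z) 0).rel b a).card =
      (s.nw.filter fun b => b = smap z a ∨ (wk hs 0).rel b (smap z a)).card := by
    rw [Finset.filter_image, Finset.card_image_of_injective _ (fmap_injective _)]
    congr 1
    refine Finset.filter_congr fun b hb => ?_
    rw [rel_wk_ins hs hz (fmap_nx_mem (mem_nw.1 hb).1) ha (q' := 0), smap_fmap_nx]
    constructor
    · rintro (rfl | h | ⟨h, rfl⟩)
      · exact Or.inl (smap_fmap_nx _ _).symm
      · exact Or.inr h
      · rw [smap_nx]
        exact Or.inl (fmap_injective (nx z) (h.trans (fmap_nx_self z).symm))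
    · rintro (rfl | h)
      · by_cases h' : a = nx z
        · subst h'
          exact Or.inr (Or.inr ⟨by rw [smap_nx, fmap_nx_self], rfl⟩)
        · exact Or.inl (fmap_nx_smap h')
      · exact Or.inr (Or.inl h)
  by_cases h : a = nx z ∨ (wk hs 0).rel z (smap z a)
  · rw [if_pos (e1.2 h), if_pos h, Finset.card_insert_of_notMem
      (fun h' => hn (Finset.mem_filter.1 h').1), e2]
  · rw [if_neg (fun h' => h (e1.1 h')), if_neg h, e2, add_zero]

open Classical in
theorem lab_wk' {s : Ins x} (hs : s.Valid) {q : ℕ} (hq : s.nw.card ≤ q) {a : U.Ball × ℕ}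
    (ha : a ∈ pts s.1) :
    (wk hs q).lab a = (s.nw.filter fun b => b = a ∨ (wk hs 0).rel b a).card := by
  rw [lab_wk hs ha, min_eq_left ((Finset.card_filter_le _ _).trans hq)]

/-- Whiskering along a family with one more insertion is the insertion of a cut. -/
theorem wk_ins {s : Ins x} (hs : s.Valid) {z : U.Ball × ℕ} (hz : z ∈ pts s.1) {q : ℕ}
    (hq : s.nw.card ≤ q) :
    wk (valid_ins hs z) (q + 1) = (wk hs q).ecut z := by
  classical
  have hq' : (s.ins z).nw.card ≤ q + 1 := by
    rw [nw_ins hz]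
    refine (Finset.card_insert_le _ _).trans ?_
    have := Finset.card_image_le (s := s.nw) (f := fmap (nx z))
    omega
  refine ext' rfl (fun a b ha hb hr => ?_) fun a ha => ?_
  · change a ∈ pts (hi s.1 z) at ha
    change b ∈ pts (hi s.1 z) at hb
    rw [rel_wk_ins hs hz ha hb (q' := q)] at hr
    exact (rel_dg (x := wk hs q) hz ha hb).2 hr
  · change a ∈ pts (hi s.1 z) at ha
    rw [lab_wk' (valid_ins hs z) hq' ha, lab_ecut (x := wk hs q) hz ha,
      lab_wk' hs hq (smap_mem hz ha), card_nw_ins hs hz ha]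
    rfl

theorem lex_fmap {z a b : U.Ball × ℕ} : lex (fmap (nx z) a) (fmap (nx z) b) ↔ lex a b := by
  obtain ⟨ν, i⟩ := a
  obtain ⟨ν', j⟩ := b
  obtain ⟨ν'', l⟩ := z
  simp only [lex, fmap, fφ, nx]
  grind

theorem lex_nx_fmap {z a : U.Ball × ℕ} : lex (nx z) (fmap (nx z) a) ↔ lex z a := by
  obtain ⟨ν, i⟩ := a
  obtain ⟨ν'', l⟩ := z
  simp only [lex, fmap, fφ, nx]
  grind

theorem lex_fmap_nx {z a : U.Ball × ℕ} : lex (fmap (nx z) a) (nx z) ↔ ¬ lex z a := by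
  obtain ⟨ν, i⟩ := a
  obtain ⟨ν'', l⟩ := z
  simp only [lex, fmap, fφ, nx]
  grind

theorem pos_hi {ℓ : U.Ball → ℕ} {z : U.Ball × ℕ} (hz : z ∈ pts ℓ) :
    pos (hi ℓ z) = insert (nx z) ((pos ℓ).image (fmap (nx z))) := by
  ext a
  simp only [Finset.mem_insert, Finset.mem_image, pos, Finset.mem_filter]
  have hp : ∀ b : U.Ball × ℕ, 0 < (fmap (nx z) b).2 ↔ 0 < b.2 := by
    rintro ⟨ν, i⟩
    simp only [fmap, fφ, nx]
    grind
  constructor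
  · rintro ⟨h1, h2⟩
    by_cases h : a = nx z
    · exact Or.inl h
    · exact Or.inr ⟨smap z a, ⟨smap_mem hz h1, by rwa [← hp, fmap_nx_smap h]⟩, fmap_nx_smap h⟩
  · rintro (rfl | ⟨b, ⟨h1, h2⟩, rfl⟩)
    · exact ⟨nx_mem_hi hz, Nat.succ_pos _⟩
    · exact ⟨fmap_nx_mem h1, (hp b).2 h2⟩

open Classical in
/-- The elementary intervals behind a point complement those counted by its Koszul sign. -/
theorem sum_pos_lex (ℓ : U.Ball → ℕ) {z : U.Ball × ℕ} (hz : z ∈ pts ℓ) :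
    (∑ b ∈ pos ℓ, if lex z b then 1 else 0) + ex ℓ z = ∑ ν, ℓ ν := by
  have e : ∀ ν, (∑ i ∈ Finset.range (ℓ ν + 1), if 0 < i then if lex z (ν, i) then 1 else 0 else 0) +
      (if ν < z.1 then ℓ ν else 0) + (if ν = z.1 then z.2 else 0) = ℓ ν := by
    intro ν
    have h1 : ∀ i, lex z (ν, i) ↔ z.1 < ν ∨ (z.1 = ν ∧ z.2 < i) := fun i => Iff.rfl
    rw [← Finset.sum_filter, ← Finset.card_filter, Finset.filter_filter]
    simp only [h1]
    rcases lt_trichotomy ν z.1 with h | h | h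
    · simp [h, h.ne, h.ne', h.not_gt]
    · subst h
      simp only [lt_irrefl, false_or, true_and, if_false, if_true, add_zero]
      have : ((Finset.range (ℓ z.1 + 1)).filter fun i => 0 < i ∧ z.2 < i) =
          Finset.Ioc z.2 (ℓ z.1) := by
        ext i
        simp only [Finset.mem_filter, Finset.mem_range, Finset.mem_Ioc]
        omega
      rw [this, Nat.card_Ioc]
      have := mem_pts.1 hz
      omega
    · simp only [h, h.ne', h.not_gt, true_or, and_true, if_false, add_zero]
      have : ((Finset.range (ℓ ν + 1)).filter fun i => 0 < i) = Finset.Ioc 0 (ℓ ν) := by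
        ext i
        simp only [Finset.mem_filter, Finset.mem_range, Finset.mem_Ioc]
        omega
      rw [this, Nat.card_Ioc]
      omega
  rw [pos, Finset.sum_filter, sum_pts]
  have h2 : ex ℓ z = ∑ ν, ((if ν < z.1 then ℓ ν else 0) + if ν = z.1 then z.2 else 0) := by
    rw [Finset.sum_add_distrib, ← Finset.sum_filter, ex]
    simp only [Finset.sum_ite_eq', Finset.mem_univ, if_true]
    congr 2
    ext ν
    simp
  rw [h2, ← Finset.sum_add_distrib]
  refine Finset.sum_congr rfl fun ν _ => ?_
  conv_rhs => rw [← e ν]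
  rw [Finset.sum_range, add_assoc]

/-- The sign of a whiskering, after one more insertion. -/
theorem whiskerSign_ins {s : Ins x} (hs : s.Valid) {z : U.Ball × ℕ} (hz : z ∈ pts s.1) {q : ℕ}
    (hq : s.nw.card = q) :
    x.whiskerSign (s.ins z).1 (s.ins z).2 (valid_ins hs z).1 % 2 =
      (x.whiskerSign s.1 s.2 hs.1 + (x.dim + (wk hs q).lab z) + ex s.1 z) % 2 := by
  classical
  have hzn : z ≠ nx z := fun h => by simpa [nx] using congrArg Prod.snd h
  have hnl : ∀ a : U.Ball × ℕ, ¬ lex a a := fun a => by simp [lex]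
  have hn1 : nx z ∉ s.nw.image (fmap (nx z)) := by
    simp only [Finset.mem_image, not_exists, not_and]
    exact fun b _ => fmap_ne _ _
  have hn2 : nx z ∉ (pos s.1).image (fmap (nx z)) := by
    simp only [Finset.mem_image, not_exists, not_and]
    exact fun b _ => fmap_ne _ _
  have hsub : s.nw ⊆ pos s.1 := fun a ha =>
    Finset.mem_filter.2 ⟨(mem_nw.1 ha).1, (mem_nw.1 ha).2.1⟩
  have hpos : ∀ b ∈ pos s.1, b ∈ pts s.1 := fun b hb => (Finset.mem_filter.1 hb).1
  have hnw : ∀ b, fmap (nx z) b ∈ (s.ins z).nw ↔ b ∈ s.nw := by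
    intro b
    rw [nw_ins hz, Finset.mem_insert, Finset.mem_image]
    refine ⟨?_, fun h => Or.inr ⟨b, h, rfl⟩⟩
    rintro (h | ⟨c, hc, h⟩)
    · exact absurd h (fmap_ne _ _)
    · rwa [← fmap_injective _ h]
  have hr : ∀ a ∈ pts (hi s.1 z), ∀ b ∈ pts (hi s.1 z), ((wk (valid_ins hs z) 0).rel a b ↔
      (wk hs 0).rel (smap z a) (smap z b) ∨ (a = z ∧ b = nx z)) :=
    fun a ha b hb => rel_wk_ins hs hz ha hb
  rw [whiskerSign_eq (valid_ins hs z), whiskerSign_eq hs, ins_fst, pos_hi hz]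
  rw [nw_ins hz, Finset.sum_insert hn1, Finset.sum_insert hn2,
    Finset.sum_image fun a _ b _ h => fmap_injective _ h,
    Finset.sum_image fun a _ b _ h => fmap_injective _ h, ← nw_ins hz]
  have e0 : (if lex (nx z) (nx z) ∧ (nx z ∉ (s.ins z).nw ∨
      (wk (valid_ins hs z) 0).rel (nx z) (nx z)) then 1 else 0) = 0 :=
    if_neg fun h => hnl _ h.1
  -- the inversions of the created point with the points behind it
  have e1 : ∀ b ∈ pos s.1, (if lex (nx z) (fmap (nx z) b) ∧ (fmap (nx z) b ∉ (s.ins z).nw ∨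
      (wk (valid_ins hs z) 0).rel (fmap (nx z) b) (nx z)) then 1 else 0) =
      if lex z b ∧ (b ∉ s.nw ∨ (wk hs 0).rel b z) then 1 else 0 := by
    intro b hb
    have e3 := hr _ (fmap_nx_mem (hpos b hb)) _ (nx_mem_hi hz)
    rw [smap_fmap_nx, smap_nx] at e3
    have : lex z b → ¬ fmap (nx z) b = z := by
      intro h h'
      have : b = z := fmap_injective (nx z) (h'.trans (fmap_nx_self z).symm)
      exact hnl _ (this ▸ h)
    refine if_congr ?_ rfl rfl
    rw [hnw, e3, lex_nx_fmap]
    by_cases h : lex z b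
    · simp [h, this h]
    · simp [h]
  -- the inversions of the other new points: with the created point, and those counted before
  have e2 : ∀ a ∈ s.nw, ∑ b ∈ insert (nx z) ((pos s.1).image (fmap (nx z))),
      (if lex (fmap (nx z) a) b ∧ (b ∉ (s.ins z).nw ∨
        (wk (valid_ins hs z) 0).rel b (fmap (nx z) a)) then 1 else 0) =
      (if ¬ lex z a ∧ (wk hs 0).rel z a then 1 else 0) +
        ∑ b ∈ pos s.1, if lex a b ∧ (b ∉ s.nw ∨ (wk hs 0).rel b a) then 1 else 0 := by
    intro a ha
    have ha' := fmap_nx_mem (z := z) (mem_nw.1 ha).1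
    rw [Finset.sum_insert hn2, Finset.sum_image fun a _ b _ h => fmap_injective _ h]
    congr 1
    · have e3 := hr _ (nx_mem_hi hz) _ ha'
      rw [smap_fmap_nx, smap_nx] at e3
      refine if_congr ?_ rfl rfl
      rw [e3, lex_fmap_nx]
      simp [nx_mem_nw hz, hzn.symm]
    · refine Finset.sum_congr rfl fun b hb => ?_
      have e3 := hr _ (fmap_nx_mem (z := z) (hpos b hb)) _ ha'
      rw [smap_fmap_nx, smap_fmap_nx] at e3
      refine if_congr ?_ rfl rfl
      rw [hnw, e3, lex_fmap]
      simp [fmap_ne]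
  rw [e0, zero_add, Finset.sum_congr rfl e1, Finset.sum_congr rfl e2, Finset.sum_add_distrib]
  -- counting modulo two
  have h1 : (∑ b ∈ pos s.1, if lex z b ∧ (b ∉ s.nw ∨ (wk hs 0).rel b z) then 1 else 0) +
      (∑ a ∈ s.nw, if lex z a ∧ (wk hs 0).rel z a then 1 else 0) =
      ∑ b ∈ pos s.1, if lex z b then 1 else 0 := by
    have e3 : (∑ a ∈ s.nw, if lex z a ∧ (wk hs 0).rel z a then 1 else 0) =
        ∑ a ∈ pos s.1, if a ∈ s.nw then (if lex z a ∧ (wk hs 0).rel z a then 1 else 0) else 0 := by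
      rw [Finset.sum_ite_mem, Finset.inter_eq_right.2 hsub]
    rw [e3, ← Finset.sum_add_distrib]
    refine Finset.sum_congr rfl fun b hb => ?_
    by_cases hl : lex z b
    · have hzb : z ≠ b := fun h => hnl z (by rwa [← h] at hl)
      by_cases hb' : b ∈ s.nw
      · rcases (wk hs 0).rel_total hz (hpos b hb) hzb with h | h
        · simp [hl, hb', h, rel_asymm h]
        · simp [hl, hb', h, rel_asymm h]
      · simp [hl, hb']
    · simp [hl]
  have h2 : (∑ a ∈ s.nw, if ¬ lex z a ∧ (wk hs 0).rel z a then 1 else 0) +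
      (∑ a ∈ s.nw, if lex z a ∧ (wk hs 0).rel z a then 1 else 0) +
      (s.nw.filter fun b => b = z ∨ (wk hs 0).rel b z).card = q := by
    rw [← hq, Finset.card_filter, Finset.card_eq_sum_ones, ← Finset.sum_add_distrib,
      ← Finset.sum_add_distrib]
    refine Finset.sum_congr rfl fun b hb => ?_
    by_cases hzb : b = z
    · subst hzb
      simp [rel_irrefl]
    · rcases (wk hs 0).rel_total (mem_nw.1 hb).1 hz hzb with h | h
      · simp [h, rel_asymm h]
      · by_cases hl : lex z b
        · simp [h, rel_asymm h, hl, hzb]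
        · simp [h, rel_asymm h, hl, hzb]
  have h3 := sum_pos_lex s.1 hz
  have h4 := card_nw hs
  rw [lab_wk' hs hq.le hz]
  simp only [Finset.sum_boole, Nat.cast_id] at *
  omega

end Cell.Ins

/-! ### The recursion of whiskering -/

namespace Cell.Ins

variable {U : TwoDisk} {x : Cell U 0}

open Classical in
/-- The number of new points strictly before a given point. -/
noncomputable def rank {s : Ins x} (hs : s.Valid) (a : U.Ball × ℕ) : ℕ :=
  (s.nw.filter fun b => (wk hs 0).rel b a).card

theorem rank_lt {s : Ins x} (hs : s.Valid) {a b : U.Ball × ℕ} (ha : a ∈ s.nw)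
    (h : (wk hs 0).rel a b) : rank hs a < rank hs b := by
  classical
  exact card_filter_lt_of_rel _ (rel_irrefl _) (fun _ _ _ => rel_trans) ha h

theorem rank_inj {s : Ins x} (hs : s.Valid) {a b : U.Ball × ℕ} (ha : a ∈ s.nw) (hb : b ∈ s.nw)
    (h : rank hs a = rank hs b) : a = b := by
  by_contra hab
  rcases (wk hs 0).rel_total (mem_nw.1 ha).1 (mem_nw.1 hb).1 hab with h' | h'
  · exact absurd (rank_lt hs ha h') (by omega)
  · exact absurd (rank_lt hs hb h') (by omega)

open Classical in
theorem card_eq_rank {s : Ins x} (hs : s.Valid) {a : U.Ball × ℕ} (ha : a ∈ s.nw) :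
    (s.nw.filter fun b => b = a ∨ (wk hs 0).rel b a).card = rank hs a + 1 := by
  have : (s.nw.filter fun b => b = a ∨ (wk hs 0).rel b a) =
      insert a (s.nw.filter fun b => (wk hs 0).rel b a) := by
    ext b
    simp only [Finset.mem_filter, Finset.mem_insert]
    constructor
    · rintro ⟨h, rfl | h'⟩
      · exact Or.inl rfl
      · exact Or.inr ⟨h, h'⟩
    · rintro (rfl | ⟨h, h'⟩)
      · exact ⟨ha, Or.inl rfl⟩
      · exact ⟨h, Or.inr h'⟩
  rw [this, Finset.card_insert_of_notMem (by simp [rel_irrefl]), rank]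

theorem rank_lt_card {s : Ins x} (hs : s.Valid) {a : U.Ball × ℕ} (ha : a ∈ s.nw) :
    rank hs a < s.nw.card := by
  classical
  have h := card_eq_rank hs ha
  have := Finset.card_filter_le s.nw fun b => b = a ∨ (wk hs 0).rel b a
  omega

theorem exists_rank {s : Ins x} (hs : s.Valid) {u : ℕ} (hu : u < s.nw.card) :
    ∃ a ∈ s.nw, rank hs a = u := by
  classical
  have h1 : s.nw.image (rank hs) = Finset.range s.nw.card := by
    refine Finset.eq_of_subset_of_card_le (fun i hi => ?_) ?_
    · obtain ⟨a, ha, rfl⟩ := Finset.mem_image.1 hi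
      exact Finset.mem_range.2 (rank_lt_card hs ha)
    · rw [Finset.card_range, Finset.card_image_of_injOn fun a ha b hb h => rank_inj hs ha hb h]
  have h2 := Finset.mem_range.2 hu
  rw [← h1] at h2
  exact Finset.mem_image.1 h2

/-- The rank of the point created by an insertion is the label of the doubled point. -/
theorem rank_ins {s : Ins x} (hs : s.Valid) {z : U.Ball × ℕ} (hz : z ∈ pts s.1) {q : ℕ}
    (hq : s.nw.card ≤ q) : rank (valid_ins hs z) (nx z) = (wk hs q).lab z := by
  classical
  have h1 := card_eq_rank (valid_ins hs z) (nx_mem_nw hz)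
  have h2 := card_nw_ins hs hz (nx_mem_hi hz)
  rw [smap_nx, if_pos (Or.inl rfl), ← lab_wk' hs hq hz] at h2
  omega

theorem card_nw_ins_eq {s : Ins x} {z : U.Ball × ℕ} (hz : z ∈ pts s.1) :
    (s.ins z).nw.card = s.nw.card + 1 := by
  rw [nw_ins hz, Finset.card_insert_of_notMem, Finset.card_image_of_injective _ (fmap_injective _)]
  simp only [Finset.mem_image, not_exists, not_and]
  exact fun b _ => fmap_ne _ _

/-- Every new point arises by an insertion. -/
theorem exists_ins {t : Ins x} (ht : t.Valid) {w : U.Ball × ℕ} (hw : w ∈ t.nw) :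
    ∃ (s : Ins x) (z : U.Ball × ℕ), s.Valid ∧ z ∈ pts s.1 ∧ s.ins z = t ∧ nx z = w := by
  refine ⟨t.del w, (w.1, w.2 - 1), valid_del ht hw, ?_, ins_del hw, ?_⟩
  · have hw' := mem_nw.1 hw
    have := mem_pts.1 hw'.1
    simp only [mem_pts, del_fst, lo_apply, if_true]
    omega
  · have := (mem_nw.1 hw).2.1
    exact Prod.ext rfl (Nat.sub_add_cancel this)

open Classical in
/-- The families of surjections that insert `q` intervals. -/
noncomputable def fams (x : Cell U 0) (q : ℕ) : Finset {s : Ins x // s.Valid} :=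
  (((Finset.univ : Finset U.Ball).piAntidiag (x.dim + q)).sigma fun _ => Finset.univ).subtype _

theorem mem_fams {q : ℕ} {s : {s : Ins x // s.Valid}} : s ∈ fams x q ↔ s.1.nw.card = q := by
  have := card_nw s.2
  simp only [fams, Finset.mem_subtype, Finset.mem_sigma, Finset.mem_piAntidiag, Finset.mem_univ,
    implies_true, and_true]
  change (∑ ν, s.1.1 ν) = _ ↔ _
  omega

end Cell.Ins

open Cell Cell.Ins

variable {k : Type u} [Field k] {U : TwoDisk}

theorem whiskering_single (x : Cell U 0) (q : ℕ) :
    whiskering k U (Finsupp.single x 1) q = ∑ s ∈ fams x q,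
      (-1 : k) ^ x.whiskerSign s.1.1 s.1.2 s.2.1 • Finsupp.single (wk s.2 q) (1 : k) := by
  classical
  have h1 : whiskering k U (Finsupp.single x 1) q =
      ∑ s ∈ ((Finset.univ : Finset U.Ball).piAntidiag (x.dim + q)).sigma
        (fun ℓ' => (Finset.univ : Finset (∀ ν, Fin (ℓ' ν + 1) → Fin (x.1 ν + 1)))),
        if h : Valid (x := x) s then
          Finsupp.single (wk h q) ((-1 : k) ^ x.whiskerSign s.1 s.2 h.1) else 0 := by
    rw [Finset.sum_sigma]
    simp only [whiskering, LinearMap.pi_apply, Finsupp.linearCombination_single, one_smul]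
    refine Finset.sum_congr rfl fun ℓ' _ => Finset.sum_congr rfl fun p _ => ?_
    by_cases h : Valid (x := x) ⟨ℓ', p⟩
    · rw [dif_pos h]
      exact dif_pos h
    · rw [dif_neg h]
      exact dif_neg h
  rw [h1, fams, ← Finset.sum_subset (Finset.filter_subset (Valid (x := x)) _)]
  · rw [← Finset.sum_subtype_map_embedding (p := Valid (x := x)) (s := Finset.subtype _ _)
      (f := fun s => (-1 : k) ^ x.whiskerSign s.1.1 s.1.2 s.2.1 • Finsupp.single (wk s.2 q) (1 : k))
      (g := fun s : Ins x => if h : Valid (x := x) s then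
          Finsupp.single (wk h q) ((-1 : k) ^ x.whiskerSign s.1 s.2 h.1) else 0)]
    · rw [Finset.subtype_map]
    · rintro ⟨s, hs⟩ _
      rw [dif_pos hs]
      simp
  · intro s hs hs'
    rw [dif_neg]
    exact fun h => hs' (Finset.mem_filter.2 ⟨hs, h⟩)

/-- Whiskering with one more inserted interval: the new intervals are inserted one at a time, the
last one as the `u`-th in the total order. -/
theorem whiskering_single_succ (x : Cell U 0) {q u : ℕ} (hu : u ≤ q) :
    whiskering k U (Finsupp.single x 1) (q + 1) =
      (-1 : k) ^ (x.dim + u) • eop k u (whiskering k U (Finsupp.single x 1) q) := by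
  classical
  rw [whiskering_single, whiskering_single, map_sum, Finset.smul_sum]
  simp only [map_smul, eop_single, Finset.smul_sum, ← Finset.sum_filter, wk_fst]
  rw [Finset.sum_sigma']
  symm
  refine Finset.sum_bij (fun p _ => ⟨p.1.1.ins p.2, valid_ins p.1.2 p.2⟩) ?_ ?_ ?_ ?_
  · rintro ⟨s, z⟩ h
    simp only [Finset.mem_sigma, Finset.mem_filter, mem_fams] at h ⊢
    rw [card_nw_ins_eq h.2.1, h.1]
  · rintro ⟨⟨s, hs⟩, z⟩ h ⟨⟨s', hs'⟩, z'⟩ h' e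
    simp only [Finset.mem_sigma, Finset.mem_filter, mem_fams] at h h' e
    have e1 : s.ins z = s'.ins z' := congrArg Subtype.val e
    have r1 := rank_ins hs h.2.1 h.1.le
    have r2 := rank_ins hs' h'.2.1 h'.1.le
    have key : ∀ {t t' : Ins x} (ht : t.Valid) (ht' : t'.Valid) {a b : U.Ball × ℕ}, t = t' →
        a ∈ t.nw → b ∈ t'.nw → rank ht a = rank ht' b → a = b := by
      rintro t _ ht ht' a b rfl ha hb h
      exact rank_inj ht ha hb h
    have e2 : nx z = nx z' := key (valid_ins hs z) (valid_ins hs' z') e1 (nx_mem_nw h.2.1)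
      (nx_mem_nw h'.2.1) (by rw [r1, r2, h.2.2, h'.2.2])
    have e3 : z = z' := by
      simp only [nx, Prod.mk.injEq, add_left_inj] at e2
      exact Prod.ext e2.1 e2.2
    subst e3
    have e4 : s = s' := by rw [← del_ins (s := s) (z := z), e1, del_ins]
    subst e4
    rfl
  · rintro ⟨t, ht⟩ h
    rw [mem_fams] at h
    obtain ⟨w, hw, hr⟩ := exists_rank ht (u := u) (by simp only at h; omega)
    obtain ⟨s, z, hs, hz, rfl, rfl⟩ := exists_ins ht hw
    have h1 := card_nw_ins_eq hz
    have hc : s.nw.card = q := by simp only at h; omega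
    refine ⟨⟨⟨s, hs⟩, z⟩, ?_, rfl⟩
    simp only [Finset.mem_sigma, Finset.mem_filter, mem_fams]
    exact ⟨hc, hz, (rank_ins hs hz hc.le).symm.trans hr⟩
  · rintro ⟨⟨s, hs⟩, z⟩ h
    simp only [Finset.mem_sigma, Finset.mem_filter, mem_fams] at h
    obtain ⟨h1, h2, h3⟩ := h
    have h4 := whiskerSign_ins hs h2 h1
    rw [h3] at h4
    simp only
    rw [wk_ins hs h2 h1.le, smul_smul, smul_smul, ← pow_add, ← pow_add,
      neg_one_pow_of_mod_eq (b := x.whiskerSign (s.ins z).1 (s.ins z).2 (valid_ins hs z).1)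
        (by omega)]

/-- The only surjections that insert no interval are the identities. -/
theorem whiskering_zero (c : Chains k U 0) : whiskering k U c 0 = c := by
  have : LinearMap.proj 0 ∘ₗ whiskering k U = LinearMap.id := by
    ext x : 2
    simp only [LinearMap.comp_apply, Finsupp.lsingle_apply, LinearMap.proj_apply,
      LinearMap.id_apply]
    let s : Ins x := ⟨x.1, fun ν => id⟩
    have hs : s.Valid := ⟨fun ν => monotone_id, fun ν => Function.surjective_id⟩
    have hpv : ∀ a ∈ pts x.1, s.pv a = a.2 := fun a ha => by
      simp [pv, s, Fin.clamp, mem_pts.1 ha]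
    have hnw : s.nw = ∅ := by
      refine Finset.eq_empty_of_forall_notMem fun a ha => ?_
      obtain ⟨h1, h2, h3⟩ := mem_nw.1 ha
      have h1' := mem_pts.1 h1
      change a.2 ≤ x.1 a.1 at h1'
      rw [hpv a h1, hpv _ (by simp only [mem_pts]; omega)] at h3
      simp only at h3
      omega
    have hf : fams x 0 = {⟨s, hs⟩} := by
      ext ⟨t, ht⟩
      rw [mem_fams, Finset.mem_singleton, Finset.card_eq_zero, Subtype.mk.injEq]
      constructor
      · intro h
        have h1 : ∀ ν, t.1 ν = x.1 ν := fun ν => by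
          have := pv_add_card ht ν (le_refl (t.1 ν))
          rw [pv_last ht] at this
          simp [h] at this
          omega
        refine ext_pv (s := t) (funext h1) fun a ha => ?_
        have := pv_add_card ht a.1 (mem_pts.1 ha)
        simp [h] at this
        rw [hpv a (by rw [mem_pts, ← h1]; exact mem_pts.1 ha)]
        exact this
      · rintro rfl
        exact hnw
    have hsg : x.whiskerSign s.1 s.2 hs.1 = 0 := by
      classical
      rw [whiskerSign_eq hs, hnw, Finset.sum_empty]
    rw [whiskering_single, hf, Finset.sum_singleton, hsg, pow_zero, one_smul]
    congr 1
    refine ext' rfl (fun a b ha hb h => ?_) fun a ha => ?_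
    · have h2 := (rel_wk hs ha hb).1 h
      have e : ∀ c ∈ pts x.1, s.pt c = c := fun c hc => Prod.ext rfl (hpv c hc)
      rw [e a ha, e b hb] at h2
      rcases h2 with h2 | ⟨rfl, h2⟩
      · exact h2
      · omega
    · have h1 := (wk hs 0).lab_le a
      have h2 := x.lab_le a
      omega
  exact LinearMap.congr_fun this c

theorem whiskering_injective : Function.Injective (whiskering k U) := fun c c' h => by
  rw [← whiskering_zero c, ← whiskering_zero c', h]

/-! ### Whiskering and the differential -/

section Whiskering

open Cell Cell.Ins

variable {k : Type u} [Field k] {U : TwoDisk}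

theorem cochainD_of_mem {m p : ℕ} {c : Chains k U m}
    (hc : c ∈ Finsupp.supported k k {x : Cell U m | x.dim = m + p}) :
    cochainD k U m c = ∑ j : Fin (m + 2), (-1 : k) ^ (p + (j : ℕ)) • cof k j c := by
  rw [Finsupp.supported_eq_span_single] at hc
  refine Submodule.span_induction (p := fun c _ => cochainD k U m c =
    ∑ j : Fin (m + 2), (-1 : k) ^ (p + (j : ℕ)) • cof k j c) ?_ ?_ ?_ ?_ hc
  · rintro _ ⟨x, hx, rfl⟩
    rw [cochainD_single]
    refine Finset.sum_congr rfl fun j _ => ?_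
    have : x.dim = m + p := hx
    rw [neg_one_pow_of_mod_eq (b := p + (j : ℕ)) (by omega)]
  · simp
  · intro x y _ _ hx hy
    simp only [map_add, hx, hy, smul_add, Finset.sum_add_distrib]
  · intro a x _ hx
    simp only [map_smul, hx, Finset.smul_sum]
    refine Finset.sum_congr rfl fun j _ => smul_comm _ _ _

/-- The families of degree `-p` each of whose components is obtained from the preceding one by
inserting one more cut, after all others. -/
structure IsWhiskered (p : ℕ) (f : Fam k U) : Prop where
  mem : ∀ m, f m ∈ Finsupp.supported k k {x : Cell U m | x.dim = m + p}
  succ : ∀ m, f (m + 1) = (-1 : k) ^ (p + m) • eop k m (f m)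

theorem mem_eop {m p u : ℕ} {c : Chains k U m}
    (hc : c ∈ Finsupp.supported k k {x : Cell U m | x.dim = m + p}) :
    eop k u c ∈ Finsupp.supported k k {x : Cell U (m + 1) | x.dim = m + 1 + p} := by
  refine eop_mem (fun x hx z _ _ => ?_) hc
  have hx : x.dim = m + p := hx
  change (x.ecut z).dim = _
  rw [dim_ecut, hx]
  omega

theorem IsWhiskered.of_zero {p : ℕ} {f : Fam k U}
    (h0 : f 0 ∈ Finsupp.supported k k {x : Cell U 0 | x.dim = p})
    (hs : ∀ m, f (m + 1) = (-1 : k) ^ (p + m) • eop k m (f m)) : IsWhiskered p f := by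
  refine ⟨fun m => ?_, hs⟩
  induction m with
  | zero => simpa using h0
  | succ m ih =>
    rw [hs]
    exact Submodule.smul_mem _ _ (mem_eop ih)

/-- A whiskered family is determined by its component at `[0]`. -/
theorem IsWhiskered.ext {p : ℕ} {f g : Fam k U} (hf : IsWhiskered p f) (hg : IsWhiskered p g)
    (h : f 0 = g 0) : f = g := by
  funext m
  induction m with
  | zero => exact h
  | succ m ih => rw [hf.succ, hg.succ, ih]

/-- The family generated from a chain by insertions has the boundary generated from the boundary
of the chain: the cofaces are the boundary terms of the insertions. -/
theorem IsWhiskered.dtot_eq {p : ℕ} {f g : Fam k U} (hf : IsWhiskered p f)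
    (hg : ∀ m, g (m + 1) = (-1 : k) ^ (p + 1 + m) • eop k m (g m))
    (h0 : chainD k U 0 (f 0) = g 0) : dtot k U f = g := by
  funext m
  induction m with
  | zero => exact h0
  | succ m ih =>
    have h1 := LinearMap.congr_fun (chainD_eop k (U := U) (le_refl m)) (f m)
    simp only [LinearMap.add_apply, LinearMap.comp_apply, LinearMap.sub_apply] at h1
    rw [← eq_sub_iff_add_eq] at h1
    have h2 : eop k m (chainD k U m (f m)) = eop k m (g m) + (-1 : k) ^ (p + 1 + m) •
        ∑ j : Fin m, (-1 : k) ^ (p + (j : ℕ)) • cof k ⟨j, by omega⟩ (f m) := by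
      rw [← ih]
      cases m with
      | zero => simp
      | succ n =>
        rw [dtot_succ, map_sub, cochainD_of_mem (hf.mem n), Fin.sum_univ_castSucc, map_add,
          map_smul, map_sum, Fin.val_last, show (Fin.last (n + 1)) = ⟨n + 1, by omega⟩ from rfl,
          eop_cof_last, smul_zero, add_zero]
        have e : ∀ j : Fin (n + 1), eop k (n + 1) ((-1 : k) ^ (p + (j.castSucc : ℕ)) •
            cof k j.castSucc (f n)) = (-1 : k) ^ (p + 1 + (n + 1)) •
            (-1 : k) ^ (p + (j : ℕ)) • cof k ⟨j, by omega⟩ (f (n + 1)) := by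
          intro j
          have hj := eop_cof k (U := U) (Nat.lt_succ_iff.1 j.2) (f n)
          rw [map_smul, show j.castSucc = (⟨j, by omega⟩ : Fin (n + 2)) from rfl, hj, hf.succ,
            map_smul, smul_smul, smul_smul, ← pow_add, ← pow_add]
          congr 1
          exact neg_one_pow_of_mod_eq (by simp only; omega)
        simp only [e, Finset.smul_sum]
        abel
    rw [dtot_succ, hf.succ, map_smul, h1, h2, hg, cochainD_of_mem (hf.mem m),
      Fin.sum_univ_castSucc, Fin.sum_univ_castSucc]
    simp only [Fin.val_castSucc, Fin.val_last, smul_sub, smul_add, smul_smul, ← pow_add]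
    rw [neg_one_pow_of_mod_ne (a := p + (m + 1)) (b := p + m) (by omega),
      neg_one_pow_of_mod_eq (a := p + m + (p + 1 + m)) (b := 1) (by omega),
      neg_one_pow_of_mod_ne (a := p + 1 + m) (b := p + m) (by omega)]
    have e1 : (Fin.last (m + 1) : Fin (m + 2)) = ⟨m + 1, by omega⟩ := rfl
    have e2 : ((Fin.last m).castSucc : Fin (m + 2)) = ⟨m, by omega⟩ := rfl
    have e3 : ∀ j : Fin m, (j.castSucc.castSucc : Fin (m + 2)) = ⟨j, by omega⟩ := fun _ => rfl
    simp only [e1, e2, e3, neg_smul, pow_one, one_smul]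
    abel

theorem whiskering_succ {p q u : ℕ} (hu : u ≤ q) {c : Chains k U 0}
    (hc : c ∈ Finsupp.supported k k {x : Cell U 0 | x.dim = p}) :
    whiskering k U c (q + 1) = (-1 : k) ^ (p + u) • eop k u (whiskering k U c q) := by
  rw [Finsupp.supported_eq_span_single] at hc
  refine Submodule.span_induction (p := fun c _ => whiskering k U c (q + 1) =
    (-1 : k) ^ (p + u) • eop k u (whiskering k U c q)) ?_ ?_ ?_ ?_ hc
  · rintro _ ⟨x, hx, rfl⟩
    have hx : x.dim = p := hx
    rw [whiskering_single_succ x hu, hx]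
  · simp
  · intro x y _ _ hx hy
    simp only [map_add, Pi.add_apply, hx, hy, smul_add]
  · intro a x _ hx
    simp only [map_smul, Pi.smul_apply, hx]
    exact smul_comm _ _ _

theorem isWhiskered_whiskering {p : ℕ} {c : Chains k U 0}
    (hc : c ∈ Finsupp.supported k k {x : Cell U 0 | x.dim = p}) :
    IsWhiskered p (whiskering k U c) :=
  .of_zero (by rwa [whiskering_zero]) fun _ => whiskering_succ le_rfl hc

theorem dtot_whiskering (c : Chains k U 0) :
    dtot k U (whiskering k U c) = whiskering k U (chainD k U 0 c) := by
  have : dtot k U ∘ₗ whiskering k U = whiskering k U ∘ₗ chainD k U 0 := by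
    ext x : 2
    simp only [LinearMap.comp_apply, Finsupp.lsingle_apply]
    have hx : Finsupp.single x (1 : k) ∈ Finsupp.supported k k {y : Cell U 0 | y.dim = x.dim} :=
      Finsupp.single_mem_supported _ _ rfl
    have hd : chainD k U 0 (Finsupp.single x 1) ∈
        Finsupp.supported k k {y : Cell U 0 | y.dim + 1 = x.dim} := by
      refine chainD_mem (fun y hy w _ h => ?_) hx
      exact (dim_fc h).trans hy
    refine (isWhiskered_whiskering hx).dtot_eq (fun m => ?_) ?_
    · by_cases h : x.dim = 0
      · have : chainD k U 0 (Finsupp.single x (1 : k)) = 0 := by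
          rw [Finsupp.mem_supported] at hd
          refine Finsupp.support_eq_empty.1 (Finset.eq_empty_of_forall_notMem fun y hy => ?_)
          have : y.dim + 1 = x.dim := hd hy
          omega
        simp [this]
      · rw [whiskering_succ (p := x.dim - 1) (le_refl m),
          neg_one_pow_of_mod_eq (a := x.dim - 1 + m) (b := x.dim + 1 + m) (by omega)]
        refine Finsupp.supported_mono (fun y hy => ?_) hd
        have hy : y.dim + 1 = x.dim := hy
        change y.dim = x.dim - 1
        omega
    · rw [whiskering_zero, whiskering_zero]
  exact LinearMap.congr_fun this c

theorem whiskering_mem {n : ℤ} {c : Chains k U 0}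
    (hc : c ∈ Finsupp.supported k k {x : Cell U 0 | -(x.dim : ℤ) = n}) :
    whiskering k U c ∈ degS k U n := by
  rw [Finsupp.supported_eq_span_single] at hc
  refine Submodule.span_le.2 ?_ (Submodule.mem_map_of_mem (f := whiskering k U) hc |> fun h => by
    rw [Submodule.map_span] at h; exact h)
  rintro _ ⟨_, ⟨x, hx, rfl⟩, rfl⟩
  have hx : -(x.dim : ℤ) = n := hx
  refine mem_degS.2 fun m => ?_
  have h := (isWhiskered_whiskering (k := k) (Finsupp.single_mem_supported k 1
    (show x ∈ {y : Cell U 0 | y.dim = x.dim} from rfl))).mem m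
  refine Finsupp.supported_mono (fun y hy => ?_) h
  have hy : y.dim = m + x.dim := hy
  simp only [Set.mem_ofPred_eq]
  omega

end Whiskering

/-! ### Composition of cells in coordinates -/

namespace TwoDisk.Fibration

variable {U V : TwoDisk} {P : Hom U V} {T : V.Ball → TwoDisk} (F : Fibration P T)

/-- A ball of a fibre, as a ball of the total disk. -/
def glob (μ : V.Ball) (b : (T μ).Ball) : U.Ball := F.e μ b

@[simp] theorem map_glob (μ : V.Ball) (b : (T μ).Ball) : P (F.glob μ b) = μ := (F.e μ b).2

@[simp] theorem glob_loc (ν : U.Ball) : F.glob (P ν) (F.loc ν) = ν := by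
  simp [glob, loc]

theorem apply_loc_glob {X : Type*} (φ : ∀ μ, (T μ).Ball → X) (μ : V.Ball) (b : (T μ).Ball) :
    φ (P (F.glob μ b)) (F.loc (F.glob μ b)) = φ μ b := by
  have key : ∀ (ν : U.Ball) (μ' : V.Ball) (h : P ν = μ'),
      φ (P ν) (F.loc ν) = φ μ' ((F.e μ').symm ⟨ν, h⟩) := by
    rintro ν _ rfl
    rfl
  rw [key _ μ (F.map_glob μ b)]
  congr 1
  exact (F.e μ).symm_apply_apply b

theorem glob_inj {μ : V.Ball} {b b' : (T μ).Ball} : F.glob μ b = F.glob μ b' ↔ b = b' :=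
  ⟨fun h => (F.e μ).injective (Subtype.ext h), fun h => h ▸ rfl⟩

theorem glob_le {μ : V.Ball} {b b' : (T μ).Ball} : F.glob μ b ≤ F.glob μ b' ↔ b ≤ b' :=
  (F.le_iff μ b b').symm

theorem glob_lt {μ : V.Ball} {b b' : (T μ).Ball} : F.glob μ b < F.glob μ b' ↔ b < b' := by
  rw [← not_le, ← not_le, glob_le]

theorem glob_ne {μ μ' : V.Ball} (h : μ ≠ μ') (b : (T μ).Ball) (b' : (T μ').Ball) :
    F.glob μ b ≠ F.glob μ' b' := fun h' => h (by rw [← F.map_glob μ b, h', F.map_glob])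

theorem sum_glob {M : Type*} [AddCommMonoid M] (f : U.Ball → M) :
    ∑ ν, f ν = ∑ μ, ∑ b, f (F.glob μ b) := by
  exact (Fintype.sum_equiv ((Equiv.sigmaCongrRight F.e).trans (Equiv.sigmaFiberEquiv P))
    (fun p => f (F.glob p.1 p.2)) f fun p => rfl).symm.trans (Fintype.sum_sigma _)

/-- A point of a fibre, as a point of the total disk. -/
def gp (μ : V.Ball) (c : (T μ).Ball × ℕ) : U.Ball × ℕ := (F.glob μ c.1, c.2)

theorem exists_gp (a : U.Ball × ℕ) : ∃ μ c, F.gp μ c = a :=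
  ⟨P a.1, (F.loc a.1, a.2), by simp [gp]⟩

theorem gp_inj {μ : V.Ball} {c c' : (T μ).Ball × ℕ} : F.gp μ c = F.gp μ c' ↔ c = c' := by
  simp only [gp, F.glob_inj, Prod.ext_iff]

theorem gp_ne {μ μ' : V.Ball} (h : μ ≠ μ') (c : (T μ).Ball × ℕ) (c' : (T μ').Ball × ℕ) :
    F.gp μ c ≠ F.gp μ' c' := fun h' => F.glob_ne h _ _ (congrArg Prod.fst h')

theorem gp_nx (μ : V.Ball) (c : (T μ).Ball × ℕ) : F.gp μ (Cell.nx c) = Cell.nx (F.gp μ c) := rfl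

theorem fmap_gp {μ : V.Ball} (c c' : (T μ).Ball × ℕ) :
    Cell.fmap (F.gp μ c) (F.gp μ c') = F.gp μ (Cell.fmap c c') := by
  simp only [Cell.fmap, gp, Cell.fφ, F.glob_inj]

theorem fmap_gp_of_ne {μ μ' : V.Ball} (h : μ' ≠ μ) (c : (T μ).Ball × ℕ) (c' : (T μ').Ball × ℕ) :
    Cell.fmap (F.gp μ c) (F.gp μ' c') = F.gp μ' c' := by
  simp only [Cell.fmap, gp, Cell.fφ, F.glob_ne h, false_and, if_false]

theorem smap_gp {μ : V.Ball} (c c' : (T μ).Ball × ℕ) :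
    Cell.smap (F.gp μ c) (F.gp μ c') = F.gp μ (Cell.smap c c') := by
  simp only [Cell.smap, gp, Cell.sφ, F.glob_inj]

theorem smap_gp_of_ne {μ μ' : V.Ball} (h : μ' ≠ μ) (c : (T μ).Ball × ℕ) (c' : (T μ').Ball × ℕ) :
    Cell.smap (F.gp μ c) (F.gp μ' c') = F.gp μ' c' := by
  simp only [Cell.smap, gp, Cell.sφ, F.glob_ne h, false_and, if_false]

theorem lo_glob (ℓ : U.Ball → ℕ) {μ : V.Ball} (c : (T μ).Ball × ℕ) (b : (T μ).Ball) :
    Cell.lo ℓ (F.gp μ c) (F.glob μ b) = Cell.lo (fun b => ℓ (F.glob μ b)) c b := by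
  simp only [Cell.lo_apply, gp, F.glob_inj]

theorem lo_glob_of_ne (ℓ : U.Ball → ℕ) {μ μ' : V.Ball} (h : μ' ≠ μ) (c : (T μ).Ball × ℕ)
    (b : (T μ').Ball) : Cell.lo ℓ (F.gp μ c) (F.glob μ' b) = ℓ (F.glob μ' b) := by
  simp only [Cell.lo_apply, gp, F.glob_ne h, if_false]

theorem hi_glob (ℓ : U.Ball → ℕ) {μ : V.Ball} (c : (T μ).Ball × ℕ) (b : (T μ).Ball) :
    Cell.hi ℓ (F.gp μ c) (F.glob μ b) = Cell.hi (fun b => ℓ (F.glob μ b)) c b := by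
  simp only [Cell.hi_apply, gp, F.glob_inj]

theorem hi_glob_of_ne (ℓ : U.Ball → ℕ) {μ μ' : V.Ball} (h : μ' ≠ μ) (c : (T μ).Ball × ℕ)
    (b : (T μ').Ball) : Cell.hi ℓ (F.gp μ c) (F.glob μ' b) = ℓ (F.glob μ' b) := by
  simp only [Cell.hi_apply, gp, F.glob_ne h, if_false]

end TwoDisk.Fibration

/-- A cell with an arbitrary output ordinal. -/
abbrev ACell (U : TwoDisk) : Type := Σ m : ℕ, Cell U m

namespace Cell

variable {U V : TwoDisk} {P : Hom U V} {T : V.Ball → TwoDisk} {F : Fibration P T} {K : ℕ}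

/-- The relation saying that `γ` is the composite of `β` with the cells `α μ`, in coordinates. -/
structure IsComp (F : Fibration P T) (β : Cell V K) (α : ∀ μ, ACell (T μ)) (γ : Cell U K) :
    Prop where
  idx : ∀ μ, (α μ).1 = β.1 μ
  len : ∀ μ b, γ.1 (F.glob μ b) = (α μ).2.1 b
  rel_same : ∀ μ c c', c ∈ pts (α μ).2.1 → c' ∈ pts (α μ).2.1 →
    (γ.rel (F.gp μ c) (F.gp μ c') ↔ (α μ).2.rel c c')
  rel_ne : ∀ μ μ' c c', μ ≠ μ' → c ∈ pts (α μ).2.1 → c' ∈ pts (α μ').2.1 →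
    (γ.rel (F.gp μ c) (F.gp μ' c') ↔ β.rel (μ, (α μ).2.lab c) (μ', (α μ').2.lab c'))
  lab : ∀ μ c, c ∈ pts (α μ).2.1 → γ.lab (F.gp μ c) = β.lab (μ, (α μ).2.lab c)

namespace IsComp

variable {β : Cell V K} {α : ∀ μ, ACell (T μ)} {γ : Cell U K}

theorem mem_iff (h : IsComp F β α γ) {μ : V.Ball} {c : (T μ).Ball × ℕ} :
    F.gp μ c ∈ pts γ.1 ↔ c ∈ pts (α μ).2.1 := by
  simp only [mem_pts, Fibration.gp, h.len]

theorem lab_mem (h : IsComp F β α γ) {μ : V.Ball} (c : (T μ).Ball × ℕ) :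
    (μ, (α μ).2.lab c) ∈ pts β.1 := by
  have := (α μ).2.lab_le c
  simpa [h.idx] using this

theorem unique (h : IsComp F β α γ) {γ' : Cell U K} (h' : IsComp F β α γ') : γ = γ' := by
  refine ext' ?_ (fun a b ha hb hr => ?_) fun a ha => ?_
  · funext ν
    rw [← F.glob_loc ν, h.len, h'.len]
  · obtain ⟨μ, c, rfl⟩ := F.exists_gp a
    obtain ⟨μ', c', rfl⟩ := F.exists_gp b
    rw [h.mem_iff] at ha hb
    rcases eq_or_ne μ μ' with rfl | hne
    · rw [h.rel_same _ _ _ ha hb] at hr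
      rwa [h'.rel_same _ _ _ ha hb]
    · rw [h.rel_ne _ _ _ _ hne ha hb] at hr
      rwa [h'.rel_ne _ _ _ _ hne ha hb]
  · obtain ⟨μ, c, rfl⟩ := F.exists_gp a
    rw [h.mem_iff] at ha
    rw [h.lab _ _ ha, h'.lab _ _ ha]

theorem sum_pts (h : IsComp F β α γ) {M : Type*} [AddCommMonoid M] (f : U.Ball × ℕ → M) :
    ∑ z ∈ pts γ.1, f z = ∑ μ, ∑ c ∈ pts (α μ).2.1, f (F.gp μ c) := by
  rw [_root_.sum_pts, F.sum_glob]
  refine Finset.sum_congr rfl fun μ _ => ?_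
  rw [_root_.sum_pts]
  refine Finset.sum_congr rfl fun b _ => ?_
  rw [← Finset.sum_range (fun i => f (F.glob μ b, i)),
    ← Finset.sum_range (fun i => f (F.gp μ (b, i))), h.len]
  rfl

theorem dim_eq (h : IsComp F β α γ) : γ.dim = ∑ μ, (α μ).2.dim := by
  rw [dim, F.sum_glob]
  exact Finset.sum_congr rfl fun μ _ => Finset.sum_congr rfl fun b _ => h.len μ b

end IsComp

theorem locate_gp (ℓ : ∀ μ, (T μ).Ball → ℕ) {μ : V.Ball} {c : (T μ).Ball × ℕ} (hc : c ∈ pts (ℓ μ))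
    (hi : c.2 < ℓ (P (F.glob μ c.1)) (F.loc (F.glob μ c.1)) + 1) :
    TSeq.locate F ℓ ⟨F.glob μ c.1, ⟨c.2, hi⟩⟩ =
      ⟨μ, ⟨c.1, ⟨c.2, Nat.lt_succ_iff.2 (mem_pts.1 hc)⟩⟩⟩ := by
  obtain ⟨b, hb, h⟩ := TSeq.locate_of_mem F ℓ (F.glob μ c.1) (F.map_glob μ c.1)
  obtain rfl : b = c.1 := F.glob_inj.1 hb
  obtain ⟨i', hi', h'⟩ := h ⟨c.2, hi⟩
  rw [h']
  congr 2
  exact Fin.ext hi'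

theorem isComp_comp (F : Fibration P T) (β : Cell V K) (α : ∀ μ, Cell (T μ) (β.1 μ)) :
    IsComp F β (fun μ => ⟨β.1 μ, α μ⟩) (Cell.comp F β α) := by
  have len : ∀ μ b, (Cell.comp F β α).1 (F.glob μ b) = (α μ).1 b := fun μ b =>
    F.apply_loc_glob (fun μ b => (α μ).1 b) μ b
  have hlt : ∀ {μ : V.Ball} {c : (T μ).Ball × ℕ}, c ∈ pts (α μ).1 →
      c.2 < (Cell.comp F β α).1 (F.glob μ c.1) + 1 := fun {μ c} hc => by
    rw [len]; exact Nat.lt_succ_iff.2 (mem_pts.1 hc)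
  have hout : ∀ {μ : V.Ball} {c : (T μ).Ball × ℕ} (hc : c ∈ pts (α μ).1),
      TSeq.toOuter (fun μ => (α μ).2)
        (TSeq.locate F (fun μ => (α μ).1) ⟨F.glob μ c.1, ⟨c.2, hlt hc⟩⟩) =
      ⟨μ, ⟨(α μ).lab c, Nat.lt_succ_iff.2 ((α μ).lab_le c)⟩⟩ := by
    intro μ c hc
    rw [locate_gp (F := F) (fun μ => (α μ).1) hc (hlt hc)]
    simp only [TSeq.toOuter]
    congr 1
    exact Fin.ext ((α μ).lab_eq hc).symm
  have hrel : ∀ {μ μ' : V.Ball} {c : (T μ).Ball × ℕ} {c' : (T μ').Ball × ℕ}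
      (_ : c ∈ pts (α μ).1) (_ : c' ∈ pts (α μ').1),
      β.rel (μ, (α μ).lab c) (μ', (α μ').lab c') → (Cell.comp F β α).rel (F.gp μ c) (F.gp μ' c') := by
    rintro μ μ' c c' hc hc' ⟨_, _, h⟩
    refine ⟨hlt hc, hlt hc', Or.inl ?_⟩
    change β.2.lt (TSeq.toOuter _ (TSeq.locate F (fun μ => (α μ).1) ⟨F.glob μ c.1, ⟨c.2, hlt hc⟩⟩))
      (TSeq.toOuter _ (TSeq.locate F (fun μ => (α μ).1) ⟨F.glob μ' c'.1, ⟨c'.2, hlt hc'⟩⟩))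
    rw [hout hc, hout hc']
    exact h
  have hrel' : ∀ {μ : V.Ball} {c c' : (T μ).Ball × ℕ}
      (_ : c ∈ pts (α μ).1) (_ : c' ∈ pts (α μ).1), (α μ).rel c c' →
      (Cell.comp F β α).rel (F.gp μ c) (F.gp μ c') := by
    rintro μ c c' hc hc' h
    rcases (lab_mono h).lt_or_eq with h1 | h1
    · exact hrel hc hc' (β.rel_index h1 ((α μ).lab_le c'))
    · obtain ⟨_, _, h⟩ := h
      refine ⟨hlt hc, hlt hc', Or.inr ⟨μ, _, _, locate_gp (F := F) (fun μ => (α μ).1) hc (hlt hc),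
        locate_gp (F := F) (fun μ => (α μ).1) hc' (hlt hc'), ?_, h⟩⟩
      rw [lab_eq _ hc, lab_eq _ hc'] at h1
      exact Fin.ext h1
  refine ⟨fun μ => rfl, len, fun μ c c' hc hc' => ⟨fun h => ?_, hrel' hc hc'⟩,
    fun μ μ' c c' hne hc hc' => ⟨fun h => ?_, hrel hc hc'⟩, fun μ c hc => ?_⟩
  · by_contra hn
    rcases eq_or_ne c c' with rfl | hcc
    · exact rel_irrefl _ _ h
    · exact rel_asymm h (hrel' hc' hc (((α μ).rel_total hc hc' hcc).resolve_left hn))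
  · by_contra hn
    have hm : ∀ μ (c : (T μ).Ball × ℕ), (μ, (α μ).lab c) ∈ pts β.1 := fun μ c => by
      simpa using (α μ).lab_le c
    exact rel_asymm h (hrel hc' hc ((β.rel_total (hm _ _) (hm _ _)
      (fun h => hne (congrArg Prod.fst h))).resolve_left hn))
  · have hc2 : F.gp μ c ∈ pts (Cell.comp F β α).1 := by
      simp only [mem_pts, Fibration.gp]
      exact Nat.lt_succ_iff.1 (hlt hc)
    rw [lab_eq _ hc2, lab_eq _ (show (μ, (α μ).lab c) ∈ pts β.1 by simpa using (α μ).lab_le c)]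
    change ((β.2.W (TSeq.toOuter _ (TSeq.locate F (fun μ => (α μ).1)
      ⟨F.glob μ c.1, ⟨c.2, hlt hc⟩⟩)) : Fin (K + 1)) : ℕ) = _
    rw [hout hc]

theorem exists_isComp (F : Fibration P T) {β : Cell V K} {α : ∀ μ, ACell (T μ)}
    (h : ∀ μ, (α μ).1 = β.1 μ) : ∃ γ, IsComp F β α γ := by
  have : ∀ μ, ∃ A : Cell (T μ) (β.1 μ), α μ = ⟨β.1 μ, A⟩ := by
    intro μ
    have := h μ
    generalize α μ = A at this ⊢
    obtain ⟨m, A⟩ := A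
    obtain rfl : m = β.1 μ := this
    exact ⟨A, rfl⟩
  choose α' h' using this
  rw [funext h']
  exact ⟨_, isComp_comp F β α'⟩

namespace IsComp

variable {β : Cell V K} {α : ∀ μ, ACell (T μ)} {γ : Cell U K}

/-- To recognise a composite it suffices to check one direction of the orders. -/
theorem of_imp (idx : ∀ μ, (α μ).1 = β.1 μ) (len : ∀ μ b, γ.1 (F.glob μ b) = (α μ).2.1 b)
    (rel_same : ∀ μ c c', c ∈ pts (α μ).2.1 → c' ∈ pts (α μ).2.1 → (α μ).2.rel c c' →
      γ.rel (F.gp μ c) (F.gp μ c'))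
    (rel_ne : ∀ μ μ' c c', μ ≠ μ' → c ∈ pts (α μ).2.1 → c' ∈ pts (α μ').2.1 →
      β.rel (μ, (α μ).2.lab c) (μ', (α μ').2.lab c') → γ.rel (F.gp μ c) (F.gp μ' c'))
    (lab : ∀ μ c, c ∈ pts (α μ).2.1 → γ.lab (F.gp μ c) = β.lab (μ, (α μ).2.lab c)) :
    IsComp F β α γ := by
  refine ⟨idx, len, fun μ c c' hc hc' => ⟨fun h => ?_, rel_same _ _ _ hc hc'⟩,
    fun μ μ' c c' hne hc hc' => ⟨fun h => ?_, rel_ne _ _ _ _ hne hc hc'⟩, lab⟩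
  · by_contra hn
    rcases eq_or_ne c c' with rfl | hcc
    · exact rel_irrefl _ _ h
    · exact rel_asymm h
        (rel_same _ _ _ hc' hc (((α μ).2.rel_total hc hc' hcc).resolve_left hn))
  · by_contra hn
    have hm : ∀ μ (c : (T μ).Ball × ℕ), (μ, (α μ).2.lab c) ∈ pts β.1 := fun μ c => by
      have := (α μ).2.lab_le c
      simpa [idx] using this
    exact rel_asymm h (rel_ne _ _ _ _ hne.symm hc' hc ((β.rel_total (hm _ _) (hm _ _)
      (fun h => hne (congrArg Prod.fst h))).resolve_left hn))

theorem coface (h : IsComp F β α γ) (j : Fin (K + 2)) :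
    IsComp F (β.coface j) α (γ.coface j) :=
  ⟨h.idx, h.len, h.rel_same, h.rel_ne, fun μ c hc => by
    rw [lab_coface (h.mem_iff.2 hc), lab_coface (h.lab_mem c), h.lab _ _ hc]⟩

/-- A face of an inner cell induces a face of the composite. -/
theorem fc (h : IsComp F β α γ) {μ : V.Ball} {c : (T μ).Ball × ℕ}
    (hc1 : 1 ≤ (α μ).2.1 c.1) :
    IsComp F β (Function.update α μ ⟨(α μ).1, (α μ).2.fc c⟩) (γ.fc (F.gp μ c)) := by
  have hg1 : 1 ≤ γ.1 (F.gp μ c).1 := by rw [Fibration.gp, h.len]; exact hc1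
  have len : ∀ μ' b, (γ.fc (F.gp μ c)).1 (F.glob μ' b) =
      (Function.update α μ ⟨(α μ).1, (α μ).2.fc c⟩ μ').2.1 b := by
    intro μ' b
    rw [fc_fst]
    rcases eq_or_ne μ' μ with rfl | hne
    · rw [F.lo_glob, Function.update_self]
      simp only [h.len]
      rfl
    · rw [F.lo_glob_of_ne _ hne, Function.update_of_ne hne, h.len]
  -- the inner cells and their points, before and after the face
  have key : ∀ μ' (c' : (T μ').Ball × ℕ),
      c' ∈ pts (Function.update α μ ⟨(α μ).1, (α μ).2.fc c⟩ μ').2.1 →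
      ∃ e ∈ pts (α μ').2.1, fmap (F.gp μ c) (F.gp μ' c') = F.gp μ' e ∧
        (Function.update α μ ⟨(α μ).1, (α μ).2.fc c⟩ μ').2.lab c' = (α μ').2.lab e ∧
        F.gp μ' c' ∈ pts (lo γ.1 (F.gp μ c)) := by
    intro μ' c' hc'
    have hm : F.gp μ' c' ∈ pts (γ.fc (F.gp μ c)).1 := by
      refine mem_pts.2 ?_
      change c'.2 ≤ (γ.fc (F.gp μ c)).1 (F.glob μ' c'.1)
      rw [len]
      exact mem_pts.1 hc'
    rcases eq_or_ne μ' μ with rfl | hne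
    · rw [Function.update_self] at hc' ⊢
      exact ⟨fmap c c', fmap_mem hc1 hc', F.fmap_gp _ _, lab_fc hc1 hc', hm⟩
    · rw [Function.update_of_ne hne] at hc' ⊢
      exact ⟨c', hc', F.fmap_gp_of_ne hne _ _, rfl, hm⟩
  refine of_imp (fun μ' => ?_) len ?_ ?_ ?_
  · rcases eq_or_ne μ' μ with rfl | hne
    · rw [Function.update_self]; exact h.idx _
    · rw [Function.update_of_ne hne]; exact h.idx _
  · intro μ' c' c'' hc' hc'' hr
    obtain ⟨e', he', h1, h2, h3⟩ := key _ _ hc'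
    obtain ⟨e'', he'', h1', h2', h3'⟩ := key _ _ hc''
    rw [rel_fc hg1 h3 h3', h1, h1', h.rel_same _ _ _ he' he'']
    rcases eq_or_ne μ' μ with rfl | hne
    · rw [Function.update_self] at hr hc' hc''
      rw [rel_fc hc1 hc' hc''] at hr
      rw [F.fmap_gp, F.gp_inj] at h1 h1'
      rwa [← h1, ← h1']
    · rw [Function.update_of_ne hne] at hr
      rw [F.fmap_gp_of_ne hne, F.gp_inj] at h1 h1'
      rwa [← h1, ← h1']
  · intro μ' μ'' c' c'' hne hc' hc'' hr
    obtain ⟨e', he', h1, h2, h3⟩ := key _ _ hc'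
    obtain ⟨e'', he'', h1', h2', h3'⟩ := key _ _ hc''
    rwa [rel_fc hg1 h3 h3', h1, h1', h.rel_ne _ _ _ _ hne he' he'', ← h2, ← h2']
  · intro μ' c' hc'
    obtain ⟨e', he', h1, h2, h3⟩ := key _ _ hc'
    rw [lab_fc hg1 h3, h1, h2, h.lab _ _ he']

/-- A coface of an inner cell is traded for a face of the outer cell. -/
theorem fc_outer {μ : V.Ball} {m : ℕ} {A : Cell (T μ) m} {j : Fin (m + 2)}
    (h : IsComp F β (Function.update α μ ⟨m + 1, A.coface j⟩) γ) :
    IsComp F (β.fc (μ, j)) (Function.update α μ ⟨m, A⟩) γ := by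
  have hJ : m + 1 = β.1 μ := by
    have := h.idx μ
    rwa [Function.update_self] at this
  have h1 : 1 ≤ β.1 (μ, (j : ℕ)).1 := by simp only; omega
  have idx : ∀ μ', (Function.update α μ ⟨m, A⟩ μ').1 = (β.fc (μ, j)).1 μ' := by
    intro μ'
    rw [fc_fst, lo_apply]
    rcases eq_or_ne μ' μ with rfl | hne
    · rw [Function.update_self, if_pos rfl]
      simp only
      omega
    · have := h.idx μ'
      rw [Function.update_of_ne hne] at this ⊢
      rwa [if_neg hne]
  have key : ∀ μ' (c : (T μ').Ball × ℕ), c ∈ pts (Function.update α μ ⟨m, A⟩ μ').2.1 →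
      c ∈ pts (Function.update α μ ⟨m + 1, A.coface j⟩ μ').2.1 ∧
      fmap (μ, (j : ℕ)) (μ', (Function.update α μ ⟨m, A⟩ μ').2.lab c) =
        (μ', (Function.update α μ ⟨m + 1, A.coface j⟩ μ').2.lab c) ∧
      (μ', (Function.update α μ ⟨m, A⟩ μ').2.lab c) ∈ pts (lo β.1 (μ, j)) := by
    intro μ' c hc
    have h2 : (μ', (Function.update α μ ⟨m, A⟩ μ').2.lab c) ∈ pts (lo β.1 (μ, j)) := by
      have := (Function.update α μ ⟨m, A⟩ μ').2.lab_le c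
      exact mem_pts.2 (this.trans (idx μ').le)
    refine ⟨?_, ?_, h2⟩
    · rcases eq_or_ne μ' μ with rfl | hne
      · rw [Function.update_self] at hc ⊢
        exact hc
      · rwa [Function.update_of_ne hne] at hc ⊢
    · rcases eq_or_ne μ' μ with rfl | hne
      · rw [Function.update_self] at hc ⊢
        rw [Function.update_self]
        simp only [lab_coface hc, fmap, fφ, true_and]
        split_ifs <;> first | rfl | omega
      · rw [Function.update_of_ne hne, Function.update_of_ne hne]
        simp [fmap, fφ, hne]
  refine of_imp idx (fun μ' b => ?_) ?_ ?_ ?_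
  · rw [h.len]
    rcases eq_or_ne μ' μ with rfl | hne
    · rw [Function.update_self, Function.update_self]
      rfl
    · rw [Function.update_of_ne hne, Function.update_of_ne hne]
  · intro μ' c c' hc hc' hr
    rw [h.rel_same _ _ _ (key _ _ hc).1 (key _ _ hc').1]
    rcases eq_or_ne μ' μ with rfl | hne
    · rw [Function.update_self] at hr ⊢
      exact hr
    · rwa [Function.update_of_ne hne] at hr ⊢
  · intro μ' μ'' c c' hne hc hc' hr
    obtain ⟨k1, k2, k3⟩ := key _ _ hc
    obtain ⟨k1', k2', k3'⟩ := key _ _ hc'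
    rwa [rel_fc h1 k3 k3', k2, k2', ← h.rel_ne _ _ _ _ hne k1 k1'] at hr
  · intro μ' c hc
    obtain ⟨k1, k2, k3⟩ := key _ _ hc
    rw [lab_fc h1 k3, k2, h.lab _ _ k1]

end IsComp

end Cell

/-! ### Degeneracies and insertions of composites -/

namespace Cell

namespace IsComp

variable {U V : TwoDisk} {P : Hom U V} {T : V.Ball → TwoDisk} {F : Fibration P T} {K : ℕ}
variable {β : Cell V K} {α : ∀ μ, ACell (T μ)} {γ : Cell U K}

theorem len_hi (h : IsComp F β α γ) {μ : V.Ball} {c : (T μ).Ball × ℕ} {A : ACell (T μ)}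
    (hA : A.2.1 = hi (α μ).2.1 c) (μ' : V.Ball) (b : (T μ').Ball) :
    hi γ.1 (F.gp μ c) (F.glob μ' b) = (Function.update α μ A μ').2.1 b := by
  rcases eq_or_ne μ' μ with rfl | hne
  · rw [F.hi_glob, Function.update_self, hA]
    simp only [h.len]
  · rw [F.hi_glob_of_ne _ hne, Function.update_of_ne hne, h.len]

theorem mem_hi (h : IsComp F β α γ) {μ : V.Ball} {c : (T μ).Ball × ℕ} {A : ACell (T μ)}
    (hA : A.2.1 = hi (α μ).2.1 c) {μ' : V.Ball} {c' : (T μ').Ball × ℕ}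
    (hc' : c' ∈ pts (Function.update α μ A μ').2.1) :
    F.gp μ' c' ∈ pts (hi γ.1 (F.gp μ c)) := by
  refine mem_pts.2 ?_
  change c'.2 ≤ hi γ.1 (F.gp μ c) (F.glob μ' c'.1)
  rw [h.len_hi hA]
  exact mem_pts.1 hc'

/-- The labels of the points after an insertion in an inner cell. -/
theorem smap_ecut (h : IsComp F β α γ) {μ : V.Ball} {c : (T μ).Ball × ℕ}
    (hc : c ∈ pts (α μ).2.1) {μ' : V.Ball} {c' : (T μ').Ball × ℕ}
    (hc' : c' ∈ pts (Function.update α μ ⟨(α μ).1 + 1, (α μ).2.ecut c⟩ μ').2.1) :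
    ∃ e ∈ pts (α μ').2.1, smap (F.gp μ c) (F.gp μ' c') = F.gp μ' e ∧
      smap (μ, (α μ).2.lab c)
        (μ', (Function.update α μ ⟨(α μ).1 + 1, (α μ).2.ecut c⟩ μ').2.lab c') =
        (μ', (α μ').2.lab e) ∧
      ((F.gp μ' c' = nx (F.gp μ c) ∨ γ.rel (F.gp μ c) (F.gp μ' e)) ↔
        ((μ', (Function.update α μ ⟨(α μ).1 + 1, (α μ).2.ecut c⟩ μ').2.lab c') =
          nx (μ, (α μ).2.lab c) ∨ β.rel (μ, (α μ).2.lab c) (μ', (α μ').2.lab e))) := by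
  classical
  rcases eq_or_ne μ' μ with rfl | hne
  · rw [Function.update_self] at hc' ⊢
    change c' ∈ pts (hi (α μ').2.1 c) at hc'
    have he := smap_mem hc hc'
    refine ⟨smap c c', he, F.smap_gp _ _, ?_⟩
    have hl := lab_ecut (x := (α μ').2) hc hc'
    have hle : (α μ').2.lab (smap c c') ≤ β.1 μ' := mem_pts.1 (h.lab_mem (smap c c'))
    have h1 : (c' = nx c ∨ (α μ').2.rel c (smap c c')) →
        (α μ').2.lab c ≤ (α μ').2.lab (smap c c') := by
      rintro (rfl | h1)
      · rw [smap_nx]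
      · exact lab_mono h1
    have h2 : ¬(c' = nx c ∨ (α μ').2.rel c (smap c c')) →
        (α μ').2.lab (smap c c') ≤ (α μ').2.lab c := by
      intro hn
      rcases eq_or_ne c (smap c c') with h3 | h3
      · rw [← h3]
      · exact lab_mono (((α μ').2.rel_total hc he h3).resolve_left fun h4 => hn (Or.inr h4))
    rw [← F.gp_nx, F.gp_inj, h.rel_same _ _ _ hc he, Cell.rel_same, hl]
    by_cases hi' : c' = nx c ∨ (α μ').2.rel c (smap c c')
    · have := h1 hi'
      rw [if_pos hi']
      clear hl h2
      generalize (α μ').2.lab (smap c c') = l at *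
      generalize (α μ').2.lab c = t at *
      refine ⟨?_, iff_of_true hi' ?_⟩ <;> simp only [smap, sφ, nx, Prod.mk.injEq, true_and]
      · split_ifs <;> omega
      · omega
    · have := h2 hi'
      rw [if_neg hi']
      clear hl h1
      generalize (α μ').2.lab (smap c c') = l at *
      generalize (α μ').2.lab c = t at *
      refine ⟨?_, iff_of_false hi' ?_⟩ <;>
        simp only [smap, sφ, nx, Prod.mk.injEq, true_and, add_zero]
      · split_ifs <;> omega
      · omega
  · rw [Function.update_of_ne hne] at hc' ⊢
    refine ⟨c', hc', F.smap_gp_of_ne hne _ _, by simp [smap, sφ, hne], ?_⟩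
    rw [h.rel_ne _ _ _ _ hne.symm hc hc', ← F.gp_nx]
    simp only [F.gp_ne hne, false_or, nx, Prod.mk.injEq, hne, false_and]

theorem idx_ecut (h : IsComp F β α γ) {μ : V.Ball} {c : (T μ).Ball × ℕ} (μ' : V.Ball) :
    (Function.update α μ ⟨(α μ).1 + 1, (α μ).2.ecut c⟩ μ').1 =
      hi β.1 (μ, (α μ).2.lab c) μ' := by
  rw [hi_apply]
  rcases eq_or_ne μ' μ with rfl | hne
  · rw [Function.update_self, if_pos rfl, ← h.idx]
  · rw [Function.update_of_ne hne, if_neg hne, h.idx]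

/-- An insertion in an inner cell and a degeneracy of the outer cell induce a degeneracy of the
composite. -/
theorem dg_outer (h : IsComp F β α γ) {μ : V.Ball} {c : (T μ).Ball × ℕ}
    (hc : c ∈ pts (α μ).2.1) :
    IsComp F (β.dg (μ, (α μ).2.lab c))
      (Function.update α μ ⟨(α μ).1 + 1, (α μ).2.ecut c⟩) (γ.dg (F.gp μ c)) := by
  have hz : F.gp μ c ∈ pts γ.1 := h.mem_iff.2 hc
  have hb : (μ, (α μ).2.lab c) ∈ pts β.1 := h.lab_mem c
  have hlm : ∀ μ' (c' : (T μ').Ball × ℕ),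
      (μ', (Function.update α μ ⟨(α μ).1 + 1, (α μ).2.ecut c⟩ μ').2.lab c') ∈
        pts (hi β.1 (μ, (α μ).2.lab c)) := fun μ' c' =>
    mem_pts.2 ((lab_le _ c').trans (h.idx_ecut μ').le)
  refine of_imp h.idx_ecut (h.len_hi rfl) ?_ ?_ ?_
  · intro μ' c' c'' hc' hc'' hr
    rw [rel_dg hz (h.mem_hi rfl hc') (h.mem_hi rfl hc'')]
    rcases eq_or_ne μ' μ with rfl | hne
    · rw [Function.update_self] at hr hc' hc''
      have hr := (rel_dg (x := (α μ').2) hc hc' hc'').1 hr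
      rw [F.smap_gp, F.smap_gp, h.rel_same _ _ _ (smap_mem hc hc') (smap_mem hc hc''), ← F.gp_nx,
        F.gp_inj, F.gp_inj]
      exact hr
    · rw [Function.update_of_ne hne] at hr hc' hc''
      rw [F.smap_gp_of_ne hne, F.smap_gp_of_ne hne, h.rel_same _ _ _ hc' hc'']
      exact Or.inl hr
  · intro μ' μ'' c' c'' hne hc' hc'' hr
    rw [rel_dg hz (h.mem_hi rfl hc') (h.mem_hi rfl hc'')]
    rw [rel_dg hb (hlm _ _) (hlm _ _)] at hr
    obtain ⟨e', he', h1, h2, -⟩ := h.smap_ecut hc hc'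
    obtain ⟨e'', he'', h1', h2', -⟩ := h.smap_ecut hc hc''
    rw [h1, h1', h.rel_ne _ _ _ _ hne he' he'', ← h2, ← h2']
    refine hr.imp id fun h3 => absurd ?_ hne
    exact (congrArg Prod.fst h3.1).trans (congrArg Prod.fst h3.2).symm
  · intro μ' c' hc'
    obtain ⟨e', he', h1, h2, -⟩ := h.smap_ecut hc hc'
    rw [lab_dg hz (h.mem_hi rfl hc'), h1, lab_dg hb (hlm _ _), h2, h.lab _ _ he']

/-- Insertions in an inner cell and in the outer cell induce an insertion in the composite. -/
theorem ecut (h : IsComp F β α γ) {μ : V.Ball} {c : (T μ).Ball × ℕ} (hc : c ∈ pts (α μ).2.1) :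
    IsComp F (β.ecut (μ, (α μ).2.lab c))
      (Function.update α μ ⟨(α μ).1 + 1, (α μ).2.ecut c⟩) (γ.ecut (F.gp μ c)) := by
  classical
  have h' := h.dg_outer hc
  have hlm : ∀ μ' (c' : (T μ').Ball × ℕ),
      (μ', (Function.update α μ ⟨(α μ).1 + 1, (α μ).2.ecut c⟩ μ').2.lab c') ∈
        pts (hi β.1 (μ, (α μ).2.lab c)) := fun μ' c' =>
    mem_pts.2 ((lab_le _ c').trans (h.idx_ecut μ').le)
  refine ⟨h'.idx, h'.len, h'.rel_same, h'.rel_ne, fun μ' c' hc' => ?_⟩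
  obtain ⟨e', he', h1, h2, h3⟩ := h.smap_ecut hc hc'
  rw [lab_ecut (h.mem_iff.2 hc) (h.mem_hi rfl hc'), lab_ecut (h.lab_mem c) (hlm _ _), h1, h2,
    h.lab _ _ he']
  by_cases h4 : F.gp μ' c' = nx (F.gp μ c) ∨ γ.rel (F.gp μ c) (F.gp μ' e')
  · rw [if_pos h4, if_pos (h3.1 h4)]
  · rw [if_neg h4, if_neg fun h5 => h4 (h3.2 h5)]

end IsComp

end Cell

/-! ### Units and associativity of the composition of cells -/

namespace TwoDisk.Fibration

variable {U V : TwoDisk} {P : Hom U V} {T : V.Ball → TwoDisk} (F : Fibration P T)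

theorem glob_strictMono (μ : V.Ball) : StrictMono (F.glob μ) := fun _ _ h => F.glob_lt.2 h

theorem range_glob (μ : V.Ball) : Set.range (F.glob μ) = {ν | P ν = μ} := by
  ext ν
  constructor
  · rintro ⟨b, rfl⟩
    exact F.map_glob μ b
  · rintro rfl
    exact ⟨_, F.glob_loc ν⟩

theorem glob_point {P : Hom U point} (F : Fibration P (fun _ => U)) (μ : point.Ball)
    (b : U.Ball) : F.glob μ b = b := by
  have : F.glob μ = id := by
    refine (StrictMono.range_inj (F.glob_strictMono μ) strictMono_id).1 ?_
    rw [range_glob, Set.range_id]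
    exact Set.eq_univ_of_forall fun ν => Subsingleton.elim (α := Fin 1) _ _
  rw [this]
  rfl

theorem glob_id {P : Hom U U} (F : Fibration P (fun _ => point)) (hP : ∀ ν, P ν = ν) (μ : U.Ball)
    (b : point.Ball) : F.glob μ b = μ := by
  rw [← hP (F.glob μ b), F.map_glob]

section Assoc

variable {W : TwoDisk} {Q : Hom V W} {S : Hom U W} {A : V.Ball → TwoDisk}
  {B C : W.Ball → TwoDisk} (F : Fibration P A) (G : Fibration Q B) (H : Fibration S C)
  {R : ∀ w, Hom (C w) (B w)} (K : ∀ w, Fibration (R w) (fun b => A (G.glob w b)))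

theorem glob_glob (hS : ∀ ν, S ν = Q (P ν))
    (hR : ∀ w c, (G.e w (R w c) : V.Ball) = P (H.e w c)) (w : W.Ball) (b : (B w).Ball)
    (b' : (A (G.glob w b)).Ball) :
    H.glob w ((K w).glob b b') = F.glob (G.glob w b) b' := by
  have h := StrictMono.range_inj ((H.glob_strictMono w).comp ((K w).glob_strictMono b))
    (F.glob_strictMono (G.glob w b))
  refine congrFun (h.1 ?_) b'
  rw [range_glob]
  have hR' : ∀ c, G.glob w (R w c) = P (H.glob w c) := hR w
  ext ν
  constructor
  · rintro ⟨b', rfl⟩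
    change P (H.glob w ((K w).glob b b')) = _
    rw [← hR', (K w).map_glob]
  · intro hν
    have hν : P ν = G.glob w b := hν
    have h1 : S ν = w := by rw [hS, hν, G.map_glob]
    subst h1
    have h2 : R (S ν) (H.loc ν) = b := by
      rw [← G.glob_inj, hR', H.glob_loc, hν]
    subst h2
    exact ⟨(K (S ν)).loc (H.loc ν), by rw [Function.comp_apply, (K (S ν)).glob_loc, H.glob_loc]⟩

end Assoc

end TwoDisk.Fibration

namespace Cell

theorem rel_idCell {m : ℕ} {a b : point.Ball × ℕ} (ha : a.2 ≤ m) (hb : b.2 ≤ m) :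
    (idCell m).rel a b ↔ a.2 < b.2 :=
  ⟨fun ⟨_, _, h⟩ => h, fun h => ⟨Nat.lt_succ_iff.2 ha, Nat.lt_succ_iff.2 hb, h⟩⟩

theorem lab_idCell {m : ℕ} {a : point.Ball × ℕ} (ha : a.2 ≤ m) : (idCell m).lab a = a.2 :=
  lab_eq (idCell m) (mem_pts.2 ha)

namespace IsComp

variable {U V : TwoDisk} {P : Hom U V}

theorem unit_outer {P : Hom U point} (F : Fibration P (fun _ => U)) {m : ℕ} (x : Cell U m) :
    IsComp F (idCell m) (fun _ => ⟨m, x⟩) x := by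
  have h : ∀ μ c, F.gp μ c = c := fun μ c => Prod.ext (F.glob_point μ c.1) rfl
  refine ⟨fun μ => rfl, fun μ b => by rw [F.glob_point], fun μ c c' _ _ => by rw [h, h],
    fun μ μ' c c' hne => absurd (Subsingleton.elim (α := Fin 1) μ μ') hne, fun μ c _ => ?_⟩
  rw [h]
  exact (lab_idCell (a := (μ, x.lab c)) (x.lab_le c)).symm

theorem unit_inner {P : Hom U U} (F : Fibration P (fun _ => point)) (hP : ∀ ν, P ν = ν) {m : ℕ}
    (x : Cell U m) : IsComp F x (fun ν => ⟨x.1 ν, idCell (x.1 ν)⟩) x := by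
  have h : ∀ (μ : U.Ball) (c : point.Ball × ℕ), F.gp μ c = (μ, c.2) :=
    fun μ c => Prod.ext (F.glob_id hP μ c.1) rfl
  refine ⟨fun μ => rfl, fun μ b => by rw [F.glob_id hP]; rfl, fun μ c c' hc hc' => ?_,
    fun μ μ' c c' hne hc hc' => ?_, fun μ c hc => ?_⟩
  · have hc : c.2 ≤ x.1 μ := mem_pts.1 hc
    have hc' : c'.2 ≤ x.1 μ := mem_pts.1 hc'
    rw [h, h, Cell.rel_same]
    exact (and_iff_left hc').trans (rel_idCell hc hc').symm
  · have e1 : (idCell (x.1 μ)).lab c = c.2 := lab_idCell (mem_pts.1 hc)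
    have e2 : (idCell (x.1 μ')).lab c' = c'.2 := lab_idCell (mem_pts.1 hc')
    rw [h, h, ← e1, ← e2]
  · have e1 : (idCell (x.1 μ)).lab c = c.2 := lab_idCell (mem_pts.1 hc)
    rw [h, ← e1]

theorem assoc {W : TwoDisk} {Q : Hom V W} {S : Hom U W} {A : V.Ball → TwoDisk}
    {B C : W.Ball → TwoDisk} {F : Fibration P A} {G : Fibration Q B} {H : Fibration S C}
    {R : ∀ w, Hom (C w) (B w)} {L : ∀ w, Fibration (R w) (fun b => A (G.glob w b))}
    (hS : ∀ ν, S ν = Q (P ν)) (hR : ∀ w c, (G.e w (R w c) : V.Ball) = P (H.e w c)) {K : ℕ}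
    {x : ∀ v, ACell (A v)} {y : ∀ w, ACell (B w)} {z : Cell W K} {g : ∀ w, Cell (C w) (y w).1}
    {γ : Cell U K} {δ : Cell V K}
    (hg : ∀ w, IsComp (L w) (y w).2 (fun b => x (G.glob w b)) (g w))
    (hγ : IsComp H z (fun w => ⟨(y w).1, g w⟩) γ) (hδ : IsComp G z y δ) : IsComp F δ x γ := by
  have hgl : ∀ v, ∃ w b, G.glob w b = v := fun v => ⟨Q v, G.loc v, G.glob_loc v⟩
  have hgg := Fibration.glob_glob F G H L hS hR
  have hgp : ∀ w b (c : (A (G.glob w b)).Ball × ℕ), F.gp (G.glob w b) c = H.gp w ((L w).gp b c) :=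
    fun w b c => Prod.ext (hgg w b c.1).symm rfl
  have hm : ∀ {w b} {c : (A (G.glob w b)).Ball × ℕ}, c ∈ pts (x (G.glob w b)).2.1 →
      (L w).gp b c ∈ pts (g w).1 := fun {w b c} hc => (hg w).mem_iff.2 hc
  refine of_imp (fun v => ?_) (fun v b' => ?_) (fun v c c' hc hc' hr => ?_)
    (fun v v' c c' hne hc hc' hr => ?_) (fun v c hc => ?_)
  · obtain ⟨w, b, rfl⟩ := hgl v
    rw [hδ.len]
    exact (hg w).idx b
  · obtain ⟨w, b, rfl⟩ := hgl v
    have e1 := hγ.len w ((L w).glob b b')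
    have e2 := (hg w).len b b'
    have e3 := hgg w b b'
    rw [← e3, e1]
    exact e2
  · obtain ⟨w, b, rfl⟩ := hgl v
    rw [hgp, hgp]
    exact (hγ.rel_same w _ _ (hm hc) (hm hc')).2 (((hg w).rel_same b c c' hc hc').2 hr)
  · obtain ⟨w, b, rfl⟩ := hgl v
    obtain ⟨w', b', rfl⟩ := hgl v'
    rw [hgp, hgp]
    have hl := (hg w).lab_mem (μ := b) c
    have hl' := (hg w').lab_mem (μ := b') c'
    rcases eq_or_ne w w' with rfl | hw
    · have h1 := (hδ.rel_same w (b, (x (G.glob w b)).2.lab c) (b', (x (G.glob w b')).2.lab c') hl hl').1 hr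
      have hb : b ≠ b' := fun h => hne (by rw [h])
      exact (hγ.rel_same w _ _ (hm hc) (hm hc')).2 (((hg w).rel_ne b b' c c' hb hc hc').2 h1)
    · have h1 := (hδ.rel_ne w w' (b, (x (G.glob w b)).2.lab c) (b', (x (G.glob w' b')).2.lab c') hw
        hl hl').1 hr
      refine (hγ.rel_ne w w' _ _ hw (hm hc) (hm hc')).2 ?_
      have e1 := (hg w).lab b c hc
      have e2 := (hg w').lab b' c' hc'
      simp only at e1 e2 ⊢
      rwa [e1, e2]
  · obtain ⟨w, b, rfl⟩ := hgl v
    rw [hgp, hγ.lab w _ (hm hc)]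
    have e1 := (hg w).lab b c hc
    have e2 := hδ.lab w (b, (x (G.glob w b)).2.lab c) ((hg w).lab_mem (μ := b) c)
    simp only at e1 ⊢
    rw [e1]
    exact e2.symm

end IsComp

end Cell

/-! ### Koszul signs modulo two -/

section Quad

variable {ι κ κ' : Type*} [Fintype ι] [Fintype κ] [Fintype κ']

/-- The bilinear form with given matrix over the field with two elements. -/
def quad (c : ι → κ → ZMod 2) (f : ι → ZMod 2) (g : κ → ZMod 2) : ZMod 2 :=
  ∑ i, ∑ j, c i j * f i * g j

/-- The indicator of a proposition, modulo two. -/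
def ind (p : Prop) [Decidable p] : ZMod 2 := if p then 1 else 0

theorem quad_add_left (c : ι → κ → ZMod 2) (f f' : ι → ZMod 2) (g : κ → ZMod 2) :
    quad c (f + f') g = quad c f g + quad c f' g := by
  simp only [quad, Pi.add_apply, ← Finset.sum_add_distrib]
  exact Finset.sum_congr rfl fun i _ => Finset.sum_congr rfl fun j _ => by ring

theorem quad_add_right (c : ι → κ → ZMod 2) (f : ι → ZMod 2) (g g' : κ → ZMod 2) :
    quad c f (g + g') = quad c f g + quad c f g' := by
  simp only [quad, Pi.add_apply, ← Finset.sum_add_distrib]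
  exact Finset.sum_congr rfl fun i _ => Finset.sum_congr rfl fun j _ => by ring

theorem quad_add_coeff (c c' : ι → κ → ZMod 2) (f : ι → ZMod 2) (g : κ → ZMod 2) :
    quad c f g + quad c' f g = quad (fun i j => c i j + c' i j) f g := by
  simp only [quad, ← Finset.sum_add_distrib]
  exact Finset.sum_congr rfl fun i _ => Finset.sum_congr rfl fun j _ => by ring

theorem quad_single_left [DecidableEq ι] (c : ι → κ → ZMod 2) (i : ι) (g : κ → ZMod 2) :
    quad c (Pi.single i 1) g = ∑ j, c i j * g j := by
  rw [quad, Finset.sum_eq_single i]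
  · simp
  · intro j _ h
    simp [h]
  · simp

theorem quad_single_right [DecidableEq κ] (c : ι → κ → ZMod 2) (f : ι → ZMod 2) (j : κ) :
    quad c f (Pi.single j 1) = ∑ i, c i j * f i := by
  refine Finset.sum_congr rfl fun i _ => ?_
  rw [Finset.sum_eq_single j]
  · simp
  · intro j' _ h
    simp [h]
  · simp

theorem quad_comm (c : ι → κ → ZMod 2) (f : ι → ZMod 2) (g : κ → ZMod 2) :
    quad c f g = quad (fun j i => c i j) g f := by
  rw [quad, Finset.sum_comm]
  exact Finset.sum_congr rfl fun i _ => Finset.sum_congr rfl fun j _ => by ring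

theorem quad_congr {c c' : ι → κ → ZMod 2} (h : ∀ i j, c i j = c' i j) (f : ι → ZMod 2)
    (g : κ → ZMod 2) : quad c f g = quad c' f g := by
  rw [show c = c' from funext fun i => funext fun j => h i j]

/-- An alternating form vanishes on the diagonal. -/
theorem quad_self_eq_zero {c : ι → ι → ZMod 2} (h : ∀ i j, c i j = c j i) (h0 : ∀ i, c i i = 0)
    (f : ι → ZMod 2) : quad c f f = 0 := by
  classical
  rw [quad, ← Finset.sum_product']
  refine Finset.sum_involution (fun p _ => p.swap) ?_ ?_ (fun _ _ => by simp) (fun _ _ => by simp)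
  · rintro ⟨i, j⟩ _
    simp only [Prod.swap, h j i]
    rw [mul_right_comm]
    exact CharTwo.add_self_eq_zero _
  · rintro ⟨i, j⟩ _ hne he
    obtain rfl : j = i := congrArg Prod.fst he
    exact hne (by simp [h0])

theorem quad_push [DecidableEq κ] (c : ι → κ → ZMod 2) (f : ι → ZMod 2) (p : κ' → κ)
    (g : κ' → ZMod 2) :
    quad c f (fun j => ∑ j' with p j' = j, g j') = quad (fun i j' => c i (p j')) f g := by
  refine Finset.sum_congr rfl fun i _ => ?_
  rw [← Finset.sum_fiberwise (s := Finset.univ) (g := p)]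
  refine Finset.sum_congr rfl fun j _ => ?_
  rw [Finset.mul_sum]
  refine Finset.sum_congr rfl fun j' hj' => ?_
  simp only [(Finset.mem_filter.1 hj').2]

end Quad

/-- A family of natural numbers modulo two. -/
def zc {ι : Type*} (f : ι → ℕ) : ι → ZMod 2 := fun i => f i

open Cell

section Sign

variable {U V : TwoDisk} {P : Hom U V} {T : V.Ball → TwoDisk} {F : Fibration P T} {K : ℕ}

/-- The Koszul sign of a composition, as a function of the dimensions of the outer cell and of the
composite. -/
def sgn (P : Hom U V) (J : V.Ball → ZMod 2) (ℓ : U.Ball → ZMod 2) : ZMod 2 :=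
  quad (fun μ μ' => ind (μ < μ')) J J + quad (fun μ ν => ind (μ < P ν)) J ℓ +
    quad (fun ν ν' => ind (ν < ν' ∧ P ν' < P ν)) ℓ ℓ

theorem ind_mul (p : Prop) [Decidable p] (a : ZMod 2) : ind p * a = if p then a else 0 := by
  unfold ind
  split_ifs <;> simp

theorem sum_Iio_ind {n : ℕ} (f : Fin n → ZMod 2) (i : Fin n) :
    ∑ j ∈ Finset.Iio i, f j = ∑ j, ind (j < i) * f j := by
  simp only [ind_mul, ← Finset.sum_filter]
  exact Finset.sum_congr (by ext; simp) fun _ _ => rfl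

theorem sum_Ioi_ind {n : ℕ} (f : Fin n → ZMod 2) (i : Fin n) :
    ∑ j ∈ Finset.Ioi i, f j = ∑ j, ind (i < j) * f j := by
  simp only [ind_mul, ← Finset.sum_filter]
  exact Finset.sum_congr (by ext; simp) fun _ _ => rfl

/-- The exponent of the Koszul sign of a composite depends only on the input and output dimensions. -/
theorem compSign_eq (F : Fibration P T) (β : Cell V K) (α : ∀ μ, Cell (T μ) (β.1 μ)) :
    (compSign F β α : ZMod 2) = sgn P (zc β.1) (zc (Cell.comp F β α).1) := by
  have hl : ∀ μ b, (Cell.comp F β α).1 (F.glob μ b) = (α μ).1 b := (isComp_comp F β α).len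
  have e1 : ∀ μ, ∑ ν, ind (μ < P ν) * zc β.1 μ * zc (Cell.comp F β α).1 ν =
      ∑ μ', ind (μ < μ') * (zc β.1 μ * ((α μ').dim : ZMod 2)) := by
    intro μ
    rw [F.sum_glob]
    refine Finset.sum_congr rfl fun μ' _ => ?_
    simp only [F.map_glob, zc, hl, dim, Nat.cast_sum, Finset.mul_sum, mul_assoc]
  simp only [compSign, sgn, quad, e1]
  push_cast
  simp only [sum_Ioi_ind, ← Finset.sum_add_distrib]
  congr 1
  · refine Finset.sum_congr rfl fun μ _ => Finset.sum_congr rfl fun μ' _ => ?_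
    simp only [zc]
    ring
  · refine Finset.sum_congr rfl fun ν _ => Finset.sum_congr rfl fun ν' _ => ?_
    simp only [zc, ind]
    split_ifs <;> simp_all

theorem sgn_add_left (J : V.Ball → ZMod 2) (ℓ : U.Ball → ZMod 2) (μ : V.Ball) :
    sgn P (J + Pi.single μ 1) ℓ = sgn P J ℓ + ((∑ μ', ind (μ < μ') * J μ') +
      (∑ μ', ind (μ' < μ) * J μ') + ∑ ν, ind (μ < P ν) * ℓ ν) := by
  simp only [sgn, quad_add_left, quad_add_right, quad_single_left, quad_single_right, Pi.add_apply,
    mul_add, Finset.sum_add_distrib]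
  have : (∑ j, ind (j < μ) * (Pi.single μ 1 : V.Ball → ZMod 2) j) = 0 := by
    refine Finset.sum_eq_zero fun j _ => ?_
    rcases eq_or_ne j μ with rfl | h
    · simp [ind]
    · simp [h]
  rw [this]
  ring

theorem sgn_add_right (J : V.Ball → ZMod 2) (ℓ : U.Ball → ZMod 2) (ν : U.Ball) :
    sgn P J (ℓ + Pi.single ν 1) = sgn P J ℓ + ((∑ μ', ind (μ' < P ν) * J μ') +
      (∑ ν', ind (ν < ν' ∧ P ν' < P ν) * ℓ ν') + ∑ ν', ind (ν' < ν ∧ P ν < P ν') * ℓ ν') := by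
  simp only [sgn, quad_add_left, quad_add_right, quad_single_left, quad_single_right, Pi.add_apply,
    mul_add, Finset.sum_add_distrib]
  have : (∑ j, ind (j < ν ∧ P ν < P j) * (Pi.single ν 1 : U.Ball → ZMod 2) j) = 0 := by
    refine Finset.sum_eq_zero fun j _ => ?_
    rcases eq_or_ne j ν with rfl | h
    · simp [ind]
    · simp [h]
  rw [this]
  ring

theorem zc_hi (ℓ : U.Ball → ℕ) (z : U.Ball × ℕ) : zc (hi ℓ z) = zc ℓ + Pi.single z.1 1 := by
  funext ν
  simp only [zc, hi_apply, Pi.add_apply]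
  by_cases h : ν = z.1
  · subst h; simp
  · simp [h]

theorem zc_lo {ℓ : U.Ball → ℕ} {z : U.Ball × ℕ} (h1 : 1 ≤ ℓ z.1) :
    zc (lo ℓ z) = zc ℓ + Pi.single z.1 1 := by
  funext ν
  simp only [zc, lo_apply, Pi.add_apply]
  by_cases h : ν = z.1
  · subst h
    have h2 : ((ℓ z.1 : ℕ) : ZMod 2) = ((ℓ z.1 - 1 : ℕ) : ZMod 2) + 1 := by
      exact_mod_cast congrArg (Nat.cast (R := ZMod 2)) (Nat.sub_add_cancel h1).symm
    rw [h2]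
    simp only [if_true, Pi.single_eq_same]
    grind
  · simp [h]

theorem ex_cast (ℓ : U.Ball → ℕ) (z : U.Ball × ℕ) :
    (ex ℓ z : ZMod 2) = (∑ ν, ind (ν < z.1) * zc ℓ ν) + z.2 := by
  simp only [ex, Nat.cast_add, Nat.cast_sum, sum_Iio_ind]
  rfl

variable {β : Cell V K} {α : ∀ μ, ACell (T μ)} {γ : Cell U K}

theorem Cell.IsComp.sum_ind_dim (h : IsComp F β α γ) (p : V.Ball → Prop) [DecidablePred p] :
    ∑ μ, ind (p μ) * ((α μ).2.dim : ZMod 2) = ∑ ν, ind (p (P ν)) * zc γ.1 ν := by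
  rw [F.sum_glob]
  refine Finset.sum_congr rfl fun μ' _ => ?_
  simp only [F.map_glob, zc, h.len, dim, Nat.cast_sum, Finset.mul_sum]

/-- The change of the Koszul sign when the dimension of an inner ball changes by one. -/
theorem Cell.IsComp.sgn_inner (h : IsComp F β α γ) (J : V.Ball → ZMod 2) {μ : V.Ball}
    (c : (T μ).Ball × ℕ) :
    sgn P J (zc γ.1 + Pi.single (F.glob μ c.1) 1) = sgn P J (zc γ.1) +
      (∑ μ', ind (μ' < μ) * J μ') + (∑ μ', ind (μ' < μ) * ((α μ').2.dim : ZMod 2)) +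
      ex γ.1 (F.gp μ c) + ex (α μ).2.1 c := by
  have e1 : (ex (α μ).2.1 c : ZMod 2) =
      (∑ ν, ind (ν < F.glob μ c.1 ∧ P ν = μ) * zc γ.1 ν) + c.2 := by
    rw [ex_cast, F.sum_glob (fun ν => ind (ν < F.glob μ c.1 ∧ P ν = μ) * zc γ.1 ν),
      Finset.sum_eq_single μ]
    · simp only [F.map_glob, F.glob_lt, and_true, zc, h.len]
    · intro μ' _ hne
      exact Finset.sum_eq_zero fun b _ => by simp [ind, hne]
    · simp
  have e2 : (ex γ.1 (F.gp μ c) : ZMod 2) =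
      (∑ ν, ind (ν < F.glob μ c.1) * zc γ.1 ν) + c.2 := ex_cast _ _
  rw [sgn_add_right, h.sum_ind_dim (· < μ), e1, e2]
  simp only [F.map_glob]
  have key : (∑ ν', ind (F.glob μ c.1 < ν' ∧ P ν' < μ) * zc γ.1 ν') +
      (∑ ν', ind (ν' < F.glob μ c.1 ∧ μ < P ν') * zc γ.1 ν') =
      (∑ ν, ind (P ν < μ) * zc γ.1 ν) + (∑ ν, ind (ν < F.glob μ c.1) * zc γ.1 ν) +
      ∑ ν, ind (ν < F.glob μ c.1 ∧ P ν = μ) * zc γ.1 ν := by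
    simp only [← Finset.sum_add_distrib, ← add_mul]
    refine Finset.sum_congr rfl fun ν _ => ?_
    congr 1
    rcases lt_trichotomy ν (F.glob μ c.1) with h1 | h1 | h1
    · rcases lt_trichotomy (P ν) μ with h2 | h2 | h2
      · simp [ind, h1, h1.not_gt, h2, h2.not_gt, h2.ne]
        rfl
      · simp [ind, h1, h1.not_gt, h2]
        rfl
      · simp [ind, h1, h1.not_gt, h2, h2.not_gt, h2.ne']
    · have h2 : P ν = μ := by rw [h1, F.map_glob]
      simp [ind, h1]
    · rcases lt_trichotomy (P ν) μ with h2 | h2 | h2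
      · simp [ind, h1, h1.not_gt, h2, h2.not_gt]
      · simp [ind, h1, h1.not_gt, h2]
      · simp [ind, h1, h1.not_gt, h2, h2.not_gt]
  linear_combination key - (c.2 : ZMod 2) * (CharTwo.two_eq_zero : (2 : ZMod 2) = 0)

/-- The change of the Koszul sign when an inner output ordinal changes by one. -/
theorem Cell.IsComp.sgn_outer (h : IsComp F β α γ) (J : V.Ball → ZMod 2) (μ : V.Ball) :
    sgn P (J + Pi.single μ 1) (zc γ.1) = sgn P J (zc γ.1) + ((∑ μ', ind (μ < μ') * J μ') +
      (∑ μ', ind (μ' < μ) * J μ') + ∑ μ', ind (μ < μ') * ((α μ').2.dim : ZMod 2)) := by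
  rw [sgn_add_left, h.sum_ind_dim (μ < ·)]

end Sign

section Assoc

variable {U V W : TwoDisk} {P : Hom U V} {Q : Hom V W} {S : Hom U W} {A : V.Ball → TwoDisk}
  {B C : W.Ball → TwoDisk} (F : Fibration P A) (G : Fibration Q B) (H : Fibration S C)
  {R : ∀ w, Hom (C w) (B w)}

/-- A sum of forms over the fibres is a form on the total disks. -/
theorem sum_quad_glob {X Y Z : TwoDisk} {p : Hom X Z} {q : Hom Y Z} {A B : Z.Ball → TwoDisk}
    (F : Fibration p A) (G : Fibration q B) (c : X.Ball → Y.Ball → ZMod 2) (f : X.Ball → ZMod 2)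
    (g : Y.Ball → ZMod 2) :
    ∑ w, quad (fun b b' => c (F.glob w b) (G.glob w b')) (fun b => f (F.glob w b))
      (fun b => g (G.glob w b)) = quad (fun i j => ind (p i = q j) * c i j) f g := by
  simp only [quad]
  rw [F.sum_glob]
  refine Finset.sum_congr rfl fun w _ => Finset.sum_congr rfl fun b _ => ?_
  rw [G.sum_glob, Finset.sum_eq_single w]
  · simp [ind]
  · intro w' _ hne
    exact Finset.sum_eq_zero fun b _ => by simp [ind, hne.symm]
  · simp

/-- The Koszul signs of iterated compositions. -/
theorem sgn_assoc (hS : ∀ ν, S ν = Q (P ν))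
    (hR : ∀ w c, G.glob w (R w c) = P (H.glob w c)) (Y : W.Ball → ZMod 2) (X : V.Ball → ZMod 2)
    (ℓ : U.Ball → ZMod 2) :
    sgn S Y ℓ + (∑ w, sgn (R w) (fun b => X (G.glob w b)) (fun c => ℓ (H.glob w c))) =
      quad (fun v v' => ind (v < v' ∧ Q v' < Q v)) (X + fun v => ∑ ν with P ν = v, ℓ ν)
        (X + fun v => ∑ ν with P ν = v, ℓ ν) +
      quad (fun w v => ind (w < Q v)) (Y + fun w => ∑ v with Q v = w, X v)
        (X + fun v => ∑ ν with P ν = v, ℓ ν) + sgn P X ℓ + sgn Q Y X := by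
  have e1 : (∑ w, sgn (R w) (fun b => X (G.glob w b)) (fun c => ℓ (H.glob w c))) =
      quad (fun v v' => ind (Q v = Q v') * ind (v < v')) X X +
      quad (fun v ν => ind (Q v = S ν) * ind (v < P ν)) X ℓ +
      quad (fun ν ν' => ind (S ν = S ν') * ind (ν < ν' ∧ P ν' < P ν)) ℓ ℓ := by
    rw [← sum_quad_glob G G (fun v v' => ind (v < v')), ← sum_quad_glob G H (fun v ν => ind (v < P ν)),
      ← sum_quad_glob H H (fun ν ν' => ind (ν < ν' ∧ P ν' < P ν))]
    simp only [← Finset.sum_add_distrib, sgn, Fibration.glob_lt, ← hR]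
  rw [e1]
  simp only [quad_add_left, quad_add_right, quad_push, sgn]
  have push' : ∀ {X' Y' Z' : TwoDisk} (c : Y'.Ball → Z'.Ball → ZMod 2) (p : X'.Ball → Y'.Ball)
      (f : X'.Ball → ZMod 2) (g : Z'.Ball → ZMod 2),
      quad c (fun j => ∑ j' with p j' = j, f j') g = quad (fun j' i => c (p j') i) f g := by
    intro X' Y' Z' c p f g
    rw [quad_comm, quad_push, quad_comm]
  simp only [push']
  have xx : quad (fun v v' => ind (Q v = Q v') * ind (v < v')) X X +
      quad (fun v v' => ind (v < v')) X X + quad (fun v v' => ind (v < v' ∧ Q v' < Q v)) X X +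
      (quad (fun v v' => ind (v < v' ∧ Q v' < Q v)) X X +
      quad (fun v v' => ind (Q v < Q v')) X X) = 0 := by
    simp only [quad_add_coeff]
    refine quad_self_eq_zero (fun v v' => ?_) (fun v => ?_) X
    · rcases lt_trichotomy v v' with h | h | h <;>
        rcases lt_trichotomy (Q v) (Q v') with h' | h' | h' <;>
        first
        | simp [ind, h, h', h.not_gt, h'.not_gt, h'.ne, h'.ne'] <;> rfl
        | simp [ind, h, h', h.not_gt] <;> rfl
    · simp [ind]
  have xl : quad (fun v ν => ind (Q v = S ν) * ind (v < P ν)) X ℓ +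
      quad (fun v ν => ind (v < P ν)) X ℓ + quad (fun v ν => ind (v < P ν ∧ Q (P ν) < Q v)) X ℓ +
      (quad (fun v ν => ind (P ν < v ∧ Q v < Q (P ν))) X ℓ +
      quad (fun v ν => ind (Q v < Q (P ν))) X ℓ) = 0 := by
    simp only [quad_add_coeff]
    rw [quad_congr (c' := fun _ _ => 0)]
    · simp [quad]
    · intro v ν
      rw [hS]
      rcases lt_trichotomy v (P ν) with h | h | h <;>
        rcases lt_trichotomy (Q v) (Q (P ν)) with h' | h' | h' <;>
        first
        | simp [ind, h, h', h.not_gt, h'.not_gt, h'.ne, h'.ne'] <;> rfl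
        | simp [ind, h, h', h.not_gt] <;> rfl
  have ll : quad (fun ν ν' => ind (ν < ν' ∧ S ν' < S ν)) ℓ ℓ +
      quad (fun ν ν' => ind (S ν = S ν') * ind (ν < ν' ∧ P ν' < P ν)) ℓ ℓ +
      (quad (fun ν ν' => ind (P ν < P ν' ∧ Q (P ν') < Q (P ν))) ℓ ℓ +
      quad (fun ν ν' => ind (ν < ν' ∧ P ν' < P ν)) ℓ ℓ) = 0 := by
    simp only [quad_add_coeff]
    refine quad_self_eq_zero (fun ν ν' => ?_) (fun ν => ?_) ℓ
    · simp only [hS]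
      rcases lt_trichotomy ν ν' with h | h | h <;>
        rcases lt_trichotomy (P ν) (P ν') with h2 | h2 | h2 <;>
        rcases lt_trichotomy (Q (P ν)) (Q (P ν')) with h' | h' | h' <;>
        first
        | simp [ind, h, h2, h', h.not_gt, h2.not_gt, h'.not_gt, h'.ne, h'.ne'] <;> rfl
        | simp [ind, h, h2, h', h.not_gt, h2.not_gt] <;> rfl
    · simp [ind]
  rw [quad_comm (fun v ν => ind (P v < ν ∧ Q ν < Q (P v)))]
  have e2 : quad (fun w ν => ind (w < S ν)) Y ℓ = quad (fun w ν => ind (w < Q (P ν))) Y ℓ := by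
    simp only [hS]
  rw [e2]
  grind

end Assoc

/-! ### Local linear maps on families of chains -/

section Eps

variable (k : Type u) [Field k]

/-- The sign attached to a residue modulo two. -/
def eps (a : ZMod 2) : k := (-1) ^ a.val

variable {k}

theorem eps_natCast (n : ℕ) : eps k n = (-1) ^ n := by
  rw [eps, ZMod.val_natCast, ← neg_one_pow_eq_pow_mod_two]

@[simp] theorem eps_zero : eps k 0 = 1 := by simp [eps]

theorem eps_one : eps k 1 = -1 := by
  have := eps_natCast (k := k) 1
  simpa using this

theorem eps_add (a b : ZMod 2) : eps k (a + b) = eps k a * eps k b := by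
  rw [← ZMod.natCast_zmod_val a, ← ZMod.natCast_zmod_val b, ← Nat.cast_add]
  simp only [eps_natCast, pow_add]

theorem prod_eps {ι : Type*} (s : Finset ι) (a : ι → ZMod 2) :
    ∏ i ∈ s, eps k (a i) = eps k (∑ i ∈ s, a i) := by
  classical
  induction s using Finset.induction_on with
  | empty => simp
  | insert i s hi ih => rw [Finset.prod_insert hi, Finset.sum_insert hi, eps_add, ih]

theorem negOnePow_smul {M : Type*} [AddCommGroup M] [Module k M] (n : ℤ) (x : M) :
    n.negOnePow • x = eps k (n : ZMod 2) • x := by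
  rcases Int.even_or_odd n with h | h
  · have : ((n : ℤ) : ZMod 2) = 0 := (ZMod.intCast_zmod_eq_zero_iff_dvd n 2).2 h.two_dvd
    rw [Int.negOnePow_even _ h, this, eps_zero, one_smul, one_smul]
  · have : ((n : ℤ) : ZMod 2) = 1 := by
      obtain ⟨m, rfl⟩ := h
      push_cast
      linear_combination (m : ZMod 2) * (CharTwo.two_eq_zero : (2 : ZMod 2) = 0)
    rw [Int.negOnePow_odd _ h, this, eps_one, neg_smul, one_smul, Units.neg_smul, one_smul]

end Eps

section Local

variable {k : Type u} [Field k] {U : TwoDisk} {M M' : Type*} [AddCommGroup M] [Module k M]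
  [AddCommGroup M'] [Module k M']

/-- The family with a single term, a cell with coefficient one. -/
noncomputable def ab (c : ACell U) : Fam k U := Pi.single c.1 (Finsupp.single c.2 1)

theorem ab_self {m : ℕ} (x : Cell U m) :
    (ab ⟨m, x⟩ : Fam k U) m = Finsupp.single x 1 := Pi.single_eq_same _ _

theorem ab_of_ne {m n : ℕ} (x : Cell U m) (h : n ≠ m) :
    (ab ⟨m, x⟩ : Fam k U) n = 0 := Pi.single_eq_of_ne h _

variable (k) in
/-- A linear map on families of chains that depends on finitely many components only. -/
def LocLin (h : Fam k U → M) : Prop :=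
  ∃ g : Fam k U →ₗ[k] M, (∃ N, ∀ f, (∀ m ≤ N, f m = 0) → g f = 0) ∧ ∀ f, h f = g f

namespace LocLin

theorem eval (m : ℕ) : LocLin k (fun f : Fam k U => f m) :=
  ⟨LinearMap.proj m, ⟨m, fun _ h => h m le_rfl⟩, fun _ => rfl⟩

theorem zero : LocLin k (fun _ : Fam k U => (0 : M)) := ⟨0, ⟨0, fun _ _ => rfl⟩, fun _ => rfl⟩

theorem add {h h' : Fam k U → M} (H : LocLin k h) (H' : LocLin k h') :
    LocLin k (fun f => h f + h' f) := by
  obtain ⟨g, ⟨N, hN⟩, hg⟩ := H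
  obtain ⟨g', ⟨N', hN'⟩, hg'⟩ := H'
  refine ⟨g + g', ⟨max N N', fun f hf => ?_⟩, fun f => by simp [hg, hg']⟩
  rw [LinearMap.add_apply, hN f fun m hm => hf m (le_max_of_le_left hm),
    hN' f fun m hm => hf m (le_max_of_le_right hm), add_zero]

theorem map {h : Fam k U → M} (H : LocLin k h) (L : M →ₗ[k] M') : LocLin k (fun f => L (h f)) := by
  obtain ⟨g, ⟨N, hN⟩, hg⟩ := H
  exact ⟨L ∘ₗ g, ⟨N, fun f hf => by simp [hN f hf]⟩, fun f => by simp [hg]⟩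

theorem smul {h : Fam k U → M} (H : LocLin k h) (c : k) : LocLin k (fun f => c • h f) :=
  H.map (c • LinearMap.id)

theorem sub {h h' : Fam k U → M} (H : LocLin k h) (H' : LocLin k h') :
    LocLin k (fun f => h f - h' f) := by
  simpa [sub_eq_add_neg] using H.add (H'.smul (-1))

theorem sum {ι : Type*} (s : Finset ι) {h : ι → Fam k U → M} (H : ∀ i ∈ s, LocLin k (h i)) :
    LocLin k (fun f => ∑ i ∈ s, h i f) := by
  classical
  induction s using Finset.induction_on with
  | empty => simpa using zero
  | insert i s hi ih =>
    simp only [Finset.sum_insert hi]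
    exact (H i (Finset.mem_insert_self _ _)).add
      (ih fun j hj => H j (Finset.mem_insert_of_mem hj))

theorem comp {U' : TwoDisk} {h : Fam k U' → M} {e : Fam k U → Fam k U'} (H : LocLin k h)
    (E : ∀ m, LocLin k (fun f => e f m)) : LocLin k (fun f => h (e f)) := by
  obtain ⟨g, ⟨N, hN⟩, hg⟩ := H
  choose g' hN' hg' using E
  choose N' hN' using hN'
  refine ⟨g ∘ₗ LinearMap.pi g', ⟨(Finset.range (N + 1)).sup N', fun f hf => ?_⟩, fun f => ?_⟩
  · refine hN _ fun m hm => hN' m f fun m' hm' => hf m' (hm'.trans ?_)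
    exact Finset.le_sup (f := N') (Finset.mem_range.2 (by omega))
  · refine (hg (e f)).trans (congrArg g ?_)
    funext m
    exact hg' m f

theorem dtot_apply (m : ℕ) : LocLin k (fun f : Fam k U => dtot k U f m) := by
  cases m with
  | zero => exact (eval 0).map (chainD k U 0)
  | succ m => exact ((eval (m + 1)).map (chainD k U (m + 1))).sub ((eval m).map (cochainD k U m))

/-- A local linear map vanishes on a degree if it does so on the cells of this degree: the finitely
many relevant components are finite sums of cells. -/
theorem eq_zero {h : Fam k U → M} (H : LocLin k h) {n : ℤ}
    (h0 : ∀ c : ACell U, (c.1 : ℤ) - c.2.dim = n → h (ab c) = 0) {f : Fam k U}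
    (hf : f ∈ degS k U n) : h f = 0 := by
  obtain ⟨g, ⟨N, hN⟩, hg⟩ := H
  simp only [hg] at h0 ⊢
  have e : g f = g (∑ m ∈ Finset.range (N + 1), Pi.single m (f m)) := by
    rw [← sub_eq_zero, ← map_sub]
    refine hN _ fun m hm => ?_
    rw [Pi.sub_apply, Finset.sum_apply, Finset.sum_eq_single m]
    · simp
    · intro m' _ hne
      exact Pi.single_eq_of_ne hne.symm _
    · intro hm'
      exact absurd (Finset.mem_range.2 (by omega)) hm'
  rw [e, map_sum]
  refine Finset.sum_eq_zero fun m _ => ?_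
  have hm := mem_degS.1 hf m
  rw [Finsupp.supported_eq_span_single] at hm
  have : Submodule.span k ((fun x => Finsupp.single x (1 : k)) '' {x : Cell U m | (m : ℤ) - x.dim = n})
      ≤ LinearMap.ker (g ∘ₗ LinearMap.single k (fun m => Chains k U m) m) := by
    rw [Submodule.span_le]
    rintro _ ⟨x, hx, rfl⟩
    exact h0 ⟨m, x⟩ hx
  exact this hm

end LocLin

variable {ι : Type*} [DecidableEq ι] {T : ι → TwoDisk}

variable (k) in
/-- A multilinear map on families of chains that depends, in each variable, on finitely many
components only. -/
def LocMulti (D : (∀ i, Fam k (T i)) → M) : Prop :=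
  ∀ x i, LocLin k (fun f => D (Function.update x i f))

namespace LocMulti

theorem map {D : (∀ i, Fam k (T i)) → M} (H : LocMulti k D) (L : M →ₗ[k] M') :
    LocMulti k (fun x => L (D x)) := fun x i => (H x i).map L

theorem smul {D : (∀ i, Fam k (T i)) → M} (H : LocMulti k D) (c : k) :
    LocMulti k (fun x => c • D x) := fun x i => (H x i).smul c

theorem add {D D' : (∀ i, Fam k (T i)) → M} (H : LocMulti k D) (H' : LocMulti k D') :
    LocMulti k (fun x => D x + D' x) := fun x i => (H x i).add (H' x i)

theorem sub {D D' : (∀ i, Fam k (T i)) → M} (H : LocMulti k D) (H' : LocMulti k D') :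
    LocMulti k (fun x => D x - D' x) := fun x i => (H x i).sub (H' x i)

theorem sum {κ : Type*} (s : Finset κ) {D : κ → (∀ i, Fam k (T i)) → M}
    (H : ∀ j ∈ s, LocMulti k (D j)) : LocMulti k (fun x => ∑ j ∈ s, D j x) :=
  fun x i => LocLin.sum s fun j hj => H j hj x i

theorem post {U' : TwoDisk} {h : Fam k U' → M} {D : (∀ i, Fam k (T i)) → Fam k U'}
    (H : LocLin k h) (E : ∀ m, LocMulti k (fun x => D x m)) : LocMulti k (fun x => h (D x)) :=
  fun x i => H.comp fun m => E m x i

theorem update {D : (∀ i, Fam k (T i)) → M} (H : LocMulti k D) (i : ι)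
    {e : Fam k (T i) → Fam k (T i)} (E : ∀ m, LocLin k (fun f => e f m)) :
    LocMulti k (fun x => D (Function.update x i (e (x i)))) := by
  intro x j
  rcases eq_or_ne j i with rfl | h
  · simp only [Function.update_self, Function.update_idem]
    exact (H x j).comp E
  · simp only [Function.update_of_ne h.symm, Function.update_comm h]
    exact H _ j

theorem pre {T' : ι → TwoDisk} {D : (∀ i, Fam k (T i)) → M} (H : LocMulti k D)
    {e : ∀ i, Fam k (T' i) → Fam k (T i)} (E : ∀ i m, LocLin k (fun f => e i f m)) :
    LocMulti k (fun x => D (fun i => e i (x i))) := by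
  intro x i
  have : ∀ f, (fun j => e j (Function.update x i f j)) =
      Function.update (fun j => e j (x j)) i (e i f) := by
    intro f
    funext j
    rcases eq_or_ne j i with rfl | h
    · simp
    · simp [h]
  simp only [this]
  exact (H _ i).comp (E i)

/-- Iterated multilinear maps, for a partition of the variables. -/
theorem nest {κ : Type*} [DecidableEq κ] {B : κ → Type*} [∀ w, DecidableEq (B w)] {C : κ → TwoDisk}
    {D : (∀ w, Fam k (C w)) → M} (H : LocMulti k D) (g : ∀ w, B w → ι)
    (hg : ∀ i, ∃ w b, g w b = i) (hinj : ∀ w w' b b', g w b = g w' b' → w = w')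
    (hinj' : ∀ w, Function.Injective (g w))
    {E : ∀ w, (∀ b, Fam k (T (g w b))) → Fam k (C w)} (hE : ∀ w m, LocMulti k (fun x => E w x m)) :
    LocMulti k (fun x : ∀ i, Fam k (T i) => D (fun w => E w (fun b => x (g w b)))) := by
  intro x i
  obtain ⟨w, b, rfl⟩ := hg i
  have : ∀ f, (fun w' => E w' (fun b' => Function.update x (g w b) f (g w' b'))) =
      Function.update (fun w' => E w' (fun b' => x (g w' b'))) w
        (E w (Function.update (fun b' => x (g w b')) b f)) := by
    intro f
    funext w'
    rcases eq_or_ne w' w with rfl | h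
    · rw [Function.update_self]
      congr 1
      exact Function.update_comp_eq_of_injective' x (hinj' w') b f
    · rw [Function.update_of_ne h]
      congr 1
      funext b'
      exact Function.update_of_ne (fun h' => h (hinj _ _ _ _ h')) _ _
  simp only [this]
  exact (H _ w).comp fun m => hE w m _ b

/-- A local multilinear map vanishes on given degrees if it does so on cells of these degrees. -/
theorem eq_zero [Fintype ι] {D : (∀ i, Fam k (T i)) → M} (H : LocMulti k D) {p : ι → ℤ}
    (h0 : ∀ α : ∀ i, ACell (T i), (∀ i, ((α i).1 : ℤ) - (α i).2.dim = p i) →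
      D (fun i => ab (α i)) = 0)
    {x : ∀ i, Fam k (T i)} (hx : ∀ i, x i ∈ degS k (T i) (p i)) : D x = 0 := by
  have key : ∀ (s : Finset ι) (x : ∀ i, Fam k (T i)), (∀ i ∈ s, x i ∈ degS k (T i) (p i)) →
      (∀ i ∉ s, ∃ c : ACell (T i), (c.1 : ℤ) - c.2.dim = p i ∧ x i = ab c) → D x = 0 := by
    intro s
    induction s using Finset.induction_on with
    | empty =>
      intro x _ h
      choose α hα hx using fun i => h i (Finset.notMem_empty i)
      rw [show x = fun i => ab (α i) from funext hx]
      exact h0 α hα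
    | insert i s hi ih =>
      intro x h h'
      rw [← Function.update_eq_self i x]
      refine (H x i).eq_zero (fun c hc => ih _ (fun j hj => ?_) fun j hj => ?_)
        (h i (Finset.mem_insert_self _ _))
      · rw [Function.update_of_ne (by rintro rfl; exact hi hj)]
        exact h j (Finset.mem_insert_of_mem hj)
      · rcases eq_or_ne j i with rfl | hne
        · exact ⟨c, hc, Function.update_self _ _ _⟩
        · obtain ⟨c', hc', hx'⟩ := h' j (by simp [hne, hj])
          exact ⟨c', hc', by rw [Function.update_of_ne hne, hx']⟩
  exact key Finset.univ x (fun i _ => hx i) fun i hi => absurd (Finset.mem_univ i) hi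

end LocMulti

end Local

/-! ### Composition of families of chains -/

open Cell

section Comp

variable (k : Type u) [Field k] {U V : TwoDisk} {P : Hom U V} {T : V.Ball → TwoDisk}
  (F : Fibration P T) {K : ℕ}

open Classical in
/-- The composition with a given outer cell, as a function of the chains of inner cells. -/
noncomputable def compCell (β : Cell V K) (a : ∀ μ, Chains k (T μ) (β.1 μ)) : Chains k U K :=
  ∑ α ∈ Fintype.piFinset (fun μ => (a μ).support),
    Finsupp.single (Cell.comp F β α) ((-1 : k) ^ compSign F β α * ∏ μ, a μ (α μ))

variable {k}

theorem condensedComp_eq (x : ∀ μ, Fam k (T μ)) (y : Fam k V) :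
    condensedComp k F x y K = Finsupp.linearCombination k
      (fun β => compCell k F β (fun μ => x μ (β.1 μ))) (y K) := by
  rw [Finsupp.linearCombination_apply, condensedComp]
  refine Finsupp.sum_congr fun β _ => ?_
  rw [compCell, Finset.smul_sum]
  refine Finset.sum_congr rfl fun α _ => ?_
  rw [Finsupp.smul_single, smul_eq_mul, mul_comm]

/-- The composition with an outer cell, summed over a fixed finite set of inner cells. -/
noncomputable def compCellOn (β : Cell V K) (s : Finset (∀ μ, Cell (T μ) (β.1 μ))) :
    MultilinearMap k (fun μ => Chains k (T μ) (β.1 μ)) (Chains k U K) :=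
  ∑ α ∈ s, (LinearMap.toSpanSingleton k _ (Finsupp.single (Cell.comp F β α)
    ((-1 : k) ^ compSign F β α))).compMultilinearMap
      ((MultilinearMap.mkPiAlgebra k V.Ball k).compLinearMap fun μ => Finsupp.lapply (α μ))

open Classical in
theorem compCell_eq (β : Cell V K) {a : ∀ μ, Chains k (T μ) (β.1 μ)}
    {s : ∀ μ, Finset (Cell (T μ) (β.1 μ))} (h : ∀ μ, (a μ).support ⊆ s μ) :
    compCell k F β a = compCellOn F β (Fintype.piFinset s) a := by
  simp only [compCell, compCellOn, _root_.sum_apply]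
  refine (Finset.sum_subset (Fintype.piFinset_subset _ _ h) fun α _ hα => ?_).trans
    (Finset.sum_congr rfl fun α _ => ?_)
  · obtain ⟨μ, hμ⟩ := not_forall.1 (mt Fintype.mem_piFinset.2 hα)
    have h0 : ∏ μ, a μ (α μ) = 0 :=
      Finset.prod_eq_zero (Finset.mem_univ μ) (Finsupp.notMem_support_iff.1 hμ)
    rw [h0, mul_zero, Finsupp.single_zero]
  · simp [mul_comm]

/-- Finitely many arguments in one variable involve finitely many cells, so that the composition is
given by one multilinear map. -/
theorem exists_compCellOn (β : Cell V K) (a : ∀ μ, Chains k (T μ) (β.1 μ)) (μ : V.Ball)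
    (t : Finset (Chains k (T μ) (β.1 μ))) : ∃ L, ∀ b ∈ t,
      compCell k F β (Function.update a μ b) = compCellOn F β L (Function.update a μ b) := by
  classical
  refine ⟨Fintype.piFinset fun μ' => (a μ').support ∪ 
    if h : μ' = μ then t.biUnion fun b => (h ▸ b).support else ∅, fun b hb => compCell_eq F β ?_⟩
  intro μ'
  rcases eq_or_ne μ' μ with rfl | h
  · rw [Function.update_self, dif_pos rfl]
    exact (Finset.subset_biUnion_of_mem (fun b : Chains k (T μ') (β.1 μ') => b.support) hb).trans
      Finset.subset_union_right
  · rw [Function.update_of_ne h]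
    exact Finset.subset_union_left

theorem compCell_update_add (β : Cell V K) (a : ∀ μ, Chains k (T μ) (β.1 μ)) (μ : V.Ball)
    (b b' : Chains k (T μ) (β.1 μ)) :
    compCell k F β (Function.update a μ (b + b')) =
      compCell k F β (Function.update a μ b) + compCell k F β (Function.update a μ b') := by
  classical
  obtain ⟨L, hL⟩ := exists_compCellOn F β a μ {b, b', b + b'}
  rw [hL _ (by simp), hL _ (by simp), hL _ (by simp), MultilinearMap.map_update_add]

theorem compCell_update_smul (β : Cell V K) (a : ∀ μ, Chains k (T μ) (β.1 μ)) (μ : V.Ball)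
    (c : k) (b : Chains k (T μ) (β.1 μ)) :
    compCell k F β (Function.update a μ (c • b)) =
      c • compCell k F β (Function.update a μ b) := by
  classical
  obtain ⟨L, hL⟩ := exists_compCellOn F β a μ {b, c • b}
  rw [hL _ (by simp), hL _ (by simp), MultilinearMap.map_update_smul]

theorem compCell_single (β : Cell V K) (α : ∀ μ, Cell (T μ) (β.1 μ)) :
    compCell k F β (fun μ => Finsupp.single (α μ) 1) =
      Finsupp.single (Cell.comp F β α) ((-1 : k) ^ compSign F β α) := by
  classical
  rw [compCell]
  have : ∀ μ, (Finsupp.single (α μ) (1 : k)).support = {α μ} := fun μ =>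
    Finsupp.support_single _ one_ne_zero
  simp only [this, Fintype.piFinset_singleton, Finset.sum_singleton, Finsupp.single_eq_same,
    Finset.prod_const_one, mul_one]

theorem update_eval (x : ∀ μ, Fam k (T μ)) (μ : V.Ball) (f : Fam k (T μ)) (J : V.Ball → ℕ) :
    (fun μ' => Function.update x μ f μ' (J μ')) =
      Function.update (fun μ' => x μ' (J μ')) μ (f (J μ)) := by
  funext μ'
  rcases eq_or_ne μ' μ with rfl | h
  · simp
  · simp [h]

theorem locMulti_comp (y : Fam k V) (K : ℕ) :
    LocMulti k (fun x : ∀ μ, Fam k (T μ) => condensedComp k F x y K) := by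
  intro x μ
  simp only [condensedComp_eq, Finsupp.linearCombination_apply, Finsupp.sum, update_eval]
  refine LocLin.sum _ fun β _ => LocLin.smul ?_ _
  let L : Chains k (T μ) (β.1 μ) →ₗ[k] Chains k U K :=
    { toFun := fun b => compCell k F β (Function.update (fun μ' => x μ' (β.1 μ')) μ b)
      map_add' := compCell_update_add F β _ μ
      map_smul' := compCell_update_smul F β _ μ }
  exact (LocLin.eval (β.1 μ)).map L

theorem locLin_comp (x : ∀ μ, Fam k (T μ)) (K : ℕ) :
    LocLin k (fun y : Fam k V => condensedComp k F x y K) := by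
  simp only [condensedComp_eq]
  exact (LocLin.eval K).map _

variable (k) in
/-- The composition of families, as a multilinear map of the inner families. -/
noncomputable def compM (y : Fam k V) :
    MultilinearMap k (fun μ => Fam k (T μ)) (Fam k U) where
  toFun x := condensedComp k F x y
  map_update_add' x μ a b := by
    funext K
    obtain ⟨g, -, hg⟩ := locMulti_comp F y K x μ
    beta_reduce at hg
    convert map_add g a b using 1
    · convert hg (a + b)
    · rw [Pi.add_apply, ← hg, ← hg]
      congr!
  map_update_smul' x μ c a := by
    funext K
    obtain ⟨g, -, hg⟩ := locMulti_comp F y K x μ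
    beta_reduce at hg
    convert map_smul g c a using 1
    · convert hg (c • a)
    · rw [Pi.smul_apply, ← hg]
      congr!

variable (k) in
/-- The composition of families, as a linear map of the outer family. -/
noncomputable def compL (x : ∀ μ, Fam k (T μ)) : Fam k V →ₗ[k] Fam k U where
  toFun y := condensedComp k F x y
  map_add' a b := by
    funext K
    obtain ⟨g, -, hg⟩ := locLin_comp F x K
    beta_reduce at hg
    rw [Pi.add_apply, hg, hg, hg, map_add]
  map_smul' c a := by
    funext K
    obtain ⟨g, -, hg⟩ := locLin_comp F x K
    beta_reduce at hg
    rw [RingHom.id_apply, Pi.smul_apply, hg, hg, map_smul]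

theorem compM_apply (x : ∀ μ, Fam k (T μ)) (y : Fam k V) :
    compM k F y x = condensedComp k F x y := rfl

theorem compL_apply (x : ∀ μ, Fam k (T μ)) (y : Fam k V) :
    compL k F x y = condensedComp k F x y := rfl

variable {F} {β : Cell V K} {α : ∀ μ, ACell (T μ)} {γ : Cell U K}

/-- The composite of basis elements whose ordinals match. -/
theorem Cell.IsComp.comp_ab (h : IsComp F β α γ) :
    condensedComp k F (fun μ => ab (α μ)) (ab ⟨K, β⟩) =
      eps k (sgn P (zc β.1) (zc γ.1)) • ab ⟨K, γ⟩ := by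
  have : ∀ μ, ∃ A : Cell (T μ) (β.1 μ), α μ = ⟨β.1 μ, A⟩ := by
    intro μ
    have := h.idx μ
    generalize α μ = A at this ⊢
    obtain ⟨m, A⟩ := A
    obtain rfl : m = β.1 μ := this
    exact ⟨A, rfl⟩
  choose α' h' using this
  obtain rfl := funext h'
  obtain rfl := h.unique (isComp_comp F β α')
  funext K'
  rw [condensedComp_eq, Pi.smul_apply]
  rcases eq_or_ne K' K with rfl | hne
  · rw [ab_self, ab_self, Finsupp.linearCombination_single, one_smul]
    simp only [ab_self]
    rw [compCell_single, Finsupp.smul_single, smul_eq_mul, mul_one, ← compSign_eq, eps_natCast]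
  · rw [ab_of_ne _ hne, ab_of_ne _ hne, map_zero, smul_zero]

/-- The composite of basis elements whose ordinals do not match. -/
theorem comp_ab_of_ne {μ : V.Ball} (h : (α μ).1 ≠ β.1 μ) :
    condensedComp k F (fun μ => ab (α μ)) (ab ⟨K, β⟩) = 0 := by
  funext K'
  rw [condensedComp_eq]
  rcases eq_or_ne K' K with rfl | hne
  · rw [ab_self, Finsupp.linearCombination_single, one_smul, compCell,
      Finset.sum_eq_zero, Pi.zero_apply]
    intro A hA
    have := Finsupp.mem_support_iff.1 (Fintype.mem_piFinset.1 hA μ)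
    exact absurd (by rw [ab_of_ne _ h.symm]; rfl) this
  · rw [ab_of_ne _ hne, map_zero, Pi.zero_apply]

end Comp

/-! ### The composition is a map of complexes -/

section DComp

variable {k : Type u} [Field k] {U V : TwoDisk} {P : Hom U V} {T : V.Ball → TwoDisk}
  {F : Fibration P T} {K : ℕ}

/-- The part of the boundary of a cell given by the faces. -/
noncomputable def faceD (k : Type u) [Field k] (c : ACell U) : Fam k U :=
  ∑ w ∈ pts c.2.1, if 1 ≤ c.2.1 w.1 then eps k (ex c.2.1 w) • ab ⟨c.1, c.2.fc w⟩ else 0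

/-- The part of the boundary of a cell given by the cofaces. -/
noncomputable def cofaceD (k : Type u) [Field k] (c : ACell U) : Fam k U :=
  ∑ j : Fin (c.1 + 2), eps k (c.1 + c.2.dim + (j : ℕ)) • ab ⟨c.1 + 1, c.2.coface j⟩

/-- The boundary of a cell of `|seq|`; its cofaces have the output ordinal `[m + 1]`. -/
theorem dtot_ab (c : ACell U) : dtot k U (ab c) = faceD k c - cofaceD k c := by
  obtain ⟨m, x⟩ := c
  have hf : ∀ n, faceD k ⟨m, x⟩ n = chainD k U n ((ab ⟨m, x⟩ : Fam k U) n) := by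
    intro n
    rcases eq_or_ne n m with rfl | h
    · rw [ab_self, chainD_single', faceD, Finset.sum_apply]
      refine Finset.sum_congr rfl fun w _ => ?_
      split_ifs
      · rw [Pi.smul_apply, ab_self, eps_natCast]
      · rfl
    · rw [ab_of_ne _ h, map_zero, faceD, Finset.sum_apply]
      refine Finset.sum_eq_zero fun w _ => ?_
      split_ifs
      · rw [Pi.smul_apply, ab_of_ne _ h, smul_zero]
      · rfl
  have hc : ∀ n, cofaceD k ⟨m, x⟩ (n + 1) = cochainD k U n ((ab ⟨m, x⟩ : Fam k U) n) := by
    intro n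
    rcases eq_or_ne n m with rfl | h
    · rw [ab_self, cochainD_single, cofaceD, Finset.sum_apply]
      refine Finset.sum_congr rfl fun j _ => ?_
      rw [Pi.smul_apply, ab_self, cof_single, ← eps_natCast]
      push_cast
      rfl
    · rw [ab_of_ne _ h, map_zero, cofaceD, Finset.sum_apply]
      refine Finset.sum_eq_zero fun j _ => ?_
      rw [Pi.smul_apply, ab_of_ne _ (by simpa using h), smul_zero]
  funext n
  rw [Pi.sub_apply, hf]
  cases n with
  | zero =>
    have : cofaceD k ⟨m, x⟩ 0 = 0 := by
      rw [cofaceD, Finset.sum_apply]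
      exact Finset.sum_eq_zero fun j _ => by
        rw [Pi.smul_apply, ab_of_ne _ (Nat.succ_ne_zero m).symm, smul_zero]
    rw [this, sub_zero, dtot_zero]
  | succ n => rw [hc, dtot_succ]

theorem update_ab (α : ∀ μ, ACell (T μ)) (μ : V.Ball) (A : ACell (T μ)) :
    Function.update (fun μ => (ab (α μ) : Fam k (T μ))) μ (ab A) =
      fun μ' => ab (Function.update α μ A μ') := by
  funext μ'
  exact (Function.apply_update (fun _ => ab) α μ A μ').symm

variable {β : Cell V K} {α : ∀ μ, ACell (T μ)} {γ : Cell U K}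

theorem eps_smul_eq {a b : ZMod 2} (h : a = b) (x : Fam k U) :
    eps k a • x = eps k b • x := by rw [h]

/-- The faces of a composite are the composites with the faces of the inner cells. -/
theorem faceD_comp (p : V.Ball → ℤ) (hα : ∀ μ, ((α μ).1 : ℤ) - (α μ).2.dim = p μ)
    (h : IsComp F β α γ) :
    (eps k (sgn P (zc β.1) (zc γ.1)) • faceD k ⟨K, γ⟩ : Fam k U) =
      ∑ μ, eps k ((∑ μ' ∈ Finset.Iio μ, p μ' : ℤ) : ZMod 2) • condensedComp k F
        (Function.update (fun μ => ab (α μ)) μ (faceD k (α μ))) (ab ⟨K, β⟩) := by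
  rw [faceD, Finset.smul_sum, h.sum_pts]
  refine Finset.sum_congr rfl fun μ _ => ?_
  rw [← compM_apply, faceD, MultilinearMap.map_update_sum, Finset.smul_sum]
  refine Finset.sum_congr rfl fun c _ => ?_
  have hl : γ.1 (F.gp μ c).1 = (α μ).2.1 c.1 := h.len _ _
  rw [hl]
  split_ifs with h1
  · rw [MultilinearMap.map_update_smul, update_ab, compM_apply, (h.fc h1).comp_ab,
      smul_smul, smul_smul, smul_smul, ← eps_add, ← eps_add, ← eps_add]
    refine eps_smul_eq ?_ _
    have e := h.sgn_inner (zc β.1) c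
    rw [fc_fst, zc_lo (by rw [hl]; exact h1)]
    change _ = _ + sgn P (zc β.1) (zc γ.1 + Pi.single (F.glob μ c.1) 1)
    rw [e]
    have : ((∑ μ' ∈ Finset.Iio μ, p μ' : ℤ) : ZMod 2) = (∑ μ', ind (μ' < μ) * zc β.1 μ') +
        ∑ μ', ind (μ' < μ) * ((α μ').2.dim : ZMod 2) := by
      push_cast
      rw [sum_Iio_ind (fun μ' => (p μ' : ZMod 2)), ← Finset.sum_add_distrib]
      refine Finset.sum_congr rfl fun μ' _ => ?_
      rw [← hα, ← mul_add, zc, ← h.idx]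
      push_cast
      rw [CharTwo.sub_eq_add]
    rw [this]
    grind
  · rw [smul_zero, MultilinearMap.map_update_zero, smul_zero]

/-- The cofaces of a composite are the composites with the cofaces of the outer cell. -/
theorem cofaceD_comp (p : V.Ball → ℤ) (hα : ∀ μ, ((α μ).1 : ℤ) - (α μ).2.dim = p μ)
    (h : IsComp F β α γ) :
    (eps k (sgn P (zc β.1) (zc γ.1)) • cofaceD k ⟨K, γ⟩ : Fam k U) =
      eps k ((∑ μ, p μ : ℤ) : ZMod 2) •
        condensedComp k F (fun μ => ab (α μ)) (cofaceD k ⟨K, β⟩) := by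
  rw [← compL_apply, cofaceD, cofaceD, map_sum, Finset.smul_sum, Finset.smul_sum]
  refine Finset.sum_congr rfl fun j _ => ?_
  rw [map_smul, compL_apply, (h.coface j).comp_ab, smul_smul, smul_smul, smul_smul, ← eps_add,
    ← eps_add, ← eps_add]
  refine eps_smul_eq ?_ _
  have : ((∑ μ, p μ : ℤ) : ZMod 2) = β.dim + γ.dim := by
    rw [h.dim_eq, dim]
    push_cast
    rw [← Finset.sum_add_distrib]
    refine Finset.sum_congr rfl fun μ _ => ?_
    rw [← hα, ← h.idx]
    push_cast
    rw [CharTwo.sub_eq_add]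
  rw [this]
  change sgn P (zc β.1) (zc γ.1) + (K + γ.dim + (j : ℕ)) =
    β.dim + γ.dim + (K + β.dim + (j : ℕ)) + sgn P (zc β.1) (zc γ.1)
  linear_combination (-(β.dim : ZMod 2)) * (CharTwo.two_eq_zero : (2 : ZMod 2) = 0)

theorem sum_eq_ind {n : ℕ} (f : Fin n → ZMod 2) (i : Fin n) :
    ∑ j, f j = (∑ j, ind (j < i) * f j) + f i + ∑ j, ind (i < j) * f j := by
  have : f i = ∑ j, ind (j = i) * f j := by simp [ind_mul]
  rw [this, ← Finset.sum_add_distrib, ← Finset.sum_add_distrib]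
  refine Finset.sum_congr rfl fun j _ => ?_
  rcases lt_trichotomy j i with h | h | h
  · simp [ind, h, h.ne, h.not_gt]
  · simp [ind, h]
  · simp [ind, h, h.ne', h.not_gt]

/-- The composites with the faces of the outer cell cancel those with the cofaces of the inner cells. -/
theorem coface_face_cancel (p : V.Ball → ℤ) (hα : ∀ μ, ((α μ).1 : ℤ) - (α μ).2.dim = p μ) :
    eps k ((∑ μ, p μ : ℤ) : ZMod 2) •
        condensedComp k F (fun μ => ab (α μ)) (faceD k ⟨K, β⟩) =
      ∑ μ, eps k ((∑ μ' ∈ Finset.Iio μ, p μ' : ℤ) : ZMod 2) • condensedComp k F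
        (Function.update (fun μ => ab (α μ)) μ (cofaceD k (α μ))) (ab ⟨K, β⟩) := by
  rw [← compL_apply, faceD, map_sum, Finset.smul_sum, sum_pts]
  refine Finset.sum_congr rfl fun μ _ => ?_
  simp only
  by_cases hm : (α μ).1 + 1 = β.1 μ ∧ ∀ μ' ≠ μ, (α μ').1 = β.1 μ'
  · rw [← compM_apply, cofaceD, MultilinearMap.map_update_sum, Finset.smul_sum,
      show (β.1 μ + 1) = (α μ).1 + 2 by omega]
    refine Finset.sum_congr rfl fun j _ => ?_
    obtain ⟨γ, h⟩ := exists_isComp F (β := β)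
      (α := Function.update α μ ⟨(α μ).1 + 1, (α μ).2.coface j⟩) (fun μ' => by
        rcases eq_or_ne μ' μ with rfl | hne
        · simpa using hm.1
        · simpa [hne] using hm.2 μ' hne)
    have h' := h.fc_outer
    have h1 : 1 ≤ β.1 (μ, (j : ℕ)).1 := by simp only; omega
    rw [Sigma.eta, Function.update_eq_self] at h'
    rw [if_pos h1, map_smul, compL_apply, h'.comp_ab, MultilinearMap.map_update_smul, update_ab,
      compM_apply, h.comp_ab, smul_smul, smul_smul, smul_smul, smul_smul, ← eps_add, ← eps_add,
      ← eps_add, ← eps_add]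
    refine eps_smul_eq ?_ _
    have eJ : zc β.1 = zc (β.fc (μ, (j : ℕ))).1 + Pi.single μ 1 := by
      rw [fc_fst, zc_lo h1, add_assoc, ← Pi.single_add, CharTwo.add_self_eq_zero, Pi.single_zero,
        add_zero]
    have hJ : ∀ μ', ((α μ').1 : ZMod 2) = zc (β.fc (μ, (j : ℕ))).1 μ' := fun μ' => by
      rw [zc, h'.idx]
    have ep : ∀ μ', (p μ' : ZMod 2) = zc (β.fc (μ, (j : ℕ))).1 μ' + (α μ').2.dim := fun μ' => by
      rw [← hα, ← hJ]
      push_cast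
      rw [CharTwo.sub_eq_add]
    have ex1 : (ex β.1 (μ, (j : ℕ)) : ZMod 2) =
        (∑ μ', ind (μ' < μ) * zc (β.fc (μ, (j : ℕ))).1 μ') + (j : ℕ) := by
      refine (ex_cast _ _).trans ?_
      congr 1
      refine Finset.sum_congr rfl fun μ' _ => ?_
      rw [ind_mul, ind_mul]
      refine ite_congr rfl (fun hlt => ?_) fun _ => rfl
      rw [eJ, Pi.add_apply, Pi.single_eq_of_ne hlt.ne, add_zero]
    have e := h'.sgn_outer (zc (β.fc (μ, (j : ℕ))).1) μ
    rw [ex1, eJ, e, hJ]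
    push_cast
    rw [sum_eq_ind (fun μ' => (p μ' : ZMod 2)) μ, sum_Iio_ind (fun μ' => (p μ' : ZMod 2))]
    simp only [ep, mul_add, Finset.sum_add_distrib]
    grind
  · have hz : condensedComp k F (Function.update (fun μ => ab (α μ)) μ (cofaceD k (α μ)))
        (ab ⟨K, β⟩) = 0 := by
      rw [← compM_apply, cofaceD, MultilinearMap.map_update_sum]
      refine Finset.sum_eq_zero fun j _ => ?_
      rw [MultilinearMap.map_update_smul, update_ab, compM_apply]
      have : ∃ μ', (Function.update α μ ⟨(α μ).1 + 1, (α μ).2.coface j⟩ μ').1 ≠ β.1 μ' := by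
        by_contra! hall
        refine hm ⟨by simpa using hall μ, fun μ' hne => by simpa [hne] using hall μ'⟩
      obtain ⟨μ', hμ'⟩ := this
      rw [comp_ab_of_ne hμ', smul_zero]
    rw [hz, smul_zero]
    refine Finset.sum_eq_zero fun i _ => ?_
    split_ifs with h1
    · rw [map_smul, compL_apply]
      have : ∃ μ', (α μ').1 ≠ (β.fc (μ, (i : ℕ))).1 μ' := by
        by_contra! hall
        simp only [fc_fst, lo_apply] at hall
        refine hm ⟨?_, fun μ' hne => ?_⟩
        · have := hall μ
          rw [if_pos rfl] at this
          omega
        · have := hall μ'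
          rwa [if_neg hne] at this
      obtain ⟨μ', hμ'⟩ := this
      rw [comp_ab_of_ne hμ', smul_zero, smul_zero]
    · rw [map_zero, smul_zero]

theorem dtot_comp_ab (p : V.Ball → ℤ) (hα : ∀ μ, ((α μ).1 : ℤ) - (α μ).2.dim = p μ) :
    dtot k U (condensedComp k F (fun μ => ab (α μ)) (ab ⟨K, β⟩)) =
      (∑ μ, eps k ((∑ μ' ∈ Finset.Iio μ, p μ' : ℤ) : ZMod 2) • condensedComp k F
        (Function.update (fun μ => ab (α μ)) μ (dtot k (T μ) (ab (α μ)))) (ab ⟨K, β⟩)) +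
      eps k ((∑ μ, p μ : ℤ) : ZMod 2) •
        condensedComp k F (fun μ => ab (α μ)) (dtot k V (ab ⟨K, β⟩)) := by
  have hr : ∀ μ, condensedComp k F
      (Function.update (fun μ => ab (α μ)) μ (dtot k (T μ) (ab (α μ)))) (ab ⟨K, β⟩) =
      condensedComp k F (Function.update (fun μ => ab (α μ)) μ (faceD k (α μ))) (ab ⟨K, β⟩) -
      condensedComp k F (Function.update (fun μ => ab (α μ)) μ (cofaceD k (α μ))) (ab ⟨K, β⟩) := by
    intro μ
    rw [dtot_ab]
    exact (compM k F _).map_update_sub _ _ _ _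
  have hl : condensedComp k F (fun μ => ab (α μ)) (dtot k V (ab ⟨K, β⟩)) =
      condensedComp k F (fun μ => ab (α μ)) (faceD k ⟨K, β⟩) -
      condensedComp k F (fun μ => ab (α μ)) (cofaceD k ⟨K, β⟩) := by
    rw [dtot_ab]
    exact (compL k F _).map_sub _ _
  simp only [hr, hl, smul_sub, Finset.sum_sub_distrib, coface_face_cancel p hα]
  by_cases hm : ∀ μ, (α μ).1 = β.1 μ
  · obtain ⟨γ, h⟩ := exists_isComp F hm
    rw [← faceD_comp p hα h, ← cofaceD_comp p hα h, h.comp_ab, map_smul, dtot_ab, smul_sub]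
    abel
  · obtain ⟨μ₀, hμ₀⟩ := not_forall.1 hm
    have h1 : condensedComp k F (fun μ => ab (α μ)) (cofaceD k ⟨K, β⟩) = 0 := by
      rw [← compL_apply, cofaceD, map_sum]
      refine Finset.sum_eq_zero fun j _ => ?_
      rw [map_smul, compL_apply, comp_ab_of_ne (β := β.coface j) (μ := μ₀) hμ₀, smul_zero]
    have h2 : ∀ μ, condensedComp k F (Function.update (fun μ => ab (α μ)) μ (faceD k (α μ)))
        (ab ⟨K, β⟩) = 0 := by
      intro μ
      rw [← compM_apply, faceD, MultilinearMap.map_update_sum]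
      refine Finset.sum_eq_zero fun c _ => ?_
      split_ifs
      · rw [MultilinearMap.map_update_smul, update_ab, compM_apply, comp_ab_of_ne (μ := μ₀),
          smul_zero]
        rcases eq_or_ne μ₀ μ with rfl | hne
        · simpa using hμ₀
        · simpa [hne] using hμ₀
      · rw [MultilinearMap.map_update_zero]
    rw [comp_ab_of_ne hμ₀, map_zero, h1]
    simp only [h2, smul_zero, Finset.sum_const_zero]
    abel

/-- The Leibniz rule for the composition of `|seq|`. -/
theorem dtot_comp (F : Fibration P T) {x : ∀ μ, Fam k (T μ)} {y : Fam k V} {p : V.Ball → ℤ} {q : ℤ}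
    (hx : ∀ μ, x μ ∈ degS k (T μ) (p μ)) (hy : y ∈ degS k V q) :
    dtot k U (condensedComp k F x y) =
      (∑ μ, eps k ((∑ μ' ∈ Finset.Iio μ, p μ' : ℤ) : ZMod 2) • condensedComp k F
        (Function.update x μ (dtot k (T μ) (x μ))) y) +
      eps k ((∑ μ, p μ : ℤ) : ZMod 2) • condensedComp k F x (dtot k V y) := by
  rw [← sub_eq_zero]
  funext n
  refine LocLin.eq_zero (k := k) (h := fun y => (dtot k U (condensedComp k F x y) -
      ((∑ μ, eps k ((∑ μ' ∈ Finset.Iio μ, p μ' : ℤ) : ZMod 2) • condensedComp k F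
        (Function.update x μ (dtot k (T μ) (x μ))) y) +
      eps k ((∑ μ, p μ : ℤ) : ZMod 2) • condensedComp k F x (dtot k V y))) n) ?_ ?_ hy
  · simp only [Pi.sub_apply, Pi.add_apply, Finset.sum_apply, Pi.smul_apply]
    refine LocLin.sub ?_ (LocLin.add (LocLin.sum _ fun μ _ => LocLin.smul ?_ _) (LocLin.smul ?_ _))
    · exact (LocLin.dtot_apply n).comp (locLin_comp F x)
    · exact locLin_comp F _ n
    · exact (locLin_comp F x n).comp LocLin.dtot_apply
  · rintro ⟨K, β⟩ -
    refine LocMulti.eq_zero (k := k) (D := fun x => (dtot k U (condensedComp k F x (ab ⟨K, β⟩)) -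
      ((∑ μ, eps k ((∑ μ' ∈ Finset.Iio μ, p μ' : ℤ) : ZMod 2) • condensedComp k F
        (Function.update x μ (dtot k (T μ) (x μ))) (ab ⟨K, β⟩)) +
      eps k ((∑ μ, p μ : ℤ) : ZMod 2) • condensedComp k F x (dtot k V (ab ⟨K, β⟩)))) n) ?_ ?_ hx
    · simp only [Pi.sub_apply, Pi.add_apply, Finset.sum_apply, Pi.smul_apply]
      refine LocMulti.sub ?_
        (LocMulti.add (LocMulti.sum _ fun μ _ => LocMulti.smul ?_ _) (LocMulti.smul ?_ _))
      · exact LocMulti.post (LocLin.dtot_apply n) (locMulti_comp F _)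
      · exact (locMulti_comp F _ n).update μ (e := dtot k (T μ)) LocLin.dtot_apply
      · exact locMulti_comp F _ n
    · intro α hα
      rw [dtot_comp_ab p hα, sub_self]
      rfl

end DComp

/-! ### Associativity and units -/

section Assoc

variable {k : Type u} [Field k] {U V W : TwoDisk} {P : Hom U V} {Q : Hom V W} {S : Hom U W}
  {A : V.Ball → TwoDisk} {B C : W.Ball → TwoDisk} {F : Fibration P A} {G : Fibration Q B}
  {H : Fibration S C} {R : ∀ w, Hom (C w) (B w)} {L : ∀ w, Fibration (R w) (fun b => A (G.glob w b))}

/-- The exponent of the Koszul sign of associativity. -/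
def assocSign (Q : Hom V W) (p : V.Ball → ℤ) (q : W.Ball → ℤ) : ℤ :=
  (∑ v, ∑ v' ∈ Finset.Ioi v, if Q v' < Q v then p v * p v' else 0) +
    (∑ w, ∑ v, if w < Q v then q w * p v else 0)

theorem assocSign_cast (Q : Hom V W) (p : V.Ball → ℤ) (q : W.Ball → ℤ) :
    (assocSign Q p q : ZMod 2) =
      quad (fun v v' => ind (v < v' ∧ Q v' < Q v)) (fun v => (p v : ZMod 2)) (fun v => p v) +
      quad (fun w v => ind (w < Q v)) (fun w => (q w : ZMod 2)) (fun v => p v) := by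
  simp only [assocSign, quad]
  push_cast
  simp only [sum_Ioi_ind]
  congr 1
  · refine Finset.sum_congr rfl fun v _ => Finset.sum_congr rfl fun v' _ => ?_
    simp only [ind]
    split_ifs <;> simp_all
  · refine Finset.sum_congr rfl fun v _ => Finset.sum_congr rfl fun v' _ => ?_
    simp only [ind]
    split_ifs <;> simp_all

theorem Cell.IsComp.sum_fiber {T : V.Ball → TwoDisk} {F : Fibration P T} {K : ℕ} {β : Cell V K}
    {α : ∀ μ, ACell (T μ)} {γ : Cell U K} (h : IsComp F β α γ) (μ : V.Ball) :
    ∑ ν with P ν = μ, zc γ.1 ν = ((α μ).2.dim : ZMod 2) := by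
  have := h.sum_ind_dim (· = μ)
  simp only [ind_mul, Finset.sum_ite_eq', Finset.mem_univ, if_true, ← Finset.sum_filter] at this
  exact this.symm

theorem comp_comp_ab (hS : ∀ ν, S ν = Q (P ν))
    (hR : ∀ w c, G.glob w (R w c) = P (H.glob w c))
    (x : ∀ v, ACell (A v)) (y : ∀ w, ACell (B w)) {K : ℕ} (z : Cell W K) {p : V.Ball → ℤ}
    {q : W.Ball → ℤ} (hx : ∀ v, ((x v).1 : ℤ) - (x v).2.dim = p v)
    (hy : ∀ w, ((y w).1 : ℤ) - (y w).2.dim = q w) :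
    condensedComp k H (fun w => condensedComp k (L w) (fun b => ab (x (G.glob w b))) (ab (y w)))
        (ab ⟨K, z⟩) =
      eps k (assocSign Q p q : ZMod 2) •
        condensedComp k F (fun v => ab (x v)) (condensedComp k G (fun w => ab (y w)) (ab ⟨K, z⟩)) := by
  by_cases hin : ∀ w b, (x (G.glob w b)).1 = (y w).2.1 b
  · choose g hg using fun w => exists_isComp (L w) (β := (y w).2)
      (α := fun b => x (G.glob w b)) (hin w)
    have e1 : ∀ w, condensedComp k (L w) (fun b => ab (x (G.glob w b))) (ab (y w)) =
        eps k (sgn (R w) (zc (y w).2.1) (zc (g w).1)) • ab ⟨(y w).1, g w⟩ := fun w =>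
      (hg w).comp_ab
    rw [← compM_apply]
    simp only [e1]
    rw [MultilinearMap.map_smul_univ, compM_apply, prod_eps]
    by_cases hout : ∀ w, (y w).1 = z.1 w
    · obtain ⟨γ, hγ⟩ := exists_isComp H (β := z) (α := fun w => ⟨(y w).1, g w⟩) hout
      obtain ⟨δ, hδ⟩ := exists_isComp G (β := z) (α := y) hout
      have h : IsComp F δ x γ := IsComp.assoc hS hR hg hγ hδ
      rw [hγ.comp_ab, hδ.comp_ab, ← compL_apply, map_smul, compL_apply, h.comp_ab, smul_smul,
        smul_smul, smul_smul, ← eps_add, ← eps_add, ← eps_add]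
      refine eps_smul_eq ?_ _
      have e := sgn_assoc G H hS hR (zc z.1) (zc δ.1) (zc γ.1)
      have e2 : ∀ w, sgn (R w) (zc (y w).2.1) (zc (g w).1) =
          sgn (R w) (fun b => zc δ.1 (G.glob w b)) (fun c => zc γ.1 (H.glob w c)) := by
        intro w
        congr 1
        · funext b
          rw [zc, zc, hδ.len]
        · funext c
          rw [zc, zc, hγ.len]
      have e3 : (zc δ.1 + fun v => ∑ ν with P ν = v, zc γ.1 ν) = fun v => (p v : ZMod 2) := by
        funext v
        rw [Pi.add_apply, h.sum_fiber, ← hx, zc, ← h.idx]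
        push_cast
        rw [CharTwo.sub_eq_add]
      have e4 : (zc z.1 + fun w => ∑ v with Q v = w, zc δ.1 v) = fun w => (q w : ZMod 2) := by
        funext w
        rw [Pi.add_apply, hδ.sum_fiber, ← hy, zc, ← hδ.idx]
        push_cast
        rw [CharTwo.sub_eq_add]
      rw [e3, e4] at e
      simp only [e2, assocSign_cast]
      rw [add_comm, e]
      abel
    · obtain ⟨w, hw⟩ := not_forall.1 hout
      rw [comp_ab_of_ne (μ := w) (α := fun w => ⟨(y w).1, g w⟩) hw,
        comp_ab_of_ne (μ := w) (α := y) hw, ← compL_apply, map_zero, smul_zero, smul_zero]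
  · obtain ⟨w, hw⟩ := not_forall.1 hin
    obtain ⟨b, hb⟩ := not_forall.1 hw
    have e1 : condensedComp k (L w) (fun b => ab (x (G.glob w b))) (ab (y w)) = 0 :=
      comp_ab_of_ne (β := (y w).2) (α := fun b => x (G.glob w b)) hb
    rw [← compM_apply, (compM k H _).map_coord_zero w e1]
    by_cases hout : ∀ w, (y w).1 = z.1 w
    · obtain ⟨δ, hδ⟩ := exists_isComp G (β := z) (α := y) hout
      have : (x (G.glob w b)).1 ≠ δ.1 (G.glob w b) := by rwa [hδ.len]
      rw [hδ.comp_ab, ← compL_apply, map_smul, compL_apply, comp_ab_of_ne this, smul_zero,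
        smul_zero]
    · obtain ⟨w', hw'⟩ := not_forall.1 hout
      rw [comp_ab_of_ne (μ := w') (α := y) hw', ← compL_apply, map_zero, smul_zero]

theorem comp_comp (hS : ∀ ν, S ν = Q (P ν))
    (hR : ∀ w c, G.glob w (R w c) = P (H.glob w c))
    {x : ∀ v, Fam k (A v)} {y : ∀ w, Fam k (B w)} {z : Fam k W} {p : V.Ball → ℤ}
    {q : W.Ball → ℤ} {r : ℤ} (hx : ∀ v, x v ∈ degS k (A v) (p v))
    (hy : ∀ w, y w ∈ degS k (B w) (q w)) (hz : z ∈ degS k W r) :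
    condensedComp k H (fun w => condensedComp k (L w) (fun b => x (G.glob w b)) (y w)) z =
      eps k (assocSign Q p q : ZMod 2) • condensedComp k F x (condensedComp k G y z) := by
  rw [← sub_eq_zero]
  funext n
  refine LocLin.eq_zero (k := k) (h := fun z => (condensedComp k H
    (fun w => condensedComp k (L w) (fun b => x (G.glob w b)) (y w)) z -
      eps k (assocSign Q p q : ZMod 2) • condensedComp k F x (condensedComp k G y z)) n) ?_ ?_ hz
  · exact (locLin_comp H _ n).sub
      (((locLin_comp F x n).comp (locLin_comp G y)).smul _)
  rintro ⟨K, ζ⟩ -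
  refine LocMulti.eq_zero (k := k) (D := fun y => (condensedComp k H
    (fun w => condensedComp k (L w) (fun b => x (G.glob w b)) (y w)) (ab ⟨K, ζ⟩) -
      eps k (assocSign Q p q : ZMod 2) •
        condensedComp k F x (condensedComp k G y (ab ⟨K, ζ⟩))) n) ?_ ?_ hy
  · have h1 := (locMulti_comp H (ab ⟨K, ζ⟩ : Fam k W) n).pre (T' := B)
      (e := fun w y => condensedComp k (L w) (fun b => x (G.glob w b)) y)
      fun w => locLin_comp (L w) _
    have h2 := LocMulti.post (D := fun y => condensedComp k G y (ab ⟨K, ζ⟩))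
      (locLin_comp F x n) (locMulti_comp G _)
    exact h1.sub (h2.smul _)
  intro η hη
  refine LocMulti.eq_zero (k := k) (D := fun x => (condensedComp k H
    (fun w => condensedComp k (L w) (fun b => x (G.glob w b)) (ab (η w))) (ab ⟨K, ζ⟩) -
      eps k (assocSign Q p q : ZMod 2) •
        condensedComp k F x (condensedComp k G (fun w => ab (η w)) (ab ⟨K, ζ⟩))) n) ?_ ?_ hx
  · have h2 := (locMulti_comp F (condensedComp k G (fun w => ab (η w)) (ab ⟨K, ζ⟩)) n).smul
      (eps k (assocSign Q p q : ZMod 2))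
    have hinj : ∀ w w' b b', G.glob w b = G.glob w' b' → w = w' := fun w w' b b' h => by
      by_contra hne
      exact G.glob_ne hne _ _ h
    have h1 := LocMulti.nest (k := k) (T := A) (B := fun w => (B w).Ball)
      (locMulti_comp H (ab ⟨K, ζ⟩ : Fam k W) n) (fun w => G.glob w)
      (fun v => ⟨Q v, G.loc v, G.glob_loc v⟩) hinj (fun w b b' h => G.glob_inj.1 h)
      (E := fun w x => condensedComp k (L w) x (ab (η w)))
      (fun w => locMulti_comp (L w) (ab (η w)))
    exact h1.sub h2
  intro ξ hξ
  beta_reduce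
  rw [comp_comp_ab hS hR ξ η ζ hξ hη, sub_self]
  rfl

end Assoc

section Units

variable {k : Type u} [Field k] {U V : TwoDisk} {P : Hom U V} {T : V.Ball → TwoDisk}
  {F : Fibration P T}

theorem comp_mem_degS {x : ∀ μ, Fam k (T μ)} {y : Fam k V} {p : V.Ball → ℤ} {q : ℤ}
    (hx : ∀ μ, x μ ∈ degS k (T μ) (p μ)) (hy : y ∈ degS k V q) :
    condensedComp k F x y ∈ degS k U ((∑ μ, p μ) + q) := by
  rw [mem_degS]
  intro n
  rw [← Submodule.Quotient.mk_eq_zero]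
  refine LocLin.eq_zero (k := k) (h := fun y => Submodule.mkQ (Finsupp.supported k k
    {x : Cell U n | (n : ℤ) - x.dim = (∑ μ, p μ) + q}) (condensedComp k F x y n)) ?_ ?_ hy
  · exact (locLin_comp F x n).map _
  rintro ⟨K, β⟩ hβ
  refine LocMulti.eq_zero (k := k) (D := fun x => Submodule.mkQ (Finsupp.supported k k
    {x : Cell U n | (n : ℤ) - x.dim = (∑ μ, p μ) + q}) (condensedComp k F x (ab ⟨K, β⟩) n))
    ?_ ?_ hx
  · exact (locMulti_comp F _ n).map _
  intro α hα
  rw [Submodule.mkQ_apply, Submodule.Quotient.mk_eq_zero]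
  by_cases hm : ∀ μ, (α μ).1 = β.1 μ
  · obtain ⟨γ, h⟩ := exists_isComp F hm
    rw [h.comp_ab, Pi.smul_apply]
    refine Submodule.smul_mem _ _ ?_
    rcases eq_or_ne n K with rfl | hne
    · rw [ab_self]
      refine Finsupp.single_mem_supported _ _ ?_
      have hβ : (n : ℤ) - β.dim = q := hβ
      simp only [Set.mem_ofPred_eq, ← hβ, h.dim_eq, ← hα, Finset.sum_sub_distrib, h.idx]
      push_cast [dim]
      ring
    · rw [ab_of_ne _ hne]
      exact Submodule.zero_mem _
  · obtain ⟨μ, hμ⟩ := not_forall.1 hm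
    rw [comp_ab_of_ne hμ]
    exact Submodule.zero_mem _

theorem comp_congr_right (x : ∀ μ, Fam k (T μ)) {y y' : Fam k V} {K : ℕ} (h : y K = y' K) :
    condensedComp k F x y K = condensedComp k F x y' K := by
  rw [condensedComp_eq, condensedComp_eq, h]

theorem comp_congr_left {x x' : ∀ μ, Fam k (T μ)} {K : ℕ} {β : Cell V K}
    (h : ∀ μ, x μ (β.1 μ) = x' μ (β.1 μ)) :
    condensedComp k F x (ab ⟨K, β⟩) = condensedComp k F x' (ab ⟨K, β⟩) := by
  funext n
  rw [condensedComp_eq, condensedComp_eq]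
  rcases eq_or_ne n K with rfl | hne
  · rw [ab_self, Finsupp.linearCombination_single, Finsupp.linearCombination_single,
      show (fun μ => x μ (β.1 μ)) = fun μ => x' μ (β.1 μ) from funext h]
  · rw [ab_of_ne _ hne, map_zero, map_zero]

/-- The unit of `|seq|`. -/
noncomputable def oneFam (k : Type u) [Field k] : Fam k point :=
  fun m => Finsupp.single (idCell m) 1

theorem sgn_point {P : Hom U point} (J : point.Ball → ZMod 2) (ℓ : U.Ball → ZMod 2) :
    sgn P J ℓ = 0 := by
  have h : ∀ a b : point.Ball, ¬ a < b := fun a b => by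
    rw [Subsingleton.elim (α := Fin 1) a b]; exact lt_irrefl _
  simp [sgn, quad, ind, h]

theorem sgn_id {P : Hom U U} (hP : ∀ ν, P ν = ν) (J : U.Ball → ZMod 2) : sgn P J J = 0 := by
  have h : ∀ a b : U.Ball, ind (a < b ∧ b < a) = 0 := fun a b => if_neg fun h => lt_asymm h.1 h.2
  have h2 : quad (fun ν ν' => ind (ν < ν' ∧ ν' < ν)) J J = 0 := by simp [quad, h]
  simp only [sgn, hP, h2, add_zero]
  exact CharTwo.add_self_eq_zero _

theorem comp_oneFam {P : Hom U point} (F : Fibration P (fun _ => U)) {n : ℤ} {x : Fam k U}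
    (hx : x ∈ degS k U n) : condensedComp k F (fun _ => x) (oneFam k) = x := by
  rw [← sub_eq_zero]
  funext K
  refine LocLin.eq_zero (k := k)
    (h := fun x => (condensedComp k F (fun _ => x) (oneFam k) - x) K) ?_ ?_ hx
  · refine LocLin.sub ?_ (LocLin.eval K)
    have := locMulti_comp F (oneFam k) K (fun _ => 0) (0 : Fin 1)
    have e : ∀ f : Fam k U, (Function.update (fun _ => 0) (0 : Fin 1) f : point.Ball → Fam k U) =
        fun _ => f := fun f => by
      funext i
      obtain rfl := Subsingleton.elim (α := Fin 1) i 0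
      exact Function.update_self _ _ _
    simpa only [e] using this
  rintro ⟨m, x⟩ -
  rw [Pi.sub_apply, sub_eq_zero,
    comp_congr_right (y' := ab ⟨K, idCell K⟩) _ (by rw [ab_self]; rfl)]
  rcases eq_or_ne m K with rfl | hne
  · rw [(IsComp.unit_outer F x).comp_ab, sgn_point, eps_zero, one_smul]
  · rw [comp_ab_of_ne (μ := (0 : Fin 1)) (α := fun _ => ⟨m, x⟩) hne, ab_of_ne _ hne.symm]
    rfl

theorem oneFam_comp {P : Hom U U} (F : Fibration P (fun _ => point)) (hP : ∀ ν, P ν = ν) {n : ℤ}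
    {x : Fam k U} (hx : x ∈ degS k U n) : condensedComp k F (fun _ => oneFam k) x = x := by
  rw [← sub_eq_zero]
  funext K
  refine LocLin.eq_zero (k := k)
    (h := fun x => (condensedComp k F (fun _ => oneFam k) x - x) K) ?_ ?_ hx
  · exact (locLin_comp F _ K).sub (LocLin.eval K)
  rintro ⟨m, x⟩ -
  rw [comp_congr_left (x' := fun ν => ab ⟨x.1 ν, idCell (x.1 ν)⟩)
    (fun μ => by rw [ab_self]; rfl), (IsComp.unit_inner F hP x).comp_ab, sgn_id hP, eps_zero,
    one_smul, sub_self]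
  rfl

theorem dim_idCell (m : ℕ) : (idCell m).dim = m := Fin.sum_univ_one _

/-- The ball of the disk with a single ball. -/
def pointBall : point.Ball := (0 : Fin 1)

theorem eq_pointBall (ν : point.Ball) : ν = pointBall := Subsingleton.elim (α := Fin 1) _ _

theorem ecut_idCell (m : ℕ) : (idCell m).ecut (pointBall, m) = idCell (m + 1) := by
  have h0 : ∀ ν : point.Ball, ν = pointBall := eq_pointBall
  have hl : ((idCell m).ecut (pointBall, m)).1 = (idCell (m + 1)).1 := by
    funext ν
    rw [ecut_fst, hi_apply, if_pos (h0 ν)]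
    rfl
  refine ext' hl ?_ ?_
  · rintro ⟨ν, i⟩ ⟨ν', j⟩ _ _ h
    obtain rfl := (h0 ν).trans (h0 ν').symm
    rw [Cell.rel_same] at h ⊢
    rwa [← hl]
  · rintro ⟨ν, i⟩ ha
    obtain rfl := h0 ν
    have hi : i ≤ m + 1 := by
      rw [hl, mem_pts] at ha
      exact ha
    rw [lab_idCell (a := (pointBall, i)) hi, lab_ecut (x := idCell m) (z := (pointBall, m)) (mem_pts.2 le_rfl) ha]
    have hs : smap (pointBall, m) (pointBall, i) =
        (pointBall, if m < i then i - 1 else i) := by simp [smap, sφ]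
    rw [hs, lab_idCell (by simp only; split_ifs <;> omega), Cell.rel_same]
    simp only [nx, Prod.mk.injEq, true_and]
    split_ifs <;> omega

/-- The unit of `|seq|` is the whiskering of its component at `[0]`. -/
theorem isWhiskered_oneFam : IsWhiskered 0 (oneFam k) := by
  classical
  refine .of_zero (Finsupp.single_mem_supported _ _ (dim_idCell 0)) fun m => ?_
  change Finsupp.single (idCell (m + 1)) (1 : k) =
    (-1 : k) ^ (0 + m) • eop k m (Finsupp.single (idCell m) 1)
  rw [eop_single]
  refine Eq.trans ?_ (congrArg _ (Finset.sum_eq_single (pointBall, m) ?_ ?_).symm)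
  · rw [lab_idCell (m := m) (a := (pointBall, m)) le_rfl, if_pos rfl, ecut_idCell, smul_smul, ← pow_add, ex,
      neg_one_pow_of_mod_eq (b := 0), pow_zero, one_smul]
    have : (Finset.Iio pointBall) = ∅ := by decide
    rw [this, Finset.sum_empty]
    omega
  · rintro ⟨ν, i⟩ hi hne
    have hi : i ≤ m := mem_pts.1 hi
    rw [lab_idCell hi, if_neg]
    rintro rfl
    exact hne (by rw [eq_pointBall ν])
  · intro h
    exact absurd (mem_pts.2 le_rfl) h

theorem chainD_idCell_zero : chainD k point 0 (Finsupp.single (idCell 0) 1) = 0 := by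
  rw [chainD_single']
  exact Finset.sum_eq_zero fun w _ => if_neg (by simp [idCell])

/-- The unit is a cocycle: it is whiskered, and its component at `[0]` is a cocycle. -/
theorem dtot_oneFam : dtot k point (oneFam k) = 0 := by
  refine isWhiskered_oneFam.dtot_eq (fun m => ?_) chainD_idCell_zero
  simp

end Units

/-- The condensation of `seq` is a dg 2-operad. -/
theorem isDg2Operad_condensedSeq (k : Type u) [Field k] : IsDg2Operad (condensedSeq k) where
  d_mem U n x hx := dtot_mem hx
  d_d U n x _ := dtot_dtot x
  comp_add_left F x y μ a b := (compM k F y).map_update_add x μ a b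
  comp_smul_left F x y μ c a := (compM k F y).map_update_smul x μ c a
  comp_add_right F x a b := (compL k F x).map_add a b
  comp_smul_right F x c a := (compL k F x).map_smul c a
  comp_mem F x y p q hx hy := comp_mem_degS hx hy
  d_comp F x y p q hx hy := by
    simp only [negOnePow_smul (k := k)]
    exact dtot_comp F hx hy
  assoc F G H R K hS hR x y z p q r hx hy hz := by
    rw [negOnePow_smul (k := k)]
    exact comp_comp (G := G) hS hR hx hy hz
  one_mem := by
    refine mem_degS.2 fun m => Finsupp.single_mem_supported _ _ ?_
    simp [dim_idCell]
  d_one := dtot_oneFam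
  comp_one F n x hx := comp_oneFam F hx
  one_comp F hP n x hx := oneFam_comp F hP hx

/-! ### Whiskering and composition -/

section WhiskerComp

variable {k : Type u} [Field k] {U V : TwoDisk} {P : Hom U V} {T : V.Ball → TwoDisk}
  {F : Fibration P T} {K : ℕ}

/-- The insertion of a cut at the points with label `t`, on families. -/
noncomputable def efam (t : ℕ) : Fam k U →ₗ[k] Fam k U := LinearMap.pi fun m =>
  match m with
  | 0 => 0
  | m + 1 => eop k t ∘ₗ LinearMap.proj m

theorem efam_succ (t : ℕ) (f : Fam k U) (m : ℕ) : efam t f (m + 1) = eop k t (f m) := rfl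

theorem locLin_efam (t m : ℕ) : LocLin k (fun f : Fam k U => efam t f m) := by
  cases m with
  | zero => exact LocLin.zero
  | succ m => exact (LocLin.eval m).map (eop k t)

theorem efam_ab (t : ℕ) (c : ACell U) : (efam t (ab c) : Fam k U) =
    ∑ z ∈ pts c.2.1, if c.2.lab z = t then eps k (ex c.2.1 z) • ab ⟨c.1 + 1, c.2.ecut z⟩ else 0 := by
  classical
  obtain ⟨m, x⟩ := c
  funext n
  rw [Finset.sum_apply]
  cases n with
  | zero =>
    refine (Finset.sum_eq_zero fun z _ => ?_).symm
    split_ifs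
    · rw [Pi.smul_apply, ab_of_ne _ (Nat.succ_ne_zero m).symm, smul_zero]
    · rfl
  | succ n =>
    rw [efam_succ]
    rcases eq_or_ne n m with rfl | h
    · rw [ab_self, eop_single]
      refine Finset.sum_congr rfl fun z _ => ?_
      split_ifs
      · rw [Pi.smul_apply, ab_self, eps_natCast]
      · rfl
    · rw [ab_of_ne _ h, map_zero]
      refine (Finset.sum_eq_zero fun z _ => ?_).symm
      split_ifs
      · rw [Pi.smul_apply, ab_of_ne _ (by simpa using h), smul_zero]
      · rfl

variable {β : Cell V K} {α : ∀ μ, ACell (T μ)} {γ : Cell U K}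

/-- The change of the Koszul sign under an insertion in an inner and in the outer cell. -/
theorem Cell.IsComp.sgn_ecut (p : V.Ball → ℤ) (hα : ∀ μ, ((α μ).1 : ℤ) - (α μ).2.dim = p μ)
    (h : IsComp F β α γ) (μ : V.Ball) (c : (T μ).Ball × ℕ) (t : ℕ) :
    (ex β.1 (μ, t) : ZMod 2) + (p μ : ZMod 2) + t + ex (α μ).2.1 c +
        sgn P (zc (hi β.1 (μ, t))) (zc (hi γ.1 (F.gp μ c))) =
      ((∑ μ, p μ : ℤ) : ZMod 2) + sgn P (zc β.1) (zc γ.1) + ex γ.1 (F.gp μ c) := by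
  have ep : ∀ μ', (p μ' : ZMod 2) = zc β.1 μ' + (α μ').2.dim := fun μ' => by
    rw [← hα, zc, ← h.idx]
    push_cast
    rw [CharTwo.sub_eq_add]
  have e1 : sgn P (zc β.1 + Pi.single μ 1) (zc γ.1 + Pi.single (F.glob μ c.1) 1) = _ :=
    h.sgn_inner (zc β.1 + Pi.single μ 1) c
  have e2 : (∑ μ', ind (μ' < μ) * (zc β.1 + Pi.single μ 1 : V.Ball → ZMod 2) μ') =
      ∑ μ', ind (μ' < μ) * zc β.1 μ' := by
    refine Finset.sum_congr rfl fun μ' _ => ?_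
    rw [ind_mul, ind_mul]
    refine ite_congr rfl (fun hlt => ?_) fun _ => rfl
    rw [Pi.add_apply, Pi.single_eq_of_ne hlt.ne, add_zero]
  have e3 : (ex β.1 (μ, t) : ZMod 2) = (∑ μ', ind (μ' < μ) * zc β.1 μ') + t := ex_cast _ _
  rw [zc_hi, zc_hi]
  change _ + sgn P (zc β.1 + Pi.single μ 1) (zc γ.1 + Pi.single (F.glob μ c.1) 1) = _
  rw [e1, e2, h.sgn_outer, e3]
  push_cast
  rw [sum_eq_ind (fun μ' => (p μ' : ZMod 2)) μ]
  simp only [ep, mul_add, Finset.sum_add_distrib]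
  grind

theorem Cell.IsComp.ecut_comp_ab (p : V.Ball → ℤ)
    (hα : ∀ μ, ((α μ).1 : ℤ) - (α μ).2.dim = p μ) (h : IsComp F β α γ) {μ : V.Ball}
    {c : (T μ).Ball × ℕ} (hc : c ∈ pts (α μ).2.1) :
    eps k ((ex β.1 (μ, (α μ).2.lab c) : ZMod 2) + (p μ : ZMod 2) + (α μ).2.lab c) •
      eps k (ex (α μ).2.1 c : ZMod 2) • condensedComp k F
        (fun μ' => ab (Function.update α μ ⟨(α μ).1 + 1, (α μ).2.ecut c⟩ μ'))
        (ab ⟨K + 1, β.ecut (μ, (α μ).2.lab c)⟩) =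
      eps k ((∑ μ, p μ : ℤ) : ZMod 2) • eps k (sgn P (zc β.1) (zc γ.1)) •
        eps k (ex γ.1 (F.gp μ c) : ZMod 2) • (ab ⟨K + 1, γ.ecut (F.gp μ c)⟩ : Fam k U) := by
  rw [(h.ecut hc).comp_ab, smul_smul, smul_smul, smul_smul, smul_smul, ← eps_add, ← eps_add,
    ← eps_add, ← eps_add, ecut_fst, ecut_fst]
  refine eps_smul_eq ?_ _
  exact h.sgn_ecut p hα μ c _

/-- On cells, the insertions at the points labelled `u` of a composite are the simultaneous
insertions at the points `w` labelled `u` of the outer cell and at the points labelled `w.2` of the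
inner cells. -/
theorem efam_comp_ab (p : V.Ball → ℤ) (hα : ∀ μ, ((α μ).1 : ℤ) - (α μ).2.dim = p μ) (u : ℕ) :
    (∑ w ∈ pts β.1, if β.lab w = u then
      eps k ((ex β.1 w : ZMod 2) + (p w.1 : ZMod 2) + w.2) • condensedComp k F
        (Function.update (fun μ => ab (α μ)) w.1 (efam w.2 (ab (α w.1)))) (ab ⟨K + 1, β.ecut w⟩)
      else 0) =
    eps k ((∑ μ, p μ : ℤ) : ZMod 2) •
      efam u (condensedComp k F (fun μ => ab (α μ)) (ab ⟨K, β⟩)) := by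
  have e0 : ∀ w : V.Ball × ℕ, condensedComp k F
      (Function.update (fun μ => ab (α μ)) w.1 (efam w.2 (ab (α w.1)))) (ab ⟨K + 1, β.ecut w⟩) =
      ∑ c ∈ pts (α w.1).2.1, if (α w.1).2.lab c = w.2 then eps k (ex (α w.1).2.1 c) •
        condensedComp k F (fun μ => ab (Function.update α w.1 ⟨(α w.1).1 + 1, (α w.1).2.ecut c⟩ μ))
          (ab ⟨K + 1, β.ecut w⟩) else 0 := by
    intro w
    rw [efam_ab, ← compM_apply, MultilinearMap.map_update_sum]
    refine Finset.sum_congr rfl fun c _ => ?_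
    split_ifs
    · rw [MultilinearMap.map_update_smul, update_ab, compM_apply]
    · rw [MultilinearMap.map_update_zero]
  simp only [e0]
  by_cases hm : ∀ μ, (α μ).1 = β.1 μ
  · obtain ⟨γ, h⟩ := exists_isComp F hm
    rw [h.comp_ab, map_smul, efam_ab, h.sum_pts, sum_pts, Finset.smul_sum, Finset.smul_sum]
    refine Finset.sum_congr rfl fun μ _ => ?_
    have e1 : ∀ (q : Prop) [Decidable q] (s : Finset ((T μ).Ball × ℕ)) (a : k)
        (f : (T μ).Ball × ℕ → Fam k U),
        (if q then a • ∑ c ∈ s, f c else 0) = ∑ c ∈ s, if q then a • f c else 0 := by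
      intro q _ s a f
      split_ifs
      · rw [Finset.smul_sum]
      · rw [Finset.sum_const_zero]
    simp only [e1]
    rw [Finset.sum_comm, Finset.smul_sum, Finset.smul_sum]
    refine Finset.sum_congr rfl fun c hc => ?_
    have hl := h.lab_mem (μ := μ) c
    rw [Finset.sum_eq_single ⟨(α μ).2.lab c, Nat.lt_succ_iff.2 (mem_pts.1 hl)⟩]
    · rw [if_pos rfl, h.lab _ _ hc]
      split_ifs
      · exact h.ecut_comp_ab p hα hc
      · rw [smul_zero, smul_zero]
    · intro t _ ht
      have ht' : ¬ (α μ).2.lab c = t := (fun h' => ht (Fin.ext h'.symm))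
      simp only [if_neg ht', smul_zero, ite_self]
    · intro h'
      exact absurd (Finset.mem_univ _) h'
  · obtain ⟨μ, hμ⟩ := not_forall.1 hm
    rw [comp_ab_of_ne hμ, map_zero, smul_zero]
    refine Finset.sum_eq_zero fun w _ => ?_
    rw [Finset.sum_eq_zero, smul_zero, ite_self]
    intro c _
    rw [comp_ab_of_ne (μ := μ), smul_zero, ite_self]
    rw [ecut_fst, hi_apply]
    rcases eq_or_ne μ w.1 with rfl | hne
    · simpa using hμ
    · simpa [hne] using hμ

/-- Insertions in a composite come from simultaneous insertions in the outer and the inner cells. -/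
theorem efam_comp (F : Fibration P T) (β : Cell V K) {x : ∀ μ, Fam k (T μ)} {p : V.Ball → ℤ}
    (hx : ∀ μ, x μ ∈ degS k (T μ) (p μ)) (u : ℕ) :
    (∑ w ∈ pts β.1, if β.lab w = u then
      eps k ((ex β.1 w : ZMod 2) + (p w.1 : ZMod 2) + w.2) • condensedComp k F
        (Function.update x w.1 (efam w.2 (x w.1))) (ab ⟨K + 1, β.ecut w⟩)
      else 0) =
    eps k ((∑ μ, p μ : ℤ) : ZMod 2) • efam u (condensedComp k F x (ab ⟨K, β⟩)) := by
  rw [← sub_eq_zero]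
  funext n
  refine LocMulti.eq_zero (k := k) (D := fun x => ((∑ w ∈ pts β.1, if β.lab w = u then
      eps k ((ex β.1 w : ZMod 2) + (p w.1 : ZMod 2) + w.2) • condensedComp k F
        (Function.update x w.1 (efam w.2 (x w.1))) (ab ⟨K + 1, β.ecut w⟩)
      else 0) -
    eps k ((∑ μ, p μ : ℤ) : ZMod 2) • efam u (condensedComp k F x (ab ⟨K, β⟩))) n) ?_ ?_ hx
  · simp only [Pi.sub_apply, Finset.sum_apply, Pi.smul_apply]
    refine LocMulti.sub (LocMulti.sum _ fun w _ => ?_)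
      ((LocMulti.post (locLin_efam u n) (locMulti_comp F (ab ⟨K, β⟩))).smul _)
    split_ifs
    · simp only [Pi.smul_apply]
      exact ((locMulti_comp F (ab ⟨K + 1, β.ecut w⟩) n).update w.1 (e := efam w.2)
        (locLin_efam w.2)).smul _
    · exact fun _ _ => LocLin.zero
  · intro α hα
    beta_reduce
    rw [efam_comp_ab p hα, sub_self]
    rfl

/-- Insertions of cuts commute with the composition of families whose components are obtained from
each other by insertions. -/
theorem comp_eop (F : Fibration P T) {x : ∀ μ, Fam k (T μ)} {p : V.Ball → ℤ}
    (hx : ∀ μ, x μ ∈ degS k (T μ) (p μ))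
    (hs : ∀ μ m t, t ≤ m → x μ (m + 1) = eps k (p μ + t) • eop k t (x μ m))
    (u : ℕ) {K : ℕ} (b : Chains k V K) :
    condensedComp k F x (Pi.single (K + 1) (eop k u b)) (K + 1) =
      eps k ((∑ μ, p μ : ℤ) : ZMod 2) • eop k u (condensedComp k F x (Pi.single K b) K) := by
  classical
  induction b using Finsupp.induction_linear with
  | zero => simp [← compL_apply]
  | add b b' hb hb' =>
    simp only [← compL_apply, map_add, Pi.single_add, Pi.add_apply, smul_add] at hb hb' ⊢
    rw [hb, hb']
  | single β c =>
    rw [← mul_one c, ← smul_eq_mul, ← Finsupp.smul_single]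
    simp only [← compL_apply, map_smul, Pi.single_smul, Pi.smul_apply]
    rw [smul_comm _ c]
    congr 1
    have h := congrFun (efam_comp F β hx u) (K + 1)
    rw [Pi.smul_apply, efam_succ] at h
    refine Eq.trans ?_ h
    have e1 : (Pi.single (K + 1) (eop k u (Finsupp.single β 1)) : Fam k V) =
        efam u (ab ⟨K, β⟩) := by
      funext n
      rcases eq_or_ne n (K + 1) with rfl | hne
      · rw [Pi.single_eq_same, efam_succ, ab_self]
      · rw [Pi.single_eq_of_ne hne]
        cases n with
        | zero => rfl
        | succ n => rw [efam_succ, ab_of_ne _ (by simpa using hne), map_zero]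
    rw [e1, efam_ab, map_sum, Finset.sum_apply, Finset.sum_apply]
    refine Finset.sum_congr rfl fun w hw => ?_
    simp only
    split_ifs
    · have e2 : condensedComp k F x (ab ⟨K + 1, β.ecut w⟩) = condensedComp k F
          (Function.update x w.1 (eps k (p w.1 + w.2) • efam w.2 (x w.1)))
          (ab ⟨K + 1, β.ecut w⟩) := by
        refine comp_congr_left fun μ => ?_
        rw [ecut_fst, hi_apply]
        rcases eq_or_ne μ w.1 with rfl | hne
        · rw [if_pos rfl, Function.update_self, Pi.smul_apply, efam_succ,
            hs _ _ _ (mem_pts.1 hw)]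
        · rw [Function.update_of_ne hne]
      rw [map_smul, compL_apply, e2, ← compM_apply, MultilinearMap.map_update_smul, smul_smul,
        ← eps_add, ← add_assoc, compM_apply]
    · rw [map_zero]

/-- The whiskering map is compatible with the compositions. -/
theorem comp_whiskering (F : Fibration P T) {x : ∀ μ, Chains k (T μ) 0} {y : Chains k V 0}
    {r : V.Ball → ℕ} {s : ℕ}
    (hx : ∀ μ, x μ ∈ Finsupp.supported k k {a : Cell (T μ) 0 | a.dim = r μ})
    (hy : y ∈ Finsupp.supported k k {a : Cell V 0 | a.dim = s}) :
    condensedComp k F (fun μ => whiskering k (T μ) (x μ)) (whiskering k V y) =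
      whiskering k U
        (condensedComp k F (fun μ => whiskering k (T μ) (x μ)) (Pi.single 0 y) 0) := by
  have hd : ∀ {X : TwoDisk} {a : Chains k X 0} {t : ℕ},
      a ∈ Finsupp.supported k k {a : Cell X 0 | a.dim = t} →
      a ∈ Finsupp.supported k k {a : Cell X 0 | -(a.dim : ℤ) = -(t : ℤ)} := by
    intro X a t ha
    refine Finsupp.supported_mono (fun b hb => ?_) ha
    have hb : b.dim = t := hb
    simp only [Set.mem_ofPred_eq, hb]
  have hwx : ∀ μ, whiskering k (T μ) (x μ) ∈ degS k (T μ) (-(r μ : ℤ)) := fun μ =>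
    whiskering_mem (hd (hx μ))
  have h0 : condensedComp k F (fun μ => whiskering k (T μ) (x μ)) (whiskering k V y) 0 =
      condensedComp k F (fun μ => whiskering k (T μ) (x μ)) (Pi.single 0 y) 0 :=
    comp_congr_right _ (by rw [whiskering_zero, Pi.single_eq_same])
  have hm := comp_mem_degS (F := F) hwx (whiskering_mem (hd hy))
  have hm0 : condensedComp k F (fun μ => whiskering k (T μ) (x μ)) (whiskering k V y) 0 ∈
      Finsupp.supported k k {a : Cell U 0 | a.dim = (∑ μ, r μ) + s} := by
    refine Finsupp.supported_mono (fun b hb => ?_) (mem_degS.1 hm 0)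
    have hb : ((0 : ℕ) : ℤ) - b.dim = (∑ μ, -(r μ : ℤ)) + -(s : ℤ) := hb
    rw [Finset.sum_neg_distrib] at hb
    have : (b.dim : ℤ) = ((∑ μ, r μ) + s : ℕ) := by
      push_cast at hb ⊢
      linarith
    exact_mod_cast this
  refine IsWhiskered.ext (.of_zero hm0 fun m => ?_) (isWhiskered_whiskering (h0 ▸ hm0))
    (by rw [whiskering_zero, h0])
  have e1 := comp_eop F hwx (fun μ m t ht => by
    rw [whiskering_succ ht (hx μ), ← eps_natCast]
    refine congrArg (fun a => eps k a • _) ?_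
    push_cast
    rw [CharTwo.neg_eq]) m (whiskering k V y m)
  rw [comp_congr_right (y' := (-1 : k) ^ (s + m) •
      Pi.single (M := fun m => Chains k V m) (m + 1) (eop k m (whiskering k V y m))) _
    (by rw [Pi.smul_apply, Pi.single_eq_same, whiskering_succ le_rfl hy]),
    comp_congr_right (y := whiskering k V y)
      (y' := Pi.single (M := fun m => Chains k V m) m (whiskering k V y m)) _ (Pi.single_eq_same _ _).symm,
    ← compL_apply, map_smul, Pi.smul_apply, compL_apply, e1, smul_smul, ← eps_natCast,
    ← eps_natCast, ← eps_add]
  refine congrArg (fun a => eps k a • _) ?_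
  push_cast
  rw [Finset.sum_neg_distrib, CharTwo.neg_eq]
  ring

end WhiskerComp

/-! ### The operad of total orders -/

section Breq

variable (k : Type u) [Field k] {U V : TwoDisk} {P : Hom U V} {T : V.Ball → TwoDisk}

/-- The chains of degree `n` in `Breq(U)`. -/
noncomputable def degB (U : TwoDisk) (n : ℤ) : Submodule k (Chains k U 0) := (breq k).deg U n

variable {k} in
theorem mem_dim_of_mem_degB {n : ℤ} {c : Chains k U 0} (h : c ∈ degB k U n) :
    c ∈ Finsupp.supported k k {x : Cell U 0 | x.dim = (-n).toNat} := by
  refine Finsupp.supported_mono (fun x hx => ?_) h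
  have hx : -(x.dim : ℤ) = n := hx
  simp only [Set.mem_ofPred_eq, ← hx]
  simp

/-- The composition of `Breq`. -/
noncomputable def compB (F : Fibration P T) (x : ∀ μ, Chains k (T μ) 0) (y : Chains k V 0) :
    Chains k U 0 := (breq k).comp F x y

variable {k}

theorem whiskering_compB (F : Fibration P T) {x : ∀ μ, Chains k (T μ) 0} {y : Chains k V 0}
    {p : V.Ball → ℤ} {q : ℤ} (hx : ∀ μ, x μ ∈ degB k (T μ) (p μ)) (hy : y ∈ degB k V q) :
    whiskering k U (compB k F x y) =
      condensedComp k F (fun μ => whiskering k (T μ) (x μ)) (whiskering k V y) :=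
  (comp_whiskering F (fun μ => mem_dim_of_mem_degB (hx μ)) (mem_dim_of_mem_degB hy)).symm

theorem whiskering_mem_degS {n : ℤ} {c : Chains k U 0} (h : c ∈ degB k U n) :
    whiskering k U c ∈ degS k U n := whiskering_mem h

theorem whiskering_one : whiskering k point (Finsupp.single (idCell 0) 1) = oneFam k := by
  refine (isWhiskered_whiskering (p := 0) (Finsupp.single_mem_supported _ _ (dim_idCell 0))).ext
    isWhiskered_oneFam ?_
  rw [whiskering_zero]
  rfl

/-- The composition of `Breq`, as a multilinear map of the inner chains. -/
noncomputable def compBM (F : Fibration P T) (y : Chains k V 0) :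
    MultilinearMap k (fun μ => Chains k (T μ) 0) (Chains k U 0) :=
  (LinearMap.proj (φ := fun m => Chains k U m) 0).compMultilinearMap
    ((compM k F (Pi.single 0 y)).compLinearMap fun μ => whiskering k (T μ))

theorem compBM_apply (F : Fibration P T) (x : ∀ μ, Chains k (T μ) 0) (y : Chains k V 0) :
    compBM F y x = compB k F x y := rfl

/-- The composition of `Breq`, as a linear map of the outer chain. -/
noncomputable def compBL (F : Fibration P T) (x : ∀ μ, Chains k (T μ) 0) :
    Chains k V 0 →ₗ[k] Chains k U 0 :=
  LinearMap.proj (φ := fun m => Chains k U m) 0 ∘ₗ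
    compL k F (fun μ => whiskering k (T μ) (x μ)) ∘ₗ LinearMap.single k (fun m => Chains k V m) 0

theorem compBL_apply (F : Fibration P T) (x : ∀ μ, Chains k (T μ) 0) (y : Chains k V 0) :
    compBL F x y = compB k F x y := rfl

theorem chainD_mem_degB {n : ℤ} {c : Chains k U 0} (h : c ∈ degB k U n) :
    chainD k U 0 c ∈ degB k U (n + 1) := by
  refine chainD_mem (fun x hx w _ h => ?_) h
  have hx : -(x.dim : ℤ) = n := hx
  have := dim_fc h
  change -((x.fc w).dim : ℤ) = n + 1
  omega

theorem compB_mem (F : Fibration P T) {x : ∀ μ, Chains k (T μ) 0} {y : Chains k V 0}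
    {p : V.Ball → ℤ} {q : ℤ} (hx : ∀ μ, x μ ∈ degB k (T μ) (p μ)) (hy : y ∈ degB k V q) :
    compB k F x y ∈ degB k U ((∑ μ, p μ) + q) := by
  have h := mem_degS.1 (comp_mem_degS (F := F) (fun μ => whiskering_mem_degS (hx μ))
    (whiskering_mem_degS hy)) 0
  rw [← whiskering_compB F hx hy, whiskering_zero] at h
  simp only [Nat.cast_zero, zero_sub] at h
  exact h

/-- The Leibniz rule for `Breq`, which holds because it does after whiskering. -/
theorem chainD_compB (F : Fibration P T) {x : ∀ μ, Chains k (T μ) 0} {y : Chains k V 0}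
    {p : V.Ball → ℤ} {q : ℤ} (hx : ∀ μ, x μ ∈ degB k (T μ) (p μ)) (hy : y ∈ degB k V q) :
    chainD k U 0 (compB k F x y) = (∑ μ, eps k ((∑ μ' ∈ Finset.Iio μ, p μ' : ℤ) : ZMod 2) •
      compB k F (Function.update x μ (chainD k (T μ) 0 (x μ))) y) +
      eps k ((∑ μ, p μ : ℤ) : ZMod 2) • compB k F x (chainD k V 0 y) := by
  refine whiskering_injective (k := k) (U := U) ?_
  have h1 : ∀ μ, whiskering k U (compB k F (Function.update x μ (chainD k (T μ) 0 (x μ))) y) =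
      condensedComp k F (Function.update (fun μ => whiskering k (T μ) (x μ)) μ
        (dtot k (T μ) (whiskering k (T μ) (x μ)))) (whiskering k V y) := by
    intro μ
    rw [whiskering_compB F (p := Function.update p μ (p μ + 1)) (fun μ' => ?_) hy, dtot_whiskering]
    · congr 1
      funext μ'
      exact Function.apply_update (fun μ => whiskering k (T μ)) x μ _ μ'
    · rcases eq_or_ne μ' μ with rfl | hne
      · rw [Function.update_self, Function.update_self]
        exact chainD_mem_degB (hx _)
      · rw [Function.update_of_ne hne, Function.update_of_ne hne]
        exact hx _
  simp only [map_add, map_sum, map_smul, h1]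
  rw [← dtot_whiskering, whiskering_compB F hx hy, whiskering_compB F hx (chainD_mem_degB hy),
    dtot_comp F (fun μ => whiskering_mem_degS (hx μ)) (whiskering_mem_degS hy), dtot_whiskering y]

/-- Associativity for `Breq`, which holds because it does after whiskering. -/
theorem compB_compB {W : TwoDisk} {Q : Hom V W} {S : Hom U W} {A : V.Ball → TwoDisk}
    {B C : W.Ball → TwoDisk} {F : Fibration P A} {G : Fibration Q B} {H : Fibration S C}
    {R : ∀ w, Hom (C w) (B w)} {L : ∀ w, Fibration (R w) (fun b => A (G.glob w b))}
    (hS : ∀ ν, S ν = Q (P ν)) (hR : ∀ w c, G.glob w (R w c) = P (H.glob w c))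
    {x : ∀ v, Chains k (A v) 0} {y : ∀ w, Chains k (B w) 0} {z : Chains k W 0} {p : V.Ball → ℤ}
    {q : W.Ball → ℤ} {r : ℤ} (hx : ∀ v, x v ∈ degB k (A v) (p v))
    (hy : ∀ w, y w ∈ degB k (B w) (q w)) (hz : z ∈ degB k W r) :
    compB k H (fun w => compB k (L w) (fun b => x (G.glob w b)) (y w)) z =
      eps k (assocSign Q p q : ZMod 2) • compB k F x (compB k G y z) := by
  refine whiskering_injective (k := k) (U := U) ?_
  have h1 : ∀ w, compB k (L w) (fun b => x (G.glob w b)) (y w) ∈ degB k (C w) _ := fun w =>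
    compB_mem (L w) (fun b => hx (G.glob w b)) (hy w)
  rw [whiskering_compB H h1 hz, map_smul, whiskering_compB F hx (compB_mem G hy hz),
    whiskering_compB G hy hz, ← comp_comp (L := L) (H := H) hS hR
      (fun v => whiskering_mem_degS (hx v))
      (fun w => whiskering_mem_degS (hy w)) (whiskering_mem_degS hz)]
  congr 1
  funext w
  exact whiskering_compB (L w) (fun b => hx (G.glob w b)) (hy w)

end Breq

/-- The operad of total orders is a dg 2-operad: all axioms can be checked after whiskering, which
is injective. -/
theorem isDg2Operad_breq (k : Type u) [Field k] : IsDg2Operad (breq k) where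
  d_mem U n x hx := chainD_mem_degB hx
  d_d U n x _ := chainD_chainD x
  comp_add_left F x y μ a b := (compBM F y).map_update_add x μ a b
  comp_smul_left F x y μ c a := (compBM F y).map_update_smul x μ c a
  comp_add_right F x a b := (compBL F x).map_add a b
  comp_smul_right F x c a := (compBL F x).map_smul c a
  comp_mem F x y p q hx hy := compB_mem F hx hy
  d_comp F x y p q hx hy := by
    simp only [negOnePow_smul (k := k)]
    exact chainD_compB F hx hy
  assoc F G H R K hS hR x y z p q r hx hy hz := by
    rw [negOnePow_smul (k := k)]
    exact compB_compB (G := G) hS hR hx hy hz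
  one_mem := by
    refine Finsupp.single_mem_supported _ _ ?_
    simp [dim_idCell]
  d_one := chainD_idCell_zero
  comp_one {U P} F n x hx := by
    refine whiskering_injective (k := k) (U := U) ?_
    have h1 : Finsupp.single (idCell 0) 1 ∈ degB k point 0 :=
      Finsupp.single_mem_supported _ _ (by simp [dim_idCell])
    exact (whiskering_compB F (fun _ => hx) h1).trans
      (by rw [whiskering_one]; exact comp_oneFam F (whiskering_mem_degS hx))
  one_comp {U P} F hP n x hx := by
    refine whiskering_injective (k := k) (U := U) ?_
    have h1 : Finsupp.single (idCell 0) 1 ∈ degB k point 0 :=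
      Finsupp.single_mem_supported _ _ (by simp [dim_idCell])
    exact (whiskering_compB F (fun _ => h1) hx).trans
      (by rw [whiskering_one]; exact oneFam_comp F hP (whiskering_mem_degS hx))

/-- The whiskering map is a morphism of dg 2-operads. -/
theorem isDg2OperadHom_whiskering (k : Type u) [Field k] :
    IsDg2OperadHom (breq k) (condensedSeq k) (whiskering k) where
  map_deg _ _ _ hx := whiskering_mem_degS hx
  map_d _ _ x _ := (dtot_whiskering x).symm
  map_comp F _ _ _ _ hx hy := whiskering_compB F hx hy
  map_one := whiskering_one

/-! ### Repetitions -/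

namespace Cell

variable {U V : TwoDisk} {m : ℕ}

/-- The points `z` and `nx z` are consecutive in the total order and have the same label. -/
structure Rep (x : Cell U m) (z : U.Ball × ℕ) : Prop where
  mem : nx z ∈ pts x.1
  between : ∀ a, x.rel z a → ¬ x.rel a (nx z)
  lab_eq : x.lab (nx z) = x.lab z

theorem isDegenerate_iff {x : Cell U 0} : x.IsDegenerate ↔ ∃ z, x.Rep z := by
  constructor
  · rintro ⟨ν, i, j, hij, h⟩
    have hm : nx (ν, (i : ℕ)) ∈ pts x.1 := by
      have := j.2
      have := Fin.lt_def.1 hij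
      simp only [nx, mem_pts]
      omega
    refine ⟨(ν, (i : ℕ)), hm, fun a h1 h2 => ?_, ?_⟩
    · have h3 : x.rel a (ν, (j : ℕ)) := by
        rcases Nat.lt_or_ge ((i : ℕ) + 1) j with h' | h'
        · exact rel_trans h2 (x.rel_index h' (Nat.lt_succ_iff.1 j.2))
        · have : (i : ℕ) + 1 = j := le_antisymm (Fin.lt_def.1 hij) h'
          rwa [nx, this] at h2
      obtain ⟨_, ha, h1⟩ := h1
      obtain ⟨_, _, h3⟩ := h3
      exact h ⟨a.1, ⟨a.2, ha⟩⟩ ⟨h1, h3⟩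
    · have h1 := x.lab_le (nx (ν, (i : ℕ)))
      have h2 := x.lab_le (ν, (i : ℕ))
      omega
  · rintro ⟨⟨ν, i⟩, hm, h, -⟩
    have hm : i + 1 ≤ x.1 ν := mem_pts.1 hm
    refine ⟨ν, ⟨i, by omega⟩, ⟨i + 1, by omega⟩, Fin.lt_def.2 (Nat.lt_succ_self i), ?_⟩
    rintro ⟨ν', j⟩ ⟨h1, h2⟩
    exact h (ν', (j : ℕ)) ⟨by dsimp; omega, j.2, h1⟩ ⟨j.2, by dsimp [nx]; omega, h2⟩

theorem ne_nx (z : U.Ball × ℕ) : z ≠ nx z := fun h => by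
  have := congrArg Prod.snd h
  simp [nx] at this

namespace Rep

variable {x : Cell U m} {z w : U.Ball × ℕ}

theorem mem_left (h : x.Rep z) : z ∈ pts x.1 := by
  have := mem_pts.1 h.mem
  simp only [nx] at this
  exact mem_pts.2 (by omega)

theorem pos (h : x.Rep z) : 1 ≤ x.1 z.1 := by
  have := mem_pts.1 h.mem
  simp only [nx] at this
  omega

theorem rel (h : x.Rep z) : x.rel z (nx z) := x.rel_index (Nat.lt_succ_self _) (mem_pts.1 h.mem)

theorem rel_nx_iff (h : x.Rep z) {a : U.Ball × ℕ} (ha : a ≠ z) : x.rel a (nx z) ↔ x.rel a z := by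
  refine ⟨fun h1 => ?_, fun h1 => rel_trans h1 h.rel⟩
  exact (x.rel_total h1.left h.mem_left ha).resolve_right fun h2 => h.between _ h2 h1

theorem nx_rel_iff (h : x.Rep z) {a : U.Ball × ℕ} (ha : a ≠ nx z) : x.rel (nx z) a ↔ x.rel z a := by
  refine ⟨fun h1 => rel_trans h.rel h1, fun h1 => ?_⟩
  exact (x.rel_total h1.right h.mem ha).resolve_left fun h2 => h.between _ h1 h2

theorem of_dg (hz : z ∈ pts x.1) : (x.dg z).Rep z := by
  refine ⟨nx_mem_hi hz, fun a h1 h2 => ?_, ?_⟩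
  · have ha := h1.right
    rw [rel_dg hz (mem_hi_self hz) ha, smap_self] at h1
    rw [rel_dg hz ha (nx_mem_hi hz), smap_nx] at h2
    rcases h1 with h1 | ⟨-, rfl⟩
    · rcases h2 with h2 | ⟨rfl, -⟩
      · exact rel_asymm h1 h2
      · rw [smap_self] at h1
        exact rel_irrefl _ _ h1
    · rcases h2 with h2 | ⟨h2, -⟩
      · rw [smap_nx] at h2
        exact rel_irrefl _ _ h2
      · exact ne_nx z h2.symm
  · rw [lab_dg hz (nx_mem_hi hz), lab_dg hz (mem_hi_self hz), smap_nx, smap_self]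

theorem nx_smap (h1 : w ≠ z) : nx (smap w z) = smap w (nx z) := by
  obtain ⟨ν, i⟩ := w
  obtain ⟨ν', j⟩ := z
  have : ¬ (ν = ν' ∧ i = j) := by simpa using h1
  simp only [nx, smap, sφ, Prod.mk.injEq, true_and]
  grind

theorem fc (h : x.Rep z) (hw : w ∈ pts x.1) (h1 : w ≠ z) (h2 : w ≠ nx z) (hl : 1 ≤ x.1 w.1) :
    (x.fc w).Rep (smap w z) := by
  have m1 := smap_mem_lo hw h.mem_left h1.symm
  have m2 := smap_mem_lo hw h.mem h2.symm
  refine ⟨by rw [nx_smap h1]; exact m2, fun a => ?_, ?_⟩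
  · rw [nx_smap h1]
    intro r1 r2
    rw [rel_fc hl m1 r1.right, fmap_smap h1.symm] at r1
    rw [rel_fc hl r2.left m2, fmap_smap h2.symm] at r2
    exact h.between _ r1 r2
  · rw [nx_smap h1, lab_fc hl m2, lab_fc hl m1, fmap_smap h1.symm, fmap_smap h2.symm, h.lab_eq]

/-- A cell with a repetition is a degeneracy. -/
theorem dg_fc (h : x.Rep z) : (x.fc (nx z)).dg z = x := by
  have hz : z ∈ pts (x.fc (nx z)).1 := by
    have := mem_pts.1 h.mem
    simp only [nx] at this
    rw [fc_fst, mem_pts, lo_apply, if_pos (show z.1 = (nx z).1 from rfl)]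
    omega
  have hl : 1 ≤ x.1 (nx z).1 := h.pos
  have hf : ((x.fc (nx z)).dg z).1 = x.1 := by
    rw [dg_fst, fc_fst]
    exact hi_lo _ rfl hl
  have key : ∀ a, a ≠ nx z → fmap (nx z) (smap z a) = a := by
    rintro ⟨ν, i⟩ ha
    obtain ⟨ν', j⟩ := z
    have : ¬ (ν = ν' ∧ i = j + 1) := by simpa [nx] using ha
    simp only [nx, fmap, smap, fφ, sφ, Prod.mk.injEq, true_and]
    grind
  have key2 : fmap (nx z) (smap z (nx z)) = z := by rw [smap_nx, fmap_nx_self]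
  refine ext' hf (fun a b ha hb hr => ?_) fun a ha => ?_
  · rw [rel_dg hz ha hb] at hr
    rcases hr with hr | ⟨rfl, rfl⟩
    · rw [rel_fc hl (smap_mem hz ha) (smap_mem hz hb)] at hr
      by_cases h1 : a = nx z
      · subst h1
        by_cases h2 : b = nx z
        · subst h2
          exact absurd hr (rel_irrefl _ _)
        · rw [key2, key _ h2] at hr
          exact (h.nx_rel_iff h2).2 hr
      · by_cases h2 : b = nx z
        · subst h2
          rw [key2, key _ h1] at hr
          exact rel_trans hr h.rel
        · rwa [key _ h1, key _ h2] at hr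
    · exact h.rel
  · rw [lab_dg hz ha, lab_fc hl (smap_mem hz ha)]
    by_cases h1 : a = nx z
    · subst h1
      rw [key2, h.lab_eq]
    · rw [key _ h1]

theorem fc_eq (h : x.Rep z) : x.fc z = x.fc (nx z) := by
  have hz : z ∈ pts (x.fc (nx z)).1 := by
    have := mem_pts.1 h.mem
    simp only [nx] at this
    rw [fc_fst, mem_pts, lo_apply, if_pos (show z.1 = (nx z).1 from rfl)]
    omega
  conv_lhs => rw [← h.dg_fc]
  exact fc_dg_self hz (Or.inl rfl)

/-- Degeneracies at other points do not destroy a repetition. -/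
theorem dg_of_ne (h : x.Rep w) (hz : z ∈ pts x.1) (hne : w.1 = z.1 → w.2 < z.2) :
    (x.dg z).Rep w := by
  have h1 : smap z w = w := by
    simp only [smap, sφ]
    rw [if_neg]
    rintro ⟨h1, h2⟩
    have := hne h1
    omega
  have h2 : smap z (nx w) = nx w := by
    refine Prod.ext rfl (if_neg ?_)
    rintro ⟨h1, h2⟩
    have := hne h1
    change z.2 < w.2 + 1 at h2
    omega
  have up : ∀ {a}, a ∈ pts x.1 → a ∈ pts (hi x.1 z) := fun {a} ha => by
    rw [mem_pts] at ha ⊢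
    rw [hi_apply]
    split_ifs <;> omega
  have hwz : w ≠ z := fun h => (hne (congrArg Prod.fst h)).ne (congrArg Prod.snd h)
  refine ⟨up h.mem, fun a r1 r2 => ?_, ?_⟩
  · rw [rel_dg hz (up h.mem_left) r1.right, h1] at r1
    rw [rel_dg hz r2.left (up h.mem), h2] at r2
    have r1 := r1.resolve_right fun h => hwz h.1
    rcases r2 with r2 | ⟨rfl, r2⟩
    · exact h.between _ r1 r2
    · have e1 := congrArg Prod.fst r2
      have e2 := congrArg Prod.snd r2
      simp only [nx] at e1 e2
      have := hne e1
      omega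
  · rw [lab_dg hz (up h.mem), lab_dg hz (up h.mem_left), h1, h2, h.lab_eq]

/-- The insertion of a cut does not destroy the repetitions. -/
theorem ecut (h : x.Rep z) {c : U.Ball × ℕ} (hc : c ∈ pts x.1) : ∃ z', (x.ecut c).Rep z' := by
  classical
  obtain ⟨z', h1, h2, h3⟩ : ∃ z', smap c z' = z ∧ smap c (nx z') = nx z ∧
      (z' = nx c ∨ x.rel c z ↔ nx z' = nx c ∨ x.rel c (nx z)) := by
    by_cases h0 : c.1 = z.1 ∧ c.2 ≤ z.2
    · refine ⟨nx z, ?_, ?_, ?_⟩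
      · obtain ⟨ν, i⟩ := c
        obtain ⟨ν', j⟩ := z
        simp only [nx, smap, sφ, Prod.mk.injEq, true_and] at h0 ⊢
        grind
      · obtain ⟨ν, i⟩ := c
        obtain ⟨ν', j⟩ := z
        simp only [nx, smap, sφ, Prod.mk.injEq, true_and] at h0 ⊢
        grind
      · obtain ⟨ν, i⟩ := c
        obtain ⟨ν', j⟩ := z
        obtain ⟨rfl, h0⟩ : ν = ν' ∧ i ≤ j := h0
        refine iff_of_true ?_ (Or.inr (x.rel_index (Nat.lt_succ_of_le h0) (mem_pts.1 h.mem)))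
        rcases h0.lt_or_eq with h' | rfl
        · exact Or.inr (x.rel_index h' (mem_pts.1 h.mem_left))
        · exact Or.inl rfl
    · have hcz : c ≠ z := by
        rintro rfl
        exact h0 ⟨rfl, le_rfl⟩
      refine ⟨z, ?_, ?_, ?_⟩
      · obtain ⟨ν, i⟩ := c
        obtain ⟨ν', j⟩ := z
        simp only [smap, sφ, Prod.mk.injEq, true_and] at h0 ⊢
        grind
      · obtain ⟨ν, i⟩ := c
        obtain ⟨ν', j⟩ := z
        simp only [nx, smap, sφ, Prod.mk.injEq, true_and] at h0 ⊢
        grind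
      · rw [h.rel_nx_iff hcz]
        have e1 : z ≠ nx c := by
          rintro rfl
          exact h0 ⟨rfl, Nat.le_succ _⟩
        have e2 : nx z ≠ nx c := by
          intro h'
          have e1 := congrArg Prod.fst h'
          have e2 := congrArg Prod.snd h'
          simp only [nx] at e1 e2
          exact h0 ⟨e1.symm, by omega⟩
        simp [e1, e2]
  have up : ∀ {a}, smap c a ∈ pts x.1 → a ∈ pts (hi x.1 c) := fun {a} ha => by
    simp only [mem_pts, smap, sφ, hi_apply] at ha ⊢
    split_ifs at ha ⊢ <;> grind
  have m1 : z' ∈ pts (hi x.1 c) := up (by rw [h1]; exact h.mem_left)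
  have m2 : nx z' ∈ pts (hi x.1 c) := up (by rw [h2]; exact h.mem)
  refine ⟨z', m2, fun a r1 r2 => ?_, ?_⟩
  · have r1' := r1
    have r2' := r2
    rw [rel_ecut, rel_dg hc m1 r1.right, h1] at r1'
    rw [rel_ecut, rel_dg hc r2.left m2, h2] at r2'
    rcases r1' with r1' | ⟨rfl, rfl⟩
    · rcases r2' with r2' | ⟨rfl, e⟩
      · exact h.between _ r1' r2'
      · have e1 := congrArg Prod.fst e
        have e2 := congrArg Prod.snd e
        simp only [nx] at e1 e2
        exact rel_irrefl _ _ (by rwa [Prod.ext e1 (by omega : z'.2 = a.2)] at r1)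
    · exact rel_irrefl _ _ r2
  · rw [lab_ecut hc m2, lab_ecut hc m1, h1, h2, h.lab_eq]
    congr 1
    exact if_congr h3.symm rfl rfl

end Rep

section Comp

variable {P : Hom U V} {T : V.Ball → TwoDisk} {F : Fibration P T} {K : ℕ} {β : Cell V K}
  {α : ∀ μ, ACell (T μ)} {γ : Cell U K}

theorem IsComp.rep_inner (h : IsComp F β α γ) {μ : V.Ball} {c : (T μ).Ball × ℕ}
    (hc : (α μ).2.Rep c) : γ.Rep (F.gp μ c) := by
  refine ⟨by rw [← F.gp_nx, h.mem_iff]; exact hc.mem, fun a r1 r2 => ?_, ?_⟩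
  · obtain ⟨μ', c', rfl⟩ := F.exists_gp a
    have hc' := h.mem_iff.1 r1.right
    rw [← F.gp_nx] at r2
    rcases eq_or_ne μ μ' with rfl | hne
    · rw [h.rel_same _ _ _ hc.mem_left hc'] at r1
      rw [h.rel_same _ _ _ hc' hc.mem] at r2
      exact hc.between _ r1 r2
    · rw [h.rel_ne _ _ _ _ hne hc.mem_left hc'] at r1
      rw [h.rel_ne _ _ _ _ hne.symm hc' hc.mem, hc.lab_eq] at r2
      exact rel_asymm r1 r2
  · rw [← F.gp_nx, h.lab _ _ hc.mem, h.lab _ _ hc.mem_left, hc.lab_eq]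

/-- A repetition of the outer cell induces a repetition of the composite with an inner cell that
has consecutive points at these labels. -/
theorem IsComp.rep_outer {μ : V.Ball} {A : ACell (T μ)} {c : (T μ).Ball × ℕ} (hc : c ∈ pts A.2.1)
    (h : IsComp F β (Function.update α μ ⟨A.1 + 1, A.2.ecut c⟩) γ)
    (hβ : β.Rep (μ, A.2.lab c)) : γ.Rep (F.gp μ c) := by
  classical
  have m1 : c ∈ pts (A.2.ecut c).1 := mem_hi_self hc
  have m2 : nx c ∈ pts (A.2.ecut c).1 := nx_mem_hi hc
  have l1 : (A.2.ecut c).lab c = A.2.lab c := by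
    rw [lab_ecut hc m1, smap_self, if_neg, add_zero]
    rintro (h | h)
    · exact ne_nx c h
    · exact rel_irrefl _ _ h
  have l2 : (A.2.ecut c).lab (nx c) = A.2.lab c + 1 := by
    rw [lab_ecut hc m2, smap_nx, if_pos (Or.inl rfl)]
  have hb : ∀ a, (A.2.ecut c).rel c a → ¬ (A.2.ecut c).rel a (nx c) :=
    (Rep.of_dg (x := A.2) hc).between
  have s1 : ∀ {c' : (T μ).Ball × ℕ}, c' ∈ pts (A.2.ecut c).1 →
      c' ∈ pts (Function.update α μ ⟨A.1 + 1, A.2.ecut c⟩ μ).2.1 := by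
    intro c' hc'
    rwa [Function.update_self]
  have s2 : ∀ c' : (T μ).Ball × ℕ,
      (Function.update α μ ⟨A.1 + 1, A.2.ecut c⟩ μ).2.lab c' = (A.2.ecut c).lab c' := by
    intro c'
    rw [Function.update_self]
  refine ⟨by rw [← F.gp_nx, h.mem_iff]; exact s1 m2, fun a r1 r2 => ?_, ?_⟩
  · obtain ⟨μ', c', rfl⟩ := F.exists_gp a
    have hc' := h.mem_iff.1 r1.right
    rw [← F.gp_nx] at r2
    rcases eq_or_ne μ μ' with rfl | hne
    · rw [h.rel_same _ _ _ (s1 m1) hc', Function.update_self] at r1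
      rw [h.rel_same _ _ _ hc' (s1 m2), Function.update_self] at r2
      exact hb _ r1 r2
    · rw [h.rel_ne _ _ _ _ hne (s1 m1) hc', s2, l1] at r1
      rw [h.rel_ne _ _ _ _ hne.symm hc' (s1 m2), s2, l2] at r2
      exact hβ.between _ r1 r2
  · rw [← F.gp_nx, h.lab _ _ (s1 m2), h.lab _ _ (s1 m1), s2, s2, l1, l2]
    exact hβ.lab_eq

end Comp

end Cell

/-! ### The quotient by the degenerate orders -/

section Degenerate

variable {k : Type u} [Field k] {U V : TwoDisk} {P : Hom U V} {T : V.Ball → TwoDisk} {m : ℕ}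

variable (k U m) in
/-- The span of the cells with a repetition. -/
noncomputable def repS : Submodule k (Chains k U m) :=
  Finsupp.supported k k {x : Cell U m | ∃ z, x.Rep z}

theorem degenerate_eq : degenerate k U = repS k U 0 := by
  unfold degenerate repS
  congr 1
  ext x
  exact isDegenerate_iff

theorem single_mem_repS {x : Cell U m} {z : U.Ball × ℕ} (h : x.Rep z) (c : k) :
    Finsupp.single x c ∈ repS k U m := Finsupp.single_mem_supported _ _ ⟨z, h⟩

theorem ab_mem_repS {x : Cell U m} {z : U.Ball × ℕ} (h : x.Rep z) (n : ℕ) :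
    (ab ⟨m, x⟩ : Fam k U) n ∈ repS k U n := by
  rcases eq_or_ne n m with rfl | hne
  · rw [ab_self]
    exact single_mem_repS h 1
  · rw [ab_of_ne _ hne]
    exact Submodule.zero_mem _

theorem ex_nx (ℓ : U.Ball → ℕ) (z : U.Ball × ℕ) : ex ℓ (nx z) = ex ℓ z + 1 := by
  simp only [ex, nx]
  ring

/-- The faces at the two points of a repetition cancel. -/
theorem Cell.Rep.chainD_single {x : Cell U m} {z : U.Ball × ℕ} (h : x.Rep z) :
    chainD k U m (Finsupp.single x 1) = ∑ w ∈ ((pts x.1).erase z).erase (nx z),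
      if 1 ≤ x.1 w.1 then (-1 : k) ^ ex x.1 w • Finsupp.single (x.fc w) (1 : k) else 0 := by
  rw [chainD_single', ← Finset.add_sum_erase _ _ h.mem_left, ← Finset.add_sum_erase _ _
    (Finset.mem_erase.2 ⟨(ne_nx z).symm, h.mem⟩), ← add_assoc, if_pos h.pos,
    if_pos (show 1 ≤ x.1 (nx z).1 from h.pos), h.fc_eq, ex_nx, pow_succ, mul_neg, mul_one, neg_smul,
    add_neg_cancel, zero_add]

theorem chainD_mem_repS {c : Chains k U m} (hc : c ∈ repS k U m) :
    chainD k U m c ∈ repS k U m := by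
  refine map_mem_supported _ ?_ hc
  rintro x ⟨z, h⟩
  rw [h.chainD_single]
  refine Submodule.sum_mem _ fun w hw => ?_
  simp only [Finset.mem_erase] at hw
  split_ifs with h1
  · exact Submodule.smul_mem _ _ (single_mem_repS (h.fc hw.2.2 hw.2.1 hw.1 h1) 1)
  · exact Submodule.zero_mem _

theorem whiskering_mem_repS {c : Chains k U 0} (hc : c ∈ repS k U 0) (m : ℕ) :
    whiskering k U c m ∈ repS k U m := by
  refine map_mem_supported (LinearMap.proj (φ := fun m => Chains k U m) m ∘ₗ whiskering k U) ?_ hc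
  rintro x ⟨z, h⟩
  change whiskering k U (Finsupp.single x 1) m ∈ repS k U m
  induction m with
  | zero =>
    rw [whiskering_zero]
    exact single_mem_repS h 1
  | succ m ih =>
    rw [whiskering_succ (p := x.dim) le_rfl (Finsupp.single_mem_supported _ _ rfl)]
    refine Submodule.smul_mem _ _ (eop_mem ?_ ih)
    rintro y ⟨z', h'⟩ c hc -
    exact h'.ecut hc

/-- A composite with a degenerate inner family is degenerate. -/
theorem comp_mem_repS_left (F : Fibration P T) {x : ∀ μ, Fam k (T μ)} (y : Fam k V) {μ : V.Ball}
    (hx : ∀ m, x μ m ∈ repS k (T μ) m) (K : ℕ) : condensedComp k F x y K ∈ repS k U K := by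
  rw [condensedComp_eq, Finsupp.linearCombination_apply]
  refine Submodule.sum_mem _ fun β _ => Submodule.smul_mem _ _ (Submodule.sum_mem _ fun α hα => ?_)
  obtain ⟨z, hz⟩ := hx _ (Fintype.mem_piFinset.1 hα μ)
  exact single_mem_repS ((isComp_comp F β α).rep_inner (μ := μ) hz) _

/-- A composite with a degenerate outer cell is degenerate, if the inner family at the repetition
`w` arises by an insertion at the label `w.2`. -/
theorem comp_mem_repS_right (F : Fibration P T) {x : ∀ μ, Fam k (T μ)} {p : V.Ball → ℤ}
    (hx : ∀ μ, x μ ∈ degS k (T μ) (p μ)) {K : ℕ} {β : Cell V K} {w : V.Ball × ℕ} (hβ : β.Rep w)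
    (n : ℕ) : condensedComp k F (Function.update x w.1 (efam w.2 (x w.1))) (ab ⟨K, β⟩) n ∈
      repS k U n := by
  rw [← Submodule.Quotient.mk_eq_zero]
  refine LocMulti.eq_zero (k := k) (D := fun x => Submodule.mkQ (repS k U n)
    (condensedComp k F (Function.update x w.1 (efam w.2 (x w.1))) (ab ⟨K, β⟩) n)) ?_ ?_ hx
  · exact ((locMulti_comp F (ab ⟨K, β⟩) n).update w.1 (e := efam w.2) (locLin_efam w.2)).map _
  · intro α _
    rw [Submodule.mkQ_apply, Submodule.Quotient.mk_eq_zero, efam_ab, ← compM_apply,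
      MultilinearMap.map_update_sum, Finset.sum_apply]
    refine Submodule.sum_mem _ fun c hc => ?_
    split_ifs with hl
    · rw [MultilinearMap.map_update_smul, update_ab, compM_apply]
      by_cases hm : ∀ μ, (Function.update α w.1 ⟨(α w.1).1 + 1, (α w.1).2.ecut c⟩ μ).1 = β.1 μ
      · obtain ⟨γ, h⟩ := exists_isComp F hm
        rw [h.comp_ab]
        exact Submodule.smul_mem _ _ (Submodule.smul_mem _ _
          (ab_mem_repS (h.rep_outer hc (by rw [hl]; exact hβ)) n))
      · obtain ⟨μ, hμ⟩ := not_forall.1 hm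
        rw [comp_ab_of_ne hμ, smul_zero]
        exact Submodule.zero_mem _
    · rw [MultilinearMap.map_update_zero]
      exact Submodule.zero_mem _

theorem compB_mem_degenerate_left (F : Fibration P T) {x : ∀ μ, Chains k (T μ) 0}
    (y : Chains k V 0) {μ : V.Ball} (hx : x μ ∈ degenerate k (T μ)) :
    compB k F x y ∈ degenerate k U := by
  rw [degenerate_eq] at hx ⊢
  exact comp_mem_repS_left F _ (μ := μ) (whiskering_mem_repS hx) 0

/-- The inner whiskered chains arise by insertions at any given label, in particular at the
repetition of the outer cell. -/
theorem compB_mem_degenerate_right (F : Fibration P T) (x : ∀ μ, Chains k (T μ) 0)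
    {y : Chains k V 0} (hy : y ∈ degenerate k V) : compB k F x y ∈ degenerate k U := by
  rw [degenerate_eq] at hy ⊢
  refine map_mem_supported (compBL F x) ?_ hy
  rintro β ⟨w, hβ⟩
  change compB k F x (Finsupp.single β 1) ∈ repS k U 0
  rw [← Submodule.Quotient.mk_eq_zero, ← compBM_apply, ← Submodule.mkQ_apply,
    ← LinearMap.compMultilinearMap_apply]
  suffices h : (repS k U 0).mkQ.compMultilinearMap (compBM F (Finsupp.single β 1)) = 0 by
    rw [h]; rfl
  refine Module.Basis.ext_multilinear (fun μ => Finsupp.basisSingleOne) fun a => ?_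
  rw [LinearMap.compMultilinearMap_apply, _root_.zero_apply, Submodule.mkQ_apply,
    Submodule.Quotient.mk_eq_zero, compBM_apply]
  simp only [Finsupp.coe_basisSingleOne]
  have hw : ∀ μ, Finsupp.single (a μ) (1 : k) ∈
      Finsupp.supported k k {b : Cell (T μ) 0 | b.dim = (a μ).dim} := fun μ =>
    Finsupp.single_mem_supported _ _ rfl
  have hX : ∀ μ, whiskering k (T μ) (Finsupp.single (a μ) 1) ∈ degS k (T μ) (-((a μ).dim : ℤ)) :=
    fun μ => whiskering_mem (Finsupp.single_mem_supported _ _ rfl)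
  change condensedComp k F (fun μ => whiskering k (T μ) (Finsupp.single (a μ) 1)) (ab ⟨0, β⟩) 0 ∈ _
  have e : condensedComp k F (fun μ => whiskering k (T μ) (Finsupp.single (a μ) 1)) (ab ⟨0, β⟩) =
      condensedComp k F (Function.update (fun μ => whiskering k (T μ) (Finsupp.single (a μ) 1)) w.1
        ((-1 : k) ^ ((a w.1).dim + w.2) •
          efam w.2 (whiskering k (T w.1) (Finsupp.single (a w.1) 1)))) (ab ⟨0, β⟩) := by
    refine comp_congr_left fun μ => ?_
    rcases eq_or_ne μ w.1 with rfl | hne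
    · have h1 : w.2 + 1 ≤ β.1 w.1 := mem_pts.1 hβ.mem
      obtain ⟨J, hJ⟩ := Nat.exists_eq_add_of_le' hβ.pos
      rw [Function.update_self, hJ, Pi.smul_apply, efam_succ,
        whiskering_succ (u := w.2) (by omega) (hw w.1)]
    · rw [Function.update_of_ne hne]
  rw [e, ← compM_apply, MultilinearMap.map_update_smul, compM_apply]
  exact Submodule.smul_mem _ _ (comp_mem_repS_right F hX hβ 0)

theorem normalForm_mkQ_sub_mem (c : Chains k U 0) :
    normalForm k U ((degenerate k U).mkQ c) - c ∈ degenerate k U := by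
  classical
  have h : normalForm k U ((degenerate k U).mkQ c) = c.filter (fun x => ¬ x.IsDegenerate) := by
    simp only [normalForm, Submodule.mkQ_apply, Submodule.liftQ_apply, LinearMap.comp_apply,
      Submodule.subtype_apply]
    ext x
    rw [Finsupp.restrictDom_apply]
    simp only [Finsupp.filter_apply]
    congr
  rw [h]
  refine fun x hx => ?_
  by_contra hn
  have hn : ¬ x.IsDegenerate := hn
  refine Finsupp.mem_support_iff.1 hx ?_
  rw [Finsupp.sub_apply, Finsupp.filter_apply, if_pos hn, sub_self]

theorem mkQ_eq_of_sub_mem {c c' : Chains k U 0} (h : c - c' ∈ degenerate k U) :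
    (degenerate k U).mkQ c = (degenerate k U).mkQ c' :=
  (Submodule.Quotient.eq _).2 h

theorem chainD_mem_degenerate {c : Chains k U 0} (hc : c ∈ degenerate k U) :
    chainD k U 0 c ∈ degenerate k U := by
  rw [degenerate_eq] at hc ⊢
  exact chainD_mem_repS hc

theorem normalization_chainD (c : Chains k U 0) :
    normalization k U (chainD k U 0 c) = (norBreq k).d U (normalization k U c) := by
  refine mkQ_eq_of_sub_mem ?_
  change chainD k U 0 c - chainD k U 0 (normalForm k U ((degenerate k U).mkQ c)) ∈ _
  rw [← map_sub]
  refine chainD_mem_degenerate ?_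
  rw [← neg_sub]
  exact Submodule.neg_mem _ (normalForm_mkQ_sub_mem c)

/-- The composition of classes does not depend on the representatives, which are replaced by normal
forms one ball at a time. -/
theorem normalization_compB (F : Fibration P T) (x : ∀ μ, Chains k (T μ) 0) (y : Chains k V 0) :
    normalization k U (compB k F x y) =
      (norBreq k).comp F (fun μ => normalization k (T μ) (x μ)) (normalization k V y) := by
  change (degenerate k U).mkQ (compB k F x y) = (degenerate k U).mkQ (compB k F
    (fun μ => normalForm k (T μ) ((degenerate k (T μ)).mkQ (x μ)))
    (normalForm k V ((degenerate k V).mkQ y)))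
  have h1 : ∀ s : Finset V.Ball, (degenerate k U).mkQ (compB k F x y) =
      (degenerate k U).mkQ (compB k F (fun μ => if μ ∈ s then
        normalForm k (T μ) ((degenerate k (T μ)).mkQ (x μ)) else x μ) y) := by
    intro s
    induction s using Finset.induction_on with
    | empty => simp
    | insert μ s hμ ih =>
      rw [ih]
      set x' : ∀ μ, Chains k (T μ) 0 := fun μ => if μ ∈ s then
        normalForm k (T μ) ((degenerate k (T μ)).mkQ (x μ)) else x μ with hx'
      have e : (fun ν => if ν ∈ insert μ s then
          normalForm k (T ν) ((degenerate k (T ν)).mkQ (x ν)) else x ν) =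
          Function.update x' μ (normalForm k (T μ) ((degenerate k (T μ)).mkQ (x μ))) := by
        funext ν
        rcases eq_or_ne ν μ with rfl | hne
        · simp
        · simp [hne, hx']
      have e' : x' = Function.update x' μ (x μ) := by
        conv_lhs => rw [← Function.update_eq_self μ x']
        simp [hx', hμ]
      rw [e]
      conv_lhs => rw [e']
      refine mkQ_eq_of_sub_mem ?_
      rw [← compBM_apply, ← compBM_apply, ← MultilinearMap.map_update_sub, compBM_apply]
      refine compB_mem_degenerate_left F y (μ := μ) ?_
      rw [Function.update_self, ← neg_sub]
      exact Submodule.neg_mem _ (normalForm_mkQ_sub_mem _)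
  rw [h1 Finset.univ]
  simp only [Finset.mem_univ, if_true]
  refine mkQ_eq_of_sub_mem ?_
  rw [← compBL_apply, ← compBL_apply, ← map_sub, compBL_apply]
  refine compB_mem_degenerate_right F _ ?_
  rw [← neg_sub]
  exact Submodule.neg_mem _ (normalForm_mkQ_sub_mem _)

end Degenerate

/-- The axioms of a dg 2-operad pass to quotients. -/
theorem IsDg2Operad.of_surjective {k : Type u} [Field k] {O O' : Dg2OperadData k}
    (h : IsDg2Operad O) (f : ∀ U, O.obj U →ₗ[k] O'.obj U)
    (hf : ∀ U, Function.Surjective (f U))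
    (hdeg : ∀ U n, O'.deg U n = (O.deg U n).map (f U))
    (hd : ∀ U x, f U (O.d U x) = O'.d U (f U x))
    (hcomp : ∀ {U V : TwoDisk} {P : Hom U V} {T : V.Ball → TwoDisk} (F : Fibration P T)
      (x : ∀ μ, O.obj (T μ)) (y : O.obj V),
      f U (O.comp F x y) = O'.comp F (fun μ => f (T μ) (x μ)) (f V y))
    (hone : f point O.one = O'.one) : IsDg2Operad O' := by
  have lift : ∀ {U n} {x : O'.obj U}, x ∈ O'.deg U n → ∃ y ∈ O.deg U n, f U y = x := by
    intro U n x hx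
    rw [hdeg] at hx
    exact hx
  have mem : ∀ {U n} {x : O.obj U}, x ∈ O.deg U n → f U x ∈ O'.deg U n := by
    intro U n x hx
    rw [hdeg]
    exact ⟨x, hx, rfl⟩
  have upd : ∀ {V : TwoDisk} {T : V.Ball → TwoDisk} (x : ∀ μ, O.obj (T μ)) (μ : V.Ball)
      (a : O.obj (T μ)), Function.update (fun μ => f (T μ) (x μ)) μ (f (T μ) a) =
        fun μ' => f (T μ') (Function.update x μ a μ') := by
    intro V T x μ a
    funext μ'
    exact (Function.apply_update (fun μ => f (T μ)) x μ a μ').symm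
  have liftF : ∀ {V : TwoDisk} {T : V.Ball → TwoDisk} (x : ∀ μ, O'.obj (T μ)),
      ∃ y : ∀ μ, O.obj (T μ), (fun μ => f (T μ) (y μ)) = x := by
    intro V T x
    choose y hy using fun μ => hf (T μ) (x μ)
    exact ⟨y, funext hy⟩
  refine ⟨?_, ?_, ?_, ?_, ?_, ?_, ?_, ?_, ?_, ?_, ?_, ?_, ?_⟩
  · intro U n x hx
    obtain ⟨x, hx', rfl⟩ := lift hx
    rw [← hd]
    exact mem (h.d_mem U n x hx')
  · intro U n x hx
    obtain ⟨x, hx', rfl⟩ := lift hx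
    rw [← hd, ← hd, h.d_d U n x hx', map_zero]
  · intro U V P T F x y μ a b
    obtain ⟨x, rfl⟩ := liftF x
    obtain ⟨y, rfl⟩ := hf _ y
    obtain ⟨a, rfl⟩ := hf _ a
    obtain ⟨b, rfl⟩ := hf _ b
    rw [← map_add, upd, upd, upd, ← hcomp, ← hcomp, ← hcomp, h.comp_add_left, map_add]
  · intro U V P T F x y μ c a
    obtain ⟨x, rfl⟩ := liftF x
    obtain ⟨y, rfl⟩ := hf _ y
    obtain ⟨a, rfl⟩ := hf _ a
    rw [← map_smul, upd, upd, ← hcomp, ← hcomp, h.comp_smul_left, map_smul]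
  · intro U V P T F x a b
    obtain ⟨x, rfl⟩ := liftF x
    obtain ⟨a, rfl⟩ := hf _ a
    obtain ⟨b, rfl⟩ := hf _ b
    rw [← map_add, ← hcomp, ← hcomp, ← hcomp, h.comp_add_right, map_add]
  · intro U V P T F x c a
    obtain ⟨x, rfl⟩ := liftF x
    obtain ⟨a, rfl⟩ := hf _ a
    rw [← map_smul, ← hcomp, ← hcomp, h.comp_smul_right, map_smul]
  · intro U V P T F x y p q hx hy
    choose x' hx' hx using fun μ => lift (hx μ)
    obtain rfl := funext hx
    obtain ⟨y, hy', rfl⟩ := lift hy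
    rw [← hcomp]
    exact mem (h.comp_mem F x' y p q hx' hy')
  · intro U V P T F x y p q hx hy
    choose x' hx' hx using fun μ => lift (hx μ)
    obtain rfl := funext hx
    obtain ⟨y, hy', rfl⟩ := lift hy
    rw [← hcomp, ← hd, h.d_comp F x' y p q hx' hy', map_add, map_sum, ← hd V, ← hcomp]
    simp only [Units.smul_def, map_zsmul]
    congr 1
    refine Finset.sum_congr rfl fun μ _ => ?_
    rw [← hd, upd, ← hcomp]
  · intro U V W P Q S A B C F G H R K hS hR x y z p q r hx hy hz
    choose x' hx' hx using fun v => lift (hx v)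
    obtain rfl := funext hx
    choose y' hy' hy using fun w => lift (hy w)
    obtain rfl := funext hy
    obtain ⟨z, hz', rfl⟩ := lift hz
    have e := h.assoc F G H R K hS hR x' y' z p q r hx' hy' hz'
    rw [← hcomp G, ← hcomp F, Units.smul_def, ← map_zsmul, ← Units.smul_def, ← e, hcomp]
    congr 1
    funext w
    exact (hcomp (K w) (fun b => x' (G.e w b)) (y' w)).symm
  · rw [← hone]
    exact mem h.one_mem
  · rw [← hone, ← hd, h.d_one, map_zero]
  · intro U P F n x hx
    obtain ⟨x, hx', rfl⟩ := lift hx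
    rw [← hone, ← hcomp F (fun _ => x), h.comp_one F n x hx']
  · intro U P F hP n x hx
    obtain ⟨x, hx', rfl⟩ := lift hx
    rw [← hone, ← hcomp F (fun _ => O.one), h.one_comp F hP n x hx']

/-- The quotient of the operad of total orders by the degenerate ones is a dg 2-operad. -/
theorem isDg2Operad_norBreq (k : Type u) [Field k] : IsDg2Operad (norBreq k) :=
  (isDg2Operad_breq k).of_surjective (normalization k) (fun U => Submodule.mkQ_surjective (degenerate k U))
    (fun _ _ => rfl) (fun _ x => normalization_chainD x)
    (fun F x y => normalization_compB F x y) rfl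

/-- The quotient map is a morphism of dg 2-operads. -/
theorem isDg2OperadHom_normalization (k : Type u) [Field k] :
    IsDg2OperadHom (breq k) (norBreq k) (normalization k) where
  map_deg _ _ x hx := ⟨x, hx, rfl⟩
  map_d _ _ x _ := normalization_chainD x
  map_comp F x y _ _ _ _ := normalization_compB F x y
  map_one := rfl

/-! ### Acyclicity of the degenerate orders -/

section Acyclic

variable {k : Type u} [Field k] {U : TwoDisk} {m : ℕ}

/-- The number of a point in an enumeration of all points, in which the index of the point in its
ball is compared first. -/
def code (z : U.Ball × ℕ) : ℕ := z.2 * U.numBalls + z.1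

theorem code_injective : Function.Injective (code (U := U)) := by
  rintro ⟨ν, i⟩ ⟨ν', j⟩ h
  have h : i * U.numBalls + ν = j * U.numBalls + ν' := h
  have h1 := congrArg (· / U.numBalls) h
  have h2 := congrArg (· % U.numBalls) h
  simp only [Nat.mul_add_mod_self_right, Nat.mod_eq_of_lt ν.2, Nat.mod_eq_of_lt ν'.2] at h2
  simp only [mul_comm _ U.numBalls, Nat.mul_add_div U.pos, Nat.div_eq_of_lt ν.2,
    Nat.div_eq_of_lt ν'.2, add_zero] at h1
  rw [h1, Fin.ext h2]

theorem code_smap_le (w z : U.Ball × ℕ) : code (smap w z) ≤ code z := by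
  refine Nat.add_le_add_right (Nat.mul_le_mul_right _ ?_) _
  simp only [smap, sφ]
  split_ifs <;> omega

theorem snd_lt_of_code_lt {w z : U.Ball × ℕ} (h : code w < code z) (h1 : w.1 = z.1) :
    w.2 < z.2 := by
  refine lt_of_mul_lt_mul_right (a := U.numBalls) ?_ (Nat.zero_le _)
  simp only [code, h1] at h
  omega

variable (k U m) in
/-- The span of the cells with a repetition among the first `r` points. -/
noncomputable def repBelow (r : ℕ) : Submodule k (Chains k U m) :=
  Finsupp.supported k k {x : Cell U m | ∃ z, x.Rep z ∧ code z < r}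

theorem single_mem_repBelow {x : Cell U m} {z : U.Ball × ℕ} {r : ℕ} (h : x.Rep z) (hz : code z < r)
    (c : k) : Finsupp.single x c ∈ repBelow k U m r :=
  Finsupp.single_mem_supported _ _ ⟨z, h, hz⟩

theorem exists_mem_repBelow {c : Chains k U m} (hc : c ∈ repS k U m) :
    ∃ r, c ∈ repBelow k U m r := by
  have h : ∀ x : Cell U m, ∃ r, (∃ z, x.Rep z) → ∃ z, x.Rep z ∧ code z < r := by
    intro x
    by_cases hx : ∃ z, x.Rep z
    · obtain ⟨z, hz⟩ := hx
      exact ⟨code z + 1, fun _ => ⟨z, hz, Nat.lt_succ_self _⟩⟩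
    · exact ⟨0, fun h => absurd h hx⟩
  choose ρ hρ using h
  refine ⟨c.support.sup ρ, fun x hx => ?_⟩
  obtain ⟨z, hz, hr⟩ := hρ x (hc hx)
  exact ⟨z, hz, hr.trans_le (Finset.le_sup hx)⟩

theorem chainD_mem_repBelow {r : ℕ} {c : Chains k U m} (hc : c ∈ repBelow k U m r) :
    chainD k U m c ∈ repBelow k U m r := by
  refine map_mem_supported _ ?_ hc
  rintro x ⟨z, h, hz⟩
  rw [h.chainD_single]
  refine Submodule.sum_mem _ fun w hw => ?_
  simp only [Finset.mem_erase] at hw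
  split_ifs with h1
  · exact Submodule.smul_mem _ _ (single_mem_repBelow (h.fc hw.2.2 hw.2.1 hw.1 h1)
      ((code_smap_le _ _).trans_lt hz) 1)
  · exact Submodule.zero_mem _

/-- The point `z` is the first repetition. -/
def Cell.FirstRep (x : Cell U m) (z : U.Ball × ℕ) : Prop :=
  x.Rep z ∧ ∀ w, x.Rep w → code z ≤ code w

open Classical in
variable (k U m) in
/-- The doubling of the first repetition, when it is the point of number `r`. -/
noncomputable def doubleRep (r : ℕ) : Chains k U m →ₗ[k] Chains k U m :=
  Finsupp.linearCombination k fun x : Cell U m =>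
    if h : ∃ z, x.FirstRep z ∧ code z = r then
      Finsupp.single (x.dg h.choose) ((-1 : k) ^ ex x.1 h.choose) else 0

/-- The choice of the first repetition is unique. -/
theorem doubleRep_single {x : Cell U m} {z : U.Ball × ℕ} (h : x.FirstRep z) :
    doubleRep k U m (code z) (Finsupp.single x 1) =
      (-1 : k) ^ ex x.1 z • Finsupp.single (x.dg z) 1 := by
  have h' : ∃ w, x.FirstRep w ∧ code w = code z := ⟨z, h, rfl⟩
  rw [doubleRep, Finsupp.linearCombination_single, dif_pos h', one_smul,
    code_injective h'.choose_spec.2, Finsupp.smul_single, smul_eq_mul, mul_one]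

theorem doubleRep_single_of_lt {x : Cell U m} {z : U.Ball × ℕ} {r : ℕ} (h : x.Rep z)
    (hz : code z < r) : doubleRep k U m r (Finsupp.single x 1) = 0 := by
  rw [doubleRep, Finsupp.linearCombination_single, dif_neg, smul_zero]
  rintro ⟨w, hw, rfl⟩
  exact (hw.2 z h).not_gt hz

theorem doubleRep_mem {r : ℕ} {s : Set (Cell U m)} {t : Set (Cell U m)}
    (h : ∀ x ∈ s, ∀ z, x.FirstRep z → code z = r → x.dg z ∈ t) {c : Chains k U m}
    (hc : c ∈ Finsupp.supported k k s) : doubleRep k U m r c ∈ Finsupp.supported k k t := by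
  refine map_mem_supported _ (fun x hx => ?_) hc
  by_cases hz : ∃ z, x.FirstRep z ∧ code z = r
  · obtain ⟨z, hz, rfl⟩ := hz
    rw [doubleRep_single hz]
    exact Submodule.smul_mem _ _ (Finsupp.single_mem_supported _ _ (h x hx z hz rfl))
  · rw [doubleRep, Finsupp.linearCombination_single, dif_neg hz, smul_zero]
    exact Submodule.zero_mem _

theorem ex_lo_nx (ℓ : U.Ball → ℕ) (z : U.Ball × ℕ) : ex (lo ℓ (nx z)) z = ex ℓ z := by
  unfold ex
  congr 1
  refine Finset.sum_congr rfl fun ν hν => ?_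
  exact (lo_apply _ _ _).trans (if_neg (Finset.mem_Iio.1 hν).ne)

/-- In the boundary of the doubling of a repetition `z`, the faces at the two copies cancel, and the
face at `nx z` is the doubling of a face of the cell that gives the cell back. -/
theorem chainD_double {x : Cell U m} {z : U.Ball × ℕ} (h : x.Rep z) :
    (-1 : k) ^ ex x.1 z • chainD k U m (Finsupp.single (x.dg z) 1) =
      Finsupp.single x 1 - ∑ w ∈ ((pts x.1).erase z).erase (nx z), if 1 ≤ x.1 w.1 then
        ((-1 : k) ^ ex x.1 w * (-1 : k) ^ ex (lo x.1 w) (smap w z)) •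
          Finsupp.single ((x.fc w).dg (smap w z)) 1 else 0 := by
  have e : smap (nx z) z = z := by simp [smap, sφ, nx]
  rw [chainD_of_doubling (k := k) x (x.dg z) h.mem_left (dg_fst x z)
      (fun w => (x.fc w).dg (smap w z)) (fun w hw hne h1 => fc_dg h.mem_left hw hne h1),
    fc_dg_self h.mem_left (Or.inl rfl), fc_dg_self h.mem_left (Or.inr rfl), sub_self, zero_sub,
    ← Finset.add_sum_erase _ _ (Finset.mem_erase.2 ⟨(ne_nx z).symm, h.mem⟩),
    if_pos (show 1 ≤ x.1 (nx z).1 from h.pos), e, h.dg_fc, ex_lo_nx, ex_nx, pow_succ, mul_neg,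
    mul_one, neg_mul, ← mul_pow, neg_mul_neg, one_mul, one_pow, neg_smul, one_smul]
  abel

/-- Doubling is a contraction of the cells whose first repetition is the point of number `r`, up to
cells with an earlier repetition. -/
theorem sub_homotopy_mem_repBelow {r : ℕ} {c : Chains k U m} (hc : c ∈ repBelow k U m (r + 1)) :
    c - chainD k U m (doubleRep k U m r c) - doubleRep k U m r (chainD k U m c) ∈
      repBelow k U m r := by
  refine map_mem_supported (LinearMap.id - chainD k U m ∘ₗ doubleRep k U m r -
    doubleRep k U m r ∘ₗ chainD k U m) ?_ hc
  intro x hx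
  obtain ⟨z, hz, hr⟩ : ∃ z, x.Rep z ∧ code z < r + 1 := hx
  simp only [LinearMap.sub_apply, LinearMap.id_apply, LinearMap.comp_apply]
  by_cases hw : ∃ w, x.Rep w ∧ code w < r
  · obtain ⟨w, hw, hr⟩ := hw
    have h0 : ∀ c : Chains k U m, c ∈ repBelow k U m r → doubleRep k U m r c = 0 := by
      intro c hc
      have := map_mem_supported (doubleRep k U m r) (t := ∅) ?_ hc
      · simpa using this
      · rintro y ⟨v, hv, h⟩
        rw [doubleRep_single_of_lt hv h]
        exact Submodule.zero_mem _
    -- an earlier repetition persists in the faces, and the doubling vanishes on all terms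
    rw [h0 _ (single_mem_repBelow hw hr 1), h0 _ (chainD_mem_repBelow (single_mem_repBelow hw hr 1)),
      map_zero, sub_zero, sub_zero]
    exact single_mem_repBelow hw hr 1
  · have hf : x.FirstRep z := ⟨hz, fun w h => by
      by_contra h'
      exact hw ⟨w, h, by omega⟩⟩
    obtain rfl : code z = r := by
      by_contra h
      exact hw ⟨z, hz, by omega⟩
    rw [doubleRep_single hf, map_smul, chainD_double hz, sub_sub_cancel, hz.chainD_single, map_sum,
      ← Finset.sum_sub_distrib]
    refine Submodule.sum_mem _ fun w hw' => ?_
    simp only [Finset.mem_erase] at hw'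
    obtain ⟨n2, n1, hwp⟩ := hw'
    split_ifs with h1
    · have hfc := hz.fc hwp n1 n2 h1
      have hsz : smap w z ∈ pts (x.fc w).1 := hfc.mem_left
      rw [map_smul]
      by_cases hv : ∃ v, (x.fc w).Rep v ∧ code v < code z
      · obtain ⟨v, hv, hr⟩ := hv
        rw [doubleRep_single_of_lt hv hr, smul_zero, sub_zero]
        refine Submodule.smul_mem _ _ ?_
        -- the doubling of the face has a repetition of number less than that of `z`: the doubled point
        -- itself if its number has dropped, and the one of the face otherwise
        rcases (code_smap_le w z).lt_or_eq with h | h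
        · exact single_mem_repBelow (Rep.of_dg hsz) h 1
        · rw [code_injective h] at hsz ⊢
          exact single_mem_repBelow (hv.dg_of_ne hsz (snd_lt_of_code_lt hr)) hr 1
      -- the first repetition of the face is still `z`, and the two terms are equal
      · have e : smap w z = z := by
          by_contra h
          exact hv ⟨_, hfc, lt_of_le_of_ne (code_smap_le w z) fun h' => h (code_injective h')⟩
        rw [e] at hfc ⊢
        rw [doubleRep_single ⟨hfc, fun v h => by
          by_contra h'
          exact hv ⟨v, h, by omega⟩⟩, smul_smul, fc_fst, sub_self]
        exact Submodule.zero_mem _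
    · rw [map_zero, sub_zero]
      exact Submodule.zero_mem _

/-- Acyclicity, by induction on the bound for the first repetition. -/
theorem exists_chainD_eq_of_mem_repBelow (r : ℕ) : ∀ {n : ℤ} {c : Chains k U 0},
    c ∈ repBelow k U 0 r → c ∈ degB k U n → chainD k U 0 c = 0 →
    ∃ e ∈ repBelow k U 0 r, e ∈ degB k U (n - 1) ∧ chainD k U 0 e = c := by
  induction r with
  | zero =>
    intro n c hc _ _
    have : c = 0 := by simpa [repBelow] using hc
    exact ⟨0, Submodule.zero_mem _, Submodule.zero_mem _, by rw [map_zero, this]⟩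
  | succ r ih =>
    intro n c hc hn hd
    have h1 : doubleRep k U 0 r c ∈ repBelow k U 0 (r + 1) := doubleRep_mem
      (t := {x : Cell U 0 | ∃ z, x.Rep z ∧ code z < r + 1})
      (fun x _ z hz h => ⟨z, Rep.of_dg hz.1.mem_left, by omega⟩) hc
    have h2 : doubleRep k U 0 r c ∈ degB k U (n - 1) := by
      refine doubleRep_mem (fun x hx z hz _ => ?_) hn
      have hx : -(x.dim : ℤ) = n := hx
      have := dim_of_fst_eq_hi (x := x) (y := x.dg z) (z := z) (dg_fst x z)
      change -((x.dg z).dim : ℤ) = n - 1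
      omega
    have h3 := sub_homotopy_mem_repBelow hc
    rw [hd, map_zero, sub_zero] at h3
    have h4 := chainD_mem_degB h2
    rw [sub_add_cancel] at h4
    obtain ⟨e, he, he', hde⟩ := ih h3 (Submodule.sub_mem _ hn h4)
      (by rw [map_sub, hd, chainD_chainD, sub_zero])
    refine ⟨e + doubleRep k U 0 r c, Submodule.add_mem _ (Finsupp.supported_mono ?_ he) h1,
      Submodule.add_mem _ he' h2, by rw [map_add, hde, sub_add_cancel]⟩
    rintro x ⟨z, hz, h⟩
    exact ⟨z, hz, by omega⟩

/-- The degenerate total orders span an acyclic subcomplex. -/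
theorem exists_chainD_eq_of_mem_degenerate {n : ℤ} {c : Chains k U 0} (hc : c ∈ degenerate k U)
    (hn : c ∈ degB k U n) (hd : chainD k U 0 c = 0) :
    ∃ e ∈ degenerate k U, e ∈ degB k U (n - 1) ∧ chainD k U 0 e = c := by
  rw [degenerate_eq] at hc ⊢
  obtain ⟨r, hr⟩ := exists_mem_repBelow hc
  obtain ⟨e, he, he'⟩ := exists_chainD_eq_of_mem_repBelow r hr hn hd
  refine ⟨e, Finsupp.supported_mono ?_ he, he'⟩
  rintro x ⟨z, hz, -⟩
  exact ⟨z, hz⟩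

end Acyclic

/-! ### Quasi-isomorphisms -/

section QuasiIso

variable {k : Type u} [Field k]

theorem LinearMap.exists_comp_eq_of_forall {A M N : Type*} [AddCommGroup A] [AddCommGroup M]
    [AddCommGroup N] [Module k A] [Module k M] [Module k N] (f : M →ₗ[k] N) (a : A →ₗ[k] N)
    (h : ∀ x, ∃ y, f y = a x) : ∃ b : A →ₗ[k] M, f ∘ₗ b = a := by
  obtain ⟨g, hg⟩ := f.rangeRestrict.exists_rightInverse_of_surjective f.range_rangeRestrict
  refine ⟨g ∘ₗ a.codRestrict (LinearMap.range f) h, LinearMap.ext fun x => ?_⟩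
  exact congrArg Subtype.val (LinearMap.congr_fun hg ⟨a x, h x⟩)

/-- A map of complexes of vector spaces is a quasi-isomorphism if it is bijective on cohomology
classes, in terms of cocycles. -/
theorem quasiIso_of_forall_cocycle {K L : CochainComplex (ModuleCat.{u} k) ℤ} (φ : K ⟶ L)
    (hs : ∀ (i : ℤ) (y : L.X (i + 1)), (L.d (i + 1) (i + 1 + 1)).hom y = 0 →
      ∃ x : K.X (i + 1), (K.d (i + 1) (i + 1 + 1)).hom x = 0 ∧
        ∃ z : L.X i, (φ.f (i + 1)).hom x + (L.d i (i + 1)).hom z = y)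
    (hi : ∀ (i : ℤ) (x : K.X (i + 1)), (K.d (i + 1) (i + 1 + 1)).hom x = 0 →
      ∀ z : L.X i, (φ.f (i + 1)).hom x = (L.d i (i + 1)).hom z →
        ∃ w : K.X i, (K.d i (i + 1)).hom w = x) : QuasiIso φ := by
  refine ⟨fun n => ?_⟩
  obtain ⟨i, rfl⟩ : ∃ i, n = i + 1 := ⟨n - 1, by omega⟩
  have e1 : (ComplexShape.up ℤ).prev (i + 1) = i := by simp
  have e2 : (ComplexShape.up ℤ).next (i + 1) = i + 1 + 1 := by simp
  rw [quasiIsoAt_iff_isIso_homologyMap]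
  have hm : Mono (HomologicalComplex.homologyMap φ (i + 1)) := by
    rw [HomologicalComplex.mono_homologyMap_iff_up_to_refinements φ i (i + 1) (i + 1 + 1) e1 e2]
    intro A x hx z hz
    obtain ⟨b, hb⟩ := LinearMap.exists_comp_eq_of_forall (K.d i (i + 1)).hom x.hom fun a =>
      hi i (x.hom a) (LinearMap.congr_fun (congrArg ModuleCat.Hom.hom hx) a) (z.hom a)
        (LinearMap.congr_fun (congrArg ModuleCat.Hom.hom hz) a)
    refine ⟨A, 𝟙 A, inferInstance, ModuleCat.ofHom b, ?_⟩
    rw [Category.id_comp]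
    exact ModuleCat.hom_ext hb.symm
  have he : Epi (HomologicalComplex.homologyMap φ (i + 1)) := by
    rw [HomologicalComplex.epi_homologyMap_iff_up_to_refinements φ i (i + 1) (i + 1 + 1) e1 e2]
    intro A y hy
    obtain ⟨b, hb⟩ := LinearMap.exists_comp_eq_of_forall
      (((φ.f (i + 1)).hom ∘ₗ (LinearMap.ker (K.d (i + 1) (i + 1 + 1)).hom).subtype).coprod
        (L.d i (i + 1)).hom) y.hom fun a => by
          obtain ⟨x, hx, z, hz⟩ :=
            hs i (y.hom a) (LinearMap.congr_fun (congrArg ModuleCat.Hom.hom hy) a)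
          exact ⟨(⟨x, hx⟩, z), hz⟩
    refine ⟨A, 𝟙 A, inferInstance,
      ModuleCat.ofHom (Submodule.subtype _ ∘ₗ LinearMap.fst k _ _ ∘ₗ b),
      ModuleCat.hom_ext (LinearMap.ext fun a => (b a).1.2),
      ModuleCat.ofHom (LinearMap.snd k _ _ ∘ₗ b), ?_⟩
    rw [Category.id_comp]
    exact ModuleCat.hom_ext hb.symm
  exact isIso_of_mono_of_epi _

/-- The criterion for the components of a morphism of dg 2-operads to be quasi-isomorphisms. -/
theorem IsDg2OperadHom.quasiIso_complexMap {O O' : Dg2OperadData k}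
    {f : ∀ U, O.obj U →ₗ[k] O'.obj U} (hf : IsDg2OperadHom O O' f) (h : IsDg2Operad O)
    (h' : IsDg2Operad O') (U : TwoDisk)
    (hs : ∀ n, ∀ y ∈ O'.deg U (n + 1), O'.d U y = 0 → ∃ x ∈ O.deg U (n + 1), O.d U x = 0 ∧
      ∃ z ∈ O'.deg U n, f U x + O'.d U z = y)
    (hi : ∀ n, ∀ x ∈ O.deg U (n + 1), O.d U x = 0 → ∀ z ∈ O'.deg U n, f U x = O'.d U z →
      ∃ w ∈ O.deg U n, O.d U w = x) : QuasiIso (hf.complexMap h h' U) := by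
  have hd : ∀ n, (h.complex U).d n (n + 1) =
      ModuleCat.ofHom ((O.d U).restrict (h.d_mem U n)) := fun n => by
    simp only [IsDg2Operad.complex, CochainComplex.of_d]
  have hd' : ∀ n, (h'.complex U).d n (n + 1) =
      ModuleCat.ofHom ((O'.d U).restrict (h'.d_mem U n)) := fun n => by
    simp only [IsDg2Operad.complex, CochainComplex.of_d]
  refine quasiIso_of_forall_cocycle _ (fun n y hy => ?_) fun n x hx z hz => ?_
  · rw [hd'] at hy
    obtain ⟨x, hx, hdx, z, hz, e⟩ := hs n y.1 y.2 (congrArg Subtype.val hy)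
    rw [hd, hd']
    exact ⟨⟨x, hx⟩, Subtype.ext hdx, ⟨z, hz⟩, Subtype.ext e⟩
  · rw [hd] at hx ⊢
    rw [hd'] at hz
    obtain ⟨w, hw, e⟩ := hi n x.1 x.2 (congrArg Subtype.val hx) z.1 z.2 (congrArg Subtype.val hz)
    exact ⟨⟨w, hw⟩, Subtype.ext e⟩

variable {U : TwoDisk}

/-- Every cocycle is cohomologous to the whiskering of its component at `[0]`. -/
theorem exists_whiskering_add_dtot {n : ℤ} {f : Fam k U} (hf : f ∈ degS k U (n + 1))
    (hd : dtot k U f = 0) : ∃ c ∈ degB k U (n + 1), chainD k U 0 c = 0 ∧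
      ∃ g ∈ degS k U n, whiskering k U c + dtot k U g = f := by
  have hc : f 0 ∈ degB k U (n + 1) := by
    have h := mem_degS.1 hf 0
    simp only [Nat.cast_zero, zero_sub] at h
    exact h
  have hdc : chainD k U 0 (f 0) = 0 := congrFun hd 0
  have hfc : (f - whiskering k U (f 0) : Fam k U) ∈ degS k U (n + 1) :=
    Submodule.sub_mem _ hf (whiskering_mem_degS hc)
  obtain ⟨g, hg, e⟩ := exists_dtot_eq hfc
    (by rw [map_sub, hd, dtot_whiskering, hdc, map_zero, sub_zero])
    (by rw [Pi.sub_apply, whiskering_zero, sub_self])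
  rw [add_sub_cancel_right] at hg
  exact ⟨f 0, hc, hdc, g, hg, by rw [e, add_sub_cancel]⟩

theorem exists_chainD_eq_of_whiskering {n : ℤ} {c : Chains k U 0} {g : Fam k U}
    (hg : g ∈ degS k U n) (h : whiskering k U c = dtot k U g) :
    ∃ e ∈ degB k U n, chainD k U 0 e = c := by
  refine ⟨g 0, ?_, ?_⟩
  · have h := mem_degS.1 hg 0
    simp only [Nat.cast_zero, zero_sub] at h
    exact h
  · rw [← dtot_zero, ← h, whiskering_zero]

/-- Cocycles of the quotient lift to cocycles. -/
theorem exists_mkQ_eq {n : ℤ} {c : Chains k U 0} (hc : c ∈ degB k U (n + 1))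
    (hd : chainD k U 0 c ∈ degenerate k U) :
    ∃ b ∈ degB k U (n + 1), chainD k U 0 b = 0 ∧
      (degenerate k U).mkQ b = (degenerate k U).mkQ c := by
  obtain ⟨e, he, he', hde⟩ := exists_chainD_eq_of_mem_degenerate hd (chainD_mem_degB hc)
    (chainD_chainD c)
  rw [add_sub_cancel_right] at he'
  refine ⟨c - e, Submodule.sub_mem _ hc he', by rw [map_sub, hde, sub_self],
    mkQ_eq_of_sub_mem ?_⟩
  rw [sub_sub_cancel_left]
  exact Submodule.neg_mem _ he

/-- A cocycle is a boundary if it is one modulo degenerate orders. -/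
theorem exists_chainD_eq_of_sub_mem {n : ℤ} {c b : Chains k U 0} (hc : c ∈ degB k U (n + 1))
    (hd : chainD k U 0 c = 0) (hb : b ∈ degB k U n)
    (h : c - chainD k U 0 b ∈ degenerate k U) : ∃ e ∈ degB k U n, chainD k U 0 e = c := by
  obtain ⟨e, -, he, hde⟩ := exists_chainD_eq_of_mem_degenerate h
    (Submodule.sub_mem _ hc (chainD_mem_degB hb)) (by rw [map_sub, hd, chainD_chainD, sub_zero])
  rw [add_sub_cancel_right] at he
  exact ⟨e + b, Submodule.add_mem _ he hb, by rw [map_add, hde, sub_add_cancel]⟩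

theorem isQuasiIso_whiskering (hw : IsDg2OperadHom (breq k) (condensedSeq k) (whiskering k))
    (hB : IsDg2Operad (breq k)) (hS : IsDg2Operad (condensedSeq k)) : hw.IsQuasiIso hB hS :=
  fun U => hw.quasiIso_complexMap hB hS U
    (fun _ _ hy hd => exists_whiskering_add_dtot hy hd)
    (fun _ _ _ _ _ hz h => exists_chainD_eq_of_whiskering hz h)

theorem isQuasiIso_normalization (hp : IsDg2OperadHom (breq k) (norBreq k) (normalization k))
    (hB : IsDg2Operad (breq k)) (hN : IsDg2Operad (norBreq k)) : hp.IsQuasiIso hB hN := by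
  intro U
  refine hp.quasiIso_complexMap hB hN U ?_ ?_
  · rintro n _ ⟨c, hc, rfl⟩ hd
    have h1 : (degenerate k U).mkQ (chainD k U 0 c) = 0 :=
      (normalization_chainD c).trans hd
    obtain ⟨b, hb, hdb, e⟩ := exists_mkQ_eq hc ((Submodule.Quotient.mk_eq_zero _).1 h1)
    exact ⟨b, hb, hdb, 0, Submodule.zero_mem _, by rw [map_zero, add_zero]; exact e⟩
  · rintro n c hc hd _ ⟨b, hb, rfl⟩ h
    have h1 : (degenerate k U).mkQ c = (degenerate k U).mkQ (chainD k U 0 b) :=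
      h.trans (normalization_chainD b).symm
    exact exists_chainD_eq_of_sub_mem hc hd hb ((Submodule.Quotient.eq _).1 h1)

end QuasiIso

theorem mainTheorem2 (k : Type u) [Field k] [CharZero k] :
    ∃ (hS : IsDg2Operad (condensedSeq k)) (hB : IsDg2Operad (breq k))
      (hN : IsDg2Operad (norBreq k))
      (hw : IsDg2OperadHom (breq k) (condensedSeq k) (whiskering k))
      (hp : IsDg2OperadHom (breq k) (norBreq k) (normalization k)),
      (∀ U : TwoDisk, QuasiIso (hw.complexMap hB hS U)) ∧
      hw.IsQuasiIso hB hS ∧ hp.IsQuasiIso hB hN := by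
  have hw := isQuasiIso_whiskering (isDg2OperadHom_whiskering k) (isDg2Operad_breq k)
    (isDg2Operad_condensedSeq k)
  exact ⟨isDg2Operad_condensedSeq k, isDg2Operad_breq k, isDg2Operad_norBreq k,
    isDg2OperadHom_whiskering k, isDg2OperadHom_normalization k, hw, hw,
    isQuasiIso_normalization _ _ _⟩
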